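/- Let $n\ge 2$, $\langle y\rangle=(1+|y|^2)^{1/2}$, and for $0<h\le 1$ put $\mathcal D_{x_j}=-ih\partial_{x_j}$, $\mathcal D_x^\alpha=(-ih\partial_x)^\alpha$. Consider on $\mathbf R^n$ $$P(h)=\sum_{i,j=1}^n\mathcal D_{x_i}a_{ij}(x,h)\mathcal D_{x_j}+\sum_{j=1}^n\big(b_j(x,h)\mathcal D_{x_j}+\mathcal D_{x_j}b_j(x,h)\big)+V(x,h),$$ with real-valued coefficients $a_{ij}=a^0_{ij}(x)+ha^1_{ij}(x,h)$, $b_j=b^0_j(x)+hb^1_j(x,h)$, $V=V^0(x)+hV^1(x,h)$, where $a_{ij}(\cdot,h),b_j(\cdot,h),a^0_{ij},b^0_j,V^0\in C^1(\mathbf R^n)$ and $a^1_{ij},b^1_j,V^1\in L^\infty(\mathbf R^n)$ uniformly in $h$. Suppose that this operator admits, for every $0<h\le1$, a self-adjoint realization on $L^2(\mathbf R^n)$, again denoted $P(h)$ (a self-adjoint extension of the operator defined on $C_0^\infty(\mathbf R^n)$). Assume the following, with constants $C$ independent of $h\in(0,1]$. (1.3) $\displaystyle\sum_{0\le|\alpha|\le2}\|\mathcal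 D_x^\alpha(P(h)\pm i)^{-1}\|_{L^2\to L^2}\le C$. (1.4) For some $\delta>1$ independent of $h$ and all $0\le|\alpha|\le1$, $$\sum_{i,j}|\partial_x^\alpha(a_{ij}(x,h)-\delta_{ij})|+\sum_j|\partial_x^\alpha b_j(x,h)|+|\partial_x^\alpha V^0(x)|+|V^1(x,h)|\le C\langle x\rangle^{-\delta},$$ where $\delta_{ij}$ is the Kronecker symbol. (1.6) There are $0<\varepsilon_0<E$ independent of $h$, and a function $\mu(h)\ge h^{-1}$, such that for every $r>1/2$ the limits $$R_r^\pm(z,h)=\lim_{\eta\to0^+}\langle x\rangle^{-r}(P(h)-z\mp i\eta)^{-1}\langle x\rangle^{-r},\qquad z\in[E-\varepsilon_0,E+\varepsilon_0],$$ exist in the operator norm of $L^2\to L^2$, are continuous in $z$, and satisfy $\|R_r^\pm(z,h)\|_{L^2\to L^2}\le C\mu(h)$ for all such $z$, where $C$ may depend on $r$. Let $\varphi\in C_0^\infty((E-\varepsilon_0,E+\varepsilon_0))$ be independent of $h$, and let $e^{it\sqrt{P(h)}}\varphi(P(h))$ and $e^{itP(h)}\varphi(P(h))$ be the functions $\lambda\mapsto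 e^{it\sqrt\lambda}\varphi(\lambda)$ and $\lambda\mapsto e^{it\lambda}\varphi(\lambda)$ of $P(h)$ in the functional calculus. **Theorem.** Let $0\le s<\delta-1$, $\epsilon>0$ and $\varepsilon>0$. There is a constant $C>0$, independent of $h$, $t$ and $f$, such that for all $0<h\le1$ and all $f\in L^2(\mathbf R^n)$ $$\int_{-\infty}^\infty\langle t\rangle^{2s}\big\|\langle x\rangle^{-1/2-s-\epsilon}e^{it\sqrt{P(h)}}\varphi(P(h))\langle x\rangle^{-1/2-s-\epsilon}f\big\|_{L^2}^2\,dt\le C\mu(h)^{2+2s+2\varepsilon}\|f\|_{L^2}^2,\tag{3.1}$$ $$\big\|\langle x\rangle^{-1/2-s-\epsilon}e^{it\sqrt{P(h)}}\varphi(P(h))\langle x\rangle^{-1/2-s-\epsilon}\big\|_{L^2\to L^2}\le C\mu(h)^{1+s+\varepsilon}\langle t\rangle^{-s}\quad\forall t\in\mathbf R,\tag{3.2}$$ $$\int_{-\infty}^\infty\langle t\rangle^{2s}\big\|\langle x\rangle^{-1/2-s-\epsilon}e^{itP(h)}\varphi(P(h))\langle x\rangle^{-1/2-s-\epsilon}f\big\|_{L^2}^2\,dt\le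 C\mu(h)^{2+2s+2\varepsilon}\|f\|_{L^2}^2,\tag{3.3}$$ $$\big\|\langle x\rangle^{-1/2-s-\epsilon}e^{itP(h)}\varphi(P(h))\langle x\rangle^{-1/2-s-\epsilon}\big\|_{L^2\to L^2}\le C\mu(h)^{1+s+\varepsilon}\langle t\rangle^{-s}\quad\forall t\in\mathbf R.\tag{3.4}$$ -/

import Mathlib

open MeasureTheory Filter Topology
open scoped ENNReal ContDiff SchwartzMap LineDeriv

noncomputable section

namespace SemiclassicalDecay

/-! ### Weighted `L²` spaces -/

/-- The Euclidean space `ℝⁿ`. -/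
abbrev Space (n : ℕ) : Type := EuclideanSpace ℝ (Fin n)

/-- The complex Hilbert space `L²(ℝⁿ)`. -/
abbrev L2 (n : ℕ) : Type := Lp ℂ 2 (volume : Measure (Space n))

/-- The `j`-th vector of the standard basis of `ℝⁿ`. -/
abbrev stdVec {n : ℕ} (j : Fin n) : Space n := EuclideanSpace.single j (1 : ℝ)

/-- The Japanese bracket `⟨x⟩ = (1 + |x|²)^{1/2}`. -/
def bracket {E : Type*} [NormedAddCommGroup E] (x : E) : ℝ := Real.sqrt (1 + ‖x‖ ^ 2)

theorem one_le_bracket {E : Type*} [NormedAddCommGroup E] (x : E) : 1 ≤ bracket x := by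
  unfold bracket
  exact Real.one_le_sqrt.mpr (by nlinarith [sq_nonneg ‖x‖])

theorem continuous_bracket {E : Type*} [NormedAddCommGroup E] :
    Continuous (bracket : E → ℝ) := by
  unfold bracket
  fun_prop

/-- The function `⟨x⟩^{-r}`, as a complex-valued function on `ℝⁿ`. -/
def weightFun (n : ℕ) (r : ℝ) (x : Space n) : ℂ := ((bracket x ^ (-r) : ℝ) : ℂ)

theorem memLp_weightFun (n : ℕ) {r : ℝ} (hr : 0 ≤ r) :
    MemLp (weightFun n r) ∞ (volume : Measure (Space n)) := by
  have hc : Continuous (weightFun n r) := by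
    unfold weightFun
    refine Complex.continuous_ofReal.comp (continuous_bracket.rpow_const fun x => Or.inl ?_)
    exact (zero_lt_one.trans_le (one_le_bracket x)).ne'
  refine memLp_top_of_bound hc.aestronglyMeasurable 1 (ae_of_all _ fun x => ?_)
  have h0 : 0 ≤ bracket x := zero_le_one.trans (one_le_bracket x)
  unfold weightFun
  rw [Complex.norm_real, Real.norm_of_nonneg (Real.rpow_nonneg h0 _)]
  exact Real.rpow_le_one_of_one_le_of_nonpos (one_le_bracket x) (by linarith)

open scoped Classical in
/-- The bounded operator of multiplication by `⟨x⟩^{-r}` on `L²(ℝⁿ)`, for `r ≥ 0`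
(by convention it is zero when `⟨x⟩^{-r}` is unbounded). -/
def weightOp (n : ℕ) (r : ℝ) : L2 n →L[ℂ] L2 n :=
  if hr : MemLp (weightFun n r) ∞ (volume : Measure (Space n)) then
    (ContinuousLinearMap.mul ℂ ℂ).holderL (volume : Measure (Space n)) ∞ 2 2 (hr.toLp _)
  else 0

theorem coeFn_weightOp (n : ℕ) {r : ℝ} (hr : 0 ≤ r) (f : L2 n) :
    (weightOp n r f : Space n → ℂ) =ᵐ[volume]
      fun x => ((bracket x ^ (-r) : ℝ) : ℂ) * (f : Space n → ℂ) x := by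
  have h := memLp_weightFun n hr
  unfold weightOp
  rw [dif_pos h]
  have h1 := (ContinuousLinearMap.mul ℂ ℂ).coeFn_holder (r := 2) (h.toLp _) f
  filter_upwards [h1, h.coeFn_toLp] with x hx hx'
  simp only [ContinuousLinearMap.holderL_apply_apply]
  rw [hx, hx']
  rfl

/-! ### Unbounded self-adjoint operators: resolvent and functional calculus -/

section Abstract

variable {H : Type*} [NormedAddCommGroup H] [InnerProductSpace ℂ H]

/-- `R` is a bounded two-sided inverse of `P - z`. -/
def IsResolventAt (P : H →ₗ.[ℂ] H) (z : ℂ) (R : H →L[ℂ] H) : Prop :=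
  (∀ f : H, ∃ u : P.domain, (u : H) = R f ∧ P u - z • (u : H) = f) ∧
    ∀ u : P.domain, R (P u - z • (u : H)) = u

open scoped Classical in
/-- The resolvent `(P - z)⁻¹`, a bounded operator (zero if `z` is in the spectrum of `P`).
For self-adjoint `P` it is the genuine inverse for all non-real `z`. -/
def resolventOp (P : H →ₗ.[ℂ] H) (z : ℂ) : H →L[ℂ] H :=
  if h : ∃ R : H →L[ℂ] H, IsResolventAt P z R then h.choose else 0

theorem IsResolventAt.resolventOp_eq {P : H →ₗ.[ℂ] H} {z : ℂ} {R : H →L[ℂ] H}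
    (hR : IsResolventAt P z R) : resolventOp P z = R := by
  have h : ∃ R : H →L[ℂ] H, IsResolventAt P z R := ⟨R, hR⟩
  unfold resolventOp
  rw [dif_pos h]
  ext f
  obtain ⟨u, hu, hf⟩ := hR.1 f
  have h2 := h.choose_spec.2 u
  rw [hf] at h2
  rw [h2, hu]

variable [CompleteSpace H]

/-- The functional calculus `g(P)` of a self-adjoint operator `P`, for `g : ℝ → ℂ` continuous with
compact support. The operator `T = (P + i)⁻¹` is bounded and normal, `λ ↦ (λ + i)⁻¹` maps the
spectrum of `P` to that of `T` (up to the point `0`), and `λ = w⁻¹ - i` is recovered from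
`w = (λ + i)⁻¹`; so `g(P)` is the function `w ↦ g (w⁻¹ - i)` (with value `0` at `w = 0`) of `T` in
the continuous functional calculus of normal elements of a C⋆-algebra. -/
def funCalc (P : H →ₗ.[ℂ] H) (g : ℝ → ℂ) : H →L[ℂ] H :=
  cfc (fun w : ℂ => if w = 0 then 0 else g (w⁻¹ - Complex.I).re) (resolventOp P (-Complex.I))

/-- The localized wave group `e^{it√P} φ(P)`, for `φ` supported in `(0, ∞)`. -/
def waveGroup (P : H →ₗ.[ℂ] H) (φ : ℝ → ℂ) (t : ℝ) : H →L[ℂ] H :=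
  funCalc P fun l => Complex.exp (Complex.I * t * Real.sqrt l) * φ l

/-- The localized Schrödinger group `e^{itP} φ(P)`. -/
def schrodingerGroup (P : H →ₗ.[ℂ] H) (φ : ℝ → ℂ) (t : ℝ) : H →L[ℂ] H :=
  funCalc P fun l => Complex.exp (Complex.I * t * l) * φ l

end Abstract

/-! ### The differential operators -/

/-- The real-valued coefficients of the operators: the principal parts `a⁰, b⁰, V⁰`, functions of
`x`, and the lower order parts `a¹, b¹, V¹`, functions of `h` and `x`. -/
structure Coefficients (n : ℕ) where
  a0 : Fin n → Fin n → Space n → ℝ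
  a1 : ℝ → Fin n → Fin n → Space n → ℝ
  b0 : Fin n → Space n → ℝ
  b1 : ℝ → Fin n → Space n → ℝ
  V0 : Space n → ℝ
  V1 : ℝ → Space n → ℝ

namespace Coefficients

variable {n : ℕ} (c : Coefficients n)

/-- `a_{ij}(x,h) = a⁰_{ij}(x) + h a¹_{ij}(x,h)`. -/
def a (h : ℝ) (i j : Fin n) (x : Space n) : ℝ := c.a0 i j x + h * c.a1 h i j x

/-- `b_j(x,h) = b⁰_j(x) + h b¹_j(x,h)`. -/
def b (h : ℝ) (j : Fin n) (x : Space n) : ℝ := c.b0 j x + h * c.b1 h j x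

/-- `V(x,h) = V⁰(x) + h V¹(x,h)`. -/
def V (h : ℝ) (x : Space n) : ℝ := c.V0 x + h * c.V1 h x

/-- Regularity: `a⁰, b⁰, V⁰, a(·,h), b(·,h)` are `C¹`, and `a¹, b¹, V¹` are in `L^∞` uniformly
in `0 < h ≤ 1`. -/
structure Regular : Prop where
  contDiff_a0 : ∀ i j, ContDiff ℝ 1 (c.a0 i j)
  contDiff_b0 : ∀ j, ContDiff ℝ 1 (c.b0 j)
  contDiff_V0 : ContDiff ℝ 1 c.V0
  contDiff_a : ∀ h ∈ Set.Ioc (0 : ℝ) 1, ∀ i j, ContDiff ℝ 1 (c.a h i j)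
  contDiff_b : ∀ h ∈ Set.Ioc (0 : ℝ) 1, ∀ j, ContDiff ℝ 1 (c.b h j)
  aestronglyMeasurable_V1 : ∀ h ∈ Set.Ioc (0 : ℝ) 1, AEStronglyMeasurable (c.V1 h) volume
  bounded : ∃ M : ℝ, ∀ h ∈ Set.Ioc (0 : ℝ) 1,
    (∀ i j, ∀ᵐ x, |c.a1 h i j x| ≤ M) ∧ (∀ j, ∀ᵐ x, |c.b1 h j x| ≤ M) ∧ ∀ᵐ x, |c.V1 h x| ≤ M

/-- Short range condition: `∂^α (a_{ij} - δ_{ij})`, `∂^α b_j`, `∂^α V⁰`, for `|α| ≤ 1`, and `V¹`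
are `O(⟨x⟩^{-δ})`, uniformly in `0 < h ≤ 1`. -/
def ShortRange (δ : ℝ) : Prop :=
  ∃ C : ℝ, ∀ h ∈ Set.Ioc (0 : ℝ) 1,
    (∀ x, ∑ i, ∑ j, |c.a h i j x - if i = j then 1 else 0| + ∑ j, |c.b h j x| + |c.V0 x|
        ≤ C * bracket x ^ (-δ)) ∧
    (∀ k : Fin n, ∀ x, ∑ i, ∑ j, |fderiv ℝ (c.a h i j) x (stdVec k)|
        + ∑ j, |fderiv ℝ (c.b h j) x (stdVec k)| + |fderiv ℝ c.V0 x (stdVec k)|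
        ≤ C * bracket x ^ (-δ)) ∧
    ∀ᵐ x, |c.V1 h x| ≤ C * bracket x ^ (-δ)

end Coefficients

/-- `D_{x_j} u = -i h ∂_{x_j} u` for differentiable `u`. -/
def semiD {n : ℕ} (h : ℝ) (j : Fin n) (u : Space n → ℂ) (x : Space n) : ℂ :=
  -(Complex.I * h) * fderiv ℝ u x (stdVec j)

/-- The expression
`∑ D_{x_i} a_{ij} D_{x_j} ψ + ∑ (b_j D_{x_j} ψ + D_{x_j} (b_j ψ)) + V ψ` for smooth `ψ`. -/
def Coefficients.diffOp {n : ℕ} (c : Coefficients n) (h : ℝ) (ψ : Space n → ℂ) (x : Space n) : ℂ :=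
  ∑ i, ∑ j, semiD h i (fun y => (c.a h i j y : ℂ) * semiD h j ψ y) x
    + ∑ j, ((c.b h j x : ℂ) * semiD h j ψ x + semiD h j (fun y => (c.b h j y : ℂ) * ψ y) x)
    + (c.V h x : ℂ) * ψ x

/-- `P` is a self-adjoint realization of the differential expression on `L²(ℝⁿ)`: a self-adjoint
operator that extends the differential operator with domain `C_c^∞(ℝⁿ)`. -/
structure IsSelfAdjointRealization {n : ℕ} (c : Coefficients n) (h : ℝ) (P : L2 n →ₗ.[ℂ] L2 n) :
    Prop where
  isSelfAdjoint : IsSelfAdjoint P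
  eq_diffOp : ∀ ψ : Space n → ℂ, ContDiff ℝ ∞ ψ → HasCompactSupport ψ →
    ∃ u : P.domain, ((u : L2 n) : Space n → ℂ) =ᵐ[volume] ψ ∧
      (P u : Space n → ℂ) =ᵐ[volume] c.diffOp h ψ

/-- The ellipticity condition `∑_{|α| ≤ 2} ‖D_x^α (P(h) ± i)⁻¹‖ ≤ C`, uniformly in `0 < h ≤ 1`.
The derivatives are taken in the sense of distributions; a multi-index of order `k ≤ 2` is given
by `k` directions. -/
def Elliptic {n : ℕ} (P : ℝ → (L2 n →ₗ.[ℂ] L2 n)) : Prop :=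
  ∃ C : ℝ, ∀ h ∈ Set.Ioc (0 : ℝ) 1, ∀ z : ℂ, (z = Complex.I ∨ z = -Complex.I) →
    ∀ k ≤ 2, ∀ j : Fin k → Fin n, ∀ f : L2 n, ∃ w : L2 n,
      (-(Complex.I * h)) ^ k •
          ∂^{fun i => stdVec (j i)} (Lp.toTemperedDistribution (resolventOp (P h) z f))
        = Lp.toTemperedDistribution w ∧
      ‖w‖ ≤ C * ‖f‖

/-- The weighted resolvent `R_s(z) = ⟨x⟩^{-s} (P - z)⁻¹ ⟨x⟩^{-s}`. -/
def weightedResolvent {n : ℕ} (P : L2 n →ₗ.[ℂ] L2 n) (s : ℝ) (z : ℂ) : L2 n →L[ℂ] L2 n :=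
  weightOp n s ∘L resolventOp P z ∘L weightOp n s

/-- For every `s > 1/2`, the limits `R_s^±(z,h) = lim_{η → 0⁺} R_s(z ± iη, h)` exist in the operator
norm for `z ∈ [E - ε₀, E + ε₀]`, are continuous in `z`, and are `O(μ(h))` uniformly in `z` and
`0 < h ≤ 1`. -/
def LimitingAbsorption {n : ℕ} (P : ℝ → (L2 n →ₗ.[ℂ] L2 n)) (μ : ℝ → ℝ) (E ε₀ : ℝ) : Prop :=
  ∀ s : ℝ, 1 / 2 < s → ∃ C : ℝ, ∀ h ∈ Set.Ioc (0 : ℝ) 1, ∀ σ : ℝ, (σ = 1 ∨ σ = -1) →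
    ∃ R : ℝ → (L2 n →L[ℂ] L2 n), ContinuousOn R (Set.Icc (E - ε₀) (E + ε₀)) ∧
      ∀ z ∈ Set.Icc (E - ε₀) (E + ε₀),
        Tendsto (fun η : ℝ => weightedResolvent (P h) s (z + σ * η * Complex.I)) (𝓝[>] 0)
          (𝓝 (R z)) ∧
        ‖R z‖ ≤ C * μ h

/-- The operator `⟨x⟩^{-1/2-s-ϵ} U ⟨x⟩^{-1/2-s-ϵ}`. -/
def sandwich {n : ℕ} (s ϵ : ℝ) (U : L2 n →L[ℂ] L2 n) : L2 n →L[ℂ] L2 n :=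
  weightOp n (1 / 2 + s + ϵ) ∘L U ∘L weightOp n (1 / 2 + s + ϵ)

end SemiclassicalDecay

end

noncomputable section

namespace SemiclassicalDecay

/-! ### Resolvents of self-adjoint operators -/

section Abstract

variable {H : Type*} [NormedAddCommGroup H] [InnerProductSpace ℂ H] [CompleteSpace H]

open scoped InnerProductSpace

/-! By Stone's formula, ⟨x⟩^{-b} e^{itP} φ(P) ⟨x⟩^{-b} is the limit, as η → 0, of the integral of
e^{itλ} φ(λ) against (2πi)^{-1} times the jump of the weighted resolvent between λ + iη and λ - iη.
Decay in t is therefore regularity in λ of the weighted resolvent up to the real axis, and its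
derivatives are weighted powers R(z)^k. Let N + q lie slightly above s, with N a natural number and
0 < q < 1. If ⟨x⟩^{-b} R(λ ± iη)^k ⟨x⟩^{-b} = O(K η^{q-1}) for k ≤ N + 2, the N-th derivative is
q-Hölder up to the boundary. Splitting the integrand at height η = 1/|t|, with N + 1 integrations by
parts in the smooth part and N in the remainder, gives O(K |t|^{-N-q}). Plancherel on dyadic shells
in t gives the square integrated bound. The wave group differs only by the substitution λ = ρ². This
half is `exists_group_decay`.

The other half is ‖⟨x⟩^{-c} R(z)^k ⟨x⟩^{-b}‖ ≤ K μ^p T^{k-p} with T = 1/|Im z| ≥ μ, for p < k, p < c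
+ 1/2 and c < δ - 1/2 (`powerBounds`). For k = 1 it comes from limiting absorption. A bound on Im⟨g,
R(λ + i0) g⟩ bounds the density of the spectral measure of g, and a Poisson integral turns this into
a bound on |Im z| ‖R(z) g‖² for all small Im z (`mul_norm_resolventOp_sq_le`). Integrating R² in Im
z then gives the two-sided bound for every p < 1.

The induction on k uses one commutator only, which is why C¹ coefficients suffice. For the
symmetrized radial operator A, i[P, A]/h equals 2P up to terms of size ⟨x⟩^{1-δ}
(`exists_norm_inner_conjOp_sub_add_le`). Telescoping over R^m produces 2hm (z R^{m+1} + R^m), up to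
boundary terms containing A R^m and errors with ⟨x⟩^{1-δ} between R^{m-i} and R^{i+1}
(`exists_norm_inner_pow_le`). In the boundary terms A costs one power of |x| and division by h costs
one power of μ, since 1/h ≤ μ. So bounds at (c - 1, p - 1) pass to (c, p). For c < 1 the weight
grows, and the growth estimate `exists_norm_mulOp_bracket_div_half_le` replaces the induction
hypothesis. In the errors the decay δ - 1 is divided between the two factors, and this fixes the
restriction s < δ - 1. -/

theorem inner_map_comm {P : H →ₗ.[ℂ] H} (hP : IsSelfAdjoint P) (u v : P.domain) :
    ⟪P u, (v : H)⟫_ℂ = ⟪(u : H), P v⟫_ℂ := by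
  have h := P.adjoint_isFormalAdjoint hP.dense_domain
  rw [LinearPMap.isSelfAdjoint_def.1 hP] at h
  exact h u v

/-- Self-adjointness in its full strength: a weak solution of P y = w already lies in the domain. It
yields the density of the range of P - z, and later the invariance of the domain under weights. -/
theorem mem_domain_of_forall_inner {P : H →ₗ.[ℂ] H} (hP : IsSelfAdjoint P) {y w : H}
    (h : ∀ u : P.domain, ⟪w, (u : H)⟫_ℂ = ⟪y, P u⟫_ℂ) :
    ∃ v : P.domain, (v : H) = y ∧ P v = w := by
  have hy : y ∈ P.adjoint.domain := P.mem_adjoint_domain_of_exists y ⟨w, h⟩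
  have hw := P.adjoint_apply_eq hP.dense_domain ⟨y, hy⟩ h
  -- Generalizing over `Q` avoids rewriting the adjoint inside the dependent type of its domain.
  have key : ∀ Q : H →ₗ.[ℂ] H, P.adjoint = Q → ∃ v : Q.domain, (v : H) = y ∧ Q v = w := by
    rintro Q rfl
    exact ⟨⟨y, hy⟩, rfl, hw⟩
  exact key P (LinearPMap.isSelfAdjoint_def.1 hP)

/-- `⟪u, P u⟫` is real, so only the imaginary part of `z` survives. -/
theorem im_mul_norm_sq {P : H →ₗ.[ℂ] H} (hP : IsSelfAdjoint P) (z : ℂ) (u : P.domain) :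
    z.im * ‖(u : H)‖ ^ 2 = -(⟪(u : H), P u - z • (u : H)⟫_ℂ).im := by
  have h1 : (⟪(u : H), P u⟫_ℂ).im = 0 := by
    have := inner_map_comm hP u u
    have h2 : (starRingEnd ℂ) ⟪(u : H), P u⟫_ℂ = ⟪(u : H), P u⟫_ℂ := by
      rw [inner_conj_symm, this]
    exact Complex.conj_eq_iff_im.1 h2
  rw [inner_sub_right, inner_smul_right, inner_self_eq_norm_sq_to_K, Complex.sub_im, h1]
  simp [← Complex.ofReal_pow]

theorem abs_im_mul_norm_le {P : H →ₗ.[ℂ] H} (hP : IsSelfAdjoint P) (z : ℂ) (u : P.domain) :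
    |z.im| * ‖(u : H)‖ ≤ ‖P u - z • (u : H)‖ := by
  rcases eq_or_lt_of_le (norm_nonneg (u : H)) with h0 | h0
  · rw [← h0]; simp
  · have h := im_mul_norm_sq hP z u
    have h2 : |z.im| * ‖(u : H)‖ ^ 2 ≤ ‖(u : H)‖ * ‖P u - z • (u : H)‖ := by
      rw [← abs_of_nonneg (sq_nonneg ‖(u : H)‖), ← abs_mul, h, abs_neg]
      exact (Complex.abs_im_le_norm _).trans (norm_inner_le_norm _ _)
    nlinarith

/-- The range is closed, by the a priori bound and the closedness of the graph. It is dense, because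
a vector orthogonal to it would be an eigenvector of P with the non-real eigenvalue conj z. -/
theorem exists_map_sub_smul_eq {P : H →ₗ.[ℂ] H} (hP : IsSelfAdjoint P) {z : ℂ} (hz : z.im ≠ 0)
    (f : H) : ∃ u : P.domain, P u - z • (u : H) = f := by
  let S : P.domain →ₗ[ℂ] H := P.toFun - z • P.domain.subtype
  have hS : ∀ u : P.domain, S u = P u - z • (u : H) := fun u => rfl
  have hclosed : IsClosed (LinearMap.range S : Set H) := by
    rw [← isSeqClosed_iff_isClosed]
    intro g f hg hgf
    choose u hu using hg
    have hcau : CauchySeq fun k => (u k : H) := by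
      have hgc := hgf.cauchySeq
      rw [Metric.cauchySeq_iff'] at hgc ⊢
      intro e he
      obtain ⟨N, hN⟩ := hgc (|z.im| * e) (mul_pos (abs_pos.2 hz) he)
      refine ⟨N, fun k hk => ?_⟩
      have h1 := hN k hk
      have h2 := abs_im_mul_norm_le hP z (u k - u N)
      rw [← hS, map_sub, hu, hu, ← dist_eq_norm] at h2
      have h3 := h2.trans_lt h1
      rw [dist_eq_norm]
      exact lt_of_mul_lt_mul_left h3 (abs_nonneg _)
    obtain ⟨y, hy⟩ := cauchySeq_tendsto_of_complete hcau
    have hPu : Tendsto (fun k => P (u k)) atTop (𝓝 (f + z • y)) := by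
      have : (fun k => P (u k)) = fun k => g k + z • (u k : H) := by
        funext k; rw [← hu k, hS]; abel
      rw [this]
      exact hgf.add (hy.const_smul z)
    have hgr : (y, f + z • y) ∈ P.graph := by
      have hc : IsClosed (P.graph : Set (H × H)) := hP.isClosed
      refine hc.mem_of_tendsto (hy.prodMk_nhds hPu) (Eventually.of_forall fun k => ?_)
      exact P.mem_graph (u k)
    obtain ⟨v, hv1, hv2⟩ := P.mem_graph_iff.1 hgr
    refine ⟨v, ?_⟩
    simp only at hv1 hv2
    rw [hS, hv2, hv1]; abel
  have hdense : (LinearMap.range S)ᗮ = ⊥ := by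
    rw [Submodule.eq_bot_iff]
    intro y hy
    have h1 : ∀ u : P.domain, ⟪(starRingEnd ℂ z) • y, (u : H)⟫_ℂ = ⟪y, P u⟫_ℂ := by
      intro u
      have := (Submodule.mem_orthogonal' _ _).1 hy (S u) ⟨u, rfl⟩
      rw [hS, inner_sub_right, inner_smul_right, sub_eq_zero] at this
      rw [inner_smul_left, this]; simp
    obtain ⟨v, rfl, hv⟩ := mem_domain_of_forall_inner hP h1
    have h2 := abs_im_mul_norm_le hP (starRingEnd ℂ z) v
    rw [hv, sub_self, norm_zero] at h2
    have h3 : 0 < |(starRingEnd ℂ z).im| := by simpa using hz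
    have : ‖(v : H)‖ ≤ 0 := by nlinarith [norm_nonneg (v : H)]
    exact norm_le_zero_iff.1 this
  have htop : LinearMap.range S = ⊤ := by
    have : (LinearMap.range S).topologicalClosure = ⊤ :=
      (Submodule.topologicalClosure_eq_top_iff).2 hdense
    rwa [IsClosed.submodule_topologicalClosure_eq hclosed] at this
  obtain ⟨u, hu⟩ := LinearMap.range_eq_top.1 htop f
  exact ⟨u, by rw [← hS, hu]⟩

/-- Off the real axis the default value of `resolventOp` never occurs. The a priori bound makes the
preimage unique, hence linear in f, and bounded by 1/|Im z|. -/
theorem isResolventAt_resolventOp {P : H →ₗ.[ℂ] H} (hP : IsSelfAdjoint P) {z : ℂ}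
    (hz : z.im ≠ 0) : IsResolventAt P z (resolventOp P z) := by
  have hinj : ∀ u v : P.domain, P u - z • (u : H) = P v - z • (v : H) → u = v := by
    intro u v h
    have h2 := abs_im_mul_norm_le hP z (u - v)
    have h3 : P (u - v) - z • ((u - v : P.domain) : H) = 0 := by
      rw [LinearPMap.map_sub]
      push_cast
      rw [smul_sub, ← sub_eq_zero.2 h]; abel
    rw [h3, norm_zero] at h2
    have h4 : 0 < |z.im| := by simpa using hz
    have : ‖((u - v : P.domain) : H)‖ ≤ 0 := by nlinarith [norm_nonneg ((u - v : P.domain) : H)]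
    exact sub_eq_zero.1 (Subtype.ext (norm_le_zero_iff.1 this))
  choose r hr using fun f => exists_map_sub_smul_eq hP hz f
  let L : H →ₗ[ℂ] H :=
    { toFun := fun f => r f
      map_add' := fun f g => by
        have : r (f + g) = r f + r g := hinj _ _ (by
          rw [hr, LinearPMap.map_add]; push_cast
          rw [smul_add]
          conv_lhs => rw [← hr f, ← hr g]
          abel)
        rw [this]; rfl
      map_smul' := fun a f => by
        have : r (a • f) = a • r f := hinj _ _ (by
          rw [hr, LinearPMap.map_smul]; push_cast
          rw [smul_comm]
          conv_lhs => rw [← hr f]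
          rw [smul_sub])
        rw [this]; rfl }
  let R : H →L[ℂ] H := L.mkContinuous |z.im|⁻¹ (fun f => by
    have h := abs_im_mul_norm_le hP z (r f)
    rw [hr] at h
    rw [inv_mul_eq_div, le_div_iff₀' (abs_pos.2 hz)]
    exact h)
  have hR : IsResolventAt P z R :=
    ⟨fun f => ⟨r f, rfl, hr f⟩, fun u => congrArg Subtype.val (hinj _ _ (hr _))⟩
  rw [hR.resolventOp_eq]
  exact hR

theorem exists_resolventOp {P : H →ₗ.[ℂ] H} (hP : IsSelfAdjoint P) {z : ℂ}
    (hz : z.im ≠ 0) (f : H) :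
    ∃ u : P.domain, (u : H) = resolventOp P z f ∧ P u = z • resolventOp P z f + f := by
  obtain ⟨u, hu, hf⟩ := (isResolventAt_resolventOp hP hz).1 f
  exact ⟨u, hu, by rw [← hu]; exact sub_eq_iff_eq_add'.1 hf⟩

theorem resolventOp_apply_sub {P : H →ₗ.[ℂ] H} (hP : IsSelfAdjoint P) {z : ℂ}
    (hz : z.im ≠ 0) (u : P.domain) : resolventOp P z (P u - z • (u : H)) = u :=
  (isResolventAt_resolventOp hP hz).2 u

theorem norm_resolventOp_le {P : H →ₗ.[ℂ] H} (hP : IsSelfAdjoint P) {z : ℂ} (hz : z.im ≠ 0) :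
    ‖resolventOp P z‖ ≤ |z.im|⁻¹ := by
  refine ContinuousLinearMap.opNorm_le_bound _ (by positivity) fun f => ?_
  obtain ⟨u, hu, hf⟩ := (isResolventAt_resolventOp hP hz).1 f
  have h := abs_im_mul_norm_le hP z u
  rw [hf, hu] at h
  rw [inv_mul_eq_div, le_div_iff₀' (abs_pos.2 hz)]
  exact h

theorem resolventOp_sub {P : H →ₗ.[ℂ] H} (hP : IsSelfAdjoint P) {z w : ℂ} (hz : z.im ≠ 0)
    (hw : w.im ≠ 0) :
    resolventOp P z - resolventOp P w = (z - w) • (resolventOp P z * resolventOp P w) := by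
  ext f
  obtain ⟨u, hu, hPu⟩ := exists_resolventOp hP hw f
  have h := resolventOp_apply_sub hP hz u
  have h2 : P u - z • (u : H) = f - (z - w) • resolventOp P w f := by
    rw [hPu, hu, sub_smul]; abel
  rw [h2, map_sub, map_smul, hu] at h
  exact sub_eq_iff_eq_add'.2 (sub_eq_iff_eq_add.1 h)

theorem resolventOp_mul_comm {P : H →ₗ.[ℂ] H} (hP : IsSelfAdjoint P) {z w : ℂ} (hz : z.im ≠ 0)
    (hw : w.im ≠ 0) :
    resolventOp P z * resolventOp P w = resolventOp P w * resolventOp P z := by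
  rcases eq_or_ne z w with rfl | hne
  · rfl
  have h1 := resolventOp_sub hP hz hw
  have h2 := resolventOp_sub hP hw hz
  have h3 : (z - w) • (resolventOp P z * resolventOp P w)
      = (z - w) • (resolventOp P w * resolventOp P z) := by
    rw [← h1, ← neg_sub, h2, ← neg_smul, neg_sub]
  exact smul_right_injective _ (sub_ne_zero.2 hne) h3

theorem star_resolventOp {P : H →ₗ.[ℂ] H} (hP : IsSelfAdjoint P) {z : ℂ} (hz : z.im ≠ 0) :
    star (resolventOp P z) = resolventOp P (starRingEnd ℂ z) := by
  have hz' : (starRingEnd ℂ z).im ≠ 0 := by simpa using hz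
  rw [ContinuousLinearMap.star_eq_adjoint, eq_comm, ContinuousLinearMap.eq_adjoint_iff]
  intro f g
  obtain ⟨u, hu, hPu⟩ := exists_resolventOp hP hz' f
  obtain ⟨v, hv, hPv⟩ := exists_resolventOp hP hz g
  have h := inner_map_comm hP u v
  rw [hPu, hPv, hu, hv, inner_add_left, inner_add_right, inner_smul_left, inner_smul_right] at h
  simp only [Complex.conj_conj] at h
  exact (add_left_cancel h).symm

theorem isStarNormal_resolventOp {P : H →ₗ.[ℂ] H} (hP : IsSelfAdjoint P) {z : ℂ}
    (hz : z.im ≠ 0) : IsStarNormal (resolventOp P z) := by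
  refine ⟨?_⟩
  rw [star_resolventOp hP hz]
  exact resolventOp_mul_comm hP (by simpa using hz) hz

theorem continuousAt_resolventOp {P : H →ₗ.[ℂ] H} (hP : IsSelfAdjoint P) {z : ℂ}
    (hz : z.im ≠ 0) : ContinuousAt (resolventOp P) z := by
  have hev : ∀ᶠ w in 𝓝 z, |z.im| / 2 < |w.im| := by
    have hc : ContinuousAt (fun w : ℂ => |w.im|) z := by fun_prop
    exact hc.eventually_const_lt (by linarith [abs_pos.2 hz])
  rw [ContinuousAt, tendsto_iff_norm_sub_tendsto_zero]
  have hb : Tendsto (fun w : ℂ => ‖w - z‖ * (2 * |z.im|⁻¹ * |z.im|⁻¹)) (𝓝 z) (𝓝 0) := by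
    have : Tendsto (fun w : ℂ => ‖w - z‖) (𝓝 z) (𝓝 0) := by
      have := (tendsto_id (x := 𝓝 z)).sub_const z
      simpa using this.norm
    simpa using this.mul_const (2 * |z.im|⁻¹ * |z.im|⁻¹)
  refine squeeze_zero' (Eventually.of_forall fun _ => norm_nonneg _) ?_ hb
  filter_upwards [hev] with w hw
  have hz0 := abs_pos.2 hz
  have hw0 : w.im ≠ 0 := abs_pos.1 (lt_trans (by positivity) hw)
  rw [resolventOp_sub hP hw0 hz, norm_smul]
  gcongr
  refine (norm_mul_le _ _).trans ?_
  gcongr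
  · refine (norm_resolventOp_le hP hw0).trans ?_
    rw [inv_le_comm₀ (abs_pos.2 hw0) (by positivity), mul_inv, inv_inv]
    linarith
  · exact norm_resolventOp_le hP hz

/-- By the resolvent identity the difference quotient is exactly R(w) R(z), so continuity is enough.
-/
theorem hasDerivAt_resolventOp {P : H →ₗ.[ℂ] H} (hP : IsSelfAdjoint P) {z : ℂ}
    (hz : z.im ≠ 0) : HasDerivAt (resolventOp P) (resolventOp P z ^ 2) z := by
  rw [hasDerivAt_iff_tendsto_slope]
  have hev : ∀ᶠ w in 𝓝[≠] z, resolventOp P w * resolventOp P z = slope (resolventOp P) z w := by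
    have h1 : ∀ᶠ w in 𝓝[≠] z, w.im ≠ 0 :=
      nhdsWithin_le_nhds ((Complex.continuous_im.continuousAt (x := z)).eventually_ne hz)
    filter_upwards [h1, self_mem_nhdsWithin] with w hw hwz
    rw [slope_def_module, resolventOp_sub hP hw hz, smul_smul,
      inv_mul_cancel₀ (sub_ne_zero.2 hwz), one_smul]
  refine Tendsto.congr' hev ?_
  have hc : Tendsto (resolventOp P) (𝓝[≠] z) (𝓝 (resolventOp P z)) :=
    (continuousAt_resolventOp hP hz).tendsto.mono_left nhdsWithin_le_nhds
  rw [sq]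
  exact hc.mul_const _

theorem hasDerivAt_resolventOp_pow {P : H →ₗ.[ℂ] H} (hP : IsSelfAdjoint P) {z : ℂ}
    (hz : z.im ≠ 0) (k : ℕ) :
    HasDerivAt (fun w => resolventOp P w ^ k) ((k : ℂ) • resolventOp P z ^ (k + 1)) z := by
  induction k with
  | zero => simpa using hasDerivAt_const z (1 : H →L[ℂ] H)
  | succ k ih =>
    have h := ih.mul (hasDerivAt_resolventOp hP hz)
    have e : (fun w => resolventOp P w ^ (k + 1))
        = (fun w => resolventOp P w ^ k) * resolventOp P := by
      funext w; simp [pow_succ]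
    rw [e]
    refine h.congr_deriv ?_
    rw [smul_mul_assoc, ← pow_succ, ← pow_add]
    push_cast
    rw [add_smul, one_smul]

end Abstract

end SemiclassicalDecay

end

noncomputable section

namespace SemiclassicalDecay

/-! ### The functional calculus on `C₀(ℝ)` -/

/-- Continuous functions vanishing at infinity. -/
def IsC0 (g : ℝ → ℂ) : Prop := Continuous g ∧ Tendsto g (cocompact ℝ) (𝓝 0)

theorem IsC0.const_mul {g : ℝ → ℂ} (hg : IsC0 g) (a : ℂ) : IsC0 (fun t => a * g t) :=
  ⟨continuous_const.mul hg.1, by simpa using hg.2.const_mul a⟩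

theorem IsC0.sub {f g : ℝ → ℂ} (hf : IsC0 f) (hg : IsC0 g) : IsC0 (fun t => f t - g t) :=
  ⟨hf.1.sub hg.1, by simpa using hf.2.sub hg.2⟩

theorem IsC0.mul {f g : ℝ → ℂ} (hf : IsC0 f) (hg : IsC0 g) : IsC0 (fun t => f t * g t) :=
  ⟨hf.1.mul hg.1, by simpa using hf.2.mul hg.2⟩

theorem IsC0.conj {g : ℝ → ℂ} (hg : IsC0 g) : IsC0 (fun t => (starRingEnd ℂ) (g t)) := by
  refine ⟨Complex.continuous_conj.comp hg.1, ?_⟩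
  have := (Complex.continuous_conj.tendsto 0).comp hg.2
  simpa [Function.comp_def] using this

theorem isC0_of_hasCompactSupport {g : ℝ → ℂ} (hg : Continuous g) (hc : HasCompactSupport g) :
    IsC0 g :=
  ⟨hg, hc.is_zero_at_infty⟩

theorem isC0_inv_sub {z : ℂ} (hz : z.im ≠ 0) : IsC0 (fun t : ℝ => ((t : ℂ) - z)⁻¹) := by
  have hne : ∀ t : ℝ, (t : ℂ) - z ≠ 0 := by
    intro t h
    apply hz
    have := congrArg Complex.im h
    simpa using this
  refine ⟨Continuous.inv₀ (by fun_prop) hne, ?_⟩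
  refine tendsto_inv₀_cobounded.comp ?_
  rw [← tendsto_norm_atTop_iff_cobounded]
  have h1 : Tendsto (fun t : ℝ => ‖t‖ - ‖z‖) (cocompact ℝ) atTop :=
    tendsto_atTop_add_const_right _ _ (tendsto_norm_cocompact_atTop (E := ℝ))
  refine tendsto_atTop_mono (fun t => ?_) h1
  have := norm_sub_norm_le (t : ℂ) z
  simpa using this

/-- The function of `w = (λ + i)⁻¹` that corresponds to the function `g` of `λ`. -/
def transplant (g : ℝ → ℂ) (w : ℂ) : ℂ := if w = 0 then 0 else g (w⁻¹ - Complex.I).re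

/-- The image of the extended real line under `λ ↦ (λ + i)⁻¹`. -/
def resolventCircle : Set ℂ := {w | w = 0 ∨ w⁻¹ = ((w⁻¹ - Complex.I).re : ℂ) + Complex.I}

/-- Only w = 0 is at stake. On the circle w⁻¹ is a real number plus i, so w → 0 sends that real
number to infinity, where g vanishes. -/
theorem IsC0.continuousOn_transplant {g : ℝ → ℂ} (hg : IsC0 g) :
    ContinuousOn (transplant g) resolventCircle := by
  intro w hw
  rcases eq_or_ne w 0 with rfl | hw0
  · unfold ContinuousWithinAt
    have e : transplant g 0 = 0 := by simp [transplant]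
    rw [e]
    have hlim : Tendsto (fun w : ℂ => g (w⁻¹ - Complex.I).re)
        (𝓝[resolventCircle \ {0}] 0) (𝓝 0) := by
      refine hg.2.comp ?_
      rw [← comap_norm_atTop (E := ℝ) |>.trans (Metric.cobounded_eq_cocompact),
        tendsto_comap_iff]
      have h1 : Tendsto (fun w : ℂ => ‖w⁻¹‖ - 1) (𝓝[resolventCircle \ {0}] 0) atTop := by
        refine tendsto_atTop_add_const_right _ _ ?_
        have h2 : Tendsto (fun w : ℂ => ‖w‖⁻¹) (𝓝[≠] 0) atTop := by
          refine tendsto_inv_nhdsGT_zero.comp ?_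
          exact tendsto_norm_nhdsNE_zero
        simp only [norm_inv]
        exact h2.mono_left (nhdsWithin_mono _ fun x hx => hx.2)
      refine tendsto_atTop_mono' _ ?_ h1
      filter_upwards [self_mem_nhdsWithin] with v hv
      rcases hv.1 with h0 | h0
      · exact absurd h0 hv.2
      · have h3 : ‖v⁻¹‖ ≤ ‖(((v⁻¹ - Complex.I).re : ℝ) : ℂ)‖ + ‖Complex.I‖ := by
          conv_lhs => rw [h0]
          exact norm_add_le _ _
        rw [Complex.norm_real, Complex.norm_I] at h3
        simp only [Function.comp]
        linarith
    rw [Metric.tendsto_nhdsWithin_nhds] at hlim ⊢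
    intro e he
    obtain ⟨d, hd, h⟩ := hlim e he
    refine ⟨d, hd, fun {x} hx hxd => ?_⟩
    by_cases hx0 : x = 0
    · simpa [transplant, hx0] using he
    · have := h ⟨hx, hx0⟩ hxd
      simpa [transplant, hx0] using this
  · have hev : transplant g =ᶠ[𝓝 w] fun w => g (w⁻¹ - Complex.I).re := by
      filter_upwards [isOpen_ne.mem_nhds hw0] with v hv
      simp only [transplant, if_neg (show v ≠ 0 from hv)]
    refine ContinuousAt.continuousWithinAt (ContinuousAt.congr ?_ hev.symm)
    refine hg.1.continuousAt.comp ?_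
    exact Complex.continuous_re.continuousAt.comp ((continuousAt_inv₀ hw0).sub continuousAt_const)

section Abstract

variable {H : Type*} [NormedAddCommGroup H] [InnerProductSpace ℂ H] [CompleteSpace H]

open scoped InnerProductSpace

theorem funCalc_eq_cfc (P : H →ₗ.[ℂ] H) (g : ℝ → ℂ) :
    funCalc P g = cfc (transplant g) (resolventOp P (-Complex.I)) := rfl

theorem im_neg_I_ne : (-Complex.I).im ≠ 0 := by simp

/-- The resolvent identity between -i and i reads T - T* + 2i T T* = 0. The functional calculus
transfers this relation to the points of the spectrum, where it says that w = 0 or that w⁻¹ has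
imaginary part 1. -/
theorem spectrum_subset_resolventCircle {P : H →ₗ.[ℂ] H} (hP : IsSelfAdjoint P) :
    spectrum ℂ (resolventOp P (-Complex.I)) ⊆ resolventCircle := by
  have hn := isStarNormal_resolventOp hP im_neg_I_ne
  set T := resolventOp P (-Complex.I) with hT
  have hstar : star T = resolventOp P Complex.I := by
    rw [hT, star_resolventOp hP im_neg_I_ne]; simp
  have hid : T - star T + (2 * Complex.I) • (T * star T) = 0 := by
    rw [hstar, hT, resolventOp_sub hP im_neg_I_ne (by simp : Complex.I.im ≠ 0), ← add_smul]
    ring_nf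
    simp
  have hcfc : cfc (fun w : ℂ => w - star w + (2 * Complex.I) * (w * star w)) T
      = cfc (fun _ : ℂ => (0 : ℂ)) T := by
    rw [cfc_add (a := T) (fun w : ℂ => w - star w) (fun w : ℂ => (2 * Complex.I) * (w * star w)),
      cfc_sub (a := T) (fun w : ℂ => w) (fun w : ℂ => star w),
      cfc_const_mul (2 * Complex.I) (fun w : ℂ => w * star w) T,
      cfc_mul (fun w : ℂ => w) (fun w : ℂ => star w) T, cfc_star_id (a := T), cfc_id' ℂ T, cfc_const_zero ℂ T]
    exact hid
  have heq := eqOn_of_cfc_eq_cfc hcfc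
  intro w hw
  have h := heq hw
  simp only at h
  rcases eq_or_ne w 0 with h0 | h0
  · exact Or.inl h0
  · right
    have him : w.im = -(w.re ^ 2 + w.im ^ 2) := by
      have := congrArg Complex.im h
      simp at this
      nlinarith
    have hns : Complex.normSq w ≠ 0 := by simpa using h0
    apply Complex.ext
    · simp
    · simp only [Complex.inv_im, Complex.add_im, Complex.ofReal_im, Complex.I_im, zero_add]
      rw [div_eq_one_iff_eq hns, Complex.normSq_apply]
      nlinarith

theorem continuousOn_spectrum {P : H →ₗ.[ℂ] H} (hP : IsSelfAdjoint P) {g : ℝ → ℂ}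
    (hg : IsC0 g) :
    ContinuousOn (transplant g) (spectrum ℂ (resolventOp P (-Complex.I))) :=
  hg.continuousOn_transplant.mono (spectrum_subset_resolventCircle hP)

/-- Transplanted functions vanish at w = 0, so every pointwise operation that fixes 0 is compatible
with the transplantation. All algebraic rules of `funCalc` reduce to this. -/
theorem transplant_binop (op : ℂ → ℂ → ℂ) (h0 : op 0 0 = 0) (f g : ℝ → ℂ) :
    transplant (fun t => op (f t) (g t)) = fun w => op (transplant f w) (transplant g w) := by
  funext w
  unfold transplant
  split_ifs <;> simp [h0]

theorem funCalc_add {P : H →ₗ.[ℂ] H} (hP : IsSelfAdjoint P) {f g : ℝ → ℂ} (hf : IsC0 f)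
    (hg : IsC0 g) : funCalc P (fun t => f t + g t) = funCalc P f + funCalc P g := by
  rw [funCalc_eq_cfc, transplant_binop (· + ·) (by simp),
    cfc_add _ _ _ (continuousOn_spectrum hP hf) (continuousOn_spectrum hP hg)]
  rfl

theorem funCalc_sub {P : H →ₗ.[ℂ] H} (hP : IsSelfAdjoint P) {f g : ℝ → ℂ} (hf : IsC0 f)
    (hg : IsC0 g) : funCalc P (fun t => f t - g t) = funCalc P f - funCalc P g := by
  rw [funCalc_eq_cfc, transplant_binop (· - ·) (by simp),
    cfc_sub _ _ _ (continuousOn_spectrum hP hf) (continuousOn_spectrum hP hg)]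
  rfl

theorem funCalc_mul {P : H →ₗ.[ℂ] H} (hP : IsSelfAdjoint P) {f g : ℝ → ℂ} (hf : IsC0 f)
    (hg : IsC0 g) : funCalc P (fun t => f t * g t) = funCalc P f * funCalc P g := by
  rw [funCalc_eq_cfc, transplant_binop (· * ·) (by simp),
    cfc_mul _ _ _ (continuousOn_spectrum hP hf) (continuousOn_spectrum hP hg)]
  rfl

theorem funCalc_const_mul {P : H →ₗ.[ℂ] H} (hP : IsSelfAdjoint P) {g : ℝ → ℂ}
    (hg : IsC0 g) (a : ℂ) : funCalc P (fun t => a * g t) = a • funCalc P g := by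
  rw [funCalc_eq_cfc, transplant_binop (fun _ y => a * y) (by simp) g g,
    cfc_const_mul _ _ _ (continuousOn_spectrum hP hg)]
  rfl

theorem funCalc_conj (P : H →ₗ.[ℂ] H) (g : ℝ → ℂ) :
    funCalc P (fun t => (starRingEnd ℂ) (g t)) = star (funCalc P g) := by
  rw [funCalc_eq_cfc, transplant_binop (fun _ y => (starRingEnd ℂ) y) (by simp) g g,
    funCalc_eq_cfc, ← cfc_star]
  rfl

theorem norm_funCalc_le {P : H →ₗ.[ℂ] H} (g : ℝ → ℂ) {C : ℝ} (hC : 0 ≤ C)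
    (h : ∀ t, ‖g t‖ ≤ C) : ‖funCalc P g‖ ≤ C := by
  rw [funCalc_eq_cfc]
  refine norm_cfc_le hC fun w _ => ?_
  unfold transplant
  split_ifs
  · simpa using hC
  · exact h _

theorem funCalc_sq {P : H →ₗ.[ℂ] H} (hP : IsSelfAdjoint P) {g : ℝ → ℝ}
    (hg : IsC0 fun t => (g t : ℂ)) (f : H) :
    ⟪f, funCalc P (fun t => ((g t ^ 2 : ℝ) : ℂ)) f⟫_ℂ
      = ((‖funCalc P (fun t => (g t : ℂ)) f‖ ^ 2 : ℝ) : ℂ) := by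
  have e : (fun t => ((g t ^ 2 : ℝ) : ℂ)) = fun t => (starRingEnd ℂ) (g t : ℂ) * (g t : ℂ) := by
    funext t; rw [Complex.conj_ofReal]; push_cast; ring
  rw [e, funCalc_mul hP hg.conj hg, funCalc_conj, ContinuousLinearMap.star_eq_adjoint]
  rw [show ((ContinuousLinearMap.adjoint (funCalc P fun t => (g t : ℂ)))
      * funCalc P fun t => (g t : ℂ)) f = ContinuousLinearMap.adjoint (funCalc P fun t => (g t : ℂ))
      (funCalc P (fun t => (g t : ℂ)) f) from rfl, ContinuousLinearMap.adjoint_inner_right,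
    inner_self_eq_norm_sq_to_K]
  push_cast
  rfl

/-- Write g as the square of its root, which again vanishes at infinity. -/
theorem re_inner_funCalc_nonneg {P : H →ₗ.[ℂ] H} (hP : IsSelfAdjoint P) {g : ℝ → ℝ}
    (hg : IsC0 fun t => (g t : ℂ)) (h0 : ∀ t, 0 ≤ g t) (f : H) :
    0 ≤ (⟪f, funCalc P (fun t => (g t : ℂ)) f⟫_ℂ).re := by
  have hs : IsC0 fun t => (Real.sqrt (g t) : ℂ) := by
    have h1 : Tendsto g (cocompact ℝ) (𝓝 0) := by
      have := (Complex.continuous_re.tendsto 0).comp hg.2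
      simpa [Function.comp_def] using this
    have h2 : Continuous g := by
      have := Complex.continuous_re.comp hg.1
      simpa [Function.comp_def] using this
    refine ⟨by fun_prop, ?_⟩
    have := ((Complex.continuous_ofReal.comp Real.continuous_sqrt).tendsto 0).comp h1
    simpa [Function.comp_def] using this
  have := funCalc_sq hP hs f
  have e : (fun t => ((Real.sqrt (g t) ^ 2 : ℝ) : ℂ)) = fun t => (g t : ℂ) := by
    funext t; rw [Real.sq_sqrt (h0 t)]
  rw [e] at this
  rw [this, Complex.ofReal_re]
  positivity

theorem re_inner_funCalc_mono {P : H →ₗ.[ℂ] H} (hP : IsSelfAdjoint P) {g k : ℝ → ℝ}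
    (hg : IsC0 fun t => (g t : ℂ)) (hk : IsC0 fun t => (k t : ℂ)) (h : ∀ t, g t ≤ k t) (f : H) :
    (⟪f, funCalc P (fun t => (g t : ℂ)) f⟫_ℂ).re
      ≤ (⟪f, funCalc P (fun t => (k t : ℂ)) f⟫_ℂ).re := by
  have h1 : IsC0 fun t => ((k t - g t : ℝ) : ℂ) := by simpa using hk.sub hg
  have h2 := re_inner_funCalc_nonneg hP h1 (fun t => sub_nonneg.2 (h t)) f
  have e : funCalc P (fun t => ((k t - g t : ℝ) : ℂ))
      = funCalc P (fun t => (k t : ℂ)) - funCalc P (fun t => (g t : ℂ)) := by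
    rw [← funCalc_sub hP hk hg]; simp
  rw [e, sub_apply, inner_sub_right, Complex.sub_re] at h2
  linarith

/-- On the circle the function satisfies G (1 - (z + i) w) = w. Hence the operator G satisfies G (1
- (z + i) T) = T, and the resolvent identity inverts the second factor by 1 + (z + i) R(z). -/
theorem funCalc_inv_sub {P : H →ₗ.[ℂ] H} (hP : IsSelfAdjoint P) {z : ℂ} (hz : z.im ≠ 0) :
    funCalc P (fun t => ((t : ℂ) - z)⁻¹) = resolventOp P z := by
  have hn := isStarNormal_resolventOp hP im_neg_I_ne
  have hcont := continuousOn_spectrum hP (isC0_inv_sub hz)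
  have hsp := spectrum_subset_resolventCircle hP
  have hid := resolventOp_sub hP hz im_neg_I_ne
  rw [resolventOp_mul_comm hP hz im_neg_I_ne] at hid
  rw [funCalc_eq_cfc]
  set T := resolventOp P (-Complex.I) with hT
  set G := cfc (transplant fun t => ((t : ℂ) - z)⁻¹) T with hG
  have h1 : G * (1 - (z + Complex.I) • T) = T := by
    have e : cfc (fun w : ℂ => 1 - (z + Complex.I) * w) T = 1 - (z + Complex.I) • T := by
      rw [cfc_sub _ _ T, cfc_const_mul _ _ T, cfc_const_one ℂ T, cfc_id' ℂ T]
    rw [← e, hG, ← cfc_mul _ _ T hcont (by fun_prop)]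
    conv_rhs => rw [← cfc_id' ℂ T]
    refine cfc_congr fun w hw => ?_
    rcases hsp hw with h0 | h0
    · simp [h0, transplant]
    · by_cases hw0 : w = 0
      · simp [hw0, transplant]
      · simp only [transplant, if_neg hw0]
        have hne : (((w⁻¹ - Complex.I).re : ℝ) : ℂ) - z ≠ 0 := by
          intro h
          apply hz
          have := congrArg Complex.im h
          simpa using this
        have h2 : (((w⁻¹ - Complex.I).re : ℝ) : ℂ) = w⁻¹ - Complex.I := by
          linear_combination -h0
        rw [h2] at hne ⊢
        have h3 : 1 - (z + Complex.I) * w = w * (w⁻¹ - Complex.I - z) := by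
          field_simp
          ring
        rw [h3, mul_left_comm, inv_mul_cancel₀ hne, mul_one]
  have h2 : (1 - (z + Complex.I) • T) * (1 + (z + Complex.I) • resolventOp P z) = 1 := by
    have h3 : resolventOp P z = T + (z + Complex.I) • (T * resolventOp P z) := by
      rw [← sub_eq_iff_eq_add', hid, sub_neg_eq_add]
    have h4 : (z + Complex.I) • resolventOp P z = (z + Complex.I) • T
        + (z + Complex.I) • (z + Complex.I) • (T * resolventOp P z) := by
      conv_lhs => rw [h3]
      rw [smul_add]
    rw [sub_mul, one_mul, mul_add, mul_one, smul_mul_assoc, mul_smul_comm]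
    conv_lhs => rw [h4]
    abel
  have h5 : G = T * (1 + (z + Complex.I) • resolventOp P z) := by
    rw [← h1, mul_assoc, h2, mul_one]
  rw [h5, mul_add, mul_one, mul_smul_comm]
  rw [sub_neg_eq_add, sub_eq_iff_eq_add'] at hid
  exact hid.symm

end Abstract

end SemiclassicalDecay

end

noncomputable section

namespace SemiclassicalDecay

/-! ### The Poisson kernel and the spectral density -/

/-- The Poisson kernel of the half plane, without the factor `π⁻¹`. -/
def poissonKernel (x η t : ℝ) : ℝ := η / ((t - x) ^ 2 + η ^ 2)

theorem poissonKernel_eq {η : ℝ} (hη : 0 < η) (x t : ℝ) :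
    poissonKernel x η t = η⁻¹ * (1 + ((t - x) / η) ^ 2)⁻¹ := by
  unfold poissonKernel
  have : (t - x) ^ 2 + η ^ 2 ≠ 0 := by positivity
  have h2 : 1 + ((t - x) / η) ^ 2 ≠ 0 := by positivity
  field_simp
  ring

theorem poissonKernel_nonneg {η : ℝ} (hη : 0 < η) (x t : ℝ) : 0 ≤ poissonKernel x η t := by
  unfold poissonKernel; positivity

theorem poissonKernel_symm (x η t : ℝ) : poissonKernel x η t = poissonKernel t η x := by
  unfold poissonKernel
  rw [← neg_sub x t, neg_sq]

theorem continuous_poissonKernel {η : ℝ} (hη : 0 < η) (x : ℝ) :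
    Continuous (poissonKernel x η) := by
  unfold poissonKernel
  refine continuous_const.div (by fun_prop) fun t => ?_
  positivity

theorem integrable_poissonKernel {η : ℝ} (hη : 0 < η) (x : ℝ) :
    Integrable (poissonKernel x η) := by
  have h : Integrable fun t : ℝ => (1 + ((t - x) / η) ^ 2)⁻¹ :=
    (integrable_inv_one_add_sq.comp_div hη.ne').comp_sub_right x
  refine (h.const_mul η⁻¹).congr (ae_of_all _ fun t => ?_)
  rw [poissonKernel_eq hη]

theorem integral_poissonKernel {η : ℝ} (hη : 0 < η) (x : ℝ) :
    ∫ t, poissonKernel x η t = Real.pi := by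
  simp_rw [poissonKernel_eq hη]
  rw [integral_const_mul, integral_sub_right_eq_self (fun t => (1 + (t / η) ^ 2)⁻¹) x,
    Measure.integral_comp_div (fun t => (1 + t ^ 2)⁻¹) η, integral_univ_inv_one_add_sq,
    abs_of_pos hη, smul_eq_mul]
  field_simp

/-- A trapezoidal cutoff function, `1` on `[x - r, x + r]` and `0` off `[x - 2r, x + 2r]`. -/
def trapezoid (x r t : ℝ) : ℝ := max 0 (min 1 (2 - |t - x| / r))

theorem continuous_trapezoid (x r : ℝ) : Continuous (trapezoid x r) := by
  unfold trapezoid; fun_prop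

theorem trapezoid_nonneg (x r t : ℝ) : 0 ≤ trapezoid x r t := le_max_left _ _

theorem trapezoid_le_one (x r t : ℝ) : trapezoid x r t ≤ 1 :=
  max_le zero_le_one (min_le_left _ _)

theorem trapezoid_eq_one {x r t : ℝ} (hr : 0 < r) (h : |t - x| ≤ r) : trapezoid x r t = 1 := by
  have : |t - x| / r ≤ 1 := (div_le_one hr).2 h
  unfold trapezoid
  rw [min_eq_left (by linarith), max_eq_right zero_le_one]

theorem trapezoid_eq_zero {x r t : ℝ} (hr : 0 < r) (h : 2 * r ≤ |t - x|) :
    trapezoid x r t = 0 := by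
  have : 2 ≤ |t - x| / r := (le_div_iff₀ hr).2 h
  unfold trapezoid
  rw [max_eq_left (min_le_of_right_le (by linarith))]

theorem hasCompactSupport_trapezoid {x r : ℝ} (hr : 0 < r) :
    HasCompactSupport (trapezoid x r) := by
  refine HasCompactSupport.of_support_subset_isCompact (isCompact_closedBall x (2 * r)) ?_
  intro t ht
  by_contra h
  rw [Metric.mem_closedBall, Real.dist_eq, not_le] at h
  exact ht (trapezoid_eq_zero hr h.le)

section Abstract

variable {H : Type*} [NormedAddCommGroup H] [InnerProductSpace ℂ H] [CompleteSpace H]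

open scoped InnerProductSpace

theorem inner_star_mul_self (A : H →L[ℂ] H) (g : H) :
    ⟪g, (star A * A) g⟫_ℂ = ((‖A g‖ ^ 2 : ℝ) : ℂ) := by
  rw [mul_apply_eq_comp, ContinuousLinearMap.star_eq_adjoint,
    ContinuousLinearMap.adjoint_inner_right, inner_self_eq_norm_sq_to_K]
  push_cast
  rfl

/-- The function `t ↦ ((t - x)² + η²)⁻¹`. -/
def normSqKernel (x η t : ℝ) : ℝ := ((t - x) ^ 2 + η ^ 2)⁻¹

theorem normSqKernel_eq (x η t : ℝ) : ((normSqKernel x η t : ℝ) : ℂ)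
    = (starRingEnd ℂ) ((t : ℂ) - (x + η * Complex.I))⁻¹ * ((t : ℂ) - (x + η * Complex.I))⁻¹ := by
  rw [map_inv₀, ← mul_inv, mul_comm ((starRingEnd ℂ) _), Complex.mul_conj, Complex.normSq_apply]
  simp [normSqKernel]
  ring

theorem isC0_normSqKernel {η : ℝ} (hη : η ≠ 0) (x : ℝ) :
    IsC0 fun t => ((normSqKernel x η t : ℝ) : ℂ) := by
  simp_rw [normSqKernel_eq]
  exact (isC0_inv_sub (by simpa using hη)).conj.mul (isC0_inv_sub (by simpa using hη))

theorem funCalc_normSqKernel {P : H →ₗ.[ℂ] H} (hP : IsSelfAdjoint P) {η : ℝ} (hη : η ≠ 0)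
    (x : ℝ) : funCalc P (fun t => ((normSqKernel x η t : ℝ) : ℂ))
      = star (resolventOp P (x + η * Complex.I)) * resolventOp P (x + η * Complex.I) := by
  have hz : (x + η * Complex.I : ℂ).im ≠ 0 := by simpa using hη
  simp_rw [normSqKernel_eq]
  rw [funCalc_mul hP (isC0_inv_sub hz).conj (isC0_inv_sub hz), funCalc_conj, funCalc_inv_sub hP hz]

theorem re_inner_normSqKernel {P : H →ₗ.[ℂ] H} (hP : IsSelfAdjoint P) {η : ℝ} (hη : η ≠ 0)
    (x : ℝ) (g : H) :
    (⟪g, funCalc P (fun t => ((normSqKernel x η t : ℝ) : ℂ)) g⟫_ℂ).re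
      = ‖resolventOp P (x + η * Complex.I) g‖ ^ 2 := by
  rw [funCalc_normSqKernel hP hη, inner_star_mul_self, Complex.ofReal_re]

theorem im_inner_resolventOp {P : H →ₗ.[ℂ] H} (hP : IsSelfAdjoint P) {η : ℝ} (hη : η ≠ 0)
    (x : ℝ) (g : H) :
    (⟪g, resolventOp P (x + η * Complex.I) g⟫_ℂ).im
      = η * ‖resolventOp P (x + η * Complex.I) g‖ ^ 2 := by
  have hz : (x + η * Complex.I : ℂ).im ≠ 0 := by simpa using hη
  obtain ⟨u, hu, hPu⟩ := exists_resolventOp hP hz g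
  have h := im_mul_norm_sq hP (x + η * Complex.I) u
  rw [hPu, hu, add_sub_cancel_left] at h
  have h2 : (⟪g, resolventOp P (x + η * Complex.I) g⟫_ℂ).im
      = -(⟪resolventOp P (x + η * Complex.I) g, g⟫_ℂ).im := by
    rw [← inner_conj_symm, Complex.conj_im]
  rw [h2, ← h]
  simp

/-- The positive functional `k ↦ ⟨g, k(P) g⟩`. -/
def spectralFunctional {P : H →ₗ.[ℂ] H} (hP : IsSelfAdjoint P) (g : H) :
    CompactlySupportedContinuousMap ℝ ℝ →ₚ[ℝ] ℝ :=
  have hC : ∀ k : CompactlySupportedContinuousMap ℝ ℝ, IsC0 fun t => ((k t : ℝ) : ℂ) := fun k =>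
    isC0_of_hasCompactSupport (by fun_prop)
      (k.hasCompactSupport.comp_left (g := ((↑) : ℝ → ℂ)) Complex.ofReal_zero)
  PositiveLinearMap.mk₀
    { toFun := fun k => (⟪g, funCalc P (fun t => ((k t : ℝ) : ℂ)) g⟫_ℂ).re
      map_add' := fun k l => by
        have : (fun t => (((k + l) t : ℝ) : ℂ)) = fun t => ((k t : ℝ) : ℂ) + ((l t : ℝ) : ℂ) := by
          funext t; simp
        rw [this, funCalc_add hP (hC k) (hC l)]
        simp
      map_smul' := fun a k => by
        have : (fun t => (((a • k) t : ℝ) : ℂ)) = fun t => (a : ℂ) * ((k t : ℝ) : ℂ) := by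
          funext t; simp
        rw [this, funCalc_const_mul hP (hC k)]
        simp }
    fun k hk => re_inner_funCalc_nonneg hP (hC k) (fun t => hk t) g

/-- The spectral measure of `P` at the vector `g`. -/
def spectralMeasure {P : H →ₗ.[ℂ] H} (hP : IsSelfAdjoint P) (g : H) : Measure ℝ :=
  RealRMK.rieszMeasure (spectralFunctional hP g)

theorem lintegral_spectralMeasure {P : H →ₗ.[ℂ] H} (hP : IsSelfAdjoint P) (g : H) {k : ℝ → ℝ}
    (hk : Continuous k) (hkc : HasCompactSupport k) (h0 : ∀ t, 0 ≤ k t) :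
    ∫⁻ t, ENNReal.ofReal (k t) ∂(spectralMeasure hP g)
      = ENNReal.ofReal (⟪g, funCalc P (fun t => ((k t : ℝ) : ℂ)) g⟫_ℂ).re := by
  let K : CompactlySupportedContinuousMap ℝ ℝ := ⟨⟨k, hk⟩, hkc⟩
  have h := RealRMK.integral_rieszMeasure (spectralFunctional hP g) K
  have hint : Integrable k (spectralMeasure hP g) := by
    unfold spectralMeasure
    exact hk.integrable_of_hasCompactSupport hkc
  rw [← ofReal_integral_eq_lintegral_ofReal hint (ae_of_all _ h0)]
  exact congrArg ENNReal.ofReal h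

/-- On the ball 1 ≤ 2r²/((t - x)² + r²), and r/((t - x)² + r²) evaluated at P is the imaginary part
of R(x + ir). The factor 2r is the length of the ball, so the resolvent bounds the density. The
trapezoid only makes the test function compactly supported. -/
theorem spectralMeasure_closedBall_le {P : H →ₗ.[ℂ] H} (hP : IsSelfAdjoint P) (g : H) (x : ℝ)
    {r : ℝ} (hr : 0 < r) :
    spectralMeasure hP g (Metric.closedBall x r)
      ≤ ENNReal.ofReal (2 * r * (⟪g, resolventOp P (x + r * Complex.I) g⟫_ℂ).im) := by
  set k : ℝ → ℝ := fun t => trapezoid x r t * (2 * r ^ 2 * normSqKernel x r t) with hk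
  have hq : Continuous (normSqKernel x r) := by
    unfold normSqKernel
    exact Continuous.inv₀ (by fun_prop) fun t => by positivity
  have hq0 : ∀ t, 0 ≤ normSqKernel x r t := fun t => by unfold normSqKernel; positivity
  have hkc : Continuous k := (continuous_trapezoid x r).mul (continuous_const.mul hq)
  have hks : HasCompactSupport k := (hasCompactSupport_trapezoid hr).mul_right
  have hk0 : ∀ t, 0 ≤ k t := fun t =>
    mul_nonneg (trapezoid_nonneg _ _ _) (mul_nonneg (by positivity) (hq0 t))
  have h1 : spectralMeasure hP g (Metric.closedBall x r)
      ≤ ∫⁻ t, ENNReal.ofReal (k t) ∂(spectralMeasure hP g) := by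
    rw [← lintegral_indicator_one Metric.isClosed_closedBall.measurableSet]
    refine lintegral_mono fun t => ?_
    by_cases ht : t ∈ Metric.closedBall x r
    · rw [Set.indicator_of_mem ht, Pi.one_apply, ENNReal.one_le_ofReal]
      rw [Metric.mem_closedBall, Real.dist_eq] at ht
      rw [hk]
      simp only
      rw [trapezoid_eq_one hr ht, one_mul, normSqKernel, ← div_eq_mul_inv,
        le_div_iff₀ (by positivity), one_mul]
      nlinarith [sq_abs (t - x), abs_nonneg (t - x)]
    · rw [Set.indicator_of_notMem ht]; exact zero_le
  refine h1.trans ?_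
  rw [lintegral_spectralMeasure hP g hkc hks hk0]
  refine ENNReal.ofReal_le_ofReal ?_
  have hC : IsC0 fun t => (((2 * r ^ 2) * normSqKernel x r t : ℝ) : ℂ) := by
    have := (isC0_normSqKernel hr.ne' x).const_mul ((2 * r ^ 2 : ℝ) : ℂ)
    simpa using this
  have hCk : IsC0 fun t => ((k t : ℝ) : ℂ) := isC0_of_hasCompactSupport (by fun_prop)
    (hks.comp_left (g := ((↑) : ℝ → ℂ)) Complex.ofReal_zero)
  refine (re_inner_funCalc_mono hP hCk hC (fun t => ?_) g).trans ?_
  · exact mul_le_of_le_one_left (mul_nonneg (by positivity) (hq0 t)) (trapezoid_le_one _ _ _)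
  · have e : (fun t => (((2 * r ^ 2) * normSqKernel x r t : ℝ) : ℂ))
        = fun t => ((2 * r ^ 2 : ℝ) : ℂ) * ((normSqKernel x r t : ℝ) : ℂ) := by
      funext t; push_cast; ring
    rw [e, funCalc_const_mul hP (isC0_normSqKernel hr.ne' x), smul_apply,
      inner_smul_right, Complex.re_ofReal_mul, re_inner_normSqKernel hP hr.ne',
      im_inner_resolventOp hP hr.ne']
    exact le_of_eq (by ring)

/-- Besicovitch differentiation: small balls around every point of s have spectral mass at most M'
times their length. The slack M' > M turns a limit at most M into an inequality valid for all small
radii. -/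
theorem spectralMeasure_le {P : H →ₗ.[ℂ] H} (hP : IsSelfAdjoint P) (g : H) {s : Set ℝ} {M M' : ℝ}
    (hM : ∀ x ∈ s, ∃ L ≤ M, Tendsto
      (fun η : ℝ => (⟪g, resolventOp P (x + η * Complex.I) g⟫_ℂ).im) (𝓝[>] 0) (𝓝 L))
    (hM' : M < M') (t : Set ℝ) (hts : t ⊆ s) :
    spectralMeasure hP g t ≤ ENNReal.ofReal M' * volume t := by
  have hfin : IsLocallyFiniteMeasure (ENNReal.ofReal M' • (volume : Measure ℝ)) :=
    inferInstanceAs (IsLocallyFiniteMeasure (M'.toNNReal • (volume : Measure ℝ)))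
  have hloc : IsFiniteMeasureOnCompacts (spectralMeasure hP g) := by
    unfold spectralMeasure; infer_instance
  have hsf : SFinite (spectralMeasure hP g) := inferInstance
  have := (Besicovitch.vitaliFamily (spectralMeasure hP g)).measure_le_of_frequently_le
    (ρ := spectralMeasure hP g) (ENNReal.ofReal M' • volume) Measure.AbsolutelyContinuous.rfl t
    (fun x hx => ?_)
  · simpa using this
  · obtain ⟨L, hL, hlim⟩ := hM x (hts hx)
    have hev : ∀ᶠ r : ℝ in 𝓝[>] 0, spectralMeasure hP g (Metric.closedBall x r)
        ≤ (ENNReal.ofReal M' • (volume : Measure ℝ)) (Metric.closedBall x r) := by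
      filter_upwards [hlim.eventually_lt_const (hL.trans_lt hM'), self_mem_nhdsWithin] with r hr hr0
      refine (spectralMeasure_closedBall_le hP g x hr0).trans ?_
      have hr0' : (0 : ℝ) < r := hr0
      rw [Measure.smul_apply, Real.volume_closedBall, smul_eq_mul,
        ← ENNReal.ofReal_mul' (by positivity), mul_comm M']
      refine ENNReal.ofReal_le_ofReal ?_
      gcongr
    exact (Besicovitch.tendsto_filterAt (spectralMeasure hP g) x).frequently hev.frequently

/-- Information on the boundary values alone controls the resolvent at every height η. The left side
is the Poisson integral of the spectral measure of g. Near x that measure is at most M times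
Lebesgue measure and the kernel has mass π; at distance at least d the kernel is at most η/d². -/
theorem mul_norm_resolventOp_sq_le {P : H →ₗ.[ℂ] H} (hP : IsSelfAdjoint P) (g : H) {s : Set ℝ}
    {M : ℝ} (hM0 : 0 ≤ M)
    (hM : ∀ x ∈ s, ∃ L ≤ M, Tendsto
      (fun η : ℝ => (⟪g, resolventOp P (x + η * Complex.I) g⟫_ℂ).im) (𝓝[>] 0) (𝓝 L))
    {x d : ℝ} (hd : 0 < d) (hx : Metric.closedBall x (2 * d) ⊆ s) {η : ℝ} (hη : 0 < η) :
    η * ‖resolventOp P (x + η * Complex.I) g‖ ^ 2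
      ≤ Real.pi * M + η / d ^ 2 * ‖g‖ ^ 2 := by
  set k : ℝ → ℝ := fun t => trapezoid x d t * poissonKernel x η t with hk
  have hkc : Continuous k := (continuous_trapezoid x d).mul (continuous_poissonKernel hη x)
  have hks : HasCompactSupport k := (hasCompactSupport_trapezoid hd).mul_right
  have hk0 : ∀ t, 0 ≤ k t := fun t =>
    mul_nonneg (trapezoid_nonneg _ _ _) (poissonKernel_nonneg hη _ _)
  have hCk : IsC0 fun t => ((k t : ℝ) : ℂ) := isC0_of_hasCompactSupport (by fun_prop)
    (hks.comp_left (g := ((↑) : ℝ → ℂ)) Complex.ofReal_zero)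
  have hP1 : ∀ t, poissonKernel x η t = η * normSqKernel x η t := fun t => rfl
  have hC : IsC0 fun t => ((poissonKernel x η t : ℝ) : ℂ) := by
    have := (isC0_normSqKernel hη.ne' x).const_mul (η : ℂ)
    simpa [hP1] using this
  have hmain : (⟪g, funCalc P (fun t => ((k t : ℝ) : ℂ)) g⟫_ℂ).re ≤ Real.pi * M := by
    -- The density bound is available only with M' > M; the slack is removed at the end.
    have hb : ∀ M' > M, (⟪g, funCalc P (fun t => ((k t : ℝ) : ℂ)) g⟫_ℂ).re ≤ Real.pi * M' := by
      intro M' hM'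
      have hM'0 : 0 ≤ M' := hM0.trans hM'.le
      have h1 : ENNReal.ofReal (⟪g, funCalc P (fun t => ((k t : ℝ) : ℂ)) g⟫_ℂ).re
          ≤ ENNReal.ofReal (Real.pi * M') := by
        rw [← lintegral_spectralMeasure hP g hkc hks hk0]
        have hle : (spectralMeasure hP g).restrict (Metric.closedBall x (2 * d))
            ≤ ENNReal.ofReal M' • volume := by
          refine Measure.le_iff.2 fun A hA => ?_
          rw [Measure.restrict_apply hA]
          refine (spectralMeasure_le hP g hM hM' _ (Set.inter_subset_right.trans hx)).trans ?_
          rw [Measure.smul_apply, smul_eq_mul]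
          gcongr
          exact Set.inter_subset_left
        calc ∫⁻ t, ENNReal.ofReal (k t) ∂(spectralMeasure hP g)
            = ∫⁻ t in Metric.closedBall x (2 * d), ENNReal.ofReal (k t)
                ∂(spectralMeasure hP g) := by
              rw [setLIntegral_eq_of_support_subset]
              intro t ht
              by_contra h
              rw [Metric.mem_closedBall, Real.dist_eq, not_le] at h
              apply ht
              simp [hk, trapezoid_eq_zero hd h.le]
          _ ≤ ∫⁻ t in Metric.closedBall x (2 * d), ENNReal.ofReal (poissonKernel x η t)
                ∂(spectralMeasure hP g) := by
              refine lintegral_mono fun t => ENNReal.ofReal_le_ofReal ?_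
              exact mul_le_of_le_one_left (poissonKernel_nonneg hη _ _) (trapezoid_le_one _ _ _)
          _ ≤ ∫⁻ t, ENNReal.ofReal (poissonKernel x η t)
                ∂(ENNReal.ofReal M' • (volume : Measure ℝ)) := lintegral_mono' hle le_rfl
          _ = ENNReal.ofReal (Real.pi * M') := by
              rw [lintegral_smul_measure, ← ofReal_integral_eq_lintegral_ofReal
                (integrable_poissonKernel hη x) (ae_of_all _ (poissonKernel_nonneg hη x)),
                integral_poissonKernel hη, smul_eq_mul, mul_comm,
                ENNReal.ofReal_mul Real.pi_pos.le]
      rwa [ENNReal.ofReal_le_ofReal_iff (by positivity)] at h1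
    refine le_of_forall_pos_le_add fun e he => ?_
    have := hb (M + e / Real.pi) (by have := Real.pi_pos; simp; positivity)
    rw [mul_add, mul_div_cancel₀ _ Real.pi_ne_zero] at this
    exact this
  have hrest : (⟪g, funCalc P (fun t => ((poissonKernel x η t - k t : ℝ) : ℂ)) g⟫_ℂ).re
      ≤ η / d ^ 2 * ‖g‖ ^ 2 := by
    have hn : ‖funCalc P (fun t => ((poissonKernel x η t - k t : ℝ) : ℂ))‖ ≤ η / d ^ 2 := by
      refine norm_funCalc_le _ (by positivity) fun t => ?_
      have e : poissonKernel x η t - k t = (1 - trapezoid x d t) * poissonKernel x η t := by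
        rw [hk]; ring
      rw [Complex.norm_real, e, Real.norm_of_nonneg (mul_nonneg
        (sub_nonneg.2 (trapezoid_le_one _ _ _)) (poissonKernel_nonneg hη _ _))]
      by_cases ht : |t - x| ≤ d
      · rw [trapezoid_eq_one hd ht]; simp; positivity
      · have h1 : poissonKernel x η t ≤ η / d ^ 2 := by
          unfold poissonKernel
          gcongr
          have := sq_abs (t - x)
          nlinarith [not_le.1 ht]
        have h2 := trapezoid_nonneg x d t
        exact (mul_le_of_le_one_left (poissonKernel_nonneg hη _ _) (by linarith)).trans h1
    refine (Complex.re_le_norm _).trans ((norm_inner_le_norm _ _).trans ?_)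
    calc ‖g‖ * ‖funCalc P (fun t => ((poissonKernel x η t - k t : ℝ) : ℂ)) g‖
        ≤ ‖g‖ * (η / d ^ 2 * ‖g‖) := by
          gcongr
          exact (ContinuousLinearMap.le_opNorm _ _).trans (by gcongr)
      _ = _ := by ring
  have hsum : η * ‖resolventOp P (x + η * Complex.I) g‖ ^ 2
      = (⟪g, funCalc P (fun t => ((k t : ℝ) : ℂ)) g⟫_ℂ).re
        + (⟪g, funCalc P (fun t => ((poissonKernel x η t - k t : ℝ) : ℂ)) g⟫_ℂ).re := by
    have e1 : funCalc P (fun t => ((poissonKernel x η t - k t : ℝ) : ℂ))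
        = funCalc P (fun t => ((poissonKernel x η t : ℝ) : ℂ))
          - funCalc P (fun t => ((k t : ℝ) : ℂ)) := by
      rw [← funCalc_sub hP hC hCk]; simp
    have e2 : funCalc P (fun t => ((poissonKernel x η t : ℝ) : ℂ))
        = (η : ℂ) • funCalc P (fun t => ((normSqKernel x η t : ℝ) : ℂ)) := by
      rw [← funCalc_const_mul hP (isC0_normSqKernel hη.ne' x)]
      simp [hP1]
    rw [e1, sub_apply, inner_sub_right, Complex.sub_re, e2, smul_apply, inner_smul_right,
      Complex.re_ofReal_mul, re_inner_normSqKernel hP hη.ne']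
    ring
  rw [hsum]
  exact add_le_add hmain hrest

end Abstract

end SemiclassicalDecay

end

noncomputable section

namespace SemiclassicalDecay

/-! ### Stone's formula -/

/-- The Poisson extension of `g`. -/
def poissonSmooth (g : ℝ → ℂ) (η t : ℝ) : ℂ :=
  ∫ l, g l * (((Real.pi⁻¹ * poissonKernel l η t : ℝ)) : ℂ)

theorem poissonKernel_le {η : ℝ} (hη : 0 < η) (x t : ℝ) : poissonKernel x η t ≤ η⁻¹ := by
  rw [poissonKernel_eq hη]
  refine mul_le_of_le_one_right (by positivity) (inv_le_one_of_one_le₀ ?_)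
  nlinarith [sq_nonneg ((t - x) / η)]

theorem continuous_poissonKernel_left {η : ℝ} (hη : 0 < η) (t : ℝ) :
    Continuous fun x => poissonKernel x η t := by
  simp_rw [fun x => poissonKernel_symm x η t]
  exact continuous_poissonKernel hη t

theorem tendsto_poissonKernel_cocompact {η : ℝ} (hη : 0 < η) (x : ℝ) :
    Tendsto (poissonKernel x η) (cocompact ℝ) (𝓝 0) := by
  have h := (isC0_normSqKernel hη.ne' x).2
  have h2 := ((Complex.continuous_re.tendsto 0).comp h).const_mul η
  rw [Complex.zero_re, mul_zero] at h2
  exact h2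

theorem isC0_poissonSmooth {g : ℝ → ℂ} (hg : Continuous g) (hc : HasCompactSupport g) {η : ℝ}
    (hη : 0 < η) : IsC0 (poissonSmooth g η) := by
  have hint : Integrable fun l => ‖g l‖ * (Real.pi⁻¹ * η⁻¹) :=
    (hg.integrable_of_hasCompactSupport hc).norm.mul_const _
  have hmeas : ∀ t, AEStronglyMeasurable
      (fun l => g l * (((Real.pi⁻¹ * poissonKernel l η t : ℝ)) : ℂ)) volume := fun t =>
    (hg.mul (Complex.continuous_ofReal.comp
      (continuous_const.mul (continuous_poissonKernel_left hη t)))).aestronglyMeasurable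
  have hb : ∀ t l, ‖g l * (((Real.pi⁻¹ * poissonKernel l η t : ℝ)) : ℂ)‖
      ≤ ‖g l‖ * (Real.pi⁻¹ * η⁻¹) := by
    intro t l
    have hpi := Real.pi_pos
    rw [norm_mul, Complex.norm_real, Real.norm_of_nonneg
      (mul_nonneg (by positivity) (poissonKernel_nonneg hη _ _))]
    gcongr
    exact poissonKernel_le hη _ _
  constructor
  · refine continuous_of_dominated hmeas (fun t => ae_of_all _ (hb t)) hint (ae_of_all _ fun l => ?_)
    exact continuous_const.mul (Complex.continuous_ofReal.comp
      (continuous_const.mul (continuous_poissonKernel hη l)))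
  · have hcg : (cocompact ℝ).IsCountablyGenerated := by
      rw [cocompact_eq_atBot_atTop]; infer_instance
    have := tendsto_integral_filter_of_dominated_convergence (l := cocompact ℝ)
      (F := fun t l => g l * (((Real.pi⁻¹ * poissonKernel l η t : ℝ)) : ℂ)) (f := fun _ => 0)
      _ (Eventually.of_forall hmeas) (Eventually.of_forall fun t => ae_of_all _ (hb t)) hint
      (ae_of_all _ fun l => ?_)
    · rw [integral_zero] at this
      exact this
    · have h1 := ((tendsto_poissonKernel_cocompact hη l).const_mul Real.pi⁻¹).ofReal.const_mul (g l)
      rw [mul_zero, Complex.ofReal_zero, mul_zero] at h1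
      exact h1

/-- Substitute l = t + ηy and use that the kernel has mass one after division by π. -/
theorem poissonSmooth_sub {g : ℝ → ℂ} (hg : Continuous g) (hc : HasCompactSupport g) {η : ℝ}
    (hη : 0 < η) (t : ℝ) : poissonSmooth g η t - g t
      = ∫ y, (g (t + η * y) - g t) * ((Real.pi⁻¹ * (1 + y ^ 2)⁻¹ : ℝ) : ℂ) := by
  obtain ⟨B, hB⟩ := hg.bounded_above_of_compact_support hc
  have hk : Integrable fun y : ℝ => ((Real.pi⁻¹ * (1 + y ^ 2)⁻¹ : ℝ) : ℂ) :=
    (integrable_inv_one_add_sq.const_mul _).ofReal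
  have hgk : Integrable fun y : ℝ => g (t + η * y) * ((Real.pi⁻¹ * (1 + y ^ 2)⁻¹ : ℝ) : ℂ) :=
    hk.bdd_mul (by fun_prop) (ae_of_all _ fun y => hB _)
  simp_rw [sub_mul]
  rw [integral_sub hgk (hk.const_mul _), integral_const_mul, integral_complex_ofReal, integral_const_mul,
    integral_univ_inv_one_add_sq, inv_mul_cancel₀ Real.pi_ne_zero, Complex.ofReal_one, mul_one]
  congr 1
  have h1 := Measure.integral_comp_mul_left (fun s => g (t + s) *
    (((Real.pi⁻¹ * (η⁻¹ * (1 + (s / η) ^ 2)⁻¹) : ℝ)) : ℂ)) η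
  have h2 := integral_add_left_eq_self (μ := (volume : Measure ℝ)) (fun s => g s *
    (((Real.pi⁻¹ * (η⁻¹ * (1 + ((s - t) / η) ^ 2)⁻¹) : ℝ)) : ℂ)) t
  simp only [add_sub_cancel_left] at h2
  rw [h2] at h1
  have h3 : poissonSmooth g η t = ∫ s, g s *
    (((Real.pi⁻¹ * (η⁻¹ * (1 + ((s - t) / η) ^ 2)⁻¹) : ℝ)) : ℂ) := by
    unfold poissonSmooth
    congr 1
    funext l
    rw [poissonKernel_symm, poissonKernel_eq hη]
  rw [h3]
  have h4 : (η : ℝ) • ∫ x, g (t + η * x) *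
      (((Real.pi⁻¹ * (η⁻¹ * (1 + (η * x / η) ^ 2)⁻¹) : ℝ)) : ℂ) = ∫ s, g s *
    (((Real.pi⁻¹ * (η⁻¹ * (1 + ((s - t) / η) ^ 2)⁻¹) : ℝ)) : ℂ) := by
    rw [h1, smul_smul, abs_of_pos (by positivity), mul_inv_cancel₀ hη.ne', one_smul]
  rw [← h4, ← integral_smul]
  congr 1
  funext x
  rw [mul_div_cancel_left₀ _ hη.ne', Complex.real_smul]
  push_cast
  have : (η : ℂ) ≠ 0 := by exact_mod_cast hη.ne'
  field_simp

/-- For |ηy| < d uniform continuity gives e/2. Elsewhere the difference is at most 2B, and min(1,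
|ηy|/d) is a continuous majorant of the indicator of that region whose integral against the kernel
tends to 0. The bound is uniform in t, as the functional calculus requires. -/
theorem eventually_norm_poissonSmooth_sub_le {g : ℝ → ℂ} (hg : Continuous g)
    (hc : HasCompactSupport g) {e : ℝ} (he : 0 < e) :
    ∀ᶠ η in 𝓝[>] (0 : ℝ), ∀ t, ‖poissonSmooth g η t - g t‖ ≤ e := by
  obtain ⟨B, hB⟩ := hg.bounded_above_of_compact_support hc
  have hB0 : 0 ≤ B := (norm_nonneg _).trans (hB 0)
  have huc := hc.uniformContinuous_of_continuous hg
  obtain ⟨d, hd, hdist⟩ := Metric.uniformContinuous_iff.1 huc (e / 2) (by positivity)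
  have hk : Integrable fun y : ℝ => Real.pi⁻¹ * (1 + y ^ 2)⁻¹ :=
    integrable_inv_one_add_sq.const_mul _
  have hk0 : ∀ y : ℝ, 0 ≤ Real.pi⁻¹ * (1 + y ^ 2)⁻¹ := fun y => by
    have := Real.pi_pos; positivity
  have hk1 : ∫ y : ℝ, Real.pi⁻¹ * (1 + y ^ 2)⁻¹ = 1 := by
    rw [integral_const_mul, integral_univ_inv_one_add_sq, inv_mul_cancel₀ Real.pi_ne_zero]
  have hmk : ∀ η : ℝ, Integrable fun y : ℝ =>
      2 * B * min 1 (|η * y| / d) * (Real.pi⁻¹ * (1 + y ^ 2)⁻¹) := fun η => by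
    refine hk.bdd_mul (c := 2 * B) (by fun_prop) (ae_of_all _ fun y => ?_)
    have h0 : 0 ≤ min 1 (|η * y| / d) := le_min zero_le_one (by positivity)
    rw [Real.norm_of_nonneg (by positivity)]
    exact mul_le_of_le_one_right (by positivity) (min_le_left _ _)
  have hlim : Tendsto (fun η : ℝ => ∫ y : ℝ,
      2 * B * min 1 (|η * y| / d) * (Real.pi⁻¹ * (1 + y ^ 2)⁻¹)) (𝓝[>] 0) (𝓝 0) := by
    have := tendsto_integral_filter_of_dominated_convergence (l := 𝓝[>] (0 : ℝ))
      (F := fun η y => 2 * B * min 1 (|η * y| / d) * (Real.pi⁻¹ * (1 + y ^ 2)⁻¹))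
      (f := fun _ => 0) (fun y => 2 * B * (Real.pi⁻¹ * (1 + y ^ 2)⁻¹))
      (Eventually.of_forall fun η => (hmk η).1)
      (Eventually.of_forall fun η => ae_of_all _ fun y => ?_) (hk.const_mul _)
      (ae_of_all _ fun y => ?_)
    · simpa using this
    · have h0 : 0 ≤ min 1 (|η * y| / d) := le_min zero_le_one (by positivity)
      rw [Real.norm_of_nonneg (mul_nonneg (by positivity) (hk0 y))]
      refine mul_le_mul_of_nonneg_right ?_ (hk0 y)
      exact mul_le_of_le_one_right (by positivity) (min_le_left _ _)
    · have hcont : Continuous fun η : ℝ =>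
          2 * B * min 1 (|η * y| / d) * (Real.pi⁻¹ * (1 + y ^ 2)⁻¹) := by fun_prop
      have := (hcont.tendsto 0).mono_left (nhdsWithin_le_nhds (s := Set.Ioi 0))
      simpa using this
  filter_upwards [hlim.eventually_lt_const (show 0 < e / 2 by positivity), self_mem_nhdsWithin]
    with η hη hη0 t
  have hη0' : 0 < η := hη0
  rw [poissonSmooth_sub hg hc hη0']
  refine (norm_integral_le_integral_norm _).trans ?_
  have hpt : ∀ y : ℝ, ‖(g (t + η * y) - g t) * ((Real.pi⁻¹ * (1 + y ^ 2)⁻¹ : ℝ) : ℂ)‖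
      ≤ e / 2 * (Real.pi⁻¹ * (1 + y ^ 2)⁻¹)
        + 2 * B * min 1 (|η * y| / d) * (Real.pi⁻¹ * (1 + y ^ 2)⁻¹) := by
    intro y
    rw [norm_mul, Complex.norm_real, Real.norm_of_nonneg (hk0 y), ← add_mul]
    refine mul_le_mul_of_nonneg_right ?_ (hk0 y)
    have h0 : 0 ≤ min 1 (|η * y| / d) := le_min zero_le_one (by positivity)
    by_cases h : |η * y| < d
    · have := hdist (a := t + η * y) (b := t) (by simpa [Real.dist_eq] using h)
      rw [dist_eq_norm] at this
      have : 0 ≤ 2 * B * min 1 (|η * y| / d) := by positivity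
      linarith
    · have h1 : 1 ≤ |η * y| / d := (one_le_div hd).2 (not_lt.1 h)
      rw [min_eq_left h1, mul_one]
      refine (norm_sub_le _ _).trans ?_
      linarith [hB (t + η * y), hB t]
  refine (integral_mono_of_nonneg (ae_of_all _ fun y => norm_nonneg _)
    ((hk.const_mul _).add (hmk η)) (ae_of_all _ hpt)).trans ?_
  refine (integral_add (hk.const_mul (e / 2)) (hmk η)).trans_le ?_
  rw [integral_const_mul, hk1]
  linarith

section Abstract

variable {H : Type*} [NormedAddCommGroup H] [InnerProductSpace ℂ H] [CompleteSpace H]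

theorem smul_resolventOp_sub {P : H →ₗ.[ℂ] H} (hP : IsSelfAdjoint P) {η : ℝ} (hη : 0 < η)
    (x : ℝ) (a : ℂ) :
    ((2 * Real.pi * Complex.I)⁻¹ * a) • (resolventOp P (x + η * Complex.I)
        - resolventOp P (x - η * Complex.I))
      = funCalc P (fun t => a * ((Real.pi⁻¹ * poissonKernel x η t : ℝ) : ℂ)) := by
  have hz : (x + η * Complex.I : ℂ).im ≠ 0 := by simpa using hη.ne'
  have hz' : (x - η * Complex.I : ℂ).im ≠ 0 := by simpa using hη.ne'
  have e : (fun t => a * ((Real.pi⁻¹ * poissonKernel x η t : ℝ) : ℂ))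
      = fun t => (a * (Real.pi⁻¹ * η)) * ((normSqKernel x η t : ℝ) : ℂ) := by
    funext t
    simp only [poissonKernel, normSqKernel]
    push_cast
    ring
  rw [e, funCalc_const_mul hP (isC0_normSqKernel hη.ne' x), funCalc_normSqKernel hP hη.ne',
    star_resolventOp hP hz]
  have h2 : (starRingEnd ℂ) (x + η * Complex.I : ℂ) = x - η * Complex.I := by
    simp [sub_eq_add_neg]
  rw [h2, resolventOp_sub hP hz hz', resolventOp_mul_comm hP hz hz', smul_smul]
  congr 1
  have : (Real.pi : ℂ) ≠ 0 := by exact_mod_cast Real.pi_ne_zero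
  rw [Complex.ofReal_inv]
  field_simp
  ring

/-- Joint continuity, including the point w = 0, is what permits exchanging the integral in l with
the functional calculus. It is read off from a formula that is rational in w and conj w. -/
theorem continuousOn_transplant_poissonKernel {g : ℝ → ℂ} (hg : Continuous g) {η : ℝ}
    (hη : 0 < η) :
    ContinuousOn (Function.uncurry fun (l : ℝ) (w : ℂ) =>
      transplant (fun t => g l * ((Real.pi⁻¹ * poissonKernel l η t : ℝ) : ℂ)) w)
      (Set.univ ×ˢ resolventCircle) := by
  -- A zero would force w⁻¹ to have imaginary part 1 + η, whereas it is 1 on the circle.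
  have hne : ∀ (l : ℝ) (w : ℂ), w ∈ resolventCircle →
      1 - ((l + η * Complex.I) + Complex.I) * w ≠ 0 := by
    intro l w hw h
    rcases hw with h0 | h0
    · simp [h0] at h
    · have hw0 : w ≠ 0 := by rintro rfl; simp at h
      have h1 : w⁻¹ = (l + η * Complex.I) + Complex.I := by
        rw [inv_eq_of_mul_eq_one_left]
        linear_combination -h
      rw [h0] at h1
      have := congrArg Complex.im h1
      simp at this
      exact hη.ne' this
  have heq : Set.EqOn (Function.uncurry fun (l : ℝ) (w : ℂ) =>
      transplant (fun t => g l * ((Real.pi⁻¹ * poissonKernel l η t : ℝ) : ℂ)) w)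
      (fun p : ℝ × ℂ => g p.1 * (Real.pi⁻¹ * η : ℝ)
        * ((starRingEnd ℂ) (p.2 / (1 - ((p.1 + η * Complex.I) + Complex.I) * p.2))
          * (p.2 / (1 - ((p.1 + η * Complex.I) + Complex.I) * p.2))))
      (Set.univ ×ˢ resolventCircle) := by
    rintro ⟨l, w⟩ ⟨-, hw⟩
    simp only [Function.uncurry_apply_pair]
    by_cases hw0 : w = 0
    · simp [transplant, hw0]
    · have h0 := hw.resolve_left hw0
      have h1 : w / (1 - ((l + η * Complex.I) + Complex.I) * w)
          = (((w⁻¹ - Complex.I).re : ℂ) - (l + η * Complex.I))⁻¹ := by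
        have h3 : (((w⁻¹ - Complex.I).re : ℂ) - (l + η * Complex.I))
            = w⁻¹ - Complex.I - (l + η * Complex.I) := by linear_combination -h0
        have h4 : 1 - ((l + η * Complex.I) + Complex.I) * w
          = w * (w⁻¹ - Complex.I - (l + η * Complex.I)) := by
          have : w * w⁻¹ = 1 := mul_inv_cancel₀ hw0
          linear_combination -this
        rw [h3, h4, div_mul_eq_div_div, div_self hw0, one_div]
      rw [h1, ← normSqKernel_eq]
      simp only [transplant, if_neg hw0, poissonKernel, normSqKernel]
      push_cast
      ring
  refine ContinuousOn.congr ?_ heq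
  have hq : ContinuousOn (fun p : ℝ × ℂ => p.2 / (1 - ((p.1 + η * Complex.I) + Complex.I) * p.2))
      (Set.univ ×ˢ resolventCircle) :=
    ContinuousOn.div (by fun_prop) (by fun_prop) fun p hp => hne p.1 p.2 hp.2
  exact ContinuousOn.mul (by fun_prop) ((Complex.continuous_conj.comp_continuousOn hq).mul hq)

theorem integral_resolventOp_sub {P : H →ₗ.[ℂ] H} (hP : IsSelfAdjoint P) {g : ℝ → ℂ}
    (hg : Continuous g) (hc : HasCompactSupport g) {η : ℝ} (hη : 0 < η) :
    ∫ x : ℝ, ((2 * Real.pi * Complex.I)⁻¹ * g x) • (resolventOp P (x + η * Complex.I)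
        - resolventOp P (x - η * Complex.I)) = funCalc P (poissonSmooth g η) := by
  have hn := isStarNormal_resolventOp hP im_neg_I_ne
  simp_rw [smul_resolventOp_sub hP hη, funCalc_eq_cfc]
  rw [← cfc_integral (fun (l : ℝ) (w : ℂ) =>
      transplant (fun t => g l * ((Real.pi⁻¹ * poissonKernel l η t : ℝ) : ℂ)) w)
    (fun l => ‖g l‖ * (Real.pi⁻¹ * η⁻¹)) (resolventOp P (-Complex.I))
    ((continuousOn_transplant_poissonKernel hg hη).mono
      (Set.prod_mono le_rfl (spectrum_subset_resolventCircle hP)))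
    (ae_of_all _ fun l w _ => ?_)
    ((hg.integrable_of_hasCompactSupport hc).norm.mul_const _).2]
  · congr 1
    funext w
    unfold transplant poissonSmooth
    split_ifs <;> simp
  · have hpi := Real.pi_pos
    unfold transplant
    split_ifs
    · simp; positivity
    · rw [norm_mul, Complex.norm_real, Real.norm_of_nonneg
        (mul_nonneg (by positivity) (poissonKernel_nonneg hη _ _))]
      gcongr
      exact poissonKernel_le hη _ _

/-- Stone's formula. -/
theorem tendsto_integral_resolventOp_sub {P : H →ₗ.[ℂ] H} (hP : IsSelfAdjoint P) {g : ℝ → ℂ}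
    (hg : Continuous g) (hc : HasCompactSupport g) :
    Tendsto (fun η : ℝ => ∫ x : ℝ, ((2 * Real.pi * Complex.I)⁻¹ * g x) •
      (resolventOp P (x + η * Complex.I) - resolventOp P (x - η * Complex.I)))
      (𝓝[>] 0) (𝓝 (funCalc P g)) := by
  rw [Metric.tendsto_nhds]
  intro e he
  filter_upwards [eventually_norm_poissonSmooth_sub_le hg hc (half_pos he), self_mem_nhdsWithin]
    with η hη hη0
  -- Uniform convergence of the Poisson extensions becomes convergence in operator norm.
  rw [integral_resolventOp_sub hP hg hc hη0, dist_eq_norm,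
    ← funCalc_sub hP (isC0_poissonSmooth hg hc hη0) (isC0_of_hasCompactSupport hg hc)]
  exact (norm_funCalc_le _ (by positivity) hη).trans_lt (by linarith)

end Abstract

end SemiclassicalDecay

end

noncomputable section

namespace SemiclassicalDecay

/-! ### Oscillatory integrals with values in a Hilbert space -/

section Oscillatory

open scoped FourierTransform

variable {E : Type*} [NormedAddCommGroup E] [InnerProductSpace ℂ E]

/-- The oscillatory integral `∫ e^{itρ} u(ρ) dρ`. -/
def oscInt (u : ℝ → E) (t : ℝ) : E := ∫ ρ : ℝ, Complex.exp (Complex.I * t * ρ) • u ρ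

theorem oscInt_eq_fourier (u : ℝ → E) (t : ℝ) :
    oscInt u t = 𝓕 u (t * (-(2 * Real.pi)⁻¹)) := by
  rw [Real.fourier_real_eq_integral_exp_smul]
  unfold oscInt
  congr 1
  funext v
  congr 2
  push_cast
  have : (Real.pi : ℂ) ≠ 0 := by exact_mod_cast Real.pi_ne_zero
  field_simp

theorem norm_exp_I_mul (t ρ : ℝ) : ‖Complex.exp (Complex.I * t * ρ)‖ = 1 := by
  rw [show Complex.I * t * ρ = ((t * ρ : ℝ) : ℂ) * Complex.I by push_cast; ring]
  exact Complex.norm_exp_ofReal_mul_I _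

theorem oscInt_add {u v : ℝ → E} (hu : Continuous u) (huc : HasCompactSupport u)
    (hv : Continuous v) (hvc : HasCompactSupport v) (t : ℝ) :
    oscInt (fun ρ => u ρ + v ρ) t = oscInt u t + oscInt v t := by
  unfold oscInt
  simp_rw [smul_add]
  refine integral_add (Continuous.integrable_of_hasCompactSupport ?_ huc.smul_left)
    (Continuous.integrable_of_hasCompactSupport ?_ hvc.smul_left) <;> fun_prop

theorem continuous_oscInt {u : ℝ → E} (hu : Continuous u) (huc : HasCompactSupport u) :
    Continuous (oscInt u) := by
  have hi := hu.integrable_of_hasCompactSupport huc (μ := volume)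
  refine continuous_of_dominated (fun t => ?_) (fun t => ae_of_all _ fun ρ => ?_) hi.norm
    (ae_of_all _ fun ρ => ?_)
  · exact Continuous.aestronglyMeasurable (by fun_prop)
  · rw [norm_smul, norm_exp_I_mul, one_mul]
  · fun_prop

theorem hasCompactSupport_iteratedDeriv {u : ℝ → E} (huc : HasCompactSupport u) (j : ℕ) :
    HasCompactSupport (iteratedDeriv j u) := by
  induction j with
  | zero => simpa using huc
  | succ j ih => rw [iteratedDeriv_succ]; exact ih.deriv

theorem contDiff_iteratedDeriv {u : ℝ → E} (hu : ContDiff ℝ ∞ u) (j : ℕ) :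
    ContDiff ℝ ∞ (iteratedDeriv j u) := by
  induction j with
  | zero => simpa using hu
  | succ j ih =>
    rw [iteratedDeriv_succ]
    exact (contDiff_infty_iff_deriv.1 ih).2

/-- This is j-fold integration by parts, read off from the Fourier transform of a derivative. -/
theorem abs_pow_mul_norm_oscInt {u : ℝ → E} (hu : ContDiff ℝ ∞ u) (huc : HasCompactSupport u)
    (j : ℕ) (t : ℝ) : |t| ^ j * ‖oscInt u t‖ = ‖oscInt (iteratedDeriv j u) t‖ := by
  have h := Real.fourier_iteratedDeriv (N := ⊤) (n := j) hu
    (fun k _ => (contDiff_iteratedDeriv hu k).continuous.integrable_of_hasCompactSupport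
      (hasCompactSupport_iteratedDeriv huc k)) le_top
  rw [oscInt_eq_fourier, oscInt_eq_fourier, h]
  simp only
  rw [norm_smul, norm_pow]
  congr 2
  simp only [norm_mul, Complex.norm_real, Complex.norm_I, Complex.norm_ofNat, Real.norm_eq_abs,
    abs_mul, abs_neg, abs_inv, abs_of_pos Real.pi_pos, abs_two]
  field_simp [Real.pi_ne_zero]

theorem integral_norm_le_of_support {F : Type*} [NormedAddCommGroup F] {u : ℝ → F} {S : Set ℝ}
    (hS : IsCompact S) {b : ℝ} {p : ℕ}
    (hp : p ≠ 0) (hb : ∀ ρ, ‖u ρ‖ ≤ b) (hs : ∀ ρ, ρ ∉ S → u ρ = 0) :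
    ∫ ρ, ‖u ρ‖ ^ p ≤ volume.real S * b ^ p := by
  have h0 : 0 ≤ b := (norm_nonneg _).trans (hb 0)
  have e : ∫ ρ, ‖u ρ‖ ^ p = ∫ ρ in S, ‖u ρ‖ ^ p := by
    rw [setIntegral_eq_integral_of_forall_compl_eq_zero]
    intro ρ hρ
    rw [hs ρ hρ, norm_zero, zero_pow hp]
  rw [e]
  have h1 := norm_setIntegral_le_of_norm_le_const (μ := volume) (s := S)
    (f := fun ρ => ‖u ρ‖ ^ p) (C := b ^ p) hS.measure_lt_top (fun ρ _ => by
      rw [norm_pow, norm_norm]; exact pow_le_pow_left₀ (norm_nonneg _) (hb ρ) p)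
  exact (le_abs_self _).trans (h1.trans_eq (mul_comm _ _))

theorem norm_oscInt_le {u : ℝ → E} {S : Set ℝ} (hS : IsCompact S) {b : ℝ}
    (hb : ∀ ρ, ‖u ρ‖ ≤ b) (hs : ∀ ρ, ρ ∉ S → u ρ = 0) (t : ℝ) :
    ‖oscInt u t‖ ≤ volume.real S * b := by
  refine (norm_integral_le_integral_norm _).trans ?_
  simp_rw [norm_smul, norm_exp_I_mul, one_mul]
  have := integral_norm_le_of_support hS one_ne_zero hb hs
  simpa using this

theorem lintegral_oscInt_sq_le [CompleteSpace E] {u : ℝ → E} (hu : ContDiff ℝ ∞ u) (huc : HasCompactSupport u)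
    {S : Set ℝ} (hS : IsCompact S) {b : ℝ} (hb : ∀ ρ, ‖u ρ‖ ≤ b)
    (hs : ∀ ρ, ρ ∉ S → u ρ = 0) :
    ∫⁻ t, ENNReal.ofReal (‖oscInt u t‖ ^ 2)
      ≤ ENNReal.ofReal (2 * Real.pi * (volume.real S * b ^ 2)) := by
  let v : SchwartzMap ℝ E := huc.toSchwartzMap hu
  have hpl := SchwartzMap.integral_norm_sq_fourier v
  rw [SchwartzMap.fourier_coe] at hpl
  change ∫ x, ‖𝓕 u x‖ ^ 2 = ∫ x, ‖u x‖ ^ 2 at hpl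
  have hint : Integrable fun x => ‖𝓕 u x‖ ^ 2 := by
    have := ((𝓕 v).memLp 2 (volume : Measure ℝ)).integrable_norm_pow (by norm_num)
    rw [SchwartzMap.fourier_coe] at this
    exact this
  have hne : (-(2 * Real.pi)⁻¹ : ℝ) ≠ 0 := by
    have := Real.pi_pos
    simp [Real.pi_ne_zero]
  have hint2 : Integrable fun t : ℝ => ‖𝓕 u (t * (-(2 * Real.pi)⁻¹))‖ ^ 2 :=
    hint.comp_mul_right' hne
  simp_rw [oscInt_eq_fourier]
  rw [← ofReal_integral_eq_lintegral_ofReal hint2 (ae_of_all _ fun t => by positivity)]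
  refine ENNReal.ofReal_le_ofReal ?_
  rw [Measure.integral_comp_mul_right (fun x => ‖𝓕 u x‖ ^ 2), hpl, smul_eq_mul, inv_neg, inv_inv,
    abs_neg, abs_of_pos Real.two_pi_pos]
  have := integral_norm_le_of_support hS two_ne_zero hb hs
  have := Real.two_pi_pos
  gcongr

/-- `G` is a sequence of functions with `G i' = κ' G (i+1)`. -/
def IsDerivChain (κ' : ℝ → ℝ) (G : ℕ → ℝ → E) : Prop :=
  ∀ i ρ, HasDerivAt (G i) (κ' ρ • G (i + 1) ρ) ρ

/-- A bootstrap: each derivative is a smooth multiple of the next member, so C^k for all members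
gives C^{k+1} for all members. -/
theorem IsDerivChain.contDiff {κ' : ℝ → ℝ} (hκ : ContDiff ℝ ∞ κ') {G : ℕ → ℝ → E}
    (hG : IsDerivChain κ' G) (i : ℕ) : ContDiff ℝ ∞ (G i) := by
  rw [contDiff_infty]
  intro k
  induction k generalizing i with
  | zero =>
    exact contDiff_zero.2 (continuous_iff_continuousAt.2 fun ρ => (hG i ρ).continuousAt)
  | succ k ih =>
    push_cast
    refine contDiff_succ_iff_deriv.2 ⟨fun ρ => (hG i ρ).differentiableAt, by simp, ?_⟩
    rw [show deriv (G i) = fun ρ => κ' ρ • G (i + 1) ρ from funext fun ρ => (hG i ρ).deriv]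
    exact (hκ.of_le (by exact_mod_cast le_top)).smul (ih (i + 1))

/-- The derivative of χ • G 0 is χ' • G 0 + (κ' χ) • G 1, two products of the same kind with a
shifted chain. Quantifying over χ inside the induction keeps the constant independent of G. -/
theorem exists_norm_iteratedDeriv_smul_le {κ' : ℝ → ℝ} (hκ : ContDiff ℝ ∞ κ') (j : ℕ) :
    ∀ χ : ℝ → ℂ, ContDiff ℝ ∞ χ → HasCompactSupport χ → ∃ C : ℝ, 0 ≤ C ∧
      ∀ (G : ℕ → ℝ → E) (B : ℝ), 0 ≤ B → IsDerivChain κ' G →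
        (∀ i ≤ j, ∀ ρ ∈ tsupport χ, ‖G i ρ‖ ≤ B) →
        ∀ ρ, ‖iteratedDeriv j (fun ρ => χ ρ • G 0 ρ) ρ‖ ≤ C * B := by
  induction j with
  | zero =>
    intro χ hχ hχc
    obtain ⟨C, hC⟩ := hχ.continuous.bounded_above_of_compact_support hχc
    refine ⟨C, (norm_nonneg _).trans (hC 0), fun G B hB _ hb ρ => ?_⟩
    rw [iteratedDeriv_zero, norm_smul]
    by_cases hρ : ρ ∈ tsupport χ
    · exact mul_le_mul (hC ρ) (hb 0 le_rfl ρ hρ) (norm_nonneg _) ((norm_nonneg _).trans (hC 0))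
    · rw [image_eq_zero_of_notMem_tsupport hρ]
      have := (norm_nonneg _).trans (hC 0)
      simp; positivity
  | succ j ih =>
    intro χ hχ hχc
    have hχ' : ContDiff ℝ ∞ (deriv χ) := (contDiff_infty_iff_deriv.1 hχ).2
    have hκχ : ContDiff ℝ ∞ fun ρ => (κ' ρ : ℂ) * χ ρ :=
      (Complex.ofRealCLM.contDiff.comp hκ).mul hχ
    obtain ⟨C1, hC1, h1⟩ := ih (deriv χ) hχ' hχc.deriv
    obtain ⟨C2, hC2, h2⟩ := ih (fun ρ => (κ' ρ : ℂ) * χ ρ) hκχ hχc.mul_left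
    refine ⟨C1 + C2, by positivity, fun G B hB hG hb ρ => ?_⟩
    have hd : deriv (fun ρ => χ ρ • G 0 ρ)
        = (fun ρ => deriv χ ρ • G 0 ρ) + fun ρ => ((κ' ρ : ℂ) * χ ρ) • G 1 ρ := by
      funext ρ
      have hχd : HasDerivAt χ (deriv χ ρ) ρ :=
        ((contDiff_infty_iff_deriv.1 hχ).1 ρ).hasDerivAt
      refine (hχd.smul (hG 0 ρ)).deriv.trans ?_
      rw [Pi.add_apply, add_comm, mul_comm, ← smul_smul, Complex.coe_smul]
    have hsm : ∀ i, ContDiff ℝ ∞ (G i) := hG.contDiff hκ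
    have hadd := iteratedDeriv_add (n := j) (x := ρ) (f := fun ρ => deriv χ ρ • G 0 ρ)
      (g := fun ρ => ((κ' ρ : ℂ) * χ ρ) • G 1 ρ)
      ((hχ'.smul (hsm 0)).of_le (by exact_mod_cast le_top)).contDiffAt
      ((hκχ.smul (hsm 1)).of_le (by exact_mod_cast le_top)).contDiffAt
    rw [iteratedDeriv_succ', hd, hadd, add_mul]
    refine (norm_add_le _ _).trans (add_le_add ?_ ?_)
    · refine h1 G B hB hG (fun i hi ρ hρ => hb i (by omega) ρ ?_) ρ
      exact closure_minimal (support_deriv_subset) (isClosed_tsupport χ) hρ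
    · refine h2 (fun i => G (i + 1)) B hB (fun i => hG (i + 1))
        (fun i hi ρ hρ => hb (i + 1) (by omega) ρ ?_) ρ
      exact tsupport_mul_subset_right hρ

theorem iteratedDeriv_eq_zero_of_notMem {u : ℝ → E} (j : ℕ) {ρ : ℝ} (hρ : ρ ∉ tsupport u) :
    iteratedDeriv j u ρ = 0 := by
  have : tsupport (iteratedDeriv j u) ⊆ tsupport u := by
    induction j with
    | zero => simp
    | succ j ih =>
      rw [iteratedDeriv_succ]
      exact (closure_minimal support_deriv_subset (isClosed_tsupport _)).trans ih
  exact image_eq_zero_of_notMem_tsupport fun h => hρ (this h)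

/-- Bounds for the oscillatory integral of a product `χ • G 0`, pointwise and in `L²`. -/
theorem exists_oscInt_bounds [CompleteSpace E] {κ' : ℝ → ℝ} (hκ : ContDiff ℝ ∞ κ') {χ : ℝ → ℂ}
    (hχ : ContDiff ℝ ∞ χ) (hχc : HasCompactSupport χ) (j : ℕ) :
    ∃ C : ℝ, 0 ≤ C ∧ ∀ (G : ℕ → ℝ → E) (B : ℝ), 0 ≤ B → IsDerivChain κ' G →
        (∀ i ≤ j, ∀ ρ ∈ tsupport χ, ‖G i ρ‖ ≤ B) →
        (∀ t, |t| ^ j * ‖oscInt (fun ρ => χ ρ • G 0 ρ) t‖ ≤ C * B) ∧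
        ∫⁻ t, ENNReal.ofReal ((|t| ^ j * ‖oscInt (fun ρ => χ ρ • G 0 ρ) t‖) ^ 2)
          ≤ ENNReal.ofReal (C * B ^ 2) := by
  obtain ⟨C, hC, h⟩ := exists_norm_iteratedDeriv_smul_le (E := E) hκ j χ hχ hχc
  have hpi := Real.two_pi_pos
  have hV : 0 ≤ volume.real (tsupport χ) := measureReal_nonneg
  refine ⟨max (volume.real (tsupport χ) * C) (2 * Real.pi * (volume.real (tsupport χ) * C ^ 2)),
    le_max_of_le_left (by positivity), fun G B hB hG hb => ?_⟩
  have hu : ContDiff ℝ ∞ fun ρ => χ ρ • G 0 ρ := hχ.smul (hG.contDiff hκ 0)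
  have huc : HasCompactSupport fun ρ => χ ρ • G 0 ρ := hχc.smul_right
  have hs : ∀ ρ, ρ ∉ tsupport χ → iteratedDeriv j (fun ρ => χ ρ • G 0 ρ) ρ = 0 := fun ρ hρ =>
    iteratedDeriv_eq_zero_of_notMem j fun h => hρ
      (closure_mono (Function.support_smul_subset_left χ (G 0)) h)
  simp_rw [abs_pow_mul_norm_oscInt hu huc]
  constructor
  · intro t
    refine (norm_oscInt_le hχc (h G B hB hG hb) hs t).trans ?_
    rw [← mul_assoc]
    gcongr
    exact le_max_left _ _
  · refine (lintegral_oscInt_sq_le (contDiff_iteratedDeriv hu j)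
      (hasCompactSupport_iteratedDeriv huc j) hχc (h G B hB hG hb) hs).trans ?_
    refine ENNReal.ofReal_le_ofReal ?_
    rw [mul_pow, ← mul_assoc, ← mul_assoc]
    gcongr
    refine le_trans (le_of_eq ?_) (le_max_right _ _)
    ring

end Oscillatory

end SemiclassicalDecay

end

noncomputable section

namespace SemiclassicalDecay

/-! ### Time decay from Hölder bounds near the boundary -/

section TimeDecay

variable {E : Type*} [NormedAddCommGroup E] [InnerProductSpace ℂ E]

theorem bracket_le_two_mul (t : ℝ) : bracket t ≤ 2 * max 1 |t| := by
  unfold bracket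
  rw [Real.sqrt_le_left (by positivity), Real.norm_eq_abs, sq_abs]
  have h1 := le_max_left 1 |t|
  have h2 := le_max_right 1 |t|
  nlinarith [sq_abs t, abs_nonneg t]

/-- Bounds for the functions `G η i = ∂^i F(· + iη)`, where `F` is Hölder of order `M + q` with
constant `B` up to the boundary `η = 0`. -/
structure HolderBounds (κ' : ℝ → ℝ) (S : Set ℝ) (M : ℕ) (q B : ℝ) (G : ℝ → ℕ → ℝ → E) :
    Prop where
  chain : ∀ η ∈ Set.Ioc (0 : ℝ) 1, IsDerivChain κ' (G η)
  bound : ∀ η ∈ Set.Ioc (0 : ℝ) 1, ∀ i ≤ M + 1, ∀ ρ ∈ S, ‖G η i ρ‖ ≤ B * η ^ (q - 1)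
  diff : ∀ η ∈ Set.Ioc (0 : ℝ) 1, ∀ η' ∈ Set.Ioc (0 : ℝ) η, ∀ i ≤ M, ∀ ρ ∈ S,
    ‖G η' i ρ - G η i ρ‖ ≤ B * η ^ q

theorem IsDerivChain.sub {κ' : ℝ → ℝ} {G G' : ℕ → ℝ → E} (hG : IsDerivChain κ' G)
    (hG' : IsDerivChain κ' G') : IsDerivChain κ' fun i ρ => G i ρ - G' i ρ := fun i ρ => by
  simp only [smul_sub]
  exact (hG i ρ).sub (hG' i ρ)

theorem oscInt_split {κ' : ℝ → ℝ} (hκ : ContDiff ℝ ∞ κ') {χ : ℝ → ℂ}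
    (hχ : ContDiff ℝ ∞ χ) (hχc : HasCompactSupport χ) {G G' : ℕ → ℝ → E}
    (hG : IsDerivChain κ' G) (hG' : IsDerivChain κ' G') (t : ℝ) :
    oscInt (fun ρ => χ ρ • G' 0 ρ) t
      = oscInt (fun ρ => χ ρ • G 0 ρ) t + oscInt (fun ρ => χ ρ • (G' 0 ρ - G 0 ρ)) t := by
  have h := oscInt_add (u := fun ρ => χ ρ • G 0 ρ) (v := fun ρ => χ ρ • (G' 0 ρ - G 0 ρ))
    (hχ.smul (hG.contDiff hκ 0)).continuous hχc.smul_right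
    (hχ.smul ((hG'.sub hG).contDiff hκ 0)).continuous hχc.smul_right t
  rw [← h]
  congr 1
  funext ρ
  rw [← smul_add, add_sub_cancel]

/-- Split G η' as G (1/T) plus the difference. The first has M + 1 derivatives of size B T^{1-q} and
gains T^{-(M+1)}. The second has M derivatives of size B T^{-q} and gains T^{-M}. Both yield
T^{-(M+q)}, uniformly in η'. -/
theorem exists_decay_bounds [CompleteSpace E] {κ' : ℝ → ℝ} (hκ : ContDiff ℝ ∞ κ') {χ : ℝ → ℂ}
    (hχ : ContDiff ℝ ∞ χ) (hχc : HasCompactSupport χ) (M : ℕ) (q : ℝ) :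
    ∃ C : ℝ, 0 ≤ C ∧ ∀ (G : ℝ → ℕ → ℝ → E) (B : ℝ), 0 ≤ B →
      HolderBounds κ' (tsupport χ) M q B G →
      (∀ t, ∀ η' ∈ Set.Ioc (0 : ℝ) (max 1 |t|)⁻¹,
        ‖oscInt (fun ρ => χ ρ • G η' 0 ρ) t‖ ≤ C * B * (max 1 |t|) ^ (-(M + q))) ∧
      ∀ T : ℝ, 1 ≤ T → ∀ η' ∈ Set.Ioc (0 : ℝ) T⁻¹,
        ∫⁻ t in {t : ℝ | T ≤ |t|}, ENNReal.ofReal (‖oscInt (fun ρ => χ ρ • G η' 0 ρ) t‖ ^ 2)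
          ≤ ENNReal.ofReal (C * B ^ 2 * T ^ (-(2 * (M + q)))) := by
  obtain ⟨C0, hC0, h0⟩ := exists_oscInt_bounds (E := E) hκ hχ hχc 0
  obtain ⟨C1, hC1, h1⟩ := exists_oscInt_bounds (E := E) hκ hχ hχc (M + 1)
  obtain ⟨C2, hC2, h2⟩ := exists_oscInt_bounds (E := E) hκ hχ hχc M
  refine ⟨max (2 * C0) (2 * (C1 + C2)), le_max_of_le_left (by positivity),
    fun G B hB hG => ⟨fun t η' hη' => ?_, fun T hT η' hη' => ?_⟩⟩
  · set T := max 1 |t| with hT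
    have hT1 : 1 ≤ T := le_max_left _ _
    have hT0 : 0 < T := zero_lt_one.trans_le hT1
    have hη : T⁻¹ ∈ Set.Ioc (0 : ℝ) 1 := ⟨by positivity, inv_le_one_of_one_le₀ hT1⟩
    have hη'1 : η' ∈ Set.Ioc (0 : ℝ) 1 := ⟨hη'.1, hη'.2.trans hη.2⟩
    rw [oscInt_split hκ hχ hχc (hG.chain _ hη) (hG.chain _ hη'1)]
    refine (norm_add_le _ _).trans ?_
    rcases le_total |t| 1 with ht | ht
    -- For |t| ≤ 1 the cut is at η = 1 and no integration by parts is made.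
    · have hTe : T = 1 := max_eq_left ht
      have b1 := (h0 (G T⁻¹) B hB (hG.chain _ hη) (fun i hi ρ hρ => by
        simpa [hTe] using hG.bound _ hη i (by omega) ρ hρ)).1 t
      have b2 := (h0 _ B hB ((hG.chain _ hη'1).sub (hG.chain _ hη)) (fun i hi ρ hρ => by
        simpa [hTe] using hG.diff _ hη η' hη' i (by omega) ρ hρ)).1 t
      rw [pow_zero, one_mul] at b1 b2
      rw [hTe, Real.one_rpow, mul_one] at *
      calc _ ≤ C0 * B + C0 * B := add_le_add b1 b2
        _ = 2 * C0 * B := by ring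
        _ ≤ _ := by gcongr; exact le_max_left _ _
    · have hTe : T = |t| := max_eq_right ht
      have b1 := (h1 (G T⁻¹) (B * T⁻¹ ^ (q - 1)) (by positivity) (hG.chain _ hη)
        (fun i hi ρ hρ => hG.bound _ hη i hi ρ hρ)).1 t
      have b2 := (h2 _ (B * T⁻¹ ^ q) (by positivity) ((hG.chain _ hη'1).sub (hG.chain _ hη))
        (fun i hi ρ hρ => hG.diff _ hη η' hη' i hi ρ hρ)).1 t
      rw [← hTe, mul_comm, ← le_div_iff₀ (by positivity)] at b1 b2
      have e1 : C1 * (B * T⁻¹ ^ (q - 1)) / T ^ (M + 1) = C1 * B * T ^ (-(M + q)) := by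
        rw [Real.inv_rpow hT0.le, ← Real.rpow_neg hT0.le, div_eq_mul_inv, ← Real.rpow_natCast,
          ← Real.rpow_neg hT0.le, ← mul_assoc, mul_assoc, ← Real.rpow_add hT0]
        congr 2; push_cast; ring
      have e2 : C2 * (B * T⁻¹ ^ q) / T ^ M = C2 * B * T ^ (-(M + q)) := by
        rw [Real.inv_rpow hT0.le, ← Real.rpow_neg hT0.le, div_eq_mul_inv, ← Real.rpow_natCast,
          ← Real.rpow_neg hT0.le, ← mul_assoc, mul_assoc, ← Real.rpow_add hT0]
        congr 2; ring
      rw [e1] at b1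
      rw [e2] at b2
      calc _ ≤ C1 * B * T ^ (-(M + q)) + C2 * B * T ^ (-(M + q)) := add_le_add b1 b2
        _ = (C1 + C2) * B * T ^ (-(M + q)) := by ring
        _ ≤ _ := by
          gcongr
          exact le_trans (by linarith) (le_max_right _ _)
  · have hT0 : 0 < T := zero_lt_one.trans_le hT
    have hη : T⁻¹ ∈ Set.Ioc (0 : ℝ) 1 := ⟨by positivity, inv_le_one_of_one_le₀ hT⟩
    have hη'1 : η' ∈ Set.Ioc (0 : ℝ) 1 := ⟨hη'.1, hη'.2.trans hη.2⟩
    have b1 := (h1 (G T⁻¹) (B * T⁻¹ ^ (q - 1)) (by positivity) (hG.chain _ hη)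
        (fun i hi ρ hρ => hG.bound _ hη i hi ρ hρ)).2
    have b2 := (h2 _ (B * T⁻¹ ^ q) (by positivity) ((hG.chain _ hη'1).sub (hG.chain _ hη))
        (fun i hi ρ hρ => hG.diff _ hη η' hη' i hi ρ hρ)).2
    set u := fun t => ‖oscInt (fun ρ => χ ρ • G T⁻¹ 0 ρ) t‖ with hu
    set v := fun t => ‖oscInt (fun ρ => χ ρ • (G η' 0 ρ - G T⁻¹ 0 ρ)) t‖ with hv
    -- For |t| ≥ T a factor |t|^k can be inserted at the price T^{-k}; the L² bounds for derivatives
    -- then apply on the whole line.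
    have hpt : ∀ t ∈ {t : ℝ | T ≤ |t|},
        ENNReal.ofReal (‖oscInt (fun ρ => χ ρ • G η' 0 ρ) t‖ ^ 2)
        ≤ ENNReal.ofReal (2 * (T ^ (M + 1))⁻¹ ^ 2) * ENNReal.ofReal ((|t| ^ (M + 1) * u t) ^ 2)
          + ENNReal.ofReal (2 * (T ^ M)⁻¹ ^ 2) * ENNReal.ofReal ((|t| ^ M * v t) ^ 2) := by
      intro t ht
      have ht' : T ≤ |t| := ht
      rw [← ENNReal.ofReal_mul (by positivity), ← ENNReal.ofReal_mul (by positivity),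
        ← ENNReal.ofReal_add (by positivity) (by positivity)]
      refine ENNReal.ofReal_le_ofReal ?_
      have hle : ∀ (k : ℕ) (x : ℝ), 0 ≤ x → x ≤ (T ^ k)⁻¹ * (|t| ^ k * x) := by
        intro k x hx
        rw [← mul_assoc]
        refine le_mul_of_one_le_left hx ?_
        rw [inv_mul_eq_div, one_le_div (by positivity)]
        gcongr
      have l1 := hle (M + 1) (u t) (norm_nonneg _)
      have l2 := hle M (v t) (norm_nonneg _)
      have l3 : ‖oscInt (fun ρ => χ ρ • G η' 0 ρ) t‖ ≤ u t + v t := by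
        rw [oscInt_split hκ hχ hχc (hG.chain _ hη) (hG.chain _ hη'1)]
        exact norm_add_le _ _
      have hu0 : 0 ≤ u t := norm_nonneg _
      have hv0 : 0 ≤ v t := norm_nonneg _
      calc ‖oscInt (fun ρ => χ ρ • G η' 0 ρ) t‖ ^ 2 ≤ (u t + v t) ^ 2 := by gcongr
        _ ≤ 2 * u t ^ 2 + 2 * v t ^ 2 := by nlinarith [sq_nonneg (u t - v t)]
        _ ≤ 2 * ((T ^ (M + 1))⁻¹ * (|t| ^ (M + 1) * u t)) ^ 2
            + 2 * ((T ^ M)⁻¹ * (|t| ^ M * v t)) ^ 2 := by gcongr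
        _ = _ := by ring
    have hms : MeasurableSet {t : ℝ | T ≤ |t|} := measurableSet_le measurable_const (by fun_prop)
    refine (setLIntegral_mono' hms hpt).trans ((setLIntegral_le_lintegral _ _).trans ?_)
    have hcu : Continuous u := (continuous_oscInt (hχ.smul ((hG.chain _ hη).contDiff hκ 0)).continuous
      hχc.smul_right).norm
    rw [lintegral_add_left (by fun_prop), lintegral_const_mul' _ _ ENNReal.ofReal_ne_top,
      lintegral_const_mul' _ _ ENNReal.ofReal_ne_top]
    refine (add_le_add (mul_le_mul_right b1 _) (mul_le_mul_right b2 _)).trans ?_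
    rw [← ENNReal.ofReal_mul (by positivity), ← ENNReal.ofReal_mul (by positivity),
        ← ENNReal.ofReal_add (by positivity) (by positivity)]
    refine ENNReal.ofReal_le_ofReal ?_
    have e1 : (T ^ (M + 1))⁻¹ ^ 2 * (T⁻¹ ^ (q - 1)) ^ 2 = T ^ (-(2 * (M + q))) := by
      rw [Real.inv_rpow hT0.le, ← Real.rpow_neg hT0.le, ← Real.rpow_natCast T,
        ← Real.rpow_neg hT0.le, ← mul_pow, ← Real.rpow_add hT0, ← Real.rpow_natCast,
        ← Real.rpow_mul hT0.le]
      congr 1; push_cast; ring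
    have e2 : (T ^ M)⁻¹ ^ 2 * (T⁻¹ ^ q) ^ 2 = T ^ (-(2 * (M + q))) := by
      rw [Real.inv_rpow hT0.le, ← Real.rpow_neg hT0.le, ← Real.rpow_natCast T,
        ← Real.rpow_neg hT0.le, ← mul_pow, ← Real.rpow_add hT0, ← Real.rpow_natCast,
        ← Real.rpow_mul hT0.le]
      congr 1; push_cast; ring
    calc _ = 2 * C1 * B ^ 2 * ((T ^ (M + 1))⁻¹ ^ 2 * (T⁻¹ ^ (q - 1)) ^ 2)
          + 2 * C2 * B ^ 2 * ((T ^ M)⁻¹ ^ 2 * (T⁻¹ ^ q) ^ 2) := by ring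
      _ = 2 * (C1 + C2) * B ^ 2 * T ^ (-(2 * (M + q))) := by rw [e1, e2]; ring
      _ ≤ _ := by gcongr; exact le_max_right _ _

/-- Tail bounds beyond each T = 2^j control the dyadic shells, and summation gives a geometric
series of ratio 4^{s-s'}. The strict inequality s < s' is what makes it converge. -/
theorem lintegral_bracket_le {F : Type*} [NormedAddCommGroup F] {Y : ℝ → F} {D0 D s s' : ℝ} (hD0 : 0 ≤ D0) (hD : 0 ≤ D)
    (hs : 0 ≤ s) (hss : s < s')
    (h0 : ∀ t, ‖Y t‖ ^ 2 ≤ D0)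
    (h : ∀ T : ℝ, 1 ≤ T → ∫⁻ t in {t : ℝ | T ≤ |t|}, ENNReal.ofReal (‖Y t‖ ^ 2)
      ≤ ENNReal.ofReal (D * T ^ (-(2 * s')))) :
    ∫⁻ t, ENNReal.ofReal (bracket t ^ (2 * s) * ‖Y t‖ ^ 2)
      ≤ ENNReal.ofReal (2 * 4 ^ s * D0 + D * (16 ^ s * (1 - (4 : ℝ) ^ (s - s'))⁻¹)) := by
  have hr : (4 : ℝ) ^ (s - s') < 1 := Real.rpow_lt_one_of_one_lt_of_neg (by norm_num) (by linarith)
  have hr0 : (0 : ℝ) ≤ (4 : ℝ) ^ (s - s') := by positivity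
  -- On the shell of index j one has ⟨t⟩ ≤ 4 · 2^j, which produces the factor 16^s; on [-1, 1] one
  -- has ⟨t⟩ ≤ 2, which produces 4^s.
  let A : ℕ → Set ℝ := fun j => {t | 2 ^ j ≤ |t| ∧ |t| ≤ 2 ^ (j + 1)}
  have hcover : (Set.univ : Set ℝ) ⊆ Set.Icc (-1) 1 ∪ ⋃ j, A j := by
    intro t _
    by_cases ht : |t| ≤ 1
    · exact Or.inl (abs_le.1 ht)
    · right
      obtain ⟨j, hj1, hj2⟩ := exists_nat_pow_near (le_of_lt (not_le.1 ht)) (one_lt_two)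
      exact Set.mem_iUnion.2 ⟨j, hj1, hj2.le⟩
  have hb0 : ∀ t : ℝ, 0 < bracket t := fun t => zero_lt_one.trans_le (one_le_bracket t)
  have hI : ∫⁻ t in Set.Icc (-1 : ℝ) 1, ENNReal.ofReal (bracket t ^ (2 * s) * ‖Y t‖ ^ 2)
      ≤ ENNReal.ofReal (2 * 4 ^ s * D0) := by
    calc _ ≤ ∫⁻ t in Set.Icc (-1 : ℝ) 1, ENNReal.ofReal (4 ^ s * D0) := by
          refine setLIntegral_mono' measurableSet_Icc fun t ht => ENNReal.ofReal_le_ofReal ?_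
          have h1 : bracket t ≤ 2 := by
            have := bracket_le_two_mul t
            rwa [max_eq_left (abs_le.2 ht), mul_one] at this
          have h2 : bracket t ^ (2 * s) ≤ 4 ^ s := by
            calc bracket t ^ (2 * s) ≤ 2 ^ (2 * s) :=
                  Real.rpow_le_rpow (hb0 t).le h1 (by positivity)
              _ = 4 ^ s := by rw [Real.rpow_mul (by norm_num)]; norm_num
          exact mul_le_mul h2 (h0 t) (by positivity) (by positivity)
      _ = _ := by
          rw [setLIntegral_const, Real.volume_Icc, ← ENNReal.ofReal_mul (by positivity)]
          congr 1; ring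
  have hA : ∀ j, ∫⁻ t in A j, ENNReal.ofReal (bracket t ^ (2 * s) * ‖Y t‖ ^ 2)
      ≤ ENNReal.ofReal (D * 16 ^ s * ((4 : ℝ) ^ (s - s')) ^ j) := by
    intro j
    have hmA : MeasurableSet (A j) :=
      (measurableSet_le measurable_const continuous_abs.measurable).inter
        (measurableSet_le continuous_abs.measurable measurable_const)
    calc _ ≤ ∫⁻ t in A j, ENNReal.ofReal (16 ^ s * 4 ^ (s * j)) * ENNReal.ofReal (‖Y t‖ ^ 2) := by
          refine setLIntegral_mono' hmA fun t ht => ?_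
          rw [← ENNReal.ofReal_mul (by positivity)]
          refine ENNReal.ofReal_le_ofReal ?_
          gcongr
          have h1 : bracket t ≤ 4 * 2 ^ j := by
            refine (bracket_le_two_mul t).trans ?_
            have h2 : max 1 |t| ≤ 2 ^ (j + 1) := max_le (one_le_pow₀ one_le_two) ht.2
            rw [pow_succ] at h2
            linarith
          calc bracket t ^ (2 * s) ≤ (4 * 2 ^ j) ^ (2 * s) :=
                Real.rpow_le_rpow (hb0 t).le h1 (by positivity)
            _ = ((4 * 2 ^ j) ^ 2) ^ s := by
                rw [Real.rpow_mul (by positivity), Real.rpow_two]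
            _ = (16 * 4 ^ j) ^ s := by
                rw [mul_pow, ← pow_mul, mul_comm j 2, pow_mul]; norm_num
            _ = 16 ^ s * 4 ^ (s * j) := by
                rw [Real.mul_rpow (by positivity) (by positivity), ← Real.rpow_natCast,
                  ← Real.rpow_mul (by positivity), mul_comm s]
      _ = ENNReal.ofReal (16 ^ s * 4 ^ (s * j)) * ∫⁻ t in A j, ENNReal.ofReal (‖Y t‖ ^ 2) :=
          lintegral_const_mul' _ _ ENNReal.ofReal_ne_top
      _ ≤ ENNReal.ofReal (16 ^ s * 4 ^ (s * j))
            * ENNReal.ofReal (D * ((2 : ℝ) ^ j) ^ (-(2 * s'))) := by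
          gcongr
          refine le_trans ?_ (h (2 ^ j) (one_le_pow₀ one_le_two))
          exact lintegral_mono_set fun t ht => ht.1
      _ = _ := by
          rw [← ENNReal.ofReal_mul (by positivity)]
          congr 1
          have e1 : ((2 : ℝ) ^ j) ^ (-(2 * s')) = (4 : ℝ) ^ (-(s' * j)) := by
            rw [← Real.rpow_natCast, ← Real.rpow_mul (by norm_num),
              show (4 : ℝ) = 2 ^ (2 : ℝ) by norm_num, ← Real.rpow_mul (by norm_num)]
            congr 1; ring
          have e2 : ((4 : ℝ) ^ (s - s')) ^ j = 4 ^ (s * j) * (4 : ℝ) ^ (-(s' * j)) := by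
            rw [← Real.rpow_natCast, ← Real.rpow_mul (by norm_num), ← Real.rpow_add (by norm_num)]
            congr 1; ring
          rw [e1, e2]; ring
  calc ∫⁻ t, ENNReal.ofReal (bracket t ^ (2 * s) * ‖Y t‖ ^ 2)
      ≤ ∫⁻ t in Set.Icc (-1) 1 ∪ ⋃ j, A j, ENNReal.ofReal (bracket t ^ (2 * s) * ‖Y t‖ ^ 2) := by
        rw [← setLIntegral_univ]
        exact lintegral_mono_set hcover
    _ ≤ ENNReal.ofReal (2 * 4 ^ s * D0)
        + ∑' j : ℕ, ENNReal.ofReal (D * 16 ^ s * ((4 : ℝ) ^ (s - s')) ^ j) := by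
        refine (lintegral_union_le _ _ _).trans (add_le_add hI ?_)
        refine (lintegral_iUnion_le _ _).trans ?_
        exact ENNReal.tsum_le_tsum hA
    _ = _ := by
        rw [← ENNReal.ofReal_tsum_of_nonneg (fun j => by positivity)
          ((summable_geometric_of_lt_one hr0 hr).mul_left _), tsum_mul_left,
          tsum_geometric_of_lt_one hr0 hr, ← ENNReal.ofReal_add (by positivity)]
        · congr 1; ring
        · have := inv_nonneg.2 (sub_nonneg.2 hr.le)
          positivity

/-- The bounds are uniform in η, so the pointwise one passes to the limit directly and the square
integrated one by Fatou's lemma. -/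
theorem exists_limit_decay [CompleteSpace E] {κ' : ℝ → ℝ} (hκ : ContDiff ℝ ∞ κ') {χ : ℝ → ℂ}
    (hχ : ContDiff ℝ ∞ χ) (hχc : HasCompactSupport χ) (M : ℕ) {q : ℝ}
    {s : ℝ} (hs : 0 ≤ s) (hsM : s < M + q) :
    ∃ C : ℝ, 0 ≤ C ∧ ∀ (G : ℝ → ℕ → ℝ → E) (B : ℝ), 0 ≤ B →
      HolderBounds κ' (tsupport χ) M q B G → ∀ Y : ℝ → E,
      (∀ t, Tendsto (fun η => oscInt (fun ρ => χ ρ • G η 0 ρ) t) (𝓝[>] 0) (𝓝 (Y t))) →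
      (∀ t, ‖Y t‖ ≤ C * B * bracket t ^ (-s)) ∧
      ∫⁻ t, ENNReal.ofReal (bracket t ^ (2 * s) * ‖Y t‖ ^ 2) ≤ ENNReal.ofReal (C * B ^ 2) := by
  obtain ⟨C, hC, h⟩ := exists_decay_bounds (E := E) hκ hχ hχc M q
  have hr : (4 : ℝ) ^ (s - (M + q)) < 1 :=
    Real.rpow_lt_one_of_one_lt_of_neg (by norm_num) (by linarith)
  have hinv := inv_nonneg.2 (sub_nonneg.2 hr.le)
  refine ⟨max (C * 2 ^ s) (2 * 4 ^ s * C ^ 2 + C * (16 ^ s * (1 - (4 : ℝ) ^ (s - (M + q)))⁻¹)),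
    le_max_of_le_left (by positivity), fun G B hB hG Y hY => ?_⟩
  obtain ⟨h1, h2⟩ := h G B hB hG
  have hsup : ∀ t, ‖Y t‖ ≤ C * B * (max 1 |t|) ^ (-(M + q)) := by
    intro t
    refine le_of_tendsto (hY t).norm ?_
    filter_upwards [Ioc_mem_nhdsGT (show (0 : ℝ) < (max 1 |t|)⁻¹ by positivity)] with η hη
    exact h1 t η hη
  have hmax : ∀ t : ℝ, 1 ≤ max 1 |t| := fun t => le_max_left _ _
  constructor
  · intro t
    have hb0 : 0 < bracket t := zero_lt_one.trans_le (one_le_bracket t)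
    have hm0 : 0 < max 1 |t| := zero_lt_one.trans_le (hmax t)
    calc ‖Y t‖ ≤ C * B * (max 1 |t|) ^ (-(M + q)) := hsup t
      _ ≤ C * B * (max 1 |t|) ^ (-s) := by
          gcongr
          · exact hmax t
      _ ≤ C * B * (2 ^ s * bracket t ^ (-s)) := by
          gcongr
          calc (max 1 |t|) ^ (-s) = 2 ^ s * (2 * max 1 |t|) ^ (-s) := by
                rw [Real.mul_rpow (by norm_num) hm0.le, ← mul_assoc, ← Real.rpow_add (by norm_num)]
                simp
            _ ≤ 2 ^ s * bracket t ^ (-s) := by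
                gcongr 2 ^ s * ?_
                exact Real.rpow_le_rpow_of_nonpos hb0 (bracket_le_two_mul t) (by linarith)
      _ = C * 2 ^ s * B * bracket t ^ (-s) := by ring
      _ ≤ _ := by gcongr; exact le_max_left _ _
  · have hY2 : ∀ T : ℝ, 1 ≤ T → ∫⁻ t in {t : ℝ | T ≤ |t|}, ENNReal.ofReal (‖Y t‖ ^ 2)
        ≤ ENNReal.ofReal (C * B ^ 2 * T ^ (-(2 * (M + q)))) := by
      intro T hT
      have hT0 : 0 < T := zero_lt_one.trans_le hT
      have hseq : Tendsto (fun k : ℕ => 1 / ((k : ℝ) + 1)) atTop (𝓝[>] 0) :=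
        tendsto_nhdsWithin_iff.2 ⟨tendsto_one_div_add_atTop_nhds_zero_nat,
          Eventually.of_forall fun k => by simp only [Set.mem_Ioi]; positivity⟩
      have hmem : ∀ k : ℕ, 1 / ((k : ℝ) + 1) ∈ Set.Ioc (0 : ℝ) 1 := fun k =>
        ⟨by positivity, by rw [div_le_one (by positivity)]; linarith [k.cast_nonneg (α := ℝ)]⟩
      have hlim : ∀ t, Tendsto (fun k : ℕ => ENNReal.ofReal
          (‖oscInt (fun ρ => χ ρ • G (1 / ((k : ℝ) + 1)) 0 ρ) t‖ ^ 2)) atTop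
          (𝓝 (ENNReal.ofReal (‖Y t‖ ^ 2))) := fun t =>
        ENNReal.tendsto_ofReal ((((hY t).comp hseq).norm).pow 2)
      calc ∫⁻ t in {t : ℝ | T ≤ |t|}, ENNReal.ofReal (‖Y t‖ ^ 2)
          = ∫⁻ t in {t : ℝ | T ≤ |t|}, liminf (fun k : ℕ => ENNReal.ofReal
            (‖oscInt (fun ρ => χ ρ • G (1 / ((k : ℝ) + 1)) 0 ρ) t‖ ^ 2)) atTop := by
            simp_rw [fun t => (hlim t).liminf_eq]
        _ ≤ liminf (fun k : ℕ => ∫⁻ t in {t : ℝ | T ≤ |t|}, ENNReal.ofReal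
            (‖oscInt (fun ρ => χ ρ • G (1 / ((k : ℝ) + 1)) 0 ρ) t‖ ^ 2)) atTop := by
            refine lintegral_liminf_le fun k => ?_
            have := continuous_oscInt
              (hχ.smul ((hG.chain _ (hmem k)).contDiff hκ 0)).continuous hχc.smul_right
            exact (ENNReal.continuous_ofReal.comp (this.norm.pow 2)).measurable
        _ ≤ _ := by
            refine liminf_le_of_frequently_le' (Eventually.frequently ?_)
            have := hseq (Ioc_mem_nhdsGT (show (0 : ℝ) < T⁻¹ by positivity))
            filter_upwards [this] with k hk
            exact h2 T hT _ hk
    have hY0 : ∀ t, ‖Y t‖ ^ 2 ≤ (C * B) ^ 2 := by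
      intro t
      gcongr
      refine (hsup t).trans (mul_le_of_le_one_right (by positivity) ?_)
      exact Real.rpow_le_one_of_one_le_of_nonpos (hmax t) (by linarith)
    refine (lintegral_bracket_le (by positivity) (by positivity) hs hsM hY0 hY2).trans ?_
    refine ENNReal.ofReal_le_ofReal ?_
    calc _ = (2 * 4 ^ s * C ^ 2 + C * (16 ^ s * (1 - (4 : ℝ) ^ (s - (M + q)))⁻¹)) * B ^ 2 := by ring
      _ ≤ _ := by gcongr; exact le_max_right _ _

end TimeDecay

end SemiclassicalDecay

end

noncomputable section

namespace SemiclassicalDecay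

/-! ### Decay of the localized groups from bounds on powers of the resolvent -/

section Groups

variable {H : Type*} [NormedAddCommGroup H] [InnerProductSpace ℂ H] [CompleteSpace H]

theorem hasDerivAt_resolventOp_comp {P : H →ₗ.[ℂ] H} (hP : IsSelfAdjoint P) {γ : ℝ → ℂ} {γ' : ℂ}
    {x : ℝ} (hγ : HasDerivAt γ γ' x) (hx : (γ x).im ≠ 0) (k : ℕ) :
    HasDerivAt (fun y => resolventOp P (γ y) ^ k)
      ((γ' * k) • resolventOp P (γ x) ^ (k + 1)) x := by
  have h := (hasDerivAt_resolventOp_pow hP hx k).scomp x hγ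
  rw [smul_smul] at h
  exact h

theorem im_add_mul_I (x y : ℝ) : ((x : ℂ) + y * Complex.I).im = y := by simp

/-- The operator `A ↦ w A w f`. -/
def sandwichApply (w : H →L[ℂ] H) (f : H) : (H →L[ℂ] H) →L[ℂ] H :=
  w ∘L ContinuousLinearMap.apply ℂ H (w f)

theorem sandwichApply_apply {H : Type*} [NormedAddCommGroup H] [InnerProductSpace ℂ H]
    (w A : H →L[ℂ] H) (f : H) :
    sandwichApply w f A = (w ∘L A ∘L w) f := rfl

/-- The derivative in η of the weighted k-th power is k times a weighted (k+1)-st power, of size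
η^{q-1}. This is integrable at 0 because q > 0, and integration gives the modulus η^q / q. -/
theorem norm_sandwichApply_sub_le {P : H →ₗ.[ℂ] H} (hP : IsSelfAdjoint P) (w : H →L[ℂ] H) (f : H)
    {K q x σ : ℝ} (hσ : σ = 1 ∨ σ = -1) (hq : 0 < q) {k : ℕ}
    (hb : ∀ η ∈ Set.Ioc (0 : ℝ) 1,
      ‖w ∘L (resolventOp P (x + (σ * η : ℝ) * Complex.I) ^ (k + 1)) ∘L w‖ ≤ K * η ^ (q - 1))
    {η η' : ℝ} (hη : η ∈ Set.Ioc (0 : ℝ) 1) (hη' : η' ∈ Set.Ioc (0 : ℝ) η) :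
    ‖sandwichApply w f (resolventOp P (x + (σ * η' : ℝ) * Complex.I) ^ k)
      - sandwichApply w f (resolventOp P (x + (σ * η : ℝ) * Complex.I) ^ k)‖
      ≤ k * K * ‖f‖ / q * η ^ q := by
  have hσ0 : σ ≠ 0 := by rcases hσ with rfl | rfl <;> norm_num
  have hσ1 : ‖(σ : ℂ)‖ = 1 := by rcases hσ with rfl | rfl <;> simp
  have hK : 0 ≤ K := by
    have := (norm_nonneg _).trans (hb 1 ⟨one_pos, le_rfl⟩)
    simpa using this
  have hd : ∀ y : ℝ, 0 < y → HasDerivAt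
      (fun y : ℝ => sandwichApply w f (resolventOp P (x + (σ * y : ℝ) * Complex.I) ^ k))
      (sandwichApply w f ((((σ : ℂ) * Complex.I) * k) •
        resolventOp P (x + (σ * y : ℝ) * Complex.I) ^ (k + 1))) y := by
    intro y hy
    have hγ : HasDerivAt (fun y : ℝ => (x : ℂ) + (σ * y : ℝ) * Complex.I)
        ((σ : ℂ) * Complex.I) y := by
      have h1 : HasDerivAt (fun y : ℝ => ((y : ℝ) : ℂ)) 1 y := Complex.ofRealCLM.hasDerivAt
      have h2 := ((h1.const_mul (σ : ℂ)).mul_const Complex.I).const_add (x : ℂ)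
      simpa using h2
    have h3 := hasDerivAt_resolventOp_comp hP hγ (by
      rw [im_add_mul_I]; exact mul_ne_zero hσ0 hy.ne') k
    exact ((sandwichApply w f).restrictScalars ℝ).hasFDerivAt.comp_hasDerivAt y h3
  have hnorm : ∀ y ∈ Set.Ioc (0 : ℝ) 1, ‖sandwichApply w f ((((σ : ℂ) * Complex.I) * k) •
        resolventOp P (x + (σ * y : ℝ) * Complex.I) ^ (k + 1))‖ ≤ k * K * ‖f‖ * y ^ (q - 1) := by
    intro y hy
    rw [map_smul, norm_smul, norm_mul, norm_mul, hσ1, Complex.norm_I, sandwichApply_apply,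
      Complex.norm_natCast, one_mul, one_mul]
    calc (k : ℝ) * ‖(w ∘L (resolventOp P (x + (σ * y : ℝ) * Complex.I) ^ (k + 1)) ∘L w) f‖
        ≤ k * ((K * y ^ (q - 1)) * ‖f‖) := by
          gcongr
          exact (ContinuousLinearMap.le_opNorm _ _).trans (by gcongr; exact hb y hy)
      _ = _ := by ring
  set F := fun y : ℝ => sandwichApply w f (resolventOp P (x + (σ * y : ℝ) * Complex.I) ^ k) with hF
  -- The comparison function is the primitive of k K ‖f‖ y^{q-1} that vanishes at η'.
  have hmv := image_norm_le_of_norm_deriv_right_le_deriv_boundary'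
    (f := fun y => F y - F η') (a := η') (b := η)
    (f' := fun y => sandwichApply w f ((((σ : ℂ) * Complex.I) * k) •
        resolventOp P (x + (σ * y : ℝ) * Complex.I) ^ (k + 1)))
    (B := fun y => k * K * ‖f‖ / q * (y ^ q - η' ^ q))
    (B' := fun y => k * K * ‖f‖ * y ^ (q - 1))
    (fun y hy => ((hd y (hη'.1.trans_le hy.1)).sub_const _).continuousAt.continuousWithinAt)
    (fun y hy => ((hd y (hη'.1.trans_le hy.1)).sub_const _).hasDerivWithinAt)
    (by simp)
    (fun y hy => by
      have : ContinuousAt (fun y : ℝ => y ^ q) y :=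
        Real.continuousAt_rpow_const _ _ (Or.inl (hη'.1.trans_le hy.1).ne')
      exact (continuousAt_const.mul (this.sub continuousAt_const)).continuousWithinAt)
    (fun y hy => by
      have h1 := (Real.hasDerivAt_rpow_const (x := y) (p := q)
        (Or.inl (hη'.1.trans_le hy.1).ne')).sub_const (η' ^ q)
      have h2 := h1.const_mul (k * K * ‖f‖ / q)
      refine (h2.congr_deriv ?_).hasDerivWithinAt
      field_simp)
    (fun y hy => hnorm y ⟨hη'.1.trans_le hy.1, hy.2.le.trans hη.2⟩)
    (Set.right_mem_Icc.2 hη'.2)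
  rw [norm_sub_rev]
  refine hmv.trans ?_
  have : 0 ≤ η' ^ q := Real.rpow_nonneg hη'.1.le _
  gcongr
  linarith

/-- The difference of boundary values of `w R w f` and its derivatives along `ρ ↦ κ ρ`. -/
def boundaryJump (P : H →ₗ.[ℂ] H) (w : H →L[ℂ] H) (f : H) (κ : ℝ → ℝ) (η : ℝ) (i : ℕ) (ρ : ℝ) : H :=
  ((2 * Real.pi * Complex.I)⁻¹ * (i.factorial : ℂ)) •
    (sandwichApply w f (resolventOp P (κ ρ + (1 * η : ℝ) * Complex.I) ^ (i + 1))
      - sandwichApply w f (resolventOp P (κ ρ + (-1 * η : ℝ) * Complex.I) ^ (i + 1)))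

theorem norm_two_pi_I_inv_le : ‖(2 * Real.pi * Complex.I : ℂ)⁻¹‖ ≤ 1 / 2 := by
  rw [norm_inv, norm_mul, norm_mul, Complex.norm_I, Complex.norm_real, Complex.norm_ofNat,
    Real.norm_of_nonneg Real.pi_pos.le, mul_one, inv_le_comm₀ (by have := Real.pi_pos; positivity)
    (by norm_num)]
  linarith [Real.pi_gt_three]

/-- The i-th derivative of the resolvent is i! R^{i+1}. The derivative of order M + 1 uses the power
M + 2, and so does the Hölder bound for the derivative of order M; this explains the range of k. The
factor 1/2 bounding (2πi)^{-1} compensates for the two sides of the axis. -/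
theorem holderBounds_boundaryJump {P : H →ₗ.[ℂ] H} (hP : IsSelfAdjoint P) (w : H →L[ℂ] H) (f : H)
    {κ κ' : ℝ → ℝ} (hκ : ∀ ρ, HasDerivAt κ (κ' ρ) ρ) {S : Set ℝ} {M : ℕ} {K q : ℝ} (hK : 0 ≤ K)
    (hq : 0 < q) (hq1 : q < 1)
    (hb : ∀ k, 1 ≤ k → k ≤ M + 2 → ∀ ρ ∈ S, ∀ η ∈ Set.Ioc (0 : ℝ) 1, ∀ σ : ℝ, (σ = 1 ∨ σ = -1) →
      ‖w ∘L (resolventOp P (κ ρ + (σ * η : ℝ) * Complex.I) ^ k) ∘L w‖ ≤ K * η ^ (q - 1)) :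
    HolderBounds κ' S M q ((M + 1).factorial / q * (K * ‖f‖)) (boundaryJump P w f κ) := by
  constructor
  · intro η hη i ρ
    have hγ : ∀ σ : ℝ, HasDerivAt (fun y : ℝ => (κ y : ℂ) + (σ * η : ℝ) * Complex.I) (κ' ρ) ρ :=
      fun σ => (hκ ρ).ofReal_comp.add_const _
    have hd : ∀ σ : ℝ, σ ≠ 0 → HasDerivAt (fun y : ℝ => sandwichApply w f
        (resolventOp P (κ y + (σ * η : ℝ) * Complex.I) ^ (i + 1)))
        (sandwichApply w f (((κ' ρ : ℂ) * ((i + 1 : ℕ) : ℂ)) •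
        resolventOp P (κ ρ + (σ * η : ℝ) * Complex.I) ^ (i + 1 + 1))) ρ := by
      intro σ hσ
      have h3 := hasDerivAt_resolventOp_comp hP (hγ σ) (by
        rw [im_add_mul_I]; exact mul_ne_zero hσ hη.1.ne') (i + 1)
      exact ((sandwichApply w f).restrictScalars ℝ).hasFDerivAt.comp_hasDerivAt ρ h3
    refine (((hd 1 one_ne_zero).sub (hd (-1) (by norm_num))).const_smul
      ((2 * Real.pi * Complex.I)⁻¹ * (i.factorial : ℂ))).congr_deriv ?_
    unfold boundaryJump
    rw [map_smul, map_smul, ← smul_sub, smul_smul, ← Complex.coe_smul, smul_smul,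
      Nat.factorial_succ]
    congr 1
    push_cast
    ring
  · intro η hη i hi ρ hρ
    have h1 : ∀ σ : ℝ, (σ = 1 ∨ σ = -1) → ‖sandwichApply w f
        (resolventOp P (κ ρ + (σ * η : ℝ) * Complex.I) ^ (i + 1))‖ ≤ K * η ^ (q - 1) * ‖f‖ :=
      fun σ hσ => by
        rw [sandwichApply_apply]
        exact (ContinuousLinearMap.le_opNorm _ _).trans (mul_le_mul_of_nonneg_right (hb (i + 1) (by omega) (by omega) ρ hρ η hη σ hσ)
          (norm_nonneg _))
    unfold boundaryJump
    rw [norm_smul, norm_mul, Complex.norm_natCast]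
    have hfac : (i.factorial : ℝ) ≤ (M + 1).factorial := by
      exact_mod_cast Nat.factorial_le hi
    have hη0 : 0 ≤ η ^ (q - 1) := Real.rpow_nonneg hη.1.le _
    calc _ ≤ (1 / 2 * (M + 1).factorial) * (K * η ^ (q - 1) * ‖f‖ + K * η ^ (q - 1) * ‖f‖) := by
          gcongr
          · exact norm_two_pi_I_inv_le
          · exact (norm_sub_le _ _).trans (add_le_add (h1 1 (Or.inl rfl)) (h1 (-1) (Or.inr rfl)))
      _ = (M + 1).factorial * (K * ‖f‖) * η ^ (q - 1) := by ring
      _ ≤ _ := by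
          gcongr
          exact le_div_self (by positivity) hq hq1.le
  · intro η hη η' hη' i hi ρ hρ
    have h1 : ∀ σ : ℝ, (σ = 1 ∨ σ = -1) → _ := fun σ hσ =>
      norm_sandwichApply_sub_le hP w f hσ hq (k := i + 1) (x := κ ρ) (fun y hy =>
        hb (i + 1 + 1) (by omega) (by omega) ρ hρ y hy σ hσ) hη hη'
    have e : boundaryJump P w f κ η' i ρ - boundaryJump P w f κ η i ρ
        = ((2 * Real.pi * Complex.I)⁻¹ * (i.factorial : ℂ)) •
        ((sandwichApply w f (resolventOp P (κ ρ + (1 * η' : ℝ) * Complex.I) ^ (i + 1))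
          - sandwichApply w f (resolventOp P (κ ρ + (1 * η : ℝ) * Complex.I) ^ (i + 1)))
        - (sandwichApply w f (resolventOp P (κ ρ + (-1 * η' : ℝ) * Complex.I) ^ (i + 1))
          - sandwichApply w f (resolventOp P (κ ρ + (-1 * η : ℝ) * Complex.I) ^ (i + 1)))) := by
      unfold boundaryJump
      rw [← smul_sub]
      congr 1
      abel
    have hfac : (((i + 1).factorial : ℕ) : ℝ) ≤ (M + 1).factorial := by
      exact_mod_cast Nat.factorial_le (by omega)
    have hη0 : 0 ≤ η ^ q := Real.rpow_nonneg hη.1.le _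
    rw [e, norm_smul, norm_mul, Complex.norm_natCast]
    calc _ ≤ (1 / 2 * i.factorial) * (((i + 1 : ℕ) : ℝ) * K * ‖f‖ / q * η ^ q
            + ((i + 1 : ℕ) : ℝ) * K * ‖f‖ / q * η ^ q) := by
          gcongr
          · exact norm_two_pi_I_inv_le
          · exact (norm_sub_le _ _).trans (add_le_add (h1 1 (Or.inl rfl)) (h1 (-1) (Or.inr rfl)))
      _ = ((i + 1).factorial : ℕ) / q * (K * ‖f‖) * η ^ q := by
          rw [Nat.factorial_succ]; push_cast; ring
      _ ≤ _ := by gcongr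

theorem continuous_resolventOp_line {P : H →ₗ.[ℂ] H} (hP : IsSelfAdjoint P) {y : ℝ} (hy : y ≠ 0) :
    Continuous fun x : ℝ => resolventOp P ((x : ℂ) + y * Complex.I) := by
  rw [continuous_iff_continuousAt]
  intro x
  have h1 : ContinuousAt (resolventOp P) ((x : ℂ) + y * Complex.I) :=
    continuousAt_resolventOp hP (by rw [im_add_mul_I]; exact hy)
  exact ContinuousAt.comp (f := fun x : ℝ => (x : ℂ) + y * Complex.I) h1 (by fun_prop)

/-- Stone's formula between the weights. The hypothesis `hgχ` encodes the change of variables λ =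
κ(ρ), which turns g into a pure phase e^{itρ} times an amplitude χ that does not depend on t. -/
theorem tendsto_oscInt_boundaryJump {P : H →ₗ.[ℂ] H} (hP : IsSelfAdjoint P) (w : H →L[ℂ] H) (f : H)
    {κ : ℝ → ℝ} {χ : ℝ → ℂ} {g : ℝ → ℂ} {t : ℝ} (hg : Continuous g) (hgc : HasCompactSupport g)
    (hgχ : ∀ Φ : ℝ → H, Continuous Φ → ∫ l, g l • Φ l
      = ∫ ρ : ℝ, Complex.exp (Complex.I * t * ρ) • χ ρ • Φ (κ ρ)) :
    Tendsto (fun η => oscInt (fun ρ => χ ρ • boundaryJump P w f κ η 0 ρ) t) (𝓝[>] 0)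
      (𝓝 ((w ∘L funCalc P g ∘L w) f)) := by
  have hst := tendsto_integral_resolventOp_sub hP hg hgc
  have h2 := ((sandwichApply w f).continuous.tendsto _).comp hst
  rw [sandwichApply_apply] at h2
  refine Tendsto.congr' ?_ h2
  filter_upwards [self_mem_nhdsWithin] with η hη
  have hη0 : η ≠ 0 := (show (0 : ℝ) < η from hη).ne'
  have c1 := continuous_resolventOp_line hP hη0
  have c2 := continuous_resolventOp_line hP (neg_ne_zero.2 hη0)
  have c3 : Continuous fun x : ℝ => resolventOp P ((x : ℂ) - η * Complex.I) := by
    simpa [sub_eq_add_neg] using c2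
  have hint : Integrable fun x : ℝ => ((2 * Real.pi * Complex.I)⁻¹ * g x) •
      (resolventOp P (x + η * Complex.I) - resolventOp P (x - η * Complex.I)) :=
    ((continuous_const.mul hg).smul (c1.sub c3)).integrable_of_hasCompactSupport
      hgc.mul_left.smul_right
  simp only [Function.comp]
  rw [← ContinuousLinearMap.integral_comp_comm _ hint]
  unfold oscInt
  have hΦ : Continuous fun l : ℝ => (2 * Real.pi * Complex.I : ℂ)⁻¹ •
      sandwichApply w f (resolventOp P (l + η * Complex.I) - resolventOp P (l - η * Complex.I)) :=
    continuous_const.smul ((sandwichApply w f).continuous.comp (c1.sub c3))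
  have h3 := hgχ _ hΦ
  simp_rw [map_smul, mul_comm _ (g _), ← smul_smul]
  rw [h3]
  congr 1
  funext ρ
  unfold boundaryJump
  simp [sub_eq_add_neg]

/-- Decay of `w g_t(P) w` for a family `g_t` of functions given by a phase and an amplitude. -/
theorem exists_group_decay {κ κ' : ℝ → ℝ} (hκ : ∀ ρ, HasDerivAt κ (κ' ρ) ρ)
    (hκ' : ContDiff ℝ ∞ κ') {χ : ℝ → ℂ} (hχ : ContDiff ℝ ∞ χ) (hχc : HasCompactSupport χ)
    {S : Set ℝ} (hκS : ∀ ρ ∈ tsupport χ, κ ρ ∈ S) {g : ℝ → ℝ → ℂ} (hg : ∀ t, Continuous (g t))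
    (hgc : ∀ t, HasCompactSupport (g t))
    (hgχ : ∀ t, ∀ Φ : ℝ → H, Continuous Φ → ∫ l, g t l • Φ l
      = ∫ ρ : ℝ, Complex.exp (Complex.I * t * ρ) • χ ρ • Φ (κ ρ))
    (M : ℕ) {q : ℝ} (hq : 0 < q) (hq1 : q < 1) {s : ℝ} (hs : 0 ≤ s) (hsM : s < M + q) :
    ∃ C : ℝ, 0 ≤ C ∧ ∀ (P : H →ₗ.[ℂ] H), IsSelfAdjoint P → ∀ (w : H →L[ℂ] H) (K : ℝ), 0 ≤ K →
      (∀ k, 1 ≤ k → k ≤ M + 2 → ∀ l ∈ S, ∀ η ∈ Set.Ioc (0 : ℝ) 1, ∀ σ : ℝ, (σ = 1 ∨ σ = -1) →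
        ‖w ∘L (resolventOp P (l + (σ * η : ℝ) * Complex.I) ^ k) ∘L w‖ ≤ K * η ^ (q - 1)) →
      (∀ f, ∫⁻ t, ENNReal.ofReal (bracket t ^ (2 * s) * ‖(w ∘L funCalc P (g t) ∘L w) f‖ ^ 2)
        ≤ ENNReal.ofReal (C * K ^ 2 * ‖f‖ ^ 2)) ∧
      ∀ t, ‖w ∘L funCalc P (g t) ∘L w‖ ≤ C * K * bracket t ^ (-s) := by
  obtain ⟨C, hC, h⟩ := exists_limit_decay (E := H) hκ' hχ hχc M hs hsM
  set N : ℝ := (M + 1).factorial / q with hN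
  have hN0 : 0 ≤ N := by positivity
  refine ⟨max (C * N) (C * N ^ 2), le_max_of_le_left (by positivity),
    fun P hP w K hK hb => ⟨fun f => ?_, fun t => ?_⟩⟩
  · have h1 := (h (boundaryJump P w f κ) (N * (K * ‖f‖)) (by positivity)
      (holderBounds_boundaryJump hP w f hκ hK hq hq1 fun k hk hk' ρ hρ =>
        hb k hk hk' _ (hκS ρ hρ)) _
      (fun t => tendsto_oscInt_boundaryJump hP w f (hg t) (hgc t) (hgχ t))).2
    refine h1.trans (ENNReal.ofReal_le_ofReal ?_)
    calc C * (N * (K * ‖f‖)) ^ 2 = C * N ^ 2 * K ^ 2 * ‖f‖ ^ 2 := by ring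
      _ ≤ _ := by gcongr; exact le_max_right _ _
  · have hb0 : 0 ≤ bracket t := zero_le_one.trans (one_le_bracket t)
    refine ContinuousLinearMap.opNorm_le_bound _ (by positivity) fun f => ?_
    have h1 := (h (boundaryJump P w f κ) (N * (K * ‖f‖)) (by positivity)
      (holderBounds_boundaryJump hP w f hκ hK hq hq1 fun k hk hk' ρ hρ =>
        hb k hk hk' _ (hκS ρ hρ)) _
      (fun t => tendsto_oscInt_boundaryJump hP w f (hg t) (hgc t) (hgχ t))).1 t
    refine h1.trans ?_
    calc C * (N * (K * ‖f‖)) * bracket t ^ (-s) = C * N * K * bracket t ^ (-s) * ‖f‖ := by ring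
      _ ≤ _ := by gcongr; exact le_max_left _ _

/-- Decay of the localized Schrödinger group. -/
theorem exists_schrodingerGroup_decay {φ : ℝ → ℂ} (hφ : ContDiff ℝ ∞ φ)
    (hφc : HasCompactSupport φ) (M : ℕ) {q : ℝ} (hq : 0 < q) (hq1 : q < 1) {s : ℝ} (hs : 0 ≤ s)
    (hsM : s < M + q) :
    ∃ C : ℝ, 0 ≤ C ∧ ∀ (P : H →ₗ.[ℂ] H), IsSelfAdjoint P → ∀ (w : H →L[ℂ] H) (K : ℝ), 0 ≤ K →
      (∀ k, 1 ≤ k → k ≤ M + 2 → ∀ l ∈ tsupport φ, ∀ η ∈ Set.Ioc (0 : ℝ) 1, ∀ σ : ℝ,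
        (σ = 1 ∨ σ = -1) →
        ‖w ∘L (resolventOp P (l + (σ * η : ℝ) * Complex.I) ^ k) ∘L w‖ ≤ K * η ^ (q - 1)) →
      (∀ f, ∫⁻ t, ENNReal.ofReal
          (bracket t ^ (2 * s) * ‖(w ∘L schrodingerGroup P φ t ∘L w) f‖ ^ 2)
        ≤ ENNReal.ofReal (C * K ^ 2 * ‖f‖ ^ 2)) ∧
      ∀ t, ‖w ∘L schrodingerGroup P φ t ∘L w‖ ≤ C * K * bracket t ^ (-s) := by
  refine exists_group_decay (κ := fun ρ => ρ) (κ' := fun _ => 1) hasDerivAt_id contDiff_const hφ hφc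
    (fun ρ hρ => hρ) (g := fun t l => Complex.exp (Complex.I * t * l) * φ l) (fun t => ?_)
    (fun t => hφc.mul_left) (fun t Φ _ => ?_) M hq hq1 hs hsM
  · have := hφ.continuous
    fun_prop
  · simp_rw [smul_smul]

/-- Decay of the localized wave group. -/
theorem exists_waveGroup_decay {φ : ℝ → ℂ} (hφ : ContDiff ℝ ∞ φ)
    (hφc : HasCompactSupport φ) {a : ℝ} (ha : 0 < a) (hφa : tsupport φ ⊆ Set.Ioi a) (M : ℕ)
    {q : ℝ} (hq : 0 < q) (hq1 : q < 1) {s : ℝ} (hs : 0 ≤ s) (hsM : s < M + q) :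
    ∃ C : ℝ, 0 ≤ C ∧ ∀ (P : H →ₗ.[ℂ] H), IsSelfAdjoint P → ∀ (w : H →L[ℂ] H) (K : ℝ), 0 ≤ K →
      (∀ k, 1 ≤ k → k ≤ M + 2 → ∀ l ∈ tsupport φ, ∀ η ∈ Set.Ioc (0 : ℝ) 1, ∀ σ : ℝ,
        (σ = 1 ∨ σ = -1) →
        ‖w ∘L (resolventOp P (l + (σ * η : ℝ) * Complex.I) ^ k) ∘L w‖ ≤ K * η ^ (q - 1)) →
      (∀ f, ∫⁻ t, ENNReal.ofReal
          (bracket t ^ (2 * s) * ‖(w ∘L waveGroup P φ t ∘L w) f‖ ^ 2)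
        ≤ ENNReal.ofReal (C * K ^ 2 * ‖f‖ ^ 2)) ∧
      ∀ t, ‖w ∘L waveGroup P φ t ∘L w‖ ≤ C * K * bracket t ^ (-s) := by
  -- The map ρ ↦ ρ² also reaches the support of φ from negative ρ. The cutoff θ removes that branch
  -- and equals 1 for ρ ≥ √a, which covers the positive branch. The amplitude carries the Jacobian
  -- 2ρ.
  set θ : ℝ → ℝ := fun ρ => Real.smoothTransition (ρ / Real.sqrt a) with hθ
  have hsa : 0 < Real.sqrt a := Real.sqrt_pos.2 ha
  have hsq : ContDiff ℝ ∞ fun ρ : ℝ => ρ ^ 2 := by fun_prop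
  have hθs : ContDiff ℝ ∞ θ := Real.smoothTransition.contDiff.comp (contDiff_id.div_const _)
  set χ : ℝ → ℂ := fun ρ => ((θ ρ * (2 * ρ) : ℝ) : ℂ) * φ (ρ ^ 2) with hχdef
  have hχ : ContDiff ℝ ∞ χ := by
    have h1 : ContDiff ℝ ∞ fun ρ : ℝ => ((θ ρ * (2 * ρ) : ℝ) : ℂ) :=
      Complex.ofRealCLM.contDiff.comp (hθs.mul (contDiff_const.mul contDiff_id))
    exact h1.mul (hφ.comp hsq)
  have hsupp : tsupport χ ⊆ (fun ρ : ℝ => ρ ^ 2) ⁻¹' tsupport φ := by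
    refine closure_minimal (fun ρ hρ => ?_) ((isClosed_tsupport φ).preimage (by fun_prop))
    refine subset_tsupport φ fun h => hρ ?_
    simp only [hχdef]
    rw [h, mul_zero]
  have hχc : HasCompactSupport χ := by
    obtain ⟨b, hb⟩ := hφc.isBounded.subset_closedBall 0
    refine HasCompactSupport.of_support_subset_isCompact (isCompact_Icc (a := -(|b| + 1))
      (b := |b| + 1)) fun ρ hρ => ?_
    have h1 := hb (hsupp (subset_tsupport _ hρ))
    rw [mem_closedBall_zero_iff, Real.norm_eq_abs, abs_of_nonneg (sq_nonneg ρ)] at h1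
    have h2 : ρ ^ 2 ≤ |b| := h1.trans (le_abs_self b)
    exact abs_le.1 (abs_le_of_sq_le_sq (by nlinarith [abs_nonneg b]) (by positivity))
  refine exists_group_decay (κ := fun ρ => ρ ^ 2) (κ' := fun ρ => 2 * ρ)
    (fun ρ => by simpa using hasDerivAt_pow 2 ρ) (contDiff_const.mul contDiff_id) hχ hχc
    (S := tsupport φ) (fun ρ hρ => @hsupp ρ hρ)
    (g := fun t l => Complex.exp (Complex.I * t * Real.sqrt l) * φ l) (fun t => ?_)
    (fun t => hφc.mul_left) (fun t Φ hΦ => ?_) M hq hq1 hs hsM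
  · have := hφ.continuous
    fun_prop
  · have e1 : ∫ l, (Complex.exp (Complex.I * t * Real.sqrt l) * φ l) • Φ l
        = ∫ l in Set.Ioi (0 : ℝ), (Complex.exp (Complex.I * t * Real.sqrt l) * φ l) • Φ l := by
      rw [setIntegral_eq_integral_of_forall_compl_eq_zero]
      intro l hl
      have : φ l = 0 := image_eq_zero_of_notMem_tsupport fun h => hl (ha.trans (hφa h))
      rw [this, mul_zero, zero_smul]
    have e2 : ∫ ρ : ℝ, Complex.exp (Complex.I * t * ρ) • χ ρ • Φ (ρ ^ 2)
        = ∫ ρ in Set.Ioi (0 : ℝ), Complex.exp (Complex.I * t * ρ) • χ ρ • Φ (ρ ^ 2) := by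
      rw [setIntegral_eq_integral_of_forall_compl_eq_zero]
      intro ρ hρ
      have : χ ρ = 0 := by
        simp only [hχdef, hθ]
        rw [Real.smoothTransition.zero_of_nonpos
          (div_nonpos_of_nonpos_of_nonneg (not_lt.1 hρ) hsa.le)]
        simp
      rw [this, zero_smul, smul_zero]
    rw [e1, e2, ← integral_comp_rpow_Ioi_of_pos (p := 2) two_pos]
    refine setIntegral_congr_fun measurableSet_Ioi fun ρ hρ => ?_
    have hρ0 : (0 : ℝ) < ρ := hρ
    have e3 : ((2 : ℝ) - 1) = 1 := by norm_num
    simp only [e3, Real.rpow_one, Real.rpow_two, Real.sqrt_sq hρ0.le, hχdef]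
    rw [← Complex.coe_smul, smul_smul, smul_smul]
    congr 1
    by_cases h : ρ ^ 2 ∈ tsupport φ
    · have h1 : a < ρ ^ 2 := hφa h
      have h2 : θ ρ = 1 := by
        refine Real.smoothTransition.one_of_one_le ?_
        rw [one_le_div hsa]
        exact Real.sqrt_le_iff.2 ⟨hρ0.le, h1.le⟩
      rw [h2]; push_cast; ring
    · rw [image_eq_zero_of_notMem_tsupport h]; ring

end Groups

end SemiclassicalDecay

end

noncomputable section

namespace SemiclassicalDecay

/-! ### Multiplication operators -/

section Multiplication

open scoped InnerProductSpace

variable {n : ℕ}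

/-- Essentially bounded real functions. -/
def IsMultiplier (m : Space n → ℝ) : Prop :=
  AEStronglyMeasurable m volume ∧ ∃ C : ℝ, ∀ᵐ x, |m x| ≤ C

namespace IsMultiplier

variable {m m' : Space n → ℝ}

theorem memLp (hm : IsMultiplier m) :
    MemLp (fun x => (m x : ℂ)) ∞ (volume : Measure (Space n)) := by
  obtain ⟨C, hC⟩ := hm.2
  refine memLp_top_of_bound (Complex.continuous_ofReal.comp_aestronglyMeasurable hm.1) C ?_
  filter_upwards [hC] with x hx
  simpa using hx

theorem mul (hm : IsMultiplier m) (hm' : IsMultiplier m') :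
    IsMultiplier fun x => m x * m' x := by
  obtain ⟨C, hC⟩ := hm.2
  obtain ⟨C', hC'⟩ := hm'.2
  refine ⟨hm.1.mul hm'.1, C * C', ?_⟩
  filter_upwards [hC, hC'] with x hx hx'
  rw [abs_mul]
  exact mul_le_mul hx hx' (abs_nonneg _) ((abs_nonneg _).trans hx)

theorem add (hm : IsMultiplier m) (hm' : IsMultiplier m') :
    IsMultiplier fun x => m x + m' x := by
  obtain ⟨C, hC⟩ := hm.2
  obtain ⟨C', hC'⟩ := hm'.2
  refine ⟨hm.1.add hm'.1, C + C', ?_⟩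
  filter_upwards [hC, hC'] with x hx hx'
  exact (abs_add_le _ _).trans (add_le_add hx hx')

theorem const (a : ℝ) : IsMultiplier fun _ : Space n => a :=
  ⟨aestronglyMeasurable_const, |a|, ae_of_all _ fun _ => le_rfl⟩

theorem sum {ι : Type*} {s : Finset ι} {m : ι → Space n → ℝ} (hm : ∀ i ∈ s, IsMultiplier (m i)) :
    IsMultiplier fun x => ∑ i ∈ s, m i x := by
  classical
  induction s using Finset.induction_on with
  | empty => simpa using const 0
  | insert a t ha ih =>
    simp only [Finset.sum_insert ha]
    exact (hm a (Finset.mem_insert_self _ _)).add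
      (ih fun i hi => hm i (Finset.mem_insert_of_mem hi))

end IsMultiplier

open scoped Classical in
/-- Multiplication by an essentially bounded real function (zero if the function is not
essentially bounded). -/
def mulOp (m : Space n → ℝ) : L2 n →L[ℂ] L2 n :=
  if hm : MemLp (fun x => (m x : ℂ)) ∞ (volume : Measure (Space n)) then
    (ContinuousLinearMap.mul ℂ ℂ).holderL (volume : Measure (Space n)) ∞ 2 2 (hm.toLp _)
  else 0

theorem weightOp_eq_mulOp (r : ℝ) : weightOp n r = mulOp fun x => bracket x ^ (-r) := rfl

variable {m m' : Space n → ℝ}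

theorem coeFn_mulOp (hm : IsMultiplier m) (f : L2 n) :
    (mulOp m f : Space n → ℂ) =ᵐ[volume] fun x => (m x : ℂ) * (f : Space n → ℂ) x := by
  have h := hm.memLp
  unfold mulOp
  rw [dif_pos h]
  have h1 := (ContinuousLinearMap.mul ℂ ℂ).coeFn_holder (r := 2) (h.toLp _) f
  filter_upwards [h1, h.coeFn_toLp] with x hx hx'
  simp only [ContinuousLinearMap.holderL_apply_apply]
  rw [hx, hx']
  rfl

theorem mulOp_mulOp (hm : IsMultiplier m) (hm' : IsMultiplier m') (f : L2 n) :
    mulOp m (mulOp m' f) = mulOp (fun x => m x * m' x) f := by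
  refine Lp.ext ?_
  filter_upwards [coeFn_mulOp hm (mulOp m' f), coeFn_mulOp hm' f, coeFn_mulOp (hm.mul hm') f]
    with x h1 h2 h3
  rw [h1, h2, h3]
  push_cast
  ring

theorem mulOp_add (hm : IsMultiplier m) (hm' : IsMultiplier m') (f : L2 n) :
    mulOp (fun x => m x + m' x) f = mulOp m f + mulOp m' f := by
  refine Lp.ext ?_
  filter_upwards [coeFn_mulOp hm f, coeFn_mulOp hm' f, coeFn_mulOp (hm.add hm') f,
    Lp.coeFn_add (mulOp m f) (mulOp m' f)] with x h1 h2 h3 h4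
  rw [h3, h4, Pi.add_apply, h1, h2]
  push_cast
  ring

theorem mulOp_const (a : ℝ) (f : L2 n) : mulOp (fun _ => a) f = (a : ℂ) • f := by
  refine Lp.ext ?_
  filter_upwards [coeFn_mulOp (IsMultiplier.const (n := n) a) f, Lp.coeFn_smul (a : ℂ) f]
    with x h1 h2
  rw [h1, h2]
  rfl

theorem mulOp_const_mul (a : ℝ) (hm : IsMultiplier m) (f : L2 n) :
    mulOp (fun x => a * m x) f = (a : ℂ) • mulOp m f := by
  rw [← mulOp_mulOp (IsMultiplier.const a) hm, mulOp_const]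

theorem mulOp_sum {ι : Type*} {s : Finset ι} {m : ι → Space n → ℝ}
    (hm : ∀ i ∈ s, IsMultiplier (m i)) (f : L2 n) :
    mulOp (fun x => ∑ i ∈ s, m i x) f = ∑ i ∈ s, mulOp (m i) f := by
  classical
  induction s using Finset.induction_on with
  | empty => simpa using mulOp_const 0 f
  | insert a t ha ih =>
    have h1 : ∀ i ∈ t, IsMultiplier (m i) := fun i hi => hm i (Finset.mem_insert_of_mem hi)
    simp only [Finset.sum_insert ha]
    rw [mulOp_add (hm a (Finset.mem_insert_self _ _)) (IsMultiplier.sum h1), ih h1]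

theorem inner_mulOp_left (hm : IsMultiplier m) (f g : L2 n) :
    ⟪mulOp m f, g⟫_ℂ = ⟪f, mulOp m g⟫_ℂ := by
  rw [L2.inner_def, L2.inner_def]
  refine integral_congr_ae ?_
  filter_upwards [coeFn_mulOp hm f, coeFn_mulOp hm g] with x h1 h2
  rw [h1, h2]
  simp only [RCLike.inner_apply, map_mul, Complex.conj_ofReal]
  ring

theorem norm_mulOp_le_of_abs_le (hm : IsMultiplier m) (hm' : IsMultiplier m') {C : ℝ}
    (h : ∀ᵐ x, |m x| ≤ C * |m' x|) (f : L2 n) : ‖mulOp m f‖ ≤ C * ‖mulOp m' f‖ := by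
  refine Lp.norm_le_mul_norm_of_ae_le_mul ?_
  filter_upwards [coeFn_mulOp hm f, coeFn_mulOp hm' f, h] with x h1 h2 h3
  rw [h1, h2, norm_mul, norm_mul, Complex.norm_real, Complex.norm_real, Real.norm_eq_abs,
    Real.norm_eq_abs, ← mul_assoc]
  exact mul_le_mul_of_nonneg_right h3 (norm_nonneg _)

theorem norm_mulOp_le (hm : IsMultiplier m) {C : ℝ} (h : ∀ᵐ x, |m x| ≤ C) (f : L2 n) :
    ‖mulOp m f‖ ≤ C * ‖f‖ := by
  have := norm_mulOp_le_of_abs_le hm (IsMultiplier.const 1) (C := C)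
    (by filter_upwards [h] with x hx; simpa using hx) f
  simpa [mulOp_const] using this

/-- A bilinear expression whose coefficient is dominated by a product of two weights. -/
theorem norm_inner_mulOp_le {w w' : Space n → ℝ} (hm : IsMultiplier m) (hw : IsMultiplier w)
    (hw' : IsMultiplier w') {C : ℝ} (hw0 : ∀ x, 0 < w x) (hw0' : ∀ x, 0 < w' x)
    (h : ∀ᵐ x, |m x| ≤ C * (w x * w' x)) (f g : L2 n) :
    ‖⟪f, mulOp m g⟫_ℂ‖ ≤ C * (‖mulOp w f‖ * ‖mulOp w' g‖) := by
  have hmk : AEStronglyMeasurable (fun x => m x * (w x)⁻¹ * (w' x)⁻¹) volume :=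
    (hm.1.mul hw.1.aemeasurable.inv.aestronglyMeasurable).mul
      hw'.1.aemeasurable.inv.aestronglyMeasurable
  have hb : ∀ᵐ x, |m x * (w x)⁻¹ * (w' x)⁻¹| ≤ C := by
    filter_upwards [h] with x hx
    rw [abs_mul, abs_mul, abs_of_pos (inv_pos.2 (hw0 x)), abs_of_pos (inv_pos.2 (hw0' x)),
      mul_assoc, ← mul_inv, ← div_eq_mul_inv, div_le_iff₀ (mul_pos (hw0 x) (hw0' x))]
    exact hx
  have hk : IsMultiplier fun x => m x * (w x)⁻¹ * (w' x)⁻¹ := ⟨hmk, C, hb⟩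
  -- Factor m as w times m/(w w') times w', where the middle factor is bounded by C.
  have e : mulOp m g = mulOp w (mulOp (fun x => m x * (w x)⁻¹ * (w' x)⁻¹) (mulOp w' g)) := by
    rw [mulOp_mulOp hk hw', mulOp_mulOp hw (hk.mul hw')]
    congr 2
    funext x
    have h1 := (hw0 x).ne'
    have h2 := (hw0' x).ne'
    field_simp
  rw [e, ← inner_mulOp_left hw]
  refine (norm_inner_le_norm _ _).trans ?_
  calc ‖mulOp w f‖ * ‖mulOp (fun x => m x * (w x)⁻¹ * (w' x)⁻¹) (mulOp w' g)‖
      ≤ ‖mulOp w f‖ * (C * ‖mulOp w' g‖) := by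
        gcongr
        exact norm_mulOp_le hk hb _
    _ = _ := by ring

/-- Hölder interpolation between weights. -/
theorem norm_mulOp_le_rpow_mul_rpow {w w' : Space n → ℝ} (hm : IsMultiplier m)
    (hw : IsMultiplier w) (hw' : IsMultiplier w') {θ : ℝ} (hθ : 0 ≤ θ) (hθ1 : θ ≤ 1)
    (h : ∀ᵐ x, |m x| ≤ |w x| ^ (1 - θ) * |w' x| ^ θ) (f : L2 n) :
    ‖mulOp m f‖ ≤ ‖mulOp w f‖ ^ (1 - θ) * ‖mulOp w' f‖ ^ θ := by
  have key : ∀ g : L2 n, ENNReal.ofReal (‖g‖ ^ 2) = ∫⁻ x, ‖(g : Space n → ℂ) x‖ₑ ^ (2 : ℝ) := by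
    intro g
    have h1 := eLpNorm_eq_lintegral_rpow_enorm_toReal (f := (g : Space n → ℂ)) (μ := volume)
      (p := 2) (by norm_num) (by norm_num)
    rw [← Lp.enorm_def] at h1
    rw [ENNReal.ofReal_pow (norm_nonneg _), ofReal_norm, h1, ← ENNReal.rpow_natCast,
      ← ENNReal.rpow_mul]
    norm_num
  have hh : 0 ≤ 1 - θ := by linarith
  -- Hölder's inequality for |w f|² and |w' f|² with the exponents 1 - θ and θ.
  have hi := ENNReal.lintegral_mul_norm_pow_le (μ := (volume : Measure (Space n)))
    (f := fun x => ‖(mulOp w f : Space n → ℂ) x‖ₑ ^ (2 : ℝ))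
    (g := fun x => ‖(mulOp w' f : Space n → ℂ) x‖ₑ ^ (2 : ℝ))
    ((Lp.aestronglyMeasurable _).enorm.pow_const _) ((Lp.aestronglyMeasurable _).enorm.pow_const _)
    hh hθ (by ring)
  rw [← key, ← key, ENNReal.ofReal_rpow_of_nonneg (by positivity) hh,
    ENNReal.ofReal_rpow_of_nonneg (by positivity) hθ, ← ENNReal.ofReal_mul (by positivity)] at hi
  have hl : ENNReal.ofReal (‖mulOp m f‖ ^ 2) ≤ ENNReal.ofReal
      ((‖mulOp w f‖ ^ 2) ^ (1 - θ) * (‖mulOp w' f‖ ^ 2) ^ θ) := by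
    refine le_trans ?_ hi
    rw [key]
    refine lintegral_mono_ae ?_
    filter_upwards [coeFn_mulOp hm f, coeFn_mulOp hw f, coeFn_mulOp hw' f, h] with x h1 h2 h3 h4
    rw [h1, h2, h3, ← ENNReal.rpow_mul, ← ENNReal.rpow_mul, mul_comm 2, mul_comm 2,
      ENNReal.rpow_mul, ENNReal.rpow_mul, ← ENNReal.mul_rpow_of_nonneg _ _ zero_le_two]
    refine ENNReal.rpow_le_rpow ?_ zero_le_two
    rw [← ofReal_norm, ← ofReal_norm, ← ofReal_norm,
      ENNReal.ofReal_rpow_of_nonneg (norm_nonneg _) hh,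
      ENNReal.ofReal_rpow_of_nonneg (norm_nonneg _) hθ, ← ENNReal.ofReal_mul (by positivity)]
    refine ENNReal.ofReal_le_ofReal ?_
    simp only [norm_mul, Complex.norm_real, Real.norm_eq_abs]
    rw [Real.mul_rpow (abs_nonneg _) (norm_nonneg _), Real.mul_rpow (abs_nonneg _) (norm_nonneg _)]
    have e : ‖(f : Space n → ℂ) x‖ ^ (1 - θ) * ‖(f : Space n → ℂ) x‖ ^ θ
        = ‖(f : Space n → ℂ) x‖ := by
      rw [← Real.rpow_add_of_nonneg (norm_nonneg _) hh hθ]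
      simp
    calc |m x| * ‖(f : Space n → ℂ) x‖
        ≤ (|w x| ^ (1 - θ) * |w' x| ^ θ) * ‖(f : Space n → ℂ) x‖ := by gcongr
      _ = (|w x| ^ (1 - θ) * |w' x| ^ θ) *
          (‖(f : Space n → ℂ) x‖ ^ (1 - θ) * ‖(f : Space n → ℂ) x‖ ^ θ) := by rw [e]
      _ = _ := by ring
  rw [ENNReal.ofReal_le_ofReal_iff (by positivity)] at hl
  have e2 : (‖mulOp w f‖ ^ 2) ^ (1 - θ) * (‖mulOp w' f‖ ^ 2) ^ θ
      = (‖mulOp w f‖ ^ (1 - θ) * ‖mulOp w' f‖ ^ θ) ^ 2 := by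
    rw [mul_pow, ← Real.rpow_natCast, ← Real.rpow_natCast, ← Real.rpow_natCast,
      ← Real.rpow_natCast, ← Real.rpow_mul (norm_nonneg _), ← Real.rpow_mul (norm_nonneg _),
      ← Real.rpow_mul (norm_nonneg _), ← Real.rpow_mul (norm_nonneg _), mul_comm (1 - θ),
      mul_comm θ]
  rw [e2] at hl
  exact le_of_sq_le_sq hl (by positivity)

/-- Bounded multipliers that tend to zero pointwise tend to zero strongly. -/
theorem tendsto_mulOp_zero {w : ℕ → Space n → ℝ} (hw : ∀ k, IsMultiplier (w k)) {C : ℝ}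
    (hb : ∀ k x, |w k x| ≤ C) (h0 : ∀ x, Tendsto (fun k => w k x) atTop (𝓝 0)) (f : L2 n) :
    Tendsto (fun k => ‖mulOp (w k) f‖) atTop (𝓝 0) := by
  have key : ∀ g : L2 n, ‖g‖ ^ 2 = ∫ x, ‖(g : Space n → ℂ) x‖ ^ 2 := by
    intro g
    have h1 : ((‖g‖ ^ 2 : ℝ) : ℂ) = ⟪g, g⟫_ℂ := by
      rw [inner_self_eq_norm_sq_to_K]; norm_cast
    rw [L2.inner_def] at h1
    have h2 : ∀ x, ⟪(g : Space n → ℂ) x, (g : Space n → ℂ) x⟫_ℂ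
        = ((‖(g : Space n → ℂ) x‖ ^ 2 : ℝ) : ℂ) := by
      intro x
      rw [inner_self_eq_norm_sq_to_K]; norm_cast
    simp only [h2] at h1
    rw [integral_complex_ofReal] at h1
    exact_mod_cast h1
  have hint : Integrable (fun x => C ^ 2 * ‖(f : Space n → ℂ) x‖ ^ 2) volume :=
    ((memLp_two_iff_integrable_sq_norm (Lp.aestronglyMeasurable f)).1 (Lp.memLp f)).const_mul _
  have ht : Tendsto (fun k => ∫ x, ‖(mulOp (w k) f : Space n → ℂ) x‖ ^ 2) atTop
      (𝓝 (∫ _ : Space n, (0 : ℝ))) := by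
    refine tendsto_integral_of_dominated_convergence _
      (fun k => (Lp.aestronglyMeasurable _).norm.pow 2) hint (fun k => ?_) ?_
    · filter_upwards [coeFn_mulOp (hw k) f] with x hx
      rw [hx, Real.norm_of_nonneg (by positivity), norm_mul, mul_pow, Complex.norm_real,
        Real.norm_eq_abs]
      gcongr
      exact hb k x
    · have hall : ∀ᵐ x, ∀ k, (mulOp (w k) f : Space n → ℂ) x
          = (w k x : ℂ) * (f : Space n → ℂ) x := ae_all_iff.2 fun k => coeFn_mulOp (hw k) f
      filter_upwards [hall] with x hx
      simp only [hx, norm_mul, Complex.norm_real]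
      have := (((h0 x).norm).mul_const ‖(f : Space n → ℂ) x‖).pow 2
      simpa using this
  simp only [← key, integral_zero] at ht
  have := ht.sqrt
  simpa [Real.sqrt_sq (norm_nonneg _)] using this

end Multiplication

end SemiclassicalDecay

end

noncomputable section

namespace SemiclassicalDecay

/-! ### Semiclassical weak derivatives in `L²` -/

section WeakDerivative

open scoped InnerProductSpace FourierTransform

variable {n : ℕ} {h : ℝ} {j : Fin n}

/-- `D_{x_j} f = g` in the sense of distributions, for `f, g ∈ L²`. -/
def HasD (h : ℝ) (j : Fin n) (f g : L2 n) : Prop :=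
  -(Complex.I * h) • ∂_{(stdVec j : Space n)} (Lp.toTemperedDistribution f)
    = Lp.toTemperedDistribution g

theorem toTemperedDistribution_add (f g : L2 n) : Lp.toTemperedDistribution (f + g)
    = Lp.toTemperedDistribution f + Lp.toTemperedDistribution g :=
  (Lp.toTemperedDistributionCLM ℂ (volume : Measure (Space n)) 2).map_add f g

theorem toTemperedDistribution_smul (a : ℂ) (f : L2 n) : Lp.toTemperedDistribution (a • f)
    = a • Lp.toTemperedDistribution f :=
  (Lp.toTemperedDistributionCLM ℂ (volume : Measure (Space n)) 2).map_smul a f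

theorem toTemperedDistribution_injective {f g : L2 n}
    (h : Lp.toTemperedDistribution f = Lp.toTemperedDistribution g) : f = g := by
  have hk := Lp.ker_toTemperedDistributionCLM_eq_bot (F := ℂ) (μ := (volume : Measure (Space n)))
    (p := 2)
  exact LinearMap.ker_eq_bot.1 hk h

theorem HasD.unique {f g g' : L2 n} (h1 : HasD h j f g) (h2 : HasD h j f g') : g = g' :=
  toTemperedDistribution_injective (h1.symm.trans h2)

theorem HasD.add {f g f' g' : L2 n} (h1 : HasD h j f g) (h2 : HasD h j f' g') :
    HasD h j (f + f') (g + g') := by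
  unfold HasD at *
  rw [toTemperedDistribution_add, toTemperedDistribution_add, LineDeriv.lineDerivOp_add, smul_add,
    h1, h2]

theorem HasD.const_smul {f g : L2 n} (a : ℂ) (h1 : HasD h j f g) : HasD h j (a • f) (a • g) := by
  unfold HasD at *
  rw [toTemperedDistribution_smul, toTemperedDistribution_smul, ← h1, LineDeriv.lineDerivOp_smul,
    smul_comm]

theorem HasD.zero : HasD h j (0 : L2 n) 0 := by
  have : Lp.toTemperedDistribution (0 : L2 n) = 0 :=
    (Lp.toTemperedDistributionCLM ℂ (volume : Measure (Space n)) 2).map_zero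
  unfold HasD
  rw [this, LineDeriv.lineDerivOp_zero, smul_zero]

theorem HasD.sum {ι : Type*} {s : Finset ι} {f g : ι → L2 n} (h1 : ∀ i ∈ s, HasD h j (f i) (g i)) :
    HasD h j (∑ i ∈ s, f i) (∑ i ∈ s, g i) := by
  classical
  induction s using Finset.induction_on with
  | empty => simpa using HasD.zero
  | insert a t ha ih =>
    rw [Finset.sum_insert ha, Finset.sum_insert ha]
    exact (h1 a (Finset.mem_insert_self _ _)).add
      (ih fun i hi => h1 i (Finset.mem_insert_of_mem hi))

theorem hasD_iff {f g : L2 n} : HasD h j f g ↔ ∀ ψ : 𝓢(Space n, ℂ),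
    ∫ x, ψ x * (g : Space n → ℂ) x
      = (Complex.I * h) * ∫ x, fderiv ℝ ψ x (stdVec j) * (f : Space n → ℂ) x := by
  have key : ∀ ψ : 𝓢(Space n, ℂ), (-(Complex.I * h) •
      ∂_{(stdVec j : Space n)} (Lp.toTemperedDistribution f)) ψ
      = (Complex.I * h) * ∫ x, fderiv ℝ ψ x (stdVec j) * (f : Space n → ℂ) x := by
    intro ψ
    rw [smul_apply, TemperedDistribution.lineDerivOp_apply_apply,
      map_neg, Lp.toTemperedDistribution_apply]
    simp only [SchwartzMap.lineDerivOp_apply_eq_fderiv, smul_eq_mul]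
    ring
  constructor
  · intro h1 ψ
    rw [← key, h1, Lp.toTemperedDistribution_apply]
    rfl
  · intro h1
    refine ContinuousLinearMap.ext fun ψ => ?_
    refine (key ψ).trans ?_
    rw [← h1]
    exact (Lp.toTemperedDistribution_apply g ψ).symm

/-- On the Fourier side the weak derivative is multiplication by a real function. Symmetry then
needs no approximation by smooth functions. -/
theorem HasD.fourier_ae_eq {f g : L2 n} (h1 : HasD h j f g) :
    ((𝓕 g : L2 n) : Space n → ℂ) =ᵐ[volume] fun ξ =>
      ((2 * Real.pi * h * inner ℝ ξ (stdVec j) : ℝ) : ℂ) * ((𝓕 f : L2 n) : Space n → ℂ) ξ := by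
  have hloc : ∀ f : L2 n, LocallyIntegrable (f : Space n → ℂ) volume := fun f =>
    (Lp.memLp f).locallyIntegrable (by norm_num)
  have hloc2 : LocallyIntegrable (fun ξ =>
      ((2 * Real.pi * h * inner ℝ ξ (stdVec j) : ℝ) : ℂ) * ((𝓕 f : L2 n) : Space n → ℂ) ξ)
      volume := by
    have hc : Continuous fun ξ : Space n =>
        ((2 * Real.pi * h * inner ℝ ξ (stdVec j) : ℝ) : ℂ) := by fun_prop
    have := ((hloc (𝓕 f)).locallyIntegrableOn Set.univ).continuousOn_smul isOpen_univ.isLocallyClosed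
      hc.continuousOn
    exact locallyIntegrableOn_univ.1 this
  refine ae_eq_of_integral_contDiff_smul_eq (hloc _) hloc2 fun g0 hg hgc => ?_
  have hg1 : HasCompactSupport (fun x => (g0 x : ℂ)) := hgc.comp_left (g := Complex.ofReal) rfl
  have hg2 : ContDiff ℝ ∞ (fun x => (g0 x : ℂ)) := Complex.ofRealCLM.contDiff.comp hg
  have e1 := congrArg (fun T => (𝓕 T) (hg1.toSchwartzMap hg2)) h1
  simp only [Lp.fourier_toTemperedDistribution_eq, Lp.toTemperedDistribution_apply,
    FourierTransform.fourier_smul, TemperedDistribution.fourier_lineDerivOp_eq,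
    smul_apply, TemperedDistribution.smulLeftCLM_apply_apply] at e1
  have ht : Function.HasTemperateGrowth
      (fun x : Space n => ((inner ℝ x (stdVec j) : ℝ) : ℂ)) := by fun_prop
  simp only [SchwartzMap.smulLeftCLM_apply_apply ht] at e1
  have e2 : ∀ x, g0 x • ((𝓕 g : L2 n) : Space n → ℂ) x
      = (hg1.toSchwartzMap hg2) x • ((𝓕 g : L2 n) : Space n → ℂ) x := fun x => by
    simp
  simp only [e2]
  rw [← e1, smul_smul, ← integral_smul]
  refine integral_congr_ae (ae_of_all _ fun x => ?_)
  simp only [smul_eq_mul, HasCompactSupport.toSchwartzMap_toFun, Complex.real_smul]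
  push_cast
  linear_combination (-(2 * Real.pi * h * inner ℝ x (stdVec j)) * g0 x * (𝓕 f : L2 n) x : ℂ) *
    Complex.I_sq

/-- Symmetry of `D_{x_j}`. -/
theorem HasD.inner_left {f f' g g' : L2 n} (hf : HasD h j f f') (hg : HasD h j g g') :
    ⟪f', g⟫_ℂ = ⟪f, g'⟫_ℂ := by
  rw [← Lp.inner_fourier_eq f', ← Lp.inner_fourier_eq f, L2.inner_def, L2.inner_def]
  refine integral_congr_ae ?_
  filter_upwards [hf.fourier_ae_eq, hg.fourier_ae_eq] with x h1 h2
  rw [h1, h2]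
  simp only [RCLike.inner_apply, map_mul, Complex.conj_ofReal]
  ring

/-- By symmetry ‖D f‖² = ⟪f, D² f⟫. -/
theorem HasD.norm_sq_le {f f' f'' : L2 n} (hf : HasD h j f f') (hf' : HasD h j f' f'') :
    ‖f'‖ ^ 2 ≤ ‖f‖ * ‖f''‖ := by
  have h1 : ((‖f'‖ ^ 2 : ℝ) : ℂ) = ⟪f, f''⟫_ℂ := by
    rw [← hf.inner_left hf', inner_self_eq_norm_sq_to_K]
    norm_cast
  have h2 := norm_inner_le_norm (𝕜 := ℂ) f f''
  rw [← h1, Complex.norm_real, Real.norm_of_nonneg (by positivity)] at h2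
  exact h2

theorem integrable_mul_of_memLp_two {f g : Space n → ℂ} (hf : MemLp f 2 volume)
    (hg : MemLp g 2 volume) : Integrable (fun x => f x * g x) volume := by
  exact hf.integrable_mul hg

/-- Classical derivatives are weak derivatives. -/
theorem hasD_toLp {ψ : Space n → ℂ} (hd : Differentiable ℝ ψ) (h2 : MemLp ψ 2 volume)
    (h2' : MemLp (fun x => fderiv ℝ ψ x (stdVec j)) 2 volume) :
    HasD h j (h2.toLp ψ) ((h2'.const_mul (-(Complex.I * h))).toLp (semiD h j ψ)) := by
  refine hasD_iff.2 fun η => ?_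
  have e1 : ∫ x, η x * (((h2'.const_mul (-(Complex.I * h))).toLp (semiD h j ψ) : L2 n) :
      Space n → ℂ) x = -(Complex.I * h) * ∫ x, η x * fderiv ℝ ψ x (stdVec j) := by
    rw [← integral_const_mul]
    refine integral_congr_ae ?_
    filter_upwards [(h2'.const_mul (-(Complex.I * h))).coeFn_toLp] with x hx
    unfold semiD
    rw [hx]
    ring
  have e2 : ∫ x, fderiv ℝ η x (stdVec j) * ((h2.toLp ψ : L2 n) : Space n → ℂ) x
      = ∫ x, fderiv ℝ η x (stdVec j) * ψ x := by
    refine integral_congr_ae ?_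
    filter_upwards [h2.coeFn_toLp] with x hx
    rw [hx]
  have hη' : MemLp (fun x => fderiv ℝ η x (stdVec j)) 2 volume := by
    have := (∂_{(stdVec j : Space n)} η).memLp 2 volume
    refine this.congr_norm ?_ (ae_of_all _ fun x => ?_)
    · exact (memLp_congr_ae (ae_of_all _ fun x =>
        (SchwartzMap.lineDerivOp_apply_eq_fderiv (stdVec j) η x).symm)).2 this |>.1
    · rw [SchwartzMap.lineDerivOp_apply_eq_fderiv]
  rw [e1, e2, integral_mul_fderiv_eq_neg_fderiv_mul_of_integrable
    (integrable_mul_of_memLp_two hη' h2) (integrable_mul_of_memLp_two (η.memLp 2 volume) h2')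
    (integrable_mul_of_memLp_two (η.memLp 2 volume) h2) (fun x _ => η.differentiableAt)
    (fun x _ => hd x)]
  ring

/-- Bounded `C¹` functions with bounded derivative. -/
structure C1Bounded (m : Space n → ℝ) : Prop where
  contDiff : ContDiff ℝ 1 m
  bounded : ∃ C : ℝ, ∀ x, |m x| ≤ C
  bounded_fderiv : ∃ C : ℝ, ∀ j : Fin n, ∀ x, |fderiv ℝ m x (stdVec j)| ≤ C

namespace C1Bounded

variable {m m' : Space n → ℝ}

theorem isMultiplier (hm : C1Bounded m) : IsMultiplier m := by
  obtain ⟨C, hC⟩ := hm.bounded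
  exact ⟨hm.contDiff.continuous.aestronglyMeasurable, C, ae_of_all _ hC⟩

theorem continuous_fderiv_apply (hm : C1Bounded m) (j : Fin n) :
    Continuous fun x => fderiv ℝ m x (stdVec j) :=
  (hm.contDiff.continuous_fderiv one_ne_zero).clm_apply continuous_const

theorem isMultiplier_fderiv (hm : C1Bounded m) (j : Fin n) :
    IsMultiplier fun x => fderiv ℝ m x (stdVec j) := by
  obtain ⟨C, hC⟩ := hm.bounded_fderiv
  exact ⟨(hm.continuous_fderiv_apply j).aestronglyMeasurable, C, ae_of_all _ (hC j)⟩

theorem differentiable (hm : C1Bounded m) : Differentiable ℝ m :=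
  hm.contDiff.differentiable one_ne_zero

theorem fderiv_mul_apply (hm : C1Bounded m) (hm' : C1Bounded m') (j : Fin n) (x : Space n) :
    fderiv ℝ (fun x => m x * m' x) x (stdVec j)
      = m x * fderiv ℝ m' x (stdVec j) + fderiv ℝ m x (stdVec j) * m' x := by
  rw [fderiv_fun_mul (hm.differentiable x) (hm'.differentiable x)]
  simp [mul_comm]

theorem mul (hm : C1Bounded m) (hm' : C1Bounded m') : C1Bounded fun x => m x * m' x := by
  obtain ⟨C, hC⟩ := hm.bounded
  obtain ⟨C', hC'⟩ := hm'.bounded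
  obtain ⟨D, hD⟩ := hm.bounded_fderiv
  obtain ⟨D', hD'⟩ := hm'.bounded_fderiv
  refine ⟨hm.contDiff.mul hm'.contDiff, ⟨C * C', fun x => ?_⟩, ⟨C * D' + D * C', fun j x => ?_⟩⟩
  · rw [abs_mul]
    exact mul_le_mul (hC x) (hC' x) (abs_nonneg _) ((abs_nonneg _).trans (hC x))
  · rw [hm.fderiv_mul_apply hm']
    refine (abs_add_le _ _).trans (add_le_add ?_ ?_)
    · rw [abs_mul]
      exact mul_le_mul (hC x) (hD' j x) (abs_nonneg _) ((abs_nonneg _).trans (hC x))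
    · rw [abs_mul]
      exact mul_le_mul (hD j x) (hC' x) (abs_nonneg _) ((abs_nonneg _).trans (hD j x))

theorem const (a : ℝ) : C1Bounded fun _ : Space n => a :=
  ⟨contDiff_const, ⟨|a|, fun _ => le_rfl⟩, ⟨0, fun j x => by simp⟩⟩

theorem add (hm : C1Bounded m) (hm' : C1Bounded m') : C1Bounded fun x => m x + m' x := by
  obtain ⟨C, hC⟩ := hm.bounded
  obtain ⟨C', hC'⟩ := hm'.bounded
  obtain ⟨D, hD⟩ := hm.bounded_fderiv
  obtain ⟨D', hD'⟩ := hm'.bounded_fderiv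
  refine ⟨hm.contDiff.add hm'.contDiff, ⟨C + C', fun x => ?_⟩, ⟨D + D', fun j x => ?_⟩⟩
  · exact (abs_add_le _ _).trans (add_le_add (hC x) (hC' x))
  · rw [fderiv_fun_add (hm.differentiable x) (hm'.differentiable x)]
    exact (abs_add_le _ _).trans (add_le_add (hD j x) (hD' j x))

theorem sum {ι : Type*} {s : Finset ι} {m : ι → Space n → ℝ} (hm : ∀ i ∈ s, C1Bounded (m i)) :
    C1Bounded fun x => ∑ i ∈ s, m i x := by
  classical
  induction s using Finset.induction_on with
  | empty => simpa using const 0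
  | insert a t ha ih =>
    simp only [Finset.sum_insert ha]
    exact (hm a (Finset.mem_insert_self _ _)).add
      (ih fun i hi => hm i (Finset.mem_insert_of_mem hi))

end C1Bounded

/-- The product rule for weak derivatives. -/
theorem HasD.mulOp {m : Space n → ℝ} (hm : C1Bounded m) {f g : L2 n} (hf : HasD h j f g) :
    HasD h j (mulOp m f) (mulOp m g +
      (-(Complex.I * h)) • mulOp (fun x => fderiv ℝ m x (stdVec j)) f) := by
  refine hasD_iff.2 fun η => ?_
  obtain ⟨C, hC⟩ := hm.bounded
  obtain ⟨C', hC'⟩ := hm.bounded_fderiv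
  -- Since m is only C¹, the product of m with a Schwartz function is not an admissible test
  -- function. The classical product rule is applied to ψ instead, and the symmetry of D, in the
  -- form `HasD.inner_left`, transfers it to f.
  set ψ : Space n → ℂ := fun x => starRingEnd ℂ (η x) * (m x : ℂ) with hψ
  have hηd : ∀ x, HasFDerivAt (fun x => starRingEnd ℂ (η x))
      ((Complex.conjCLE : ℂ →L[ℝ] ℂ) ∘L fderiv ℝ η x) x := fun x =>
    (Complex.conjCLE : ℂ →L[ℝ] ℂ).hasFDerivAt.comp x η.differentiableAt.hasFDerivAt
  have hmd : ∀ x, HasFDerivAt (fun x => (m x : ℂ)) (Complex.ofRealCLM ∘L fderiv ℝ m x) x :=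
    fun x => Complex.ofRealCLM.hasFDerivAt.comp x (hm.differentiable x).hasFDerivAt
  have hψd : ∀ x, fderiv ℝ ψ x (stdVec j) = starRingEnd ℂ (fderiv ℝ η x (stdVec j)) * (m x : ℂ)
      + starRingEnd ℂ (η x) * ((fderiv ℝ m x (stdVec j) : ℝ) : ℂ) := by
    intro x
    have e : fderiv ℝ ψ x = _ := ((hηd x).mul (hmd x)).fderiv
    rw [e]
    simp
    ring
  have hη2 : MemLp (fun x => starRingEnd ℂ (η x)) 2 (volume : Measure (Space n)) :=
    (η.memLp 2 volume).congr_norm (by fun_prop) (ae_of_all _ fun x => by simp)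
  have hη' : MemLp (fun x => starRingEnd ℂ (fderiv ℝ η x (stdVec j))) 2
      (volume : Measure (Space n)) := by
    have h1 := (∂_{(stdVec j : Space n)} η).memLp 2 volume
    have h2 : (fun x => starRingEnd ℂ (fderiv ℝ η x (stdVec j)))
        = fun x => starRingEnd ℂ ((∂_{(stdVec j : Space n)} η) x) := by
      funext x
      rw [SchwartzMap.lineDerivOp_apply_eq_fderiv]
    rw [h2]
    exact h1.congr_norm (by fun_prop) (ae_of_all _ fun x => by simp)
  have hb : ∀ (u : Space n → ℂ) (k : Space n → ℝ), MemLp u 2 (volume : Measure (Space n)) →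
      IsMultiplier k → MemLp (fun x => u x * (k x : ℂ)) 2 (volume : Measure (Space n)) := by
    intro u k hu hk
    exact hk.memLp.mul hu
  have hb' : ∀ k : Space n → ℝ, IsMultiplier k → ∀ f : L2 n,
      MemLp (fun x => (k x : ℂ) * (f : Space n → ℂ) x) 2 (volume : Measure (Space n)) := by
    intro k hk f
    simpa only [mul_comm] using hb _ k (Lp.memLp f) hk
  have hη1 : MemLp (fun x => fderiv ℝ η x (stdVec j)) 2 (volume : Measure (Space n)) := by
    simpa only [SchwartzMap.lineDerivOp_apply_eq_fderiv] using
      (∂_{(stdVec j : Space n)} η).memLp 2 volume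
  have hψ2 : MemLp ψ 2 volume := hb _ _ hη2 hm.isMultiplier
  have hψ2' : MemLp (fun x => fderiv ℝ ψ x (stdVec j)) 2 volume := by
    simp only [hψd]
    exact (hb _ _ hη' hm.isMultiplier).add (hb _ _ hη2 (hm.isMultiplier_fderiv j))
  have hψdiff : Differentiable ℝ ψ := fun x => ((hηd x).mul (hmd x)).differentiableAt
  have key := (hasD_toLp (h := h) (j := j) hψdiff hψ2 hψ2').inner_left hf
  rw [L2.inner_def, L2.inner_def] at key
  have e1 : ∫ x, ⟪((hψ2.toLp ψ : L2 n) : Space n → ℂ) x, (g : Space n → ℂ) x⟫_ℂ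
      = ∫ x, η x * ((m x : ℂ) * (g : Space n → ℂ) x) := by
    refine integral_congr_ae ?_
    filter_upwards [hψ2.coeFn_toLp] with x hx
    rw [hx]
    simp [hψ]
    ring
  have e2 : ∫ x, ⟪(((hψ2'.const_mul (-(Complex.I * h))).toLp (semiD h j ψ) : L2 n) :
      Space n → ℂ) x, (f : Space n → ℂ) x⟫_ℂ
      = (Complex.I * h) * ((∫ x, fderiv ℝ η x (stdVec j) * ((m x : ℂ) * (f : Space n → ℂ) x))
        + ∫ x, η x * (((fderiv ℝ m x (stdVec j) : ℝ) : ℂ) * (f : Space n → ℂ) x)) := by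
    rw [← integral_add, ← integral_const_mul]
    · refine integral_congr_ae ?_
      filter_upwards [(hψ2'.const_mul (-(Complex.I * h))).coeFn_toLp] with x hx
      unfold semiD
      rw [hx, hψd]
      simp
      ring
    · exact integrable_mul_of_memLp_two hη1 (hb' m hm.isMultiplier f)
    · exact integrable_mul_of_memLp_two (η.memLp 2 volume) (hb' _ (hm.isMultiplier_fderiv j) f)
  replace key := e2.symm.trans (key.trans e1)
  have e3 : ∫ x, fderiv ℝ η x (stdVec j) * (SemiclassicalDecay.mulOp m f : Space n → ℂ) x
      = ∫ x, fderiv ℝ η x (stdVec j) * ((m x : ℂ) * (f : Space n → ℂ) x) := by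
    refine integral_congr_ae ?_
    filter_upwards [coeFn_mulOp hm.isMultiplier f] with x hx
    rw [hx]
  rw [e3]
  have e4 : ∫ x, η x * ((SemiclassicalDecay.mulOp m g + (-(Complex.I * h)) •
      SemiclassicalDecay.mulOp (fun x => fderiv ℝ m x (stdVec j)) f : L2 n) : Space n → ℂ) x
      = (∫ x, η x * ((m x : ℂ) * (g : Space n → ℂ) x)) + (-(Complex.I * h)) *
        ∫ x, η x * (((fderiv ℝ m x (stdVec j) : ℝ) : ℂ) * (f : Space n → ℂ) x) := by
    rw [← integral_const_mul, ← integral_add]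
    · refine integral_congr_ae ?_
      filter_upwards [coeFn_mulOp hm.isMultiplier g, coeFn_mulOp (hm.isMultiplier_fderiv j) f,
        Lp.coeFn_add (SemiclassicalDecay.mulOp m g) ((-(Complex.I * h)) •
          SemiclassicalDecay.mulOp (fun x => fderiv ℝ m x (stdVec j)) f),
        Lp.coeFn_smul (-(Complex.I * h))
          (SemiclassicalDecay.mulOp (fun x => fderiv ℝ m x (stdVec j)) f)] with x h1 h2 h3 h4
      rw [h3, Pi.add_apply, h4, Pi.smul_apply, h1, h2, smul_eq_mul]
      ring
    · exact integrable_mul_of_memLp_two (η.memLp 2 volume) (hb' m hm.isMultiplier g)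
    · exact (integrable_mul_of_memLp_two (η.memLp 2 volume)
        (hb' _ (hm.isMultiplier_fderiv j) f)).const_mul _
  rw [e4, ← key]
  ring

end WeakDerivative

end SemiclassicalDecay

end

noncomputable section

namespace SemiclassicalDecay

/-! ### First order jets and the quadratic form of `P(h)` -/

section Jets

open scoped InnerProductSpace

variable {n : ℕ} {h : ℝ}

open scoped Classical in
/-- The jet components of `f`: `f` itself for `none`, and the weak derivative `D_{x_j} f` for
`some j` (zero if it does not exist in `L²`). -/
def jet (h : ℝ) : Option (Fin n) → L2 n → L2 n
  | none, f => f
  | some j, f => if H : ∃ g, HasD h j f g then H.choose else 0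

/-- The semiclassical Sobolev space of order one. -/
def InH1 (h : ℝ) (f : L2 n) : Prop := ∀ j, ∃ g, HasD h j f g

/-- The semiclassical Sobolev space of order two. -/
def InH2 (h : ℝ) (f : L2 n) : Prop := InH1 h f ∧ ∀ j : Fin n, InH1 h (jet h (some j) f)

@[simp] theorem jet_none (f : L2 n) : jet h none f = f := rfl

theorem InH1.hasD {f : L2 n} (hf : InH1 h f) (j : Fin n) : HasD h j f (jet h (some j) f) := by
  have H := hf j
  simp only [jet, dif_pos H]
  exact H.choose_spec

theorem HasD.jet_eq {j : Fin n} {f g : L2 n} (hf : HasD h j f g) : jet h (some j) f = g := by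
  have H : ∃ g, HasD h j f g := ⟨g, hf⟩
  simp only [jet, dif_pos H]
  exact H.choose_spec.unique hf

theorem InH2.jet {f : L2 n} (hf : InH2 h f) : ∀ α, InH1 h (jet h α f)
  | none => hf.1
  | some j => hf.2 j

theorem InH1.add {f g : L2 n} (hf : InH1 h f) (hg : InH1 h g) : InH1 h (f + g) :=
  fun j => ⟨_, (hf.hasD j).add (hg.hasD j)⟩

theorem InH1.const_smul {f : L2 n} (a : ℂ) (hf : InH1 h f) : InH1 h (a • f) :=
  fun j => ⟨_, (hf.hasD j).const_smul a⟩

theorem InH1.sum {ι : Type*} {s : Finset ι} {f : ι → L2 n} (hf : ∀ i ∈ s, InH1 h (f i)) :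
    InH1 h (∑ i ∈ s, f i) :=
  fun j => ⟨_, HasD.sum fun i hi => (hf i hi).hasD j⟩

theorem InH1.mulOp {m : Space n → ℝ} (hm : C1Bounded m) {f : L2 n} (hf : InH1 h f) :
    InH1 h (mulOp m f) :=
  fun j => ⟨_, (hf.hasD j).mulOp hm⟩

theorem jet_add {f g : L2 n} (hf : InH1 h f) (hg : InH1 h g) :
    ∀ α, jet h α (f + g) = jet h α f + jet h α g
  | none => rfl
  | some j => ((hf.hasD j).add (hg.hasD j)).jet_eq

theorem jet_const_smul {f : L2 n} (a : ℂ) (hf : InH1 h f) :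
    ∀ α, jet h α (a • f) = a • jet h α f
  | none => rfl
  | some j => ((hf.hasD j).const_smul a).jet_eq

theorem jet_sum {ι : Type*} {s : Finset ι} {f : ι → L2 n} (hf : ∀ i ∈ s, InH1 h (f i)) :
    ∀ α, jet h α (∑ i ∈ s, f i) = ∑ i ∈ s, jet h α (f i)
  | none => rfl
  | some j => (HasD.sum fun i hi => (hf i hi).hasD j).jet_eq

theorem jet_mulOp {m : Space n → ℝ} (hm : C1Bounded m) {f : L2 n} (hf : InH1 h f) (j : Fin n) :
    jet h (some j) (mulOp m f) = mulOp m (jet h (some j) f) +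
      (-(Complex.I * h)) • mulOp (fun x => fderiv ℝ m x (stdVec j)) f :=
  ((hf.hasD j).mulOp hm).jet_eq

theorem inner_jet_left {f g : L2 n} (hf : InH1 h f) (hg : InH1 h g) :
    ∀ α, ⟪jet h α f, g⟫_ℂ = ⟪f, jet h α g⟫_ℂ
  | none => rfl
  | some j => (hf.hasD j).inner_left (hg.hasD j)

theorem norm_jet_sq_le {f : L2 n} (hf : InH2 h f) (j : Fin n) :
    ‖jet h (some j) f‖ ^ 2 ≤ ‖f‖ * ‖jet h (some j) (jet h (some j) f)‖ :=
  (hf.1.hasD j).norm_sq_le ((hf.2 j).hasD j)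

/-- `P` is the self-adjoint operator on `L²` of the quadratic form
`∑ ⟨v_α, M_{αβ} u_β⟩ + h ⟨v, V¹ u⟩`, where `M` is a real symmetric matrix of `C¹` functions with
short range derivatives, and `C` controls all constants. -/
structure HasForm (δ C h : ℝ) (P : L2 n →ₗ.[ℂ] L2 n)
    (M : Option (Fin n) → Option (Fin n) → Space n → ℝ) (V : Space n → ℝ) : Prop where
  isSelfAdjoint : IsSelfAdjoint P
  nonneg : 0 ≤ C
  h_pos : 0 < h
  h_le_one : h ≤ 1
  symm : ∀ α β, M α β = M β α
  c1Bounded : ∀ α β, C1Bounded (M α β)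
  aestronglyMeasurable : AEStronglyMeasurable V volume
  abs_le : ∀ α β x, |M α β x| ≤ C
  abs_fderiv_le : ∀ α β k x, |fderiv ℝ (M α β) x (stdVec k)| ≤ C * bracket x ^ (-δ)
  abs_le_short : ∀ α x, |M α none x| ≤ C * bracket x ^ (-δ)
  abs_V_le : ∀ᵐ x, |V x| ≤ C * bracket x ^ (-δ)
  inH2 : ∀ u : P.domain, InH2 h (u : L2 n)
  inner_apply : ∀ v, InH1 h v → ∀ u : P.domain, ⟪v, P u⟫_ℂ =
    ∑ α, ∑ β, ⟪jet h α v, mulOp (M α β) (jet h β (u : L2 n))⟫_ℂ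
      + h * ⟪v, mulOp V (u : L2 n)⟫_ℂ
  norm_jet_le : ∀ u : P.domain, ∀ α, ‖jet h α (u : L2 n)‖ ≤ C * (‖P u‖ + ‖(u : L2 n)‖)
  norm_jet_jet_le : ∀ u : P.domain, ∀ i j,
    ‖jet h (some i) (jet h (some j) (u : L2 n))‖ ≤ C * (‖P u‖ + ‖(u : L2 n)‖)

theorem bracket_rpow_neg_le_one {r : ℝ} (hr : 0 ≤ r) (x : Space n) : bracket x ^ (-r) ≤ 1 :=
  Real.rpow_le_one_of_one_le_of_nonpos (one_le_bracket x) (by linarith)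

/-- The ellipticity hypothesis provides two weak derivatives of elements of the domain. -/
theorem Elliptic.exists_inH2 {P : ℝ → (L2 n →ₗ.[ℂ] L2 n)} (hell : Elliptic P)
    (hP : ∀ h ∈ Set.Ioc (0 : ℝ) 1, IsSelfAdjoint (P h)) :
    ∃ C : ℝ, 0 ≤ C ∧ ∀ h ∈ Set.Ioc (0 : ℝ) 1, ∀ u : (P h).domain, InH2 h (u : L2 n) ∧
      (∀ α, ‖jet h α (u : L2 n)‖ ≤ C * (‖P h u‖ + ‖(u : L2 n)‖)) ∧
      ∀ i j, ‖jet h (some i) (jet h (some j) (u : L2 n))‖ ≤ C * (‖P h u‖ + ‖(u : L2 n)‖) := by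
  obtain ⟨C, hC⟩ := hell
  refine ⟨max C 1, le_max_of_le_right zero_le_one, fun h hh u => ?_⟩
  -- u is the resolvent at i applied to F, so the hypothesis controls its derivatives by ‖F‖.
  -- Replacing C by max C 1 includes the component without derivative.
  set F : L2 n := P h u - Complex.I • (u : L2 n) with hF
  have hu : resolventOp (P h) Complex.I F = u :=
    resolventOp_apply_sub (hP h hh) (by simp) u
  have hFn : ‖F‖ ≤ ‖P h u‖ + ‖(u : L2 n)‖ := by
    refine (norm_sub_le _ _).trans ?_
    simp [norm_smul]
  have hCF : ∀ w : L2 n, ‖w‖ ≤ C * ‖F‖ → ‖w‖ ≤ max C 1 * (‖P h u‖ + ‖(u : L2 n)‖) := by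
    intro w hw
    refine hw.trans (mul_le_mul (le_max_left _ _) hFn (norm_nonneg _) ?_)
    exact le_max_of_le_right zero_le_one
  have h1 : ∀ j : Fin n, ∃ w, HasD h j (u : L2 n) w ∧ ‖w‖ ≤ C * ‖F‖ := by
    intro j
    obtain ⟨w, hw, hwn⟩ := hC h hh Complex.I (Or.inl rfl) 1 (by norm_num) (fun _ => j) F
    refine ⟨w, ?_, hwn⟩
    rw [hu, LineDeriv.iteratedLineDerivOp_one, pow_one] at hw
    exact hw
  have hH1 : InH1 h (u : L2 n) := fun j => ⟨_, (h1 j).choose_spec.1⟩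
  have h2 : ∀ i j : Fin n, ∃ w, HasD h i (jet h (some j) (u : L2 n)) w ∧ ‖w‖ ≤ C * ‖F‖ := by
    intro i j
    obtain ⟨w, hw, hwn⟩ := hC h hh Complex.I (Or.inl rfl) 2 le_rfl ![i, j] F
    refine ⟨w, ?_, hwn⟩
    rw [hu, LineDeriv.iteratedLineDerivOp_succ_left, LineDeriv.iteratedLineDerivOp_one, pow_two,
      mul_smul, ← LineDeriv.lineDerivOp_smul] at hw
    have h3 := hH1.hasD j
    unfold HasD at h3 ⊢
    rw [← h3]
    exact hw
  have hH2 : InH2 h (u : L2 n) := ⟨hH1, fun j i => ⟨_, (h2 i j).choose_spec.1⟩⟩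
  refine ⟨hH2, fun α => ?_, fun i j => ?_⟩
  · cases α with
    | none =>
      refine le_trans ?_ (mul_le_mul_of_nonneg_right (le_max_right C 1) (by positivity))
      simp
    | some j =>
      obtain ⟨w, hw, hwn⟩ := h1 j
      rw [hw.jet_eq]
      exact hCF w hwn
  · obtain ⟨w, hw, hwn⟩ := h2 i j
    rw [hw.jet_eq]
    exact hCF w hwn

end Jets

end SemiclassicalDecay

end

noncomputable section

namespace SemiclassicalDecay

/-! ### The quadratic form of a self-adjoint realization -/

section Realization

open scoped InnerProductSpace ComplexConjugate

variable {n : ℕ} {h : ℝ}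

/-- The action on `L²` of the differential expression with coefficient matrix `N`. -/
def formExpr (h : ℝ) (N : Option (Fin n) → Option (Fin n) → Space n → ℝ) (V : Space n → ℝ)
    (u : L2 n) : L2 n :=
  ∑ α, ∑ β, jet h α (mulOp (N α β) (jet h β u)) + (h : ℂ) • mulOp V u

theorem inner_formExpr {N : Option (Fin n) → Option (Fin n) → Space n → ℝ} {V : Space n → ℝ}
    (hN : ∀ α β, C1Bounded (N α β)) {u v : L2 n} (hu : InH2 h u) (hv : InH1 h v) :
    ⟪v, formExpr h N V u⟫_ℂ = ∑ α, ∑ β, ⟪jet h α v, mulOp (N α β) (jet h β u)⟫_ℂ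
      + h * ⟪v, mulOp V u⟫_ℂ := by
  unfold formExpr
  rw [inner_add_right, inner_smul_right, inner_sum]
  simp only [inner_sum]
  congr 1
  refine Finset.sum_congr rfl fun α _ => Finset.sum_congr rfl fun β _ => ?_
  rw [inner_jet_left hv ((hu.jet β).mulOp (hN α β))]

/-- Conjugation exchanges the two arguments and transposes the matrix; for a symmetric matrix this
is the symmetry of the form. -/
theorem conj_form {N : Option (Fin n) → Option (Fin n) → Space n → ℝ} {V : Space n → ℝ}
    (hN : ∀ α β, C1Bounded (N α β)) (hV : IsMultiplier V) (u v : L2 n) :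
    conj (∑ α, ∑ β, ⟪jet h α v, mulOp (N α β) (jet h β u)⟫_ℂ + h * ⟪v, mulOp V u⟫_ℂ)
      = ∑ α, ∑ β, ⟪jet h α u, mulOp (N β α) (jet h β v)⟫_ℂ + h * ⟪u, mulOp V v⟫_ℂ := by
  rw [map_add, map_sum, map_mul, Complex.conj_ofReal, inner_conj_symm, inner_mulOp_left hV,
    Finset.sum_comm]
  simp only [map_sum, inner_conj_symm, inner_mulOp_left (hN _ _).isMultiplier]

theorem contDiff_semiD {ψ : Space n → ℂ} (hψ : ContDiff ℝ ∞ ψ) (j : Fin n) :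
    ContDiff ℝ ∞ (semiD h j ψ) := by
  unfold semiD
  exact contDiff_const.mul ((hψ.fderiv_right (by simp)).clm_apply contDiff_const)

theorem hasCompactSupport_semiD {ψ : Space n → ℂ} (hψ : HasCompactSupport ψ) (j : Fin n) :
    HasCompactSupport (semiD h j ψ) := by
  have h1 : HasCompactSupport fun x => fderiv ℝ ψ x (stdVec j) :=
    hψ.fderiv_apply ℝ (stdVec j)
  exact h1.mul_left

/-- A compactly supported `C¹` function as an element of `L²` with a weak derivative. -/
theorem exists_hasD_of_ae_eq {ψ : Space n → ℂ} (hψ : ContDiff ℝ 1 ψ) (hc : HasCompactSupport ψ)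
    {p : L2 n} (hp : (p : Space n → ℂ) =ᵐ[volume] ψ) (j : Fin n) :
    ∃ g : L2 n, HasD h j p g ∧ (g : Space n → ℂ) =ᵐ[volume] semiD h j ψ := by
  have h2 : MemLp ψ 2 volume := hψ.continuous.memLp_of_hasCompactSupport hc
  have h2' : MemLp (fun x => fderiv ℝ ψ x (stdVec j)) 2 volume :=
    ((hψ.continuous_fderiv one_ne_zero).clm_apply continuous_const).memLp_of_hasCompactSupport
      (hc.fderiv_apply ℝ (stdVec j))
  have e : h2.toLp ψ = p := Lp.ext (h2.coeFn_toLp.trans hp.symm)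
  have h3 := hasD_toLp (h := h) (j := j) (hψ.differentiable one_ne_zero) h2 h2'
  rw [e] at h3
  exact ⟨_, h3, MemLp.coeFn_toLp _⟩

/-- The coefficient matrix of the form. -/
def Coefficients.formMatrix (c : Coefficients n) (h : ℝ) :
    Option (Fin n) → Option (Fin n) → Space n → ℝ
  | none, none => c.V0
  | some j, none => c.b h j
  | none, some j => c.b h j
  | some j, some i => c.a h i j

/-- The outer derivatives are moved from the test function to u. In the term with a_{ij} this puts
D_i on u and leaves D_j on the test function, which is why a_{ij} occupies the entry (j, i) of
`formMatrix`. -/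
theorem inner_diffOp_eq {c : Coefficients n} (hN : ∀ α β, C1Bounded (c.formMatrix h α β))
    (hV : IsMultiplier (c.V1 h)) {ψ : Space n → ℂ} (hψ : ContDiff ℝ ∞ ψ)
    (hc : HasCompactSupport ψ) {p q : L2 n} (hp : (p : Space n → ℂ) =ᵐ[volume] ψ)
    (hq : (q : Space n → ℂ) =ᵐ[volume] c.diffOp h ψ) {u : L2 n} (hu : InH2 h u) :
    ⟪q, u⟫_ℂ = ⟪p, formExpr h (c.formMatrix h) (c.V1 h) u⟫_ℂ := by
  have hψ1 : ContDiff ℝ 1 ψ := hψ.of_le (by simp)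
  have hpH : InH1 h p := fun j => ⟨_, (exists_hasD_of_ae_eq hψ1 hc hp j).choose_spec.1⟩
  have hpj : ∀ j, (jet h (some j) p : Space n → ℂ) =ᵐ[volume] semiD h j ψ := fun j => by
    obtain ⟨g, hg, hg'⟩ := exists_hasD_of_ae_eq (h := h) hψ1 hc hp j
    rwa [hg.jet_eq]
  have hmul : ∀ {m : Space n → ℝ} (_ : C1Bounded m) {w : L2 n} {χ : Space n → ℂ}
      (_ : ContDiff ℝ ∞ χ) (_ : HasCompactSupport χ) (_ : (w : Space n → ℂ) =ᵐ[volume] χ)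
      (i : Fin n), ∃ g : L2 n, HasD h i (mulOp m w) g ∧
        (g : Space n → ℂ) =ᵐ[volume] semiD h i fun y => (m y : ℂ) * χ y := by
    intro m hm w χ hχ hχc hw i
    refine exists_hasD_of_ae_eq ?_ ?_ ?_ i
    · exact (Complex.ofRealCLM.contDiff.comp hm.contDiff).mul (hχ.of_le (by simp))
    · exact hχc.mul_left
    · filter_upwards [coeFn_mulOp hm.isMultiplier w, hw] with x h1 h2
      rw [h1, h2]
  have ha : ∀ i j, C1Bounded (c.a h i j) := fun i j => hN (some j) (some i)
  have hb : ∀ j, C1Bounded (c.b h j) := fun j => hN (some j) none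
  have hV0 : C1Bounded c.V0 := hN none none
  have hS := fun i j => hmul (ha i j) (contDiff_semiD (h := h) hψ j)
    (hasCompactSupport_semiD hc j) (hpj j) i
  have hT := fun j => hmul (hb j) hψ hc hp j
  choose S hS hS' using hS
  choose T hT hT' using hT
  have e : q = ∑ i, ∑ j, S i j + ∑ j, (mulOp (c.b h j) (jet h (some j) p) + T j)
      + (mulOp c.V0 p + (h : ℂ) • mulOp (c.V1 h) p) := by
    refine Lp.ext ?_
    have hS2 : ∀ᵐ x, ∀ i j, (S i j : Space n → ℂ) x
        = semiD h i (fun y => (c.a h i j y : ℂ) * semiD h j ψ y) x :=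
      ae_all_iff.2 fun i => ae_all_iff.2 fun j => hS' i j
    have hS3 : ∀ᵐ x, ∀ i, ((∑ j, S i j : L2 n) : Space n → ℂ) x
        = ∑ j, (S i j : Space n → ℂ) x := ae_all_iff.2 fun i => by
      filter_upwards [Lp.coeFn_finsetSum Finset.univ (S i)] with x hx
      rw [hx, Finset.sum_apply]
    have hT2 : ∀ᵐ x, ∀ j, ((mulOp (c.b h j) (jet h (some j) p) + T j : L2 n) : Space n → ℂ) x
        = (c.b h j x : ℂ) * semiD h j ψ x + semiD h j (fun y => (c.b h j y : ℂ) * ψ y) x := by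
      refine ae_all_iff.2 fun j => ?_
      filter_upwards [hT' j, coeFn_mulOp (hb j).isMultiplier (jet h (some j) p), hpj j,
        Lp.coeFn_add (mulOp (c.b h j) (jet h (some j) p)) (T j)] with x h1 h2 h3 h4
      rw [h4, Pi.add_apply, h2, h3, h1]
    filter_upwards [hq, hS2, hS3, hT2, hp, Lp.coeFn_finsetSum Finset.univ fun i => ∑ j, S i j,
      Lp.coeFn_finsetSum Finset.univ fun j => mulOp (c.b h j) (jet h (some j) p) + T j,
      Lp.coeFn_add (∑ i, ∑ j, S i j + ∑ j, (mulOp (c.b h j) (jet h (some j) p) + T j))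
        (mulOp c.V0 p + (h : ℂ) • mulOp (c.V1 h) p),
      Lp.coeFn_add (∑ i, ∑ j, S i j) (∑ j, (mulOp (c.b h j) (jet h (some j) p) + T j)),
      Lp.coeFn_add (mulOp c.V0 p) ((h : ℂ) • mulOp (c.V1 h) p),
      Lp.coeFn_smul (h : ℂ) (mulOp (c.V1 h) p), coeFn_mulOp hV p,
      coeFn_mulOp hV0.isMultiplier p] with x h1 h2 h3 h4 h5 h6 h7 h8 h9 h10 h11 h12 h13
    rw [h1, h8, Pi.add_apply, h9, Pi.add_apply, h6, h7, h10, Pi.add_apply, h11, Pi.smul_apply,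
      h12, h13, Finset.sum_apply, Finset.sum_apply]
    simp only [h3, h2, h4, h5, Coefficients.diffOp, Coefficients.V, smul_eq_mul]
    push_cast
    ring
  have hS4 : ∀ i j, ⟪S i j, u⟫_ℂ = ⟪jet h (some j) p, mulOp (c.a h i j) (jet h (some i) u)⟫_ℂ := by
    intro i j
    rw [(hS i j).inner_left (hu.1.hasD i), inner_mulOp_left (ha i j).isMultiplier]
  have hT4 : ∀ j, ⟪T j, u⟫_ℂ = ⟪p, mulOp (c.b h j) (jet h (some j) u)⟫_ℂ := by
    intro j
    rw [(hT j).inner_left (hu.1.hasD j), inner_mulOp_left (hb j).isMultiplier]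
  rw [inner_formExpr hN hu hpH, e]
  simp only [inner_add_left, sum_inner, hS4, hT4, Fintype.sum_option, jet_none, inner_smul_left,
    Complex.conj_ofReal, inner_mulOp_left hV, inner_mulOp_left hV0.isMultiplier,
    inner_mulOp_left (hb _).isMultiplier, Coefficients.formMatrix, Finset.sum_add_distrib]
  rw [Finset.sum_comm]
  ring

/-- Elements of `L²` are determined by their inner products with test functions. -/
theorem eq_of_forall_test {f g : L2 n} (H : ∀ ψ : Space n → ℂ, ContDiff ℝ ∞ ψ →
    HasCompactSupport ψ → ∀ p : L2 n, (p : Space n → ℂ) =ᵐ[volume] ψ → ⟪p, f⟫_ℂ = ⟪p, g⟫_ℂ) :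
    f = g := by
  have hloc : ∀ f : L2 n, LocallyIntegrable (f : Space n → ℂ) volume := fun f =>
    (Lp.memLp f).locallyIntegrable (by norm_num)
  refine Lp.ext (ae_eq_of_integral_contDiff_smul_eq (hloc f) (hloc g) fun η hη hηc => ?_)
  have h1 : ContDiff ℝ ∞ fun x => (η x : ℂ) := Complex.ofRealCLM.contDiff.comp hη
  have h2 : HasCompactSupport fun x => (η x : ℂ) := hηc.comp_left (g := Complex.ofReal) rfl
  have h3 : MemLp (fun x => (η x : ℂ)) 2 (volume : Measure (Space n)) :=
    h1.continuous.memLp_of_hasCompactSupport h2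
  have h4 := H _ h1 h2 (h3.toLp _) h3.coeFn_toLp
  rw [L2.inner_def, L2.inner_def] at h4
  have h5 : ∀ f : L2 n, ∫ x, ⟪(h3.toLp (fun x => (η x : ℂ)) : Space n → ℂ) x,
      (f : Space n → ℂ) x⟫_ℂ = ∫ x, η x • (f : Space n → ℂ) x := by
    intro f
    refine integral_congr_ae ?_
    filter_upwards [h3.coeFn_toLp] with x hx
    rw [hx]
    simp [mul_comm]
  rw [← h5, ← h5, h4]

/-- A self-adjoint realization is the operator of the symmetrized form. -/
theorem IsSelfAdjointRealization.inner_apply {c : Coefficients n} {P : L2 n →ₗ.[ℂ] L2 n}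
    (hP : IsSelfAdjointRealization c h P) (hN : ∀ α β, C1Bounded (c.formMatrix h α β))
    (hV : IsMultiplier (c.V1 h)) (hu2 : ∀ u : P.domain, InH2 h (u : L2 n)) {v : L2 n}
    (hv : InH1 h v) (u : P.domain) :
    ⟪v, P u⟫_ℂ = ∑ α, ∑ β, ⟪jet h α v, mulOp (fun x => (1 / 2) * (c.formMatrix h α β x
      + c.formMatrix h β α x)) (jet h β (u : L2 n))⟫_ℂ + h * ⟪v, mulOp (c.V1 h) (u : L2 n)⟫_ℂ := by
  -- P extends the expression on test functions; symmetry of P and density of test functions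
  -- determine P u for every u in the domain.
  have e1 : ∀ u : P.domain, P u = formExpr h (c.formMatrix h) (c.V1 h) (u : L2 n) := by
    intro u
    refine eq_of_forall_test fun ψ hψ hc p hp => ?_
    obtain ⟨w, hw, hw'⟩ := hP.eq_diffOp ψ hψ hc
    have : (w : L2 n) = p := Lp.ext (hw.trans hp.symm)
    rw [← inner_diffOp_eq hN hV hψ hc hp hw' (hu2 u), ← this,
      inner_map_comm hP.isSelfAdjoint w u]
  -- The coefficients are not assumed symmetric in i and j. Symmetry of P and density of its domain
  -- show that the transposed matrix defines the same operator, so the average of the two matrices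
  -- does as well.
  have e2 : P u = formExpr h (fun α β => c.formMatrix h β α) (c.V1 h) (u : L2 n) := by
    refine hP.isSelfAdjoint.dense_domain.eq_of_inner_right ℂ fun w hw => ?_
    rw [inner_formExpr (fun α β => hN β α) (hu2 u) (hu2 ⟨w, hw⟩).1,
      ← conj_form hN hV, ← inner_formExpr hN (hu2 ⟨w, hw⟩) (hu2 u).1, ← e1 ⟨w, hw⟩,
      inner_conj_symm]
    exact (inner_map_comm hP.isSelfAdjoint ⟨w, hw⟩ u).symm
  have h1 := inner_formExpr (V := c.V1 h) hN (hu2 u) hv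
  have h2 := inner_formExpr (V := c.V1 h) (fun α β => hN β α) (hu2 u) hv
  rw [← e1 u] at h1
  rw [← e2] at h2
  have h3 : ∀ α β, ⟪jet h α v, mulOp (fun x => (1 / 2) * (c.formMatrix h α β x
      + c.formMatrix h β α x)) (jet h β (u : L2 n))⟫_ℂ =
      (1 / 2) * (⟪jet h α v, mulOp (c.formMatrix h α β) (jet h β (u : L2 n))⟫_ℂ
        + ⟪jet h α v, mulOp (c.formMatrix h β α) (jet h β (u : L2 n))⟫_ℂ) := by
    intro α β
    rw [mulOp_const_mul _ ((hN α β).isMultiplier.add (hN β α).isMultiplier),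
      mulOp_add (hN α β).isMultiplier (hN β α).isMultiplier, inner_smul_right, inner_add_right]
    push_cast
    ring
  simp only [h3, ← Finset.mul_sum, Finset.sum_add_distrib]
  linear_combination (1 / 2) * h1 + (1 / 2) * h2

end Realization

end SemiclassicalDecay

end

noncomputable section

namespace SemiclassicalDecay

/-! ### Uniform bounds for the coefficients -/

section Coefficients

variable {n : ℕ}

theorem fderiv_half_add_apply {f g : Space n → ℝ} (hf : C1Bounded f) (hg : C1Bounded g)
    (k : Fin n) (x : Space n) :
    fderiv ℝ (fun x => (1 / 2) * (f x + g x)) x (stdVec k)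
      = (1 / 2) * (fderiv ℝ f x (stdVec k) + fderiv ℝ g x (stdVec k)) := by
  rw [fderiv_const_mul ((hf.add hg).differentiable x),
    fderiv_fun_add (hf.differentiable x) (hg.differentiable x)]
  simp
  ring

/-- V⁰ belongs to the matrix, because the commutator differentiates it. V¹ is only bounded and
measurable, so it is kept apart, with the factor h that makes it harmless. -/
theorem exists_hasForm {c : Coefficients n} {P : ℝ → (L2 n →ₗ.[ℂ] L2 n)} {δ : ℝ} (hδ : 0 ≤ δ)
    (hreg : c.Regular) (hP : ∀ h ∈ Set.Ioc (0 : ℝ) 1, IsSelfAdjointRealization c h (P h))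
    (hell : Elliptic P) (hshort : c.ShortRange δ) :
    ∃ C : ℝ, ∀ h ∈ Set.Ioc (0 : ℝ) 1, ∃ M V, HasForm δ C h (P h) M V := by
  obtain ⟨C₁, hC₁0, hC₁⟩ := hell.exists_inH2 fun h hh => (hP h hh).isSelfAdjoint
  obtain ⟨C₂, hC₂⟩ := hshort
  have hC₂0 : 0 ≤ C₂ := by
    have h1 := (hC₂ 1 (by simp)).1 0
    have h2 : (bracket (0 : Space n)) ^ (-δ) = 1 := by simp [bracket]
    rw [h2, mul_one] at h1
    refine le_trans ?_ h1
    positivity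
  -- C₁ comes from ellipticity and C₂ from the short range condition; the summand 1 accounts for the
  -- Kronecker symbol in the principal part.
  refine ⟨C₁ + C₂ + 1, fun h hh => ⟨fun α β x => (1 / 2) * (c.formMatrix h α β x
      + c.formMatrix h β α x), c.V1 h, ?_⟩⟩
  obtain ⟨hs0, hs1, hsV⟩ := hC₂ h hh
  have hle : ∀ x : Space n, C₂ * bracket x ^ (-δ) ≤ C₂ := fun x =>
    mul_le_of_le_one_right hC₂0 (bracket_rpow_neg_le_one hδ x)
  have hbr : ∀ x : Space n, 0 ≤ bracket x ^ (-δ) := fun x =>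
    Real.rpow_nonneg (zero_le_one.trans (one_le_bracket x)) _
  have hle' : ∀ x : Space n, C₂ * bracket x ^ (-δ) ≤ (C₁ + C₂ + 1) * bracket x ^ (-δ) := fun x =>
    mul_le_mul_of_nonneg_right (by linarith) (hbr x)
  have hsum : ∀ (f : Fin n → Fin n → ℝ) (g : Fin n → ℝ) (r B : ℝ),
      ∑ i, ∑ j, |f i j| + ∑ j, |g j| + |r| ≤ B →
      (∀ i j, |f i j| ≤ B) ∧ (∀ j, |g j| ≤ B) ∧ |r| ≤ B := by
    intro f g r B hB
    have h1 : 0 ≤ ∑ i, ∑ j, |f i j| := by positivity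
    have h2 : 0 ≤ ∑ j, |g j| := by positivity
    have h3 := abs_nonneg r
    refine ⟨fun i j => ?_, fun j => ?_, by linarith⟩
    · have h4 : |f i j| ≤ ∑ j, |f i j| :=
        Finset.single_le_sum (f := fun j => |f i j|) (fun j _ => abs_nonneg _) (Finset.mem_univ j)
      have h5 : ∑ j, |f i j| ≤ ∑ i, ∑ j, |f i j| :=
        Finset.single_le_sum (f := fun i => ∑ j, |f i j|) (fun i _ => by positivity)
          (Finset.mem_univ i)
      linarith
    · have h4 : |g j| ≤ ∑ j, |g j| :=
        Finset.single_le_sum (f := fun j => |g j|) (fun j _ => abs_nonneg _) (Finset.mem_univ j)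
      linarith
  have h0 := fun x => hsum _ _ _ _ (hs0 x)
  have h1 := fun k x => hsum _ _ _ _ (hs1 k x)
  have habs : ∀ α β x, |c.formMatrix h α β x| ≤ C₂ + 1 := by
    intro α β x
    match α, β with
    | none, none => exact ((h0 x).2.2.trans (hle x)).trans (by linarith)
    | some j, none => exact (((h0 x).2.1 j).trans (hle x)).trans (by linarith)
    | none, some j => exact (((h0 x).2.1 j).trans (hle x)).trans (by linarith)
    | some j, some i =>
      have h2 := ((h0 x).1 i j).trans (hle x)
      have h3 : |if i = j then (1 : ℝ) else 0| ≤ 1 := by split_ifs <;> simp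
      have h4 := abs_add_le (c.a h i j x - if i = j then 1 else 0) (if i = j then 1 else 0)
      rw [sub_add_cancel] at h4
      change |c.a h i j x| ≤ _
      linarith
  have hderiv : ∀ α β k x, |fderiv ℝ (c.formMatrix h α β) x (stdVec k)|
      ≤ C₂ * bracket x ^ (-δ) := by
    intro α β k x
    match α, β with
    | none, none => exact (h1 k x).2.2
    | some j, none => exact (h1 k x).2.1 j
    | none, some j => exact (h1 k x).2.1 j
    | some j, some i => exact (h1 k x).1 i j
  have hcd : ∀ α β, ContDiff ℝ 1 (c.formMatrix h α β) := by
    intro α β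
    match α, β with
    | none, none => exact hreg.contDiff_V0
    | some j, none => exact hreg.contDiff_b h hh j
    | none, some j => exact hreg.contDiff_b h hh j
    | some j, some i => exact hreg.contDiff_a h hh i j
  have hN : ∀ α β, C1Bounded (c.formMatrix h α β) := fun α β =>
    ⟨hcd α β, ⟨_, habs α β⟩, ⟨C₂, fun k x => (hderiv α β k x).trans (hle x)⟩⟩
  have hV : IsMultiplier (c.V1 h) := ⟨hreg.aestronglyMeasurable_V1 h hh, C₂, by
    filter_upwards [hsV] with x hx
    exact hx.trans (hle x)⟩
  have hhalf : ∀ {a b B : ℝ}, |a| ≤ B → |b| ≤ B → |(1 / 2) * (a + b)| ≤ B := by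
    intro a b B ha hb
    rw [abs_mul, abs_of_pos (by norm_num : (0 : ℝ) < 1 / 2)]
    linarith [abs_add_le a b]
  have hnorm : ∀ {a : ℝ} {u : (P h).domain}, a ≤ C₁ * (‖P h u‖ + ‖(u : L2 n)‖) →
      a ≤ (C₁ + C₂ + 1) * (‖P h u‖ + ‖(u : L2 n)‖) := fun ha =>
    ha.trans (mul_le_mul_of_nonneg_right (by linarith) (by positivity))
  exact
    { isSelfAdjoint := (hP h hh).isSelfAdjoint
      nonneg := by linarith
      h_pos := hh.1
      h_le_one := hh.2
      symm := fun α β => by funext x; rw [add_comm]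
      c1Bounded := fun α β => (C1Bounded.const (1 / 2)).mul ((hN α β).add (hN β α))
      aestronglyMeasurable := hV.1
      abs_le := fun α β x => (hhalf (habs α β x) (habs β α x)).trans (by linarith)
      abs_fderiv_le := fun α β k x => by
        rw [fderiv_half_add_apply (hN α β) (hN β α)]
        exact (hhalf (hderiv α β k x) (hderiv β α k x)).trans (hle' x)
      abs_le_short := fun α x => by
        refine le_trans ?_ (hle' x)
        cases α with
        | none => exact hhalf (h0 x).2.2 (h0 x).2.2
        | some j => exact hhalf ((h0 x).2.1 j) ((h0 x).2.1 j)
      abs_V_le := by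
        filter_upwards [hsV] with x hx
        exact hx.trans (hle' x)
      inH2 := fun u => (hC₁ h hh u).1
      inner_apply := fun v hv u =>
        (hP h hh).inner_apply hN hV (fun u => (hC₁ h hh u).1) hv u
      norm_jet_le := fun u α => hnorm ((hC₁ h hh u).2.1 α)
      norm_jet_jet_le := fun u i j => hnorm ((hC₁ h hh u).2.2 i j) }

end Coefficients

end SemiclassicalDecay

end

noncomputable section

namespace SemiclassicalDecay

/-! ### Weighted estimates for derivatives -/

section Weighted

open scoped InnerProductSpace ComplexConjugate

variable {n : ℕ}

/-- Positive bounded weights with a bounded logarithmic gradient `ℓ` that itself has bounded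
derivatives. -/
structure LogWeight (C : ℝ) (m : Space n → ℝ) (ℓ : Option (Fin n) → Space n → ℝ) : Prop where
  pos : ∀ x, 0 < m x
  c1Bounded : C1Bounded m
  log_none : ∀ x, ℓ none x = 0
  fderiv_eq : ∀ j x, fderiv ℝ m x (stdVec j) = m x * ℓ (some j) x
  log_c1Bounded : ∀ α, C1Bounded (ℓ α)
  abs_log_le : ∀ α x, |ℓ α x| ≤ C
  abs_fderiv_log_le : ∀ α k x, |fderiv ℝ (ℓ α) x (stdVec k)| ≤ C

theorem mulOp_comm {m m' : Space n → ℝ} (hm : IsMultiplier m) (hm' : IsMultiplier m') (f : L2 n) :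
    mulOp m (mulOp m' f) = mulOp m' (mulOp m f) := by
  rw [mulOp_mulOp hm hm', mulOp_mulOp hm' hm]
  simp only [mul_comm]

theorem inner_mulOp_mulOp {m M : Space n → ℝ} (hm : IsMultiplier m) (hM : IsMultiplier M)
    (f g : L2 n) : ⟪f, mulOp M (mulOp m g)⟫_ℂ = ⟪mulOp m f, mulOp M g⟫_ℂ := by
  rw [inner_mulOp_left hm, mulOp_comm hm hM]

variable {C₀ h : ℝ} {m : Space n → ℝ} {ℓ : Option (Fin n) → Space n → ℝ}

theorem LogWeight.jet_mulOp (hm : LogWeight C₀ m ℓ) {f : L2 n} (hf : InH1 h f) :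
    ∀ α, jet h α (mulOp m f)
      = mulOp m (jet h α f) + (-(Complex.I * h)) • mulOp (ℓ α) (mulOp m f)
  | none => by
    have : ℓ none = fun _ => 0 := funext hm.log_none
    simp [this, mulOp_const]
  | some j => by
    have : (fun x => fderiv ℝ m x (stdVec j)) = fun x => ℓ (some j) x * m x := by
      funext x
      rw [hm.fderiv_eq, mul_comm]
    rw [SemiclassicalDecay.jet_mulOp hm.c1Bounded hf, this,
      mulOp_mulOp (hm.log_c1Bounded _).isMultiplier hm.c1Bounded.isMultiplier]

variable {δ C : ℝ} {P : L2 n →ₗ.[ℂ] L2 n}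
  {M : Option (Fin n) → Option (Fin n) → Space n → ℝ} {V : Space n → ℝ}

theorem HasForm.isMultiplier_V (hF : HasForm δ C h P M V) (hδ : 0 ≤ δ) : IsMultiplier V :=
  ⟨hF.aestronglyMeasurable, C, by
    filter_upwards [hF.abs_V_le] with x hx
    exact hx.trans (mul_le_of_le_one_right hF.nonneg (bracket_rpow_neg_le_one hδ x))⟩

theorem norm_neg_I_mul (hh : 0 ≤ h) : ‖-(Complex.I * (h : ℂ))‖ = h := by
  rw [norm_neg, norm_mul, Complex.norm_I, one_mul, Complex.norm_real, Real.norm_of_nonneg hh]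

/-- Multiplication by a weight preserves the domain. -/
theorem HasForm.exists_mulOp_mem (hF : HasForm δ C h P M V) (hδ : 0 ≤ δ)
    (hm : LogWeight C₀ m ℓ) (u : P.domain) :
    ∃ w : P.domain, (w : L2 n) = mulOp m (u : L2 n) ∧ P w = mulOp m (P u)
      - (Complex.I * h) • ∑ α, ∑ β, mulOp (fun x => ℓ α x * M α β x)
          (mulOp m (jet h β (u : L2 n)))
      + (-(Complex.I * h)) • ∑ α, ∑ β, jet h α (mulOp (fun x => M α β x * ℓ β x)
          (mulOp m (u : L2 n))) := by
  have hu := hF.inH2 u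
  have hmu : InH1 h (mulOp m (u : L2 n)) := hu.1.mulOp hm.c1Bounded
  have hmm := hm.c1Bounded.isMultiplier
  have hVm := hF.isMultiplier_V hδ
  refine mem_domain_of_forall_inner hF.isSelfAdjoint fun v => ?_
  have hv := (hF.inH2 v).1
  have h1 := hF.inner_apply _ hmu v
  have h2 := congrArg conj h1
  rw [conj_form hF.c1Bounded hVm, inner_conj_symm] at h2
  have h3 := hF.inner_apply _ (hv.mulOp hm.c1Bounded) u
  rw [← inner_conj_symm, ← inner_conj_symm (mulOp m (u : L2 n))]
  congr 1
  rw [h2]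
  -- Moving m through the form leaves one term with the logarithmic gradient on the side of v and
  -- one on the side of u. In the latter the derivative is taken off v, which is possible because M
  -- ℓ is C¹ and m u has one derivative.
  have e1 : ∀ α β, ⟪jet h α (v : L2 n), mulOp (M β α) (jet h β (mulOp m (u : L2 n)))⟫_ℂ
      = ⟪jet h α (mulOp m (v : L2 n)), mulOp (M α β) (jet h β (u : L2 n))⟫_ℂ
        - (Complex.I * h) * ⟪(v : L2 n), mulOp (fun x => ℓ α x * M α β x)
          (mulOp m (jet h β (u : L2 n)))⟫_ℂ
        + (-(Complex.I * h)) * ⟪(v : L2 n), jet h α (mulOp (fun x => M α β x * ℓ β x)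
          (mulOp m (u : L2 n)))⟫_ℂ := by
    intro α β
    have hMm := (hF.c1Bounded α β).isMultiplier
    have hℓ := (hm.log_c1Bounded α).isMultiplier
    rw [hF.symm β α, hm.jet_mulOp hu.1, hm.jet_mulOp hv, map_add, map_smul, inner_add_right,
      inner_smul_right, mulOp_mulOp hMm (hm.log_c1Bounded β).isMultiplier,
      ← inner_jet_left hv (hmu.mulOp ((hF.c1Bounded α β).mul (hm.log_c1Bounded β))),
      inner_mulOp_mulOp hmm hMm, inner_add_left, inner_smul_left]
    have e2 : ⟪mulOp (ℓ α) (mulOp m (v : L2 n)), mulOp (M α β) (jet h β (u : L2 n))⟫_ℂ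
        = ⟪(v : L2 n), mulOp (fun x => ℓ α x * M α β x) (mulOp m (jet h β (u : L2 n)))⟫_ℂ := by
      rw [inner_mulOp_left hℓ, inner_mulOp_left hmm, mulOp_mulOp hℓ hMm,
        mulOp_comm hmm (hℓ.mul hMm)]
    rw [e2]
    simp only [map_neg, map_mul, Complex.conj_I, Complex.conj_ofReal]
    ring
  have e3 : ⟪(v : L2 n), mulOp V (mulOp m (u : L2 n))⟫_ℂ
      = ⟪mulOp m (v : L2 n), mulOp V (u : L2 n)⟫_ℂ := inner_mulOp_mulOp hmm hVm _ _
  rw [e3]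
  simp only [e1, Finset.sum_add_distrib, Finset.sum_sub_distrib, ← Finset.mul_sum]
  rw [inner_add_right, inner_sub_right, inner_smul_right, inner_smul_right, ← inner_mulOp_left hmm,
    h3, inner_sum, inner_sum]
  simp only [inner_sum]
  ring

/-- Absorption of X into the left side of a quadratic inequality. -/
theorem le_of_sq_le_mul_add {K A X : ℝ} (hK : 0 ≤ K) (hA : 0 ≤ A) (hX : 0 ≤ X)
    (H : X ^ 2 ≤ K * A * (A + X)) : X ≤ (2 * K + 1) * A := by
  by_contra! hc
  have h1 : A ≤ X := by nlinarith
  have h2 : K * A * (A + X) ≤ 2 * K * A * X := by nlinarith [mul_nonneg hK hA]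
  have h3 : (2 * K + 1) * A * X < X ^ 2 := by
    have : 0 < X := by nlinarith
    nlinarith
  nlinarith [mul_nonneg hA hX]

/-- Weighted elliptic estimate: weighted derivatives are controlled by the weighted operator,
with a constant that depends only on the constants of the form and of the weight. -/
theorem exists_norm_mulOp_jet_le (n : ℕ) {C C₀ : ℝ} (hC : 0 ≤ C) (hC₀ : 0 ≤ C₀) :
    ∃ K : ℝ, 0 ≤ K ∧ ∀ (δ h : ℝ) (P : L2 n →ₗ.[ℂ] L2 n)
      (M : Option (Fin n) → Option (Fin n) → Space n → ℝ) (V m : Space n → ℝ)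
      (ℓ : Option (Fin n) → Space n → ℝ), 0 ≤ δ → HasForm δ C h P M V → LogWeight C₀ m ℓ →
      ∀ (u : P.domain) α, ‖mulOp m (jet h α (u : L2 n))‖
        ≤ K * (‖mulOp m (P u)‖ + ‖mulOp m (u : L2 n)‖) := by
  set N : ℝ := (Fintype.card (Option (Fin n)) : ℝ) with hN
  have hN0 : 0 ≤ N := by positivity
  set K₁ : ℝ := N ^ 2 * (C₀ * C * (1 + C₀)) + N ^ 2 * (3 * C * C₀) with hK₁
  have hK₁0 : 0 ≤ K₁ := by positivity
  set K₂ : ℝ := C * (2 + K₁) with hK₂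
  have hK₂0 : 0 ≤ K₂ := by positivity
  refine ⟨(2 * (N ^ 2 * K₂) + 1) + 1 + C₀, by positivity, ?_⟩
  intro δ h P M V m ℓ hδ hF hm u α
  obtain ⟨w, hw, hPw⟩ := hF.exists_mulOp_mem hδ hm u
  have hu := hF.inH2 u
  have hw1 : InH1 h (w : L2 n) := (hF.inH2 w).1
  have hmm := hm.c1Bounded.isMultiplier
  have hh0 := hF.h_pos.le
  have hh1 := hF.h_le_one
  have hbr : ∀ x : Space n, bracket x ^ (-δ) ≤ 1 := bracket_rpow_neg_le_one hδ
  -- P applied to w = m u differs from m P u only by first derivatives of w, which X measures.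
  set X : ℝ := ∑ j : Fin n, ‖jet h (some j) (w : L2 n)‖ with hX
  have hX0 : 0 ≤ X := by positivity
  have hXj : ∀ j, ‖jet h (some j) (w : L2 n)‖ ≤ X := fun j =>
    Finset.single_le_sum (f := fun j => ‖jet h (some j) (w : L2 n)‖) (fun i _ => norm_nonneg _)
      (Finset.mem_univ j)
  have hwβ : ∀ β, ‖jet h β (w : L2 n)‖ ≤ ‖(w : L2 n)‖ + X := by
    intro β
    cases β with
    | none => simpa using hX0
    | some j => exact (hXj j).trans (by simp)
  have hmu : ∀ β, ‖mulOp m (jet h β (u : L2 n))‖ ≤ ‖(w : L2 n)‖ + X + C₀ * ‖(w : L2 n)‖ := by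
    intro β
    have h1 : mulOp m (jet h β (u : L2 n)) = jet h β (w : L2 n)
        - (-(Complex.I * h)) • mulOp (ℓ β) (w : L2 n) := by
      rw [hw, hm.jet_mulOp hu.1, add_sub_cancel_right]
    rw [h1]
    refine (norm_sub_le _ _).trans (add_le_add (hwβ β) ?_)
    rw [norm_smul, norm_neg_I_mul hh0]
    have h2 := norm_mulOp_le (hm.log_c1Bounded β).isMultiplier
      (ae_of_all _ (hm.abs_log_le β)) (w : L2 n)
    calc h * ‖mulOp (ℓ β) (w : L2 n)‖ ≤ 1 * ‖mulOp (ℓ β) (w : L2 n)‖ := by gcongr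
      _ ≤ _ := by rw [one_mul]; exact h2
  have ht1 : ∀ α β, ‖mulOp (fun x => ℓ α x * M α β x) (mulOp m (jet h β (u : L2 n)))‖
      ≤ C₀ * C * (1 + C₀) * (‖(w : L2 n)‖ + X) := by
    intro α β
    refine (norm_mulOp_le (C := C₀ * C) ((hm.log_c1Bounded α).mul (hF.c1Bounded α β)).isMultiplier
      (ae_of_all _ fun x => ?_) _).trans ?_
    · rw [abs_mul]
      exact mul_le_mul (hm.abs_log_le α x) (hF.abs_le α β x) (abs_nonneg _) hC₀
    · rw [mul_assoc (C₀ * C)]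
      refine mul_le_mul_of_nonneg_left ((hmu β).trans ?_) (by positivity)
      nlinarith
  have ht2 : ∀ α β, ‖jet h α (mulOp (fun x => M α β x * ℓ β x) (w : L2 n))‖
      ≤ 3 * C * C₀ * (‖(w : L2 n)‖ + X) := by
    intro α β
    have hNc := (hF.c1Bounded α β).mul (hm.log_c1Bounded β)
    have hNb : ∀ f : L2 n, ‖mulOp (fun x => M α β x * ℓ β x) f‖ ≤ C * C₀ * ‖f‖ := by
      intro f
      refine norm_mulOp_le hNc.isMultiplier (ae_of_all _ fun x => ?_) f
      rw [abs_mul]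
      exact mul_le_mul (hF.abs_le α β x) (hm.abs_log_le β x) (abs_nonneg _) hC
    have hCC : 0 ≤ C * C₀ := by positivity
    have hwn := norm_nonneg (w : L2 n)
    cases α with
    | none =>
      refine (hNb _).trans ?_
      nlinarith [mul_nonneg hCC hX0, mul_nonneg hCC hwn]
    | some i =>
      rw [jet_mulOp hNc hw1]
      have h3 : ‖mulOp (fun x => fderiv ℝ (fun x => M (some i) β x * ℓ β x) x (stdVec i))
          (w : L2 n)‖ ≤ (C * C₀ + C * C₀) * ‖(w : L2 n)‖ := by
        refine norm_mulOp_le (hNc.isMultiplier_fderiv i) (ae_of_all _ fun x => ?_) _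
        rw [(hF.c1Bounded _ β).fderiv_mul_apply (hm.log_c1Bounded β)]
        refine (abs_add_le _ _).trans (add_le_add ?_ ?_)
        · rw [abs_mul]
          exact mul_le_mul (hF.abs_le _ β x) (hm.abs_fderiv_log_le β i x) (abs_nonneg _) hC
        · rw [abs_mul]
          refine mul_le_mul ?_ (hm.abs_log_le β x) (abs_nonneg _) hC
          exact (hF.abs_fderiv_le _ β i x).trans (mul_le_of_le_one_right hC (hbr x))
      refine (norm_add_le _ _).trans ?_
      rw [norm_smul, norm_neg_I_mul hh0]
      have h4 := hNb (jet h (some i) (w : L2 n))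
      have h5 := mul_le_mul_of_nonneg_left (hXj i) hCC
      have h6 := mul_le_mul_of_nonneg_right hh1 (norm_nonneg (mulOp (fun x => fderiv ℝ
        (fun x => M (some i) β x * ℓ β x) x (stdVec i)) (w : L2 n)))
      nlinarith [mul_nonneg hCC hX0, mul_nonneg hCC hwn]
  have hsum : ∀ (F : Option (Fin n) → Option (Fin n) → L2 n) (B : ℝ),
      (∀ α β, ‖F α β‖ ≤ B) → ‖∑ α, ∑ β, F α β‖ ≤ N ^ 2 * B := by
    intro F B hB
    calc ‖∑ α, ∑ β, F α β‖ ≤ ∑ _α : Option (Fin n), ∑ _β : Option (Fin n), B :=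
          norm_sum_le_of_le _ fun α _ => norm_sum_le_of_le _ fun β _ => hB α β
      _ = N ^ 2 * B := by
          simp only [Finset.sum_const, Finset.card_univ, nsmul_eq_mul, hN]
          ring
  have hsm : ∀ (a : ℂ) (f : L2 n) (B : ℝ), ‖a‖ ≤ 1 → ‖f‖ ≤ B → ‖a • f‖ ≤ B := by
    intro a f B ha hf
    rw [norm_smul]
    nlinarith [norm_nonneg f, norm_nonneg a]
  have hPwn : ‖P w‖ ≤ ‖mulOp m (P u)‖ + K₁ * (‖(w : L2 n)‖ + X) := by
    rw [hPw, ← hw]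
    have h1 := hsm (Complex.I * h) _ _ (by
      rw [← norm_neg, norm_neg_I_mul hh0]; exact hh1) (hsum _ _ ht1)
    have h2 := hsm (-(Complex.I * h)) _ _ (by
      rw [norm_neg_I_mul hh0]; exact hh1) (hsum _ _ ht2)
    refine (norm_add_le _ _).trans ?_
    have h3 := norm_sub_le (mulOp m (P u)) ((Complex.I * h) • ∑ α, ∑ β,
      mulOp (fun x => ℓ α x * M α β x) (mulOp m (jet h β (u : L2 n))))
    rw [hK₁]
    linarith
  set A : ℝ := ‖mulOp m (P u)‖ + ‖(w : L2 n)‖ with hA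
  have hA0 : 0 ≤ A := by positivity
  have hwA : ‖(w : L2 n)‖ ≤ A := by simp [hA]
  -- Interpolation ‖D w‖² ≤ ‖w‖ ‖D² w‖, followed by ellipticity for the second derivative. The right
  -- side is only linear in X, so X can be absorbed.
  have hjj : ∀ j, ‖jet h (some j) (w : L2 n)‖ ^ 2 ≤ K₂ * A * (A + X) := by
    intro j
    have h1 := norm_jet_sq_le (hF.inH2 w) j
    have h2 := hF.norm_jet_jet_le w j j
    have h3 : ‖P w‖ + ‖(w : L2 n)‖ ≤ (2 + K₁) * (A + X) := by
      have : ‖mulOp m (P u)‖ ≤ A := by simp [hA]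
      nlinarith [mul_le_mul_of_nonneg_left hwA hK₁0]
    calc ‖jet h (some j) (w : L2 n)‖ ^ 2
        ≤ ‖(w : L2 n)‖ * ‖jet h (some j) (jet h (some j) (w : L2 n))‖ := h1
      _ ≤ A * (C * ((2 + K₁) * (A + X))) := by
        refine mul_le_mul hwA (h2.trans (mul_le_mul_of_nonneg_left h3 hC)) (norm_nonneg _) hA0
      _ = _ := by rw [hK₂]; ring
  have hXX : X ^ 2 ≤ N ^ 2 * K₂ * A * (A + X) := by
    have h1 : X ^ 2 ≤ (n : ℝ) * ∑ j : Fin n, ‖jet h (some j) (w : L2 n)‖ ^ 2 := by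
      have := sq_sum_le_card_mul_sum_sq (s := (Finset.univ : Finset (Fin n)))
        (f := fun j => ‖jet h (some j) (w : L2 n)‖)
      simpa using this
    have h2 : ∑ j : Fin n, ‖jet h (some j) (w : L2 n)‖ ^ 2 ≤ (n : ℝ) * (K₂ * A * (A + X)) := by
      refine (Finset.sum_le_sum fun j _ => hjj j).trans ?_
      simp
    have hnN : (n : ℝ) ≤ N := by
      rw [hN]; simp
    have hn0 : (0 : ℝ) ≤ n := by positivity
    have h3 : 0 ≤ K₂ * A * (A + X) := by positivity
    calc X ^ 2 ≤ (n : ℝ) * ((n : ℝ) * (K₂ * A * (A + X))) :=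
          h1.trans (mul_le_mul_of_nonneg_left h2 hn0)
      _ ≤ N * (N * (K₂ * A * (A + X))) := by gcongr
      _ = _ := by ring
  have hXA := le_of_sq_le_mul_add (by positivity) hA0 hX0 hXX
  refine (hmu α).trans ?_
  rw [← hw]
  have : C₀ * ‖(w : L2 n)‖ ≤ C₀ * A := mul_le_mul_of_nonneg_left hwA hC₀
  change _ ≤ _ * A
  nlinarith

end Weighted

end SemiclassicalDecay

end

noncomputable section

namespace SemiclassicalDecay

/-! ### Growth estimate and explicit weights -/

section Growth

open scoped InnerProductSpace ComplexConjugate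

variable {n : ℕ} {δ C C₀ h : ℝ} {P : L2 n →ₗ.[ℂ] L2 n}
  {M : Option (Fin n) → Option (Fin n) → Space n → ℝ} {V m : Space n → ℝ}
  {ℓ : Option (Fin n) → Space n → ℝ}

/-- Weights that grow at most like `⟨x⟩^{1/2}` lose a factor `h / |Im z|` only. -/
theorem HasForm.abs_im_mul_norm_mulOp_sq_le (hF : HasForm δ C h P M V) (hδ : 0 ≤ δ)
    (hm : LogWeight C₀ m ℓ) {C₁ Y : ℝ} (hC₁ : ∀ α x, |m x * m x * ℓ α x| ≤ C₁) (hC₁0 : 0 ≤ C₁)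
    {u : P.domain} {z : ℂ} {f : L2 n} (hu : P u = z • (u : L2 n) + f)
    (hY : ∀ β, ‖jet h β (u : L2 n)‖ ≤ Y) :
    |z.im| * ‖mulOp m (u : L2 n)‖ ^ 2 ≤ ‖mulOp m (u : L2 n)‖ * ‖mulOp m f‖
      + (Fintype.card (Option (Fin n)) : ℝ) ^ 2 * (2 * C₁ * C) * h * (‖(u : L2 n)‖ * Y) := by
  have hu1 := (hF.inH2 u).1
  have hmu : InH1 h (mulOp m (u : L2 n)) := hu1.mulOp hm.c1Bounded
  have hmm := hm.c1Bounded.isMultiplier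
  have hVm := hF.isMultiplier_V hδ
  have hC := hF.nonneg
  have hh0 := hF.h_pos.le
  -- The equation is tested with m² u and imaginary parts are taken. The weighted form is real; what
  -- remains is the derivative of m², which is 2h m² ℓ and hence bounded even though m itself may be
  -- large.
  have h1 := hF.inner_apply _ (hmu.mulOp hm.c1Bounded) u
  set S₁ : ℂ := ∑ α, ∑ β, ⟪mulOp m (jet h α (u : L2 n)),
    mulOp (M α β) (mulOp m (jet h β (u : L2 n)))⟫_ℂ with hS₁
  set S₂ : ℂ := ∑ α, ∑ β, ⟪mulOp (fun x => m x * m x * ℓ α x) (u : L2 n),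
    mulOp (M α β) (jet h β (u : L2 n))⟫_ℂ with hS₂
  have e1 : ∀ α β, ⟪jet h α (mulOp m (mulOp m (u : L2 n))),
      mulOp (M α β) (jet h β (u : L2 n))⟫_ℂ
      = ⟪mulOp m (jet h α (u : L2 n)), mulOp (M α β) (mulOp m (jet h β (u : L2 n)))⟫_ℂ
        + (2 * (Complex.I * h)) * ⟪mulOp (fun x => m x * m x * ℓ α x) (u : L2 n),
          mulOp (M α β) (jet h β (u : L2 n))⟫_ℂ := by
    intro α β
    have hMm := (hF.c1Bounded α β).isMultiplier
    have hℓ := (hm.log_c1Bounded α).isMultiplier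
    have e2 : mulOp (ℓ α) (mulOp m (mulOp m (u : L2 n)))
        = mulOp (fun x => m x * m x * ℓ α x) (u : L2 n) := by
      rw [mulOp_mulOp hmm hmm, mulOp_mulOp hℓ (hmm.mul hmm)]
      simp only [mul_comm]
    have e3 : mulOp m (mulOp (ℓ α) (mulOp m (u : L2 n)))
        = mulOp (fun x => m x * m x * ℓ α x) (u : L2 n) := by
      rw [← e2, mulOp_comm hmm hℓ]
    rw [hm.jet_mulOp hmu, hm.jet_mulOp hu1, map_add, map_smul, e2, e3, inner_add_left,
      inner_add_left, inner_smul_left, inner_mulOp_mulOp hmm hMm]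
    simp only [map_neg, map_mul, Complex.conj_I, Complex.conj_ofReal]
    ring
  have e4 : ⟪mulOp m (mulOp m (u : L2 n)), mulOp V (u : L2 n)⟫_ℂ
      = ⟪mulOp m (u : L2 n), mulOp V (mulOp m (u : L2 n))⟫_ℂ :=
    (inner_mulOp_mulOp hmm hVm _ _).symm
  simp only [e1, e4, Finset.sum_add_distrib, ← Finset.mul_sum] at h1
  rw [← hS₁, ← hS₂, hu, inner_add_right, inner_smul_right,
    inner_mulOp_left hmm (mulOp m (u : L2 n)) (u : L2 n),
    inner_mulOp_left hmm (mulOp m (u : L2 n)) f] at h1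
  have hS₁im : S₁.im = 0 := by
    rw [← Complex.conj_eq_iff_im, hS₁]
    simp only [map_sum, inner_conj_symm, inner_mulOp_left (hF.c1Bounded _ _).isMultiplier]
    rw [Finset.sum_comm]
    simp only [hF.symm]
  have hVim : (⟪mulOp m (u : L2 n), mulOp V (mulOp m (u : L2 n))⟫_ℂ).im = 0 := by
    rw [← Complex.conj_eq_iff_im, inner_conj_symm, inner_mulOp_left hVm]
  have hself : ⟪mulOp m (u : L2 n), mulOp m (u : L2 n)⟫_ℂ = ((‖mulOp m (u : L2 n)‖ ^ 2 : ℝ) : ℂ) := by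
    rw [inner_self_eq_norm_sq_to_K]
    norm_cast
  have hS₂n : ‖S₂‖ ≤ (Fintype.card (Option (Fin n)) : ℝ) ^ 2 * (C₁ * C * (‖(u : L2 n)‖ * Y)) := by
    calc ‖S₂‖ ≤ ∑ _α : Option (Fin n), ∑ _β : Option (Fin n), C₁ * C * (‖(u : L2 n)‖ * Y) := by
          refine norm_sum_le_of_le _ fun α _ => norm_sum_le_of_le _ fun β _ => ?_
          refine (norm_inner_le_norm _ _).trans ?_
          have h2 := norm_mulOp_le ((hmm.mul hmm).mul (hm.log_c1Bounded α).isMultiplier)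
            (ae_of_all _ (hC₁ α)) (u : L2 n)
          have h3 := norm_mulOp_le (hF.c1Bounded α β).isMultiplier
            (ae_of_all _ (hF.abs_le α β)) (jet h β (u : L2 n))
          calc _ ≤ (C₁ * ‖(u : L2 n)‖) * (C * ‖jet h β (u : L2 n)‖) := by gcongr
            _ ≤ (C₁ * ‖(u : L2 n)‖) * (C * Y) := by gcongr; exact hY β
            _ = _ := by ring
      _ = _ := by
          simp only [Finset.sum_const, Finset.card_univ, nsmul_eq_mul]
          ring
  obtain ⟨S₃, hS₃⟩ : ∃ S, S = 2 * (Complex.I * h) * S₂ := ⟨_, rfl⟩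
  rw [hself, ← hS₃] at h1
  have h2 := congrArg Complex.im h1
  simp only [Complex.add_im, Complex.mul_im, Complex.ofReal_re, Complex.ofReal_im, hS₁im, hVim,
    mul_zero, zero_mul, add_zero, zero_add] at h2
  have h3 : |z.im| * ‖mulOp m (u : L2 n)‖ ^ 2
      ≤ ‖⟪mulOp m (u : L2 n), mulOp m f⟫_ℂ‖ + 2 * h * ‖S₂‖ := by
    have e5 : z.im * ‖mulOp m (u : L2 n)‖ ^ 2
        = S₃.im - (⟪mulOp m (u : L2 n), mulOp m f⟫_ℂ).im := by
      linarith
    rw [← abs_of_nonneg (sq_nonneg ‖mulOp m (u : L2 n)‖), ← abs_mul, e5]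
    refine (abs_sub _ _).trans ?_
    have h4 := Complex.abs_im_le_norm S₃
    have h5 : ‖S₃‖ = 2 * h * ‖S₂‖ := by
      rw [hS₃, norm_mul, norm_mul, norm_mul, Complex.norm_I, Complex.norm_real,
        Real.norm_of_nonneg hh0]
      norm_num
    have h6 := Complex.abs_im_le_norm ⟪mulOp m (u : L2 n), mulOp m f⟫_ℂ
    linarith
  refine h3.trans (add_le_add (norm_inner_le_norm _ _) ?_)
  calc 2 * h * ‖S₂‖ ≤ 2 * h *
        ((Fintype.card (Option (Fin n)) : ℝ) ^ 2 * (C₁ * C * (‖(u : L2 n)‖ * Y))) := by gcongr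
    _ = _ := by ring

end Growth

/-! ### Derivatives of ⟨x⟩^{-2} and of the logarithmic gradient of ⟨x⟩ -/

section ExplicitWeights

variable {n : ℕ}

theorem bracket_pos {E : Type*} [NormedAddCommGroup E] (x : E) : 0 < bracket x :=
  zero_lt_one.trans_le (one_le_bracket x)

theorem bracket_sq {E : Type*} [NormedAddCommGroup E] (x : E) : bracket x ^ 2 = 1 + ‖x‖ ^ 2 :=
  Real.sq_sqrt (by positivity)

theorem norm_le_bracket {E : Type*} [NormedAddCommGroup E] (x : E) : ‖x‖ ≤ bracket x := by
  have := bracket_sq x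
  nlinarith [bracket_pos x, norm_nonneg x]

/-- The function `⟨x⟩^{-2}`. -/
def invSq (x : Space n) : ℝ := (1 + ‖x‖ ^ 2)⁻¹

/-- The logarithmic derivatives `x_j / ⟨x⟩²` of `⟨x⟩`. -/
def logGrad (j : Fin n) (x : Space n) : ℝ := x j * invSq x

theorem invSq_pos (x : Space n) : 0 < invSq x := by
  unfold invSq
  positivity

theorem invSq_le_one (x : Space n) : invSq x ≤ 1 := by
  unfold invSq
  exact inv_le_one_of_one_le₀ (by nlinarith [sq_nonneg ‖x‖])

theorem abs_coord_le (x : Space n) (j : Fin n) : |x j| ≤ ‖x‖ := by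
  simpa using PiLp.norm_apply_le x j

theorem norm_sq_mul_invSq (x : Space n) : ‖x‖ ^ 2 * invSq x = 1 - invSq x := by
  unfold invSq
  field_simp
  ring

theorem abs_logGrad_le (j : Fin n) (x : Space n) : |logGrad j x| ≤ 1 := by
  unfold logGrad
  rw [abs_mul, abs_of_pos (invSq_pos x)]
  have h1 := mul_le_mul_of_nonneg_right (abs_coord_le x j) (invSq_pos x).le
  have h2 := norm_sq_mul_invSq x
  nlinarith [sq_nonneg (‖x‖ - 1), invSq_pos x]

theorem abs_logGrad_mul_logGrad_le (i j : Fin n) (x : Space n) :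
    |logGrad i x * logGrad j x| ≤ 1 - invSq x := by
  unfold logGrad
  rw [abs_mul, abs_mul, abs_mul, abs_of_pos (invSq_pos x), ← norm_sq_mul_invSq]
  have h1 := mul_le_mul (abs_coord_le x i) (abs_coord_le x j) (abs_nonneg _) (norm_nonneg _)
  have h2 : 0 ≤ |x i| * |x j| := by positivity
  have h3 := invSq_pos x
  have h4 := invSq_le_one x
  calc |x i| * invSq x * (|x j| * invSq x) = (|x i| * |x j|) * invSq x * invSq x := by ring
    _ ≤ (‖x‖ * ‖x‖) * invSq x * 1 := by gcongr
    _ = _ := by ring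

theorem hasFDerivAt_one_add_norm_sq (x : Space n) :
    HasFDerivAt (fun x : Space n => 1 + ‖x‖ ^ 2) (2 • innerSL ℝ x) x :=
  ((hasStrictFDerivAt_norm_sq x).hasFDerivAt).const_add 1

theorem hasFDerivAt_invSq (x : Space n) :
    HasFDerivAt (invSq (n := n)) (-((1 + ‖x‖ ^ 2) ^ 2)⁻¹ • (2 • innerSL ℝ x)) x :=
  (hasDerivAt_inv (by positivity)).comp_hasFDerivAt x (hasFDerivAt_one_add_norm_sq x)

theorem inner_stdVec (x : Space n) (k : Fin n) : inner ℝ x (stdVec k) = x k := by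
  simp [EuclideanSpace.inner_single_right]

theorem fderiv_invSq (k : Fin n) (x : Space n) :
    fderiv ℝ (invSq (n := n)) x (stdVec k) = -2 * (logGrad k x * invSq x) := by
  rw [(hasFDerivAt_invSq x).fderiv]
  simp only [logGrad, invSq, smul_apply, innerSL_apply_apply, inner_stdVec, smul_eq_mul, nsmul_eq_mul]
  push_cast
  field_simp

theorem fderiv_logGrad (j k : Fin n) (x : Space n) :
    fderiv ℝ (logGrad j) x (stdVec k)
      = (if j = k then 1 else 0) * invSq x - 2 * (logGrad j x * logGrad k x) := by
  have hd : DifferentiableAt ℝ (invSq (n := n)) x :=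
    (hasFDerivAt_invSq x).differentiableAt
  have h1 : HasFDerivAt (fun x : Space n => x j) (EuclideanSpace.proj j : Space n →L[ℝ] ℝ) x :=
    (EuclideanSpace.proj j : Space n →L[ℝ] ℝ).hasFDerivAt
  have h2 : fderiv ℝ (logGrad j) x = _ := (h1.mul hd.hasFDerivAt).fderiv
  have h3 : (EuclideanSpace.proj j : Space n →L[ℝ] ℝ) (stdVec k) = if j = k then 1 else 0 := by
    simp
  rw [h2]
  simp only [add_apply, smul_apply, fderiv_invSq, smul_eq_mul, h3]
  unfold logGrad
  ring

theorem contDiff_invSq : ContDiff ℝ 1 (invSq (n := n)) := by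
  unfold invSq
  exact (contDiff_const.add (contDiff_norm_sq ℝ)).inv fun x => by positivity

theorem c1Bounded_invSq : C1Bounded (invSq (n := n)) := by
  refine ⟨contDiff_invSq, ⟨1, fun x => ?_⟩, ⟨2, fun k x => ?_⟩⟩
  · rw [abs_of_pos (invSq_pos x)]
    exact invSq_le_one x
  · rw [fderiv_invSq, abs_mul, abs_mul, abs_of_pos (invSq_pos x)]
    have h1 := abs_logGrad_le k x
    have h2 := invSq_le_one x
    have h3 := invSq_pos x
    have h4 := abs_nonneg (logGrad k x)
    norm_num
    nlinarith

theorem abs_fderiv_logGrad_le (j k : Fin n) (x : Space n) :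
    |fderiv ℝ (logGrad j) x (stdVec k)| ≤ 3 := by
  rw [fderiv_logGrad]
  have h1 := abs_logGrad_mul_logGrad_le j k x
  have h2 := invSq_le_one x
  have h3 := invSq_pos x
  rw [abs_le] at h1 ⊢
  split_ifs <;> constructor <;> linarith

theorem c1Bounded_logGrad (j : Fin n) : C1Bounded (logGrad j) := by
  refine ⟨?_, ⟨1, abs_logGrad_le j⟩, ⟨3, abs_fderiv_logGrad_le j⟩⟩
  have h1 : ContDiff ℝ 1 fun x : Space n => x j := (EuclideanSpace.proj j : Space n →L[ℝ] ℝ).contDiff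
  exact h1.mul contDiff_invSq

theorem C1Bounded.comp_smul {m : Space n → ℝ} (hm : C1Bounded m) (γ : ℝ) :
    C1Bounded fun x => m (γ • x) := by
  obtain ⟨D, hD⟩ := hm.bounded_fderiv
  refine ⟨hm.contDiff.comp (contDiff_const_smul γ),
    hm.bounded.imp fun D hD x => hD _, ⟨|γ| * D, fun j x => ?_⟩⟩
  rw [fderiv_comp_smul]
  simp only [smul_apply, smul_eq_mul, abs_mul]
  exact mul_le_mul_of_nonneg_left (hD j _) (abs_nonneg _)

theorem fderiv_comp_smul_apply (m : Space n → ℝ) (γ : ℝ) (x v : Space n) :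
    fderiv ℝ (fun x => m (γ • x)) x v = γ * fderiv ℝ m (γ • x) v := by
  rw [fderiv_comp_smul]
  simp

end ExplicitWeights

end SemiclassicalDecay

end

noncomputable section

namespace SemiclassicalDecay

/-! ### The commutator with a first order operator -/

section Conjugate

open scoped InnerProductSpace ComplexConjugate

variable {n : ℕ} {h : ℝ}

theorem schwartz_lineDerivOp_comm (v w : Space n) (ψ : 𝓢(Space n, ℂ)) :
    ∂_{v} (∂_{w} ψ) = ∂_{w} (∂_{v} ψ) := by
  ext x
  have hψ : ContDiff ℝ 2 ψ := ψ.smooth 2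
  have hs : IsSymmSndFDerivAt ℝ (ψ : Space n → ℂ) x :=
    hψ.contDiffAt.isSymmSndFDerivAt (by simp)
  have key : ∀ v w : Space n, (∂_{v} (∂_{w} ψ)) x = fderiv ℝ (fderiv ℝ ψ) x v w := by
    intro v w
    rw [SchwartzMap.lineDerivOp_apply_eq_fderiv]
    have : ((∂_{w} ψ : 𝓢(Space n, ℂ)) : Space n → ℂ) = fun x => fderiv ℝ ψ x w := by
      funext x
      rw [SchwartzMap.lineDerivOp_apply_eq_fderiv]
    rw [this, fderiv_clm_apply]
    · simp
    · exact ((hψ.fderiv_right (m := 1) (by norm_num)).differentiable one_ne_zero) x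
    · fun_prop
  rw [key, key, hs.eq]

/-- Weak derivatives commute. -/
theorem HasD.comm {i j : Fin n} {f fi fj fij : L2 n} (hi : HasD h i f fi) (hj : HasD h j f fj)
    (hij : HasD h i fj fij) : HasD h j fi fij := by
  unfold HasD at *
  rw [← hij, ← hi, ← hj, LineDeriv.lineDerivOp_smul, LineDeriv.lineDerivOp_smul]
  congr 2
  refine ContinuousLinearMap.ext fun ψ => ?_
  have e : -∂_{(stdVec i : Space n)} (-∂_{(stdVec j : Space n)} ψ)
      = -∂_{(stdVec j : Space n)} (-∂_{(stdVec i : Space n)} ψ) := by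
    rw [LineDeriv.lineDerivOp_neg, LineDeriv.lineDerivOp_neg, schwartz_lineDerivOp_comm]
  exact congrArg (Lp.toTemperedDistribution f) e

theorem jet_comm_of_inH2 {u : L2 n} (hu : InH2 h u) (i j : Fin n) :
    jet h (some i) (jet h (some j) u) = jet h (some j) (jet h (some i) u) :=
  ((hu.1.hasD i).comm (hu.1.hasD j) ((hu.2 j).hasD i)).jet_eq.symm

/-- Bounded vector fields with two bounded derivatives. -/
structure SmoothField (g : Fin n → Space n → ℝ) : Prop where
  c1Bounded : ∀ j, C1Bounded (g j)
  c1Bounded_fderiv : ∀ i j, C1Bounded fun x => fderiv ℝ (g j) x (stdVec i)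

/-- The divergence of a vector field. -/
def divergence (g : Fin n → Space n → ℝ) (x : Space n) : ℝ := ∑ j, fderiv ℝ (g j) x (stdVec j)

/-- The symmetrized first order operator `∑ (g_j D_j + D_j g_j) / 2`. -/
def conjOp (h : ℝ) (g : Fin n → Space n → ℝ) (u : L2 n) : L2 n :=
  ∑ j, mulOp (g j) (jet h (some j) u) + (-(Complex.I * h) / 2) • mulOp (divergence g) u

/-- The commutator of a jet component with `conjOp`. -/
def conjComm (h : ℝ) (g : Fin n → Space n → ℝ) : Option (Fin n) → L2 n → L2 n
  | none, _ => 0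
  | some i, u => (-(Complex.I * h)) • ∑ j, mulOp (fun x => fderiv ℝ (g j) x (stdVec i))
      (jet h (some j) u) + ((-(Complex.I * h)) ^ 2 / 2) •
        mulOp (fun x => fderiv ℝ (divergence g) x (stdVec i)) u

variable {g : Fin n → Space n → ℝ}

theorem SmoothField.c1Bounded_divergence (hg : SmoothField g) : C1Bounded (divergence g) :=
  C1Bounded.sum fun j _ => hg.c1Bounded_fderiv j j

theorem inner_conjOp_left (hg : SmoothField g) {u v : L2 n} (hu : InH1 h u) (hv : InH1 h v) :
    ⟪conjOp h g u, v⟫_ℂ = ⟪u, conjOp h g v⟫_ℂ := by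
  have e1 : ∀ j, ⟪mulOp (g j) (jet h (some j) u), v⟫_ℂ = ⟪u, mulOp (g j) (jet h (some j) v)⟫_ℂ
      + (-(Complex.I * h)) * ⟪u, mulOp (fun x => fderiv ℝ (g j) x (stdVec j)) v⟫_ℂ := by
    intro j
    rw [inner_mulOp_left (hg.c1Bounded j).isMultiplier,
      inner_jet_left hu (hv.mulOp (hg.c1Bounded j)), jet_mulOp (hg.c1Bounded j) hv,
      inner_add_right, inner_smul_right]
  have e2 : ⟪u, mulOp (divergence g) v⟫_ℂ
      = ∑ j, ⟪u, mulOp (fun x => fderiv ℝ (g j) x (stdVec j)) v⟫_ℂ := by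
    rw [← inner_sum, ← mulOp_sum fun j _ => (hg.c1Bounded j).isMultiplier_fderiv j]
    rfl
  unfold conjOp
  rw [inner_add_left, inner_add_right, inner_smul_left, inner_smul_right, sum_inner, inner_sum,
    inner_mulOp_left hg.c1Bounded_divergence.isMultiplier]
  simp only [e1, Finset.sum_add_distrib, ← Finset.mul_sum, ← e2]
  simp only [map_neg, map_mul, map_div₀, Complex.conj_I, Complex.conj_ofReal, map_ofNat]
  ring

theorem inH1_conjOp (hg : SmoothField g) {u : L2 n} (hu : InH2 h u) : InH1 h (conjOp h g u) :=
  (InH1.sum fun j _ => (hu.2 j).mulOp (hg.c1Bounded j)).add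
    ((hu.1.mulOp hg.c1Bounded_divergence).const_smul _)

theorem jet_conjOp (hg : SmoothField g) {u : L2 n} (hu : InH2 h u) :
    ∀ α, jet h α (conjOp h g u) = conjOp h g (jet h α u) + conjComm h g α u
  | none => by simp [conjComm]
  | some i => by
    have h1 : ∀ j ∈ (Finset.univ : Finset (Fin n)), InH1 h (mulOp (g j) (jet h (some j) u)) :=
      fun j _ => (hu.2 j).mulOp (hg.c1Bounded j)
    have h2 := hu.1.mulOp hg.c1Bounded_divergence
    have e1 : ∀ j, jet h (some i) (mulOp (g j) (jet h (some j) u))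
        = mulOp (g j) (jet h (some j) (jet h (some i) u))
          + (-(Complex.I * h)) • mulOp (fun x => fderiv ℝ (g j) x (stdVec i))
            (jet h (some j) u) := by
      intro j
      rw [jet_mulOp (hg.c1Bounded j) (hu.2 j), jet_comm_of_inH2 hu]
    unfold conjOp conjComm
    rw [jet_add (InH1.sum h1) (h2.const_smul _), jet_sum h1, jet_const_smul _ h2,
      jet_mulOp hg.c1Bounded_divergence hu.1]
    simp only [e1, Finset.sum_add_distrib, ← Finset.smul_sum]
    module

/-- The operator has first order, so its commutator with a function is multiplication by the
derivative of the function along the field. -/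
theorem conjOp_mulOp (hg : SmoothField g) {m : Space n → ℝ} (hm : C1Bounded m) {u : L2 n}
    (hu : InH1 h u) : conjOp h g (mulOp m u) = mulOp m (conjOp h g u)
      + (-(Complex.I * h)) • mulOp (fun x => ∑ j, g j x * fderiv ℝ m x (stdVec j)) u := by
  have hmm := hm.isMultiplier
  have e1 : ∀ j, mulOp (g j) (jet h (some j) (mulOp m u)) = mulOp m (mulOp (g j) (jet h (some j) u))
      + (-(Complex.I * h)) • mulOp (fun x => g j x * fderiv ℝ m x (stdVec j)) u := by
    intro j
    have hgj := (hg.c1Bounded j).isMultiplier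
    rw [jet_mulOp hm hu, map_add, map_smul, mulOp_mulOp hgj (hm.isMultiplier_fderiv j),
      mulOp_comm hgj hmm]
  unfold conjOp
  rw [mulOp_sum fun j _ => (hg.c1Bounded j).isMultiplier.mul (hm.isMultiplier_fderiv j)]
  simp only [e1, Finset.sum_add_distrib, ← Finset.smul_sum, map_add, map_sum, map_smul]
  rw [mulOp_comm hg.c1Bounded_divergence.isMultiplier hmm]
  module

variable {δ C : ℝ} {P : L2 n →ₗ.[ℂ] L2 n}
  {M : Option (Fin n) → Option (Fin n) → Space n → ℝ} {V : Space n → ℝ}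

/-- The commutator identity. -/
theorem HasForm.inner_conjOp_sub (hF : HasForm δ C h P M V) (hδ : 0 ≤ δ) (hg : SmoothField g)
    (u v : P.domain) :
    ⟪P v, conjOp h g (u : L2 n)⟫_ℂ - ⟪conjOp h g (v : L2 n), P u⟫_ℂ
      = ∑ α, ∑ β, (⟪jet h α (v : L2 n), mulOp (M α β) (conjComm h g β (u : L2 n))⟫_ℂ
        - ⟪conjComm h g α (v : L2 n), mulOp (M α β) (jet h β (u : L2 n))⟫_ℂ
        + (Complex.I * h) * ⟪jet h α (v : L2 n), mulOp (fun x => ∑ j, g j x *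
            fderiv ℝ (M α β) x (stdVec j)) (jet h β (u : L2 n))⟫_ℂ)
        + h * (⟪(v : L2 n), mulOp V (conjOp h g (u : L2 n))⟫_ℂ
          - ⟪conjOp h g (v : L2 n), mulOp V (u : L2 n)⟫_ℂ) := by
  have hu := hF.inH2 u
  have hv := hF.inH2 v
  have hAu := inH1_conjOp hg hu
  have hAv := inH1_conjOp hg hv
  have h1 := congrArg conj (hF.inner_apply _ hAu v)
  rw [conj_form hF.c1Bounded (hF.isMultiplier_V hδ), inner_conj_symm] at h1
  rw [h1, hF.inner_apply _ hAv u]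
  -- Each entry of M is differentiated once, along the field. V is not differentiated at all: its
  -- two contributions are kept separately and estimated directly later.
  have e1 : ∀ α β, ⟪jet h α (v : L2 n), mulOp (M β α) (jet h β (conjOp h g (u : L2 n)))⟫_ℂ
      = ⟪jet h α (conjOp h g (v : L2 n)), mulOp (M α β) (jet h β (u : L2 n))⟫_ℂ
        + (⟪jet h α (v : L2 n), mulOp (M α β) (conjComm h g β (u : L2 n))⟫_ℂ
        - ⟪conjComm h g α (v : L2 n), mulOp (M α β) (jet h β (u : L2 n))⟫_ℂ
        + (Complex.I * h) * ⟪jet h α (v : L2 n), mulOp (fun x => ∑ j, g j x *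
            fderiv ℝ (M α β) x (stdVec j)) (jet h β (u : L2 n))⟫_ℂ) := by
    intro α β
    rw [hF.symm β α, jet_conjOp hg hu, jet_conjOp hg hv, map_add, inner_add_right, inner_add_left,
      inner_conjOp_left hg (hv.jet α) ((hu.jet β).mulOp (hF.c1Bounded α β)),
      conjOp_mulOp hg (hF.c1Bounded α β) (hu.jet β), inner_add_right, inner_smul_right]
    ring
  simp only [e1, Finset.sum_add_distrib]
  ring

end Conjugate

end SemiclassicalDecay

end

noncomputable section

namespace SemiclassicalDecay

/-! ### The regularized radial field and the commutator estimate -/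

section Radial

open scoped InnerProductSpace ComplexConjugate

variable {n : ℕ}

/-- The regularized radial vector field `x / (1 + γ² |x|²)`. -/
def radial (γ : ℝ) (j : Fin n) (x : Space n) : ℝ := γ⁻¹ * logGrad j (γ • x)

/-- A weight that measures the difference between the regularized and the radial field. -/
def defect (γ : ℝ) (x : Space n) : ℝ := 1 - invSq (γ • x) + γ

theorem fderiv_radial {γ : ℝ} (hγ : 0 < γ) (i j : Fin n) (x : Space n) :
    fderiv ℝ (radial γ j) x (stdVec i) = (if j = i then 1 else 0) * invSq (γ • x)
      - 2 * (logGrad j (γ • x) * logGrad i (γ • x)) := by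
  have h1 : fderiv ℝ (radial γ j) x (stdVec i)
      = γ⁻¹ * (γ * fderiv ℝ (logGrad j) (γ • x) (stdVec i)) := by
    rw [← fderiv_comp_smul_apply]
    unfold radial
    rw [fderiv_const_mul (((c1Bounded_logGrad j).comp_smul γ).differentiable x)]
    simp
  rw [h1, inv_mul_cancel_left₀ hγ.ne', fderiv_logGrad]

theorem c1Bounded_hessian (i j : Fin n) (a : ℝ) :
    C1Bounded fun x => a * invSq x - 2 * (logGrad j x * logGrad i x) := by
  have := ((C1Bounded.const a).mul c1Bounded_invSq).add ((C1Bounded.const (-2)).mul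
    ((c1Bounded_logGrad j).mul (c1Bounded_logGrad i)))
  simpa [sub_eq_add_neg] using this

theorem smoothField_radial {γ : ℝ} (hγ : 0 < γ) : SmoothField (radial (n := n) γ) := by
  refine ⟨fun j => (C1Bounded.const _).mul ((c1Bounded_logGrad j).comp_smul γ), fun i j => ?_⟩
  simp only [fderiv_radial hγ]
  exact (c1Bounded_hessian i j _).comp_smul γ

theorem invSq_eq (x : Space n) : invSq x = (bracket x ^ 2)⁻¹ := by
  rw [bracket_sq]
  rfl

/-- The field is bounded for fixed γ, so that `conjOp` maps two derivatives to one. Uniformly in γ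
it grows no faster than ⟨x⟩. -/
theorem abs_radial_le {γ : ℝ} (hγ : 0 < γ) (j : Fin n) (x : Space n) :
    |radial γ j x| ≤ bracket x / bracket (γ • x) := by
  have h1 : radial γ j x = x j * invSq (γ • x) := by
    unfold radial logGrad
    rw [PiLp.smul_apply, smul_eq_mul, mul_assoc, inv_mul_cancel_left₀ hγ.ne']
  rw [h1, abs_mul, abs_of_pos (invSq_pos _), div_eq_mul_inv]
  refine mul_le_mul ((abs_coord_le x j).trans (norm_le_bracket x)) ?_ (invSq_pos _).le
    (bracket_pos x).le
  rw [invSq_eq]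
  refine inv_anti₀ (bracket_pos _) ?_
  nlinarith [one_le_bracket (γ • x)]

theorem bracket_div_le {γ : ℝ} (x : Space n) : bracket x / bracket (γ • x) ≤ bracket x :=
  div_le_self (bracket_pos x).le (one_le_bracket _)

theorem one_le_bracket_div {γ : ℝ} (hγ : 0 ≤ γ) (hγ1 : γ ≤ 1) (x : Space n) :
    1 ≤ bracket x / bracket (γ • x) := by
  rw [one_le_div (bracket_pos _)]
  unfold bracket
  refine Real.sqrt_le_sqrt ?_
  rw [norm_smul, Real.norm_of_nonneg hγ]
  have : γ * ‖x‖ ≤ ‖x‖ := mul_le_of_le_one_left (norm_nonneg x) hγ1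
  have h0 : 0 ≤ γ * ‖x‖ := by positivity
  nlinarith [norm_nonneg x]

theorem defect_nonneg {γ : ℝ} (hγ : 0 ≤ γ) (x : Space n) : 0 ≤ defect γ x := by
  have := invSq_le_one (γ • x)
  unfold defect
  linarith

theorem defect_le_two {γ : ℝ} (hγ1 : γ ≤ 1) (x : Space n) : defect γ x ≤ 2 := by
  have := invSq_pos (γ • x)
  unfold defect
  linarith

theorem isMultiplier_defect (γ : ℝ) : IsMultiplier (defect (n := n) γ) := by
  have := ((C1Bounded.const (n := n) (1 + γ)).add ((C1Bounded.const (-1)).mul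
    (c1Bounded_invSq.comp_smul γ))).isMultiplier
  have e : defect (n := n) γ = fun x => 1 + γ + -1 * invSq (γ • x) := by
    funext x
    unfold defect
    ring
  rw [e]
  exact this

theorem tendsto_defect (x : Space n) {γ : ℕ → ℝ} (hγ : Tendsto γ atTop (𝓝 0)) :
    Tendsto (fun k => defect (γ k) x) atTop (𝓝 0) := by
  have h1 : Continuous (invSq (n := n)) := contDiff_invSq.continuous
  have h2 : Tendsto (fun k => invSq (γ k • x)) atTop (𝓝 (invSq (0 : Space n))) := by
    refine (h1.tendsto 0).comp ?_
    simpa using hγ.smul_const x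
  have h3 := (h2.const_sub 1).add hγ
  simpa [invSq, defect] using h3

theorem abs_fderiv_radial_sub_le {γ : ℝ} (hγ : 0 < γ) (i j : Fin n) (x : Space n) :
    |fderiv ℝ (radial γ j) x (stdVec i) - if j = i then 1 else 0| ≤ 3 * |defect γ x| := by
  rw [fderiv_radial hγ, abs_of_nonneg (defect_nonneg hγ.le x)]
  have h1 := abs_logGrad_mul_logGrad_le j i (γ • x)
  have h2 := invSq_le_one (γ • x)
  unfold defect
  rw [abs_le] at h1 ⊢
  split_ifs <;> constructor <;> linarith

theorem abs_divergence_radial_le {γ : ℝ} (hγ : 0 < γ) (x : Space n) :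
    |divergence (radial γ) x| ≤ n * 3 := by
  unfold divergence
  refine (Finset.abs_sum_le_sum_abs _ _).trans ?_
  calc ∑ j : Fin n, |fderiv ℝ (radial γ j) x (stdVec j)| ≤ ∑ _j : Fin n, (3 : ℝ) := by
        refine Finset.sum_le_sum fun j _ => ?_
        rw [fderiv_radial hγ, ← fderiv_logGrad]
        exact abs_fderiv_logGrad_le j j _
    _ = _ := by simp

/-- The divergence is a fixed function evaluated at γx, so its gradient has a factor γ. The summand
γ of `defect` is there to dominate this term. -/
theorem abs_fderiv_divergence_radial_le {γ : ℝ} (hγ : 0 < γ) (i : Fin n) (x : Space n) :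
    |fderiv ℝ (divergence (radial γ)) x (stdVec i)| ≤ n * 14 * |defect γ x| := by
  have hD : C1Bounded fun x : Space n => ∑ j, (1 * invSq x - 2 * (logGrad j x * logGrad j x)) :=
    C1Bounded.sum fun j _ => c1Bounded_hessian j j 1
  have e : divergence (radial (n := n) γ) = fun x =>
      (fun y => ∑ j, (1 * invSq y - 2 * (logGrad j y * logGrad j y))) (γ • x) := by
    funext x
    unfold divergence
    simp only [fderiv_radial hγ, if_true]
  rw [e, fderiv_comp_smul_apply
    (fun y => ∑ j, (1 * invSq y - 2 * (logGrad j y * logGrad j y))) γ x (stdVec i)]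
  have h1 : ∀ y : Space n, |fderiv ℝ (fun y => ∑ j, (1 * invSq y
      - 2 * (logGrad j y * logGrad j y))) y (stdVec i)| ≤ n * 14 := by
    intro y
    have h2 : fderiv ℝ (fun y => ∑ j, (1 * invSq y - 2 * (logGrad j y * logGrad j y))) y
        = ∑ j : Fin n, fderiv ℝ (fun y => 1 * invSq y - 2 * (logGrad j y * logGrad j y)) y :=
      fderiv_fun_sum fun j _ => (c1Bounded_hessian j j 1).differentiable y
    rw [h2, sum_apply]
    refine (Finset.abs_sum_le_sum_abs _ _).trans ?_
    calc _ ≤ ∑ _j : Fin n, (14 : ℝ) := by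
          refine Finset.sum_le_sum fun j _ => ?_
          have hl := c1Bounded_logGrad j
          have h3 : fderiv ℝ (fun y => 1 * invSq y - 2 * (logGrad j y * logGrad j y)) y (stdVec i)
              = fderiv ℝ invSq y (stdVec i) - 2 * (logGrad j y * fderiv ℝ (logGrad j) y (stdVec i)
                + fderiv ℝ (logGrad j) y (stdVec i) * logGrad j y) := by
            rw [← hl.fderiv_mul_apply hl, fderiv_fun_sub, fderiv_const_mul, fderiv_const_mul]
            · simp
            · exact (hl.mul hl).differentiable y
            · exact c1Bounded_invSq.differentiable y
            · exact ((C1Bounded.const 1).mul c1Bounded_invSq).differentiable y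
            · exact ((C1Bounded.const 2).mul (hl.mul hl)).differentiable y
          rw [h3, fderiv_invSq]
          -- The constant is 14 = 2 + 2 (3 + 3): once the gradient of `invSq`, and twice the two
          -- terms of the product rule.
          have a1 : |logGrad i y * invSq y| ≤ 1 := by
            rw [abs_mul, abs_of_pos (invSq_pos y)]
            nlinarith [abs_logGrad_le i y, invSq_le_one y, invSq_pos y, abs_nonneg (logGrad i y)]
          have a2 : |logGrad j y * fderiv ℝ (logGrad j) y (stdVec i)| ≤ 3 := by
            rw [abs_mul]
            nlinarith [abs_logGrad_le j y, abs_fderiv_logGrad_le j i y,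
              abs_nonneg (logGrad j y), abs_nonneg (fderiv ℝ (logGrad j) y (stdVec i))]
          rw [mul_comm (fderiv ℝ (logGrad j) y (stdVec i))]
          rw [abs_le] at a1 a2 ⊢
          constructor <;> linarith
      _ = _ := by simp
  rw [abs_mul, abs_of_pos hγ, abs_of_nonneg (defect_nonneg hγ.le x), mul_comm]
  refine mul_le_mul (h1 _) ?_ hγ.le (by positivity)
  have := invSq_le_one (γ • x)
  unfold defect
  linarith

variable {h : ℝ}

/-- Up to the regularization, the commutator of a derivative with the radial operator is
a multiple of that derivative. -/
theorem norm_conjComm_sub_le {γ : ℝ} (hγ : 0 < γ) (hh : 0 ≤ h) (hh1 : h ≤ 1) (u : L2 n)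
    {Ω : ℝ} (hΩ : ∀ α, ‖mulOp (defect γ) (jet h α u)‖ ≤ Ω) (i : Fin n) :
    ‖conjComm h (radial γ) (some i) u - (-(Complex.I * h)) • jet h (some i) u‖
      ≤ n * 10 * Ω := by
  have hg := smoothField_radial (n := n) hγ
  have hmd : ∀ j, IsMultiplier fun x =>
      fderiv ℝ (radial γ j) x (stdVec i) + (-if j = i then (1 : ℝ) else 0) := fun j =>
    (hg.c1Bounded_fderiv i j).isMultiplier.add (IsMultiplier.const _)
  have hΩ0 : 0 ≤ Ω := (norm_nonneg _).trans (hΩ none)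
  have e1 : ∀ j, mulOp (fun x => fderiv ℝ (radial γ j) x (stdVec i)) (jet h (some j) u)
      = mulOp (fun x => fderiv ℝ (radial γ j) x (stdVec i) + (-if j = i then (1 : ℝ) else 0))
        (jet h (some j) u) + (if j = i then (1 : ℂ) else 0) • jet h (some j) u := by
    intro j
    rw [mulOp_add (hg.c1Bounded_fderiv i j).isMultiplier (IsMultiplier.const _), mulOp_const]
    split_ifs <;> simp
  have e2 : ∑ j, mulOp (fun x => fderiv ℝ (radial γ j) x (stdVec i)) (jet h (some j) u)
      = ∑ j, mulOp (fun x => fderiv ℝ (radial γ j) x (stdVec i)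
        + (-if j = i then (1 : ℝ) else 0)) (jet h (some j) u) + jet h (some i) u := by
    simp only [e1, Finset.sum_add_distrib, ite_smul, one_smul, zero_smul, Finset.sum_ite_eq',
      Finset.mem_univ, if_true]
  have e3 : conjComm h (radial γ) (some i) u - (-(Complex.I * h)) • jet h (some i) u
      = (-(Complex.I * h)) • ∑ j, mulOp (fun x => fderiv ℝ (radial γ j) x (stdVec i)
        + (-if j = i then (1 : ℝ) else 0)) (jet h (some j) u) + ((-(Complex.I * h)) ^ 2 / 2) •
        mulOp (fun x => fderiv ℝ (divergence (radial γ)) x (stdVec i)) u := by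
    simp only [conjComm]
    rw [e2]
    module
  rw [e3]
  have hN1 : ‖∑ j, mulOp (fun x => fderiv ℝ (radial γ j) x (stdVec i)
      + (-if j = i then (1 : ℝ) else 0)) (jet h (some j) u)‖ ≤ n * (3 * Ω) := by
    calc _ ≤ ∑ _j : Fin n, 3 * Ω := by
          refine norm_sum_le_of_le _ fun j _ => ?_
          refine (norm_mulOp_le_of_abs_le (hmd j) (isMultiplier_defect γ) (C := 3)
            (ae_of_all _ fun x => ?_) _).trans (by gcongr; exact hΩ _)
          simpa [sub_eq_add_neg] using abs_fderiv_radial_sub_le hγ i j x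
      _ = _ := by simp
  have hN2 : ‖mulOp (fun x => fderiv ℝ (divergence (radial γ)) x (stdVec i)) u‖
      ≤ n * 14 * Ω := by
    refine (norm_mulOp_le_of_abs_le (hg.c1Bounded_divergence.isMultiplier_fderiv i)
      (isMultiplier_defect γ) (ae_of_all _ fun x => abs_fderiv_divergence_radial_le hγ i x)
      _).trans ?_
    gcongr
    exact hΩ none
  refine (norm_add_le _ _).trans ?_
  rw [norm_smul, norm_smul, norm_div, norm_pow, norm_neg_I_mul hh]
  have hnΩ : 0 ≤ n * Ω := by positivity
  have h2 : h ^ 2 ≤ 1 := by nlinarith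
  simp only [Complex.norm_ofNat]
  calc _ ≤ 1 * (n * (3 * Ω)) + 1 / 2 * (n * 14 * Ω) := by gcongr
    _ = _ := by ring

variable {δ C : ℝ} {P : L2 n →ₗ.[ℂ] L2 n}
  {M : Option (Fin n) → Option (Fin n) → Space n → ℝ} {V : Space n → ℝ}

/-- For a true derivative the commutator is -ih times that derivative up to the defect, and the two
terms cancel. For the component without derivative the commutator is zero, but then the coefficient
is short range and the remaining term is itself an error. This is why the total commutator is 2P and
not merely twice the second order part. -/
theorem HasForm.norm_inner_conjComm_add_le (hF : HasForm δ C h P M V) {γ : ℝ} (hγ : 0 < γ)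
    {u v : L2 n} {w w' : Space n → ℝ} (hw : IsMultiplier w) (hw' : IsMultiplier w')
    (hw0 : ∀ x, 0 < w x) (hw0' : ∀ x, 0 < w' x) (hww : ∀ x, bracket x ^ (-δ) ≤ w x * w' x)
    {a a' Y Ω : ℝ} (ha : ∀ α, ‖mulOp w (jet h α v)‖ ≤ a) (ha' : ∀ α, ‖mulOp w' (jet h α u)‖ ≤ a')
    (hY : ∀ α, ‖jet h α v‖ ≤ Y) (hΩ : ∀ α, ‖mulOp (defect γ) (jet h α u)‖ ≤ Ω) (α β) :
    ‖⟪jet h α v, mulOp (M α β) (conjComm h (radial γ) β u)⟫_ℂ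
      + (Complex.I * h) * ⟪jet h α v, mulOp (M α β) (jet h β u)⟫_ℂ‖
      ≤ h * (C * (a * a')) + C * (n * 10) * (Y * Ω) := by
  have hC := hF.nonneg
  have hh := hF.h_pos.le
  have ha0 : 0 ≤ a := (norm_nonneg _).trans (ha none)
  have ha0' : 0 ≤ a' := (norm_nonneg _).trans (ha' none)
  have hY0 : 0 ≤ Y := (norm_nonneg _).trans (hY none)
  have hΩ0 : 0 ≤ Ω := (norm_nonneg _).trans (hΩ none)
  cases β with
  | none =>
    have h1 : ‖⟪jet h α v, mulOp (M α none) (jet h none u)⟫_ℂ‖ ≤ C * (a * a') := by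
      refine (norm_inner_mulOp_le (hF.c1Bounded α none).isMultiplier hw hw' hw0 hw0'
        (ae_of_all _ fun x => (hF.abs_le_short α x).trans
          (mul_le_mul_of_nonneg_left (hww x) hC)) _ _).trans ?_
      gcongr
      · exact ha α
      · exact ha' none
    simp only [conjComm, map_zero, inner_zero_right, zero_add]
    rw [norm_mul, ← norm_neg, norm_neg_I_mul hh]
    have h2 := mul_le_mul_of_nonneg_left h1 hh
    have h3 : 0 ≤ C * (n * 10) * (Y * Ω) := by positivity
    linarith
  | some i =>
    have e : ⟪jet h α v, mulOp (M α (some i)) (conjComm h (radial γ) (some i) u)⟫_ℂ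
        + (Complex.I * h) * ⟪jet h α v, mulOp (M α (some i)) (jet h (some i) u)⟫_ℂ
        = ⟪jet h α v, mulOp (M α (some i)) (conjComm h (radial γ) (some i) u
          - (-(Complex.I * h)) • jet h (some i) u)⟫_ℂ := by
      rw [map_sub, map_smul, inner_sub_right, inner_smul_right]
      ring
    rw [e]
    have h1 := norm_mulOp_le (hF.c1Bounded α (some i)).isMultiplier
      (ae_of_all _ (hF.abs_le α (some i))) (conjComm h (radial γ) (some i) u
          - (-(Complex.I * h)) • jet h (some i) u)
    have h2 := norm_conjComm_sub_le hγ hh hF.h_le_one u hΩ i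
    refine (norm_inner_le_norm _ _).trans ?_
    have h3 : ‖jet h α v‖ * ‖mulOp (M α (some i)) (conjComm h (radial γ) (some i) u
          - (-(Complex.I * h)) • jet h (some i) u)‖ ≤ Y * (C * (n * 10 * Ω)) := by
      refine mul_le_mul (hY α) (h1.trans (by gcongr)) (norm_nonneg _) hY0
    have h4 : 0 ≤ h * (C * (a * a')) := by positivity
    linarith

end Radial

end SemiclassicalDecay

end

noncomputable section

namespace SemiclassicalDecay

/-! ### The commutator of P with the radial operator is 2P up to short range errors -/

section Commutator

open scoped InnerProductSpace ComplexConjugate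

variable {n : ℕ} {δ C h : ℝ} {P : L2 n →ₗ.[ℂ] L2 n}
  {M : Option (Fin n) → Option (Fin n) → Space n → ℝ} {V : Space n → ℝ}

/-- A short range potential against the radial operator. -/
theorem norm_inner_mulOp_conjOp_le {γ : ℝ} (hγ : 0 < γ) (hh : 0 ≤ h) (hh1 : h ≤ 1)
    (hV : IsMultiplier V) (hC : 0 ≤ C) (hVle : ∀ᵐ x, |V x| ≤ C * bracket x ^ (-δ))
    {u v : L2 n} {w w' : Space n → ℝ} (hw : IsMultiplier w) (hw' : IsMultiplier w')
    (hw0 : ∀ x, 0 < w x) (hw0' : ∀ x, 0 < w' x) (hww : ∀ x, bracket x ^ (1 - δ) ≤ w x * w' x)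
    {a a' : ℝ} (ha : ‖mulOp w v‖ ≤ a) (ha' : ∀ α, ‖mulOp w' (jet h α u)‖ ≤ a') :
    ‖⟪v, mulOp V (conjOp h (radial γ) u)⟫_ℂ‖ ≤ n * (3 * C) * (a * a') := by
  have hg := smoothField_radial (n := n) hγ
  have ha0 : 0 ≤ a := (norm_nonneg _).trans ha
  have ha0' : 0 ≤ a' := (norm_nonneg _).trans (ha' none)
  have hbr : ∀ x : Space n, bracket x ^ (1 - δ) = bracket x * bracket x ^ (-δ) := fun x => by
    rw [sub_eq_add_neg, Real.rpow_add (bracket_pos x), Real.rpow_one]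
  have hb0 : ∀ x : Space n, 0 ≤ bracket x ^ (-δ) := fun x => Real.rpow_nonneg (bracket_pos x).le _
  -- Both coefficients of the operator are at most a multiple of ⟨x⟩. This lowers the decay of V to
  -- ⟨x⟩^{1-δ}, which the weights w and w' share.
  have hdom : ∀ {g : Space n → ℝ} {K : ℝ} (_ : C1Bounded g) (_ : 0 ≤ K)
      (_ : ∀ x, |g x| ≤ K * bracket x) {f : L2 n} (_ : ‖mulOp w' f‖ ≤ a'),
      ‖⟪v, mulOp V (mulOp g f)⟫_ℂ‖ ≤ C * K * (a * a') := by
    intro g K hg hK hgle f hf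
    rw [mulOp_mulOp hV hg.isMultiplier]
    refine (norm_inner_mulOp_le (C := C * K) (hV.mul hg.isMultiplier) hw hw' hw0 hw0' ?_ _ _).trans ?_
    · filter_upwards [hVle] with x hx
      rw [abs_mul]
      calc |V x| * |g x| ≤ (C * bracket x ^ (-δ)) * (K * bracket x) :=
            mul_le_mul hx (hgle x) (abs_nonneg _) (mul_nonneg hC (hb0 x))
        _ = C * K * bracket x ^ (1 - δ) := by rw [hbr]; ring
        _ ≤ C * K * (w x * w' x) := mul_le_mul_of_nonneg_left (hww x) (by positivity)
    · gcongr
  have h1 : ∀ j, ‖⟪v, mulOp V (mulOp (radial γ j) (jet h (some j) u))⟫_ℂ‖ ≤ C * 1 * (a * a') :=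
    fun j => hdom (hg.c1Bounded j) zero_le_one (fun x => by
      rw [one_mul]
      exact (abs_radial_le hγ j x).trans (bracket_div_le x)) (ha' _)
  have h2 : ‖⟪v, mulOp V (mulOp (divergence (radial γ)) u)⟫_ℂ‖ ≤ C * (n * 3) * (a * a') :=
    hdom hg.c1Bounded_divergence (by positivity) (fun x =>
      (abs_divergence_radial_le hγ x).trans
        (le_mul_of_one_le_right (by positivity) (one_le_bracket x))) (ha' none)
  unfold conjOp
  rw [map_add, map_sum, map_smul, inner_add_right, inner_sum, inner_smul_right]
  refine (norm_add_le _ _).trans ?_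
  rw [norm_mul, norm_div, norm_neg_I_mul hh, Complex.norm_ofNat]
  have h3 : ‖∑ j, ⟪v, mulOp V (mulOp (radial γ j) (jet h (some j) u))⟫_ℂ‖
      ≤ n * (C * 1 * (a * a')) := by
    calc _ ≤ ∑ _j : Fin n, C * 1 * (a * a') := norm_sum_le_of_le _ fun j _ => h1 j
      _ = _ := by simp
  have h4 : h / 2 * ‖⟪v, mulOp V (mulOp (divergence (radial γ)) u)⟫_ℂ‖
      ≤ 1 / 2 * (C * (n * 3) * (a * a')) := by gcongr
  have h5 : 0 ≤ n * (C * (a * a')) := by positivity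
  linarith

/-- The commutator estimate: for `A` the regularized radial operator, `i [P, A] / h` is `2 P` up
to short range terms. -/
theorem exists_norm_inner_conjOp_sub_add_le (n : ℕ) {C : ℝ} (hC : 0 ≤ C) :
    ∃ K : ℝ, 0 ≤ K ∧ ∀ (δ h γ : ℝ) (P : L2 n →ₗ.[ℂ] L2 n)
      (M : Option (Fin n) → Option (Fin n) → Space n → ℝ) (V w w' : Space n → ℝ),
      0 ≤ δ → 0 < γ → HasForm δ C h P M V → IsMultiplier w → IsMultiplier w' →
      (∀ x, 0 < w x) → (∀ x, 0 < w' x) → (∀ x, bracket x ^ (1 - δ) ≤ w x * w' x) →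
      ∀ (u v : P.domain) (a a' Y Y' Ω Ω' : ℝ),
      (∀ α, ‖mulOp w (jet h α (v : L2 n))‖ ≤ a) → (∀ α, ‖mulOp w' (jet h α (u : L2 n))‖ ≤ a') →
      (∀ α, ‖jet h α (v : L2 n)‖ ≤ Y) → (∀ α, ‖jet h α (u : L2 n)‖ ≤ Y') →
      (∀ α, ‖mulOp (defect γ) (jet h α (v : L2 n))‖ ≤ Ω) →
      (∀ α, ‖mulOp (defect γ) (jet h α (u : L2 n))‖ ≤ Ω') →
      ‖⟪P v, conjOp h (radial γ) (u : L2 n)⟫_ℂ - ⟪conjOp h (radial γ) (v : L2 n), P u⟫_ℂ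
        + 2 * (Complex.I * h) * ⟪(v : L2 n), P u⟫_ℂ‖
      ≤ K * (h * (a * a')) + K * (Y * Ω' + Y' * Ω) := by
  set N : ℝ := (Fintype.card (Option (Fin n)) : ℝ) with hN
  have hN0 : 0 ≤ N := by positivity
  refine ⟨N ^ 2 * (2 * C + n * C) + (n * (3 * C) + n * (3 * C)) + 2 * C + N ^ 2 * (C * (n * 10)),
    by positivity, ?_⟩
  intro δ h γ P M V w w' hδ hγ hF hw hw' hw0 hw0' hww u v a a' Y Y' Ω Ω' ha ha' hY hY' hΩ hΩ'
  have hh := hF.h_pos.le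
  have hh1 := hF.h_le_one
  have ha0 : 0 ≤ a := (norm_nonneg _).trans (ha none)
  have ha0' : 0 ≤ a' := (norm_nonneg _).trans (ha' none)
  have hY0 : 0 ≤ Y := (norm_nonneg _).trans (hY none)
  have hY0' : 0 ≤ Y' := (norm_nonneg _).trans (hY' none)
  have hΩ0 : 0 ≤ Ω := (norm_nonneg _).trans (hΩ none)
  have hΩ0' : 0 ≤ Ω' := (norm_nonneg _).trans (hΩ' none)
  have hg := smoothField_radial (n := n) hγ
  have hVm := hF.isMultiplier_V hδ
  have hb0 : ∀ x : Space n, 0 ≤ bracket x ^ (-δ) := fun x => Real.rpow_nonneg (bracket_pos x).le _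
  have hbr : ∀ x : Space n, bracket x ^ (1 - δ) = bracket x * bracket x ^ (-δ) := fun x => by
    rw [sub_eq_add_neg, Real.rpow_add (bracket_pos x), Real.rpow_one]
  have hww1 : ∀ x, bracket x ^ (-δ) ≤ w x * w' x := fun x =>
    (le_mul_of_one_le_left (hb0 x) (one_le_bracket x)).trans ((hbr x).symm.le.trans (hww x))
  have hww1' : ∀ x, bracket x ^ (-δ) ≤ w' x * w x := fun x => by
    rw [mul_comm]; exact hww1 x
  have hww' : ∀ x, bracket x ^ (1 - δ) ≤ w' x * w x := fun x => by
    rw [mul_comm]; exact hww x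
  have hB : ∀ α β, ‖⟪jet h α (v : L2 n), mulOp (M α β) (conjComm h (radial γ) β (u : L2 n))⟫_ℂ
        - ⟪conjComm h (radial γ) α (v : L2 n), mulOp (M α β) (jet h β (u : L2 n))⟫_ℂ
        + (Complex.I * h) * ⟪jet h α (v : L2 n), mulOp (fun x => ∑ j, radial γ j x *
            fderiv ℝ (M α β) x (stdVec j)) (jet h β (u : L2 n))⟫_ℂ
        + 2 * (Complex.I * h) * ⟪jet h α (v : L2 n), mulOp (M α β) (jet h β (u : L2 n))⟫_ℂ‖
      ≤ (2 * C + n * C) * (h * (a * a')) + C * (n * 10) * (Y * Ω' + Y' * Ω) := by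
    intro α β
    have b1 := hF.norm_inner_conjComm_add_le hγ hw hw' hw0 hw0' hww1 ha ha' hY hΩ' α β
    have b2 := hF.norm_inner_conjComm_add_le hγ hw' hw hw0' hw0 hww1' ha' ha hY' hΩ β α
    -- The term in which the commutator falls on v is the conjugate of the first one with u and v
    -- exchanged.
    have e2 : conj (⟪jet h β (u : L2 n), mulOp (M β α) (conjComm h (radial γ) α (v : L2 n))⟫_ℂ
        + (Complex.I * h) * ⟪jet h β (u : L2 n), mulOp (M β α) (jet h α (v : L2 n))⟫_ℂ)
        = ⟪conjComm h (radial γ) α (v : L2 n), mulOp (M α β) (jet h β (u : L2 n))⟫_ℂ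
          - (Complex.I * h) * ⟪jet h α (v : L2 n), mulOp (M α β) (jet h β (u : L2 n))⟫_ℂ := by
      rw [hF.symm β α]
      simp only [map_add, map_mul, inner_conj_symm, Complex.conj_I, Complex.conj_ofReal,
        inner_mulOp_left (hF.c1Bounded α β).isMultiplier]
      ring
    rw [← RCLike.norm_conj, e2] at b2
    have hm3 : IsMultiplier fun x => ∑ j, radial γ j x * fderiv ℝ (M α β) x (stdVec j) :=
      IsMultiplier.sum fun j _ =>
        (hg.c1Bounded j).isMultiplier.mul ((hF.c1Bounded α β).isMultiplier_fderiv j)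
    have b3 : ‖⟪jet h α (v : L2 n), mulOp (fun x => ∑ j, radial γ j x *
            fderiv ℝ (M α β) x (stdVec j)) (jet h β (u : L2 n))⟫_ℂ‖ ≤ n * C * (a * a') := by
      refine (norm_inner_mulOp_le (C := n * C) hm3 hw hw' hw0 hw0'
        (ae_of_all _ fun x => ?_) _ _).trans ?_
      · refine (Finset.abs_sum_le_sum_abs _ _).trans ?_
        calc _ ≤ ∑ _j : Fin n, C * bracket x ^ (1 - δ) := by
              refine Finset.sum_le_sum fun j _ => ?_
              rw [abs_mul, hbr]
              calc _ ≤ bracket x * (C * bracket x ^ (-δ)) :=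
                    mul_le_mul ((abs_radial_le hγ j x).trans (bracket_div_le x))
                      (hF.abs_fderiv_le α β j x) (abs_nonneg _) (bracket_pos x).le
                _ = _ := by ring
          _ = n * C * bracket x ^ (1 - δ) := by simp [mul_assoc]
          _ ≤ _ := mul_le_mul_of_nonneg_left (hww x) (by positivity)
      · gcongr
        · exact ha α
        · exact ha' β
    have e3 : ∀ p q r s : ℂ, p - q + (Complex.I * h) * r + 2 * (Complex.I * h) * s
        = (p + (Complex.I * h) * s) - (q - (Complex.I * h) * s) + (Complex.I * h) * r := by
      intros
      ring
    rw [e3]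
    refine (norm_add_le _ _).trans ((add_le_add (norm_sub_le _ _) le_rfl).trans ?_)
    rw [norm_mul _ (⟪_, _⟫_ℂ), ← norm_neg (Complex.I * (h : ℂ)), norm_neg_I_mul hh]
    have b4 := mul_le_mul_of_nonneg_left b3 hh
    linarith
  have hV1 := norm_inner_mulOp_conjOp_le hγ hh hh1 hVm hC hF.abs_V_le hw hw' hw0 hw0' hww
    (ha none) ha'
  have hV2 : ‖⟪conjOp h (radial γ) (v : L2 n), mulOp V (u : L2 n)⟫_ℂ‖
      ≤ n * (3 * C) * (a * a') := by
    have := norm_inner_mulOp_conjOp_le hγ hh hh1 hVm hC hF.abs_V_le hw' hw hw0' hw0 hww'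
      (ha' none) ha
    rw [← norm_inner_symm, inner_mulOp_left hVm]
    refine this.trans (by rw [mul_comm a' a])
  have hV3 : ‖⟪(v : L2 n), mulOp V (u : L2 n)⟫_ℂ‖ ≤ C * (a * a') := by
    refine (norm_inner_mulOp_le (C := C) hVm hw hw' hw0 hw0' ?_ _ _).trans ?_
    · filter_upwards [hF.abs_V_le] with x hx
      exact hx.trans (mul_le_mul_of_nonneg_left (hww1 x) hC)
    · gcongr
      · exact ha none
      · exact ha' none
  rw [hF.inner_conjOp_sub hδ hg u v, hF.inner_apply _ (hF.inH2 v).1 u]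
  have e4 : ∀ (S T : ℂ) (a b c : ℂ), S + h * (a - b) + 2 * (Complex.I * h) * (T + h * c)
      = (S + 2 * (Complex.I * h) * T) + h * ((a - b) + 2 * (Complex.I * h) * c) := by
    intros
    ring
  rw [e4]
  simp only [Finset.mul_sum, ← Finset.sum_add_distrib]
  have hS : ∀ F : Option (Fin n) → Option (Fin n) → ℂ, (∀ α β, ‖F α β‖
      ≤ (2 * C + n * C) * (h * (a * a')) + C * (n * 10) * (Y * Ω' + Y' * Ω)) →
      ‖∑ α, ∑ β, F α β‖ ≤ N ^ 2 * ((2 * C + n * C) * (h * (a * a'))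
        + C * (n * 10) * (Y * Ω' + Y' * Ω)) := by
    intro F hF
    calc ‖∑ α, ∑ β, F α β‖ ≤ ∑ _α : Option (Fin n), ∑ _β : Option (Fin n),
          ((2 * C + n * C) * (h * (a * a')) + C * (n * 10) * (Y * Ω' + Y' * Ω)) :=
          norm_sum_le_of_le _ fun α _ => norm_sum_le_of_le _ fun β _ => hF α β
      _ = _ := by
          simp only [Finset.sum_const, Finset.card_univ, nsmul_eq_mul, hN]
          ring
  refine (norm_add_le _ _).trans ((add_le_add (hS _ hB) le_rfl).trans ?_)
  have h6 : ‖(h : ℂ) * ((⟪(v : L2 n), mulOp V (conjOp h (radial γ) (u : L2 n))⟫_ℂ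
      - ⟪conjOp h (radial γ) (v : L2 n), mulOp V (u : L2 n)⟫_ℂ)
      + 2 * (Complex.I * h) * ⟪(v : L2 n), mulOp V (u : L2 n)⟫_ℂ)‖
      ≤ h * ((n * (3 * C) * (a * a') + n * (3 * C) * (a * a')) + 2 * (C * (a * a'))) := by
    rw [norm_mul, Complex.norm_real, Real.norm_of_nonneg hh]
    refine mul_le_mul_of_nonneg_left ?_ hh
    refine (norm_add_le _ _).trans (add_le_add ((norm_sub_le _ _).trans (add_le_add hV1 hV2)) ?_)
    rw [norm_mul, norm_mul, ← norm_neg (Complex.I * (h : ℂ)), norm_neg_I_mul hh, Complex.norm_ofNat]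
    have h7 : 2 * h * ‖⟪(v : L2 n), mulOp V (u : L2 n)⟫_ℂ‖ ≤ 2 * 1 * (C * (a * a')) := by
      gcongr
    linarith
  have h8 : 0 ≤ Y * Ω' + Y' * Ω := by positivity
  have h9 : 0 ≤ h * (a * a') := by positivity
  refine (add_le_add le_rfl h6).trans ?_
  have k1 : 0 ≤ (n * (3 * C) + n * (3 * C) + 2 * C + N ^ 2 * (2 * C + n * C))
      * (Y * Ω' + Y' * Ω) := by positivity
  have k2 : 0 ≤ N ^ 2 * (C * (n * 10)) * (h * (a * a')) := by positivity
  linarith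

end Commutator

end SemiclassicalDecay

end

noncomputable section

namespace SemiclassicalDecay

/-! ### The virial identity for powers of the resolvent -/

section ResolventPowers

open scoped InnerProductSpace ComplexConjugate

variable {n : ℕ}

theorem exists_pow_resolventOp {H : Type*} [NormedAddCommGroup H] [InnerProductSpace ℂ H]
    [CompleteSpace H] {P : H →ₗ.[ℂ] H} (hP : IsSelfAdjoint P) {z : ℂ} (hz : z.im ≠ 0) (k : ℕ)
    (f : H) : ∃ u : P.domain, (u : H) = (resolventOp P z ^ (k + 1)) f ∧
      P u = z • (resolventOp P z ^ (k + 1)) f + (resolventOp P z ^ k) f := by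
  obtain ⟨u, hu, hPu⟩ := exists_resolventOp hP hz ((resolventOp P z ^ k) f)
  rw [pow_succ']
  exact ⟨u, hu, hPu⟩

theorem inner_pow_resolventOp_conj {H : Type*} [NormedAddCommGroup H] [InnerProductSpace ℂ H]
    [CompleteSpace H] {P : H →ₗ.[ℂ] H} (hP : IsSelfAdjoint P) {z : ℂ} (hz : z.im ≠ 0) (k : ℕ)
    (f g : H) : ⟪(resolventOp P (conj z) ^ k) f, g⟫_ℂ = ⟪f, (resolventOp P z ^ k) g⟫_ℂ := by
  rw [← star_resolventOp hP hz, ← star_pow, ContinuousLinearMap.star_eq_adjoint,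
    ContinuousLinearMap.adjoint_inner_left]

/-- The defect is bounded and tends to 0 pointwise, hence strongly. It carries no rate, so it is
used only for fixed vectors, to remove the regularization. -/
theorem tendsto_sum_norm_defect (f : Option (Fin n) → L2 n) :
    Tendsto (fun k : ℕ => ∑ α, ‖mulOp (defect (1 / ((k : ℝ) + 1))) (f α)‖) atTop (𝓝 0) := by
  have hγ : Tendsto (fun k : ℕ => 1 / ((k : ℝ) + 1)) atTop (𝓝 0) :=
    tendsto_one_div_add_atTop_nhds_zero_nat
  have hγ0 : ∀ k : ℕ, 0 ≤ 1 / ((k : ℝ) + 1) := fun k => by positivity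
  have hγ1 : ∀ k : ℕ, 1 / ((k : ℝ) + 1) ≤ 1 := fun k => by
    rw [div_le_one (by positivity)]
    linarith [Nat.cast_nonneg (α := ℝ) k]
  have h1 : ∀ α, Tendsto (fun k : ℕ => ‖mulOp (defect (1 / ((k : ℝ) + 1))) (f α)‖) atTop (𝓝 0) :=
    fun α => tendsto_mulOp_zero (fun k => isMultiplier_defect _) (C := 2)
      (fun k x => by
        rw [abs_of_nonneg (defect_nonneg (hγ0 k) x)]
        exact defect_le_two (hγ1 k) x)
      (fun x => tendsto_defect x hγ) (f α)
  simpa using tendsto_finsetSum Finset.univ fun α _ => h1 α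

/-- Virial identity for resolvent powers: a power of the resolvent is controlled by the boundary
terms of the radial operator and by short range errors. -/
theorem exists_norm_inner_pow_le (n : ℕ) {C : ℝ} (hC : 0 ≤ C) :
    ∃ K : ℝ, 0 ≤ K ∧ ∀ (δ h : ℝ) (P : L2 n →ₗ.[ℂ] L2 n)
      (M : Option (Fin n) → Option (Fin n) → Space n → ℝ) (V : Space n → ℝ),
      0 ≤ δ → HasForm δ C h P M V → ∀ (z : ℂ), z.im ≠ 0 → ∀ (m : ℕ) (f f' : L2 n) (B S : ℝ),
      (∀ γ ∈ Set.Ioc (0 : ℝ) 1, ‖⟪f', conjOp h (radial γ) ((resolventOp P z ^ m) f)⟫_ℂ‖ ≤ B ∧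
        ‖⟪conjOp h (radial γ) ((resolventOp P (conj z) ^ m) f'), f⟫_ℂ‖ ≤ B) →
      (∀ i < m, ∃ (w w' : Space n → ℝ) (a a' : ℝ), IsMultiplier w ∧ IsMultiplier w' ∧
        (∀ x, 0 < w x) ∧ (∀ x, 0 < w' x) ∧ (∀ x, bracket x ^ (1 - δ) ≤ w x * w' x) ∧
        (∀ α, ‖mulOp w (jet h α ((resolventOp P (conj z) ^ (i + 1)) f'))‖ ≤ a) ∧
        (∀ α, ‖mulOp w' (jet h α ((resolventOp P z ^ (m - i)) f))‖ ≤ a') ∧ a * a' ≤ S) →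
      2 * h * m * ‖⟪f', z • (resolventOp P z ^ (m + 1)) f + (resolventOp P z ^ m) f⟫_ℂ‖
        ≤ 2 * B + K * (h * (m * S)) := by
  obtain ⟨K, hK, H⟩ := exists_norm_inner_conjOp_sub_add_le n hC
  refine ⟨K, hK, ?_⟩
  intro δ h P M V hδ hF z hz m f f' B S hB hS
  have hP := hF.isSelfAdjoint
  have hh := hF.h_pos.le
  have hz' : (conj z).im ≠ 0 := by simpa using hz
  set R := resolventOp P z with hR
  set R' := resolventOp P (conj z) with hR'
  set D : ℂ := ⟪f', z • (R ^ (m + 1)) f + (R ^ m) f⟫_ℂ with hD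
  set E : ℝ → ℝ := fun γ => ∑ i ∈ Finset.range m,
    ((∑ α, ‖jet h α ((R' ^ (i + 1)) f')‖) * (∑ α, ‖mulOp (defect γ) (jet h α ((R ^ (m - i)) f))‖)
      + (∑ α, ‖jet h α ((R ^ (m - i)) f)‖) *
        (∑ α, ‖mulOp (defect γ) (jet h α ((R' ^ (i + 1)) f'))‖)) with hE
  have hsingle : ∀ (F : Option (Fin n) → L2 n) (α : Option (Fin n)), ‖F α‖ ≤ ∑ α, ‖F α‖ :=
    fun F α => Finset.single_le_sum (f := fun α => ‖F α‖) (fun _ _ => norm_nonneg _)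
      (Finset.mem_univ α)
  have key : ∀ γ ∈ Set.Ioc (0 : ℝ) 1, 2 * h * m * ‖D‖ ≤ 2 * B + K * (h * (m * S)) + K * E γ := by
    intro γ hγ
    have hg := smoothField_radial (n := n) hγ.1
    -- The operator is inserted after the first i of m resolvents, and consecutive terms differ by a
    -- commutator with P. At i = m it would act on f, which need not have derivatives, so there it
    -- acts on the left factor.
    set s : ℕ → ℂ := fun i => if i = m then ⟪conjOp h (radial γ) ((R' ^ m) f'), f⟫_ℂ
      else ⟪(R' ^ i) f', conjOp h (radial γ) ((R ^ (m - i)) f)⟫_ℂ with hs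
    have hT : ∀ i ∈ Finset.range m, ‖s i - s (i + 1) + 2 * (Complex.I * h) * D‖
        ≤ K * (h * S) + K * ((∑ α, ‖jet h α ((R' ^ (i + 1)) f')‖) *
          (∑ α, ‖mulOp (defect γ) (jet h α ((R ^ (m - i)) f))‖)
          + (∑ α, ‖jet h α ((R ^ (m - i)) f)‖) *
          (∑ α, ‖mulOp (defect γ) (jet h α ((R' ^ (i + 1)) f'))‖)) := by
      intro i hi
      rw [Finset.mem_range] at hi
      obtain ⟨w, w', a, a', hw, hw', hw0, hw0', hww, ha, ha', haa⟩ := hS i hi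
      obtain ⟨v, hv, hPv⟩ := exists_pow_resolventOp hP hz' i f'
      obtain ⟨u, hu, hPu⟩ := exists_pow_resolventOp hP hz (m - i - 1) f
      have hmi : m - i - 1 + 1 = m - i := by omega
      rw [hmi] at hu hPu
      rw [← hu] at ha' hPu ⊢
      rw [← hv] at ha hPv ⊢
      have h1 := H δ h γ P M V w w' hδ hγ.1 hF hw hw' hw0 hw0' hww u v a a' _ _ _ _ ha ha'
        (hsingle fun α => jet h α (v : L2 n)) (hsingle fun α => jet h α (u : L2 n))
        (hsingle fun α => mulOp (defect γ) (jet h α (v : L2 n)))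
        (hsingle fun α => mulOp (defect γ) (jet h α (u : L2 n)))
      -- All m commutators have the same leading term, since powers of the resolvent recombine
      -- across the inner product.
      have e1 : ⟪(v : L2 n), P u⟫_ℂ = D := by
        rw [hPu, hu, hv, hD, inner_pow_resolventOp_conj hP hz, map_add, map_smul]
        have e2 : ∀ k l : ℕ, (resolventOp P z ^ k) ((resolventOp P z ^ l) f) = (R ^ (k + l)) f :=
          fun k l => by rw [pow_add]; rfl
        have e4 : i + 1 + (m - i) = m + 1 := by omega
        have e5 : i + 1 + (m - i - 1) = m := by omega
        rw [e2, e2, e4, e5]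
      have e3 : ⟪P v, conjOp h (radial γ) (u : L2 n)⟫_ℂ - ⟪conjOp h (radial γ) (v : L2 n), P u⟫_ℂ
          = s i - s (i + 1) := by
        have hsym := inner_conjOp_left hg (hF.inH2 v).1 (hF.inH2 u).1
        have s1 : s i = ⟪(R' ^ i) f', conjOp h (radial γ) (u : L2 n)⟫_ℂ := by
          rw [hs]
          simp only [hi.ne, if_false, hu]
          rfl
        have s2 : s (i + 1) = ⟪conjOp h (radial γ) (v : L2 n), (R ^ (m - i - 1)) f⟫_ℂ := by
          rw [hs]
          by_cases him : i + 1 = m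
          · have : m - i - 1 = 0 := by omega
            simp only [him, if_true, this, pow_zero]
            rw [hv, him]
            rfl
          · obtain ⟨u', hu', -⟩ := exists_pow_resolventOp hP hz (m - i - 2) f
            have h3 : m - i - 2 + 1 = m - i - 1 := by omega
            have h4 : m - (i + 1) = m - i - 1 := by omega
            simp only [him, if_false, h4]
            rw [h3] at hu'
            rw [← hu', ← hv]
            exact (inner_conjOp_left hg (hF.inH2 v).1 (hF.inH2 u').1).symm
        rw [s1, s2, hPv, hPu, inner_add_left, inner_add_right, inner_smul_left, inner_smul_right,
          hsym, Complex.conj_conj]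
        ring
      rw [e1, e3] at h1
      refine h1.trans (add_le_add ?_ le_rfl)
      gcongr
    have hsum : s 0 - s m + 2 * (Complex.I * h) * (m * D)
        = ∑ i ∈ Finset.range m, (s i - s (i + 1) + 2 * (Complex.I * h) * D) := by
      rw [Finset.sum_add_distrib, Finset.sum_range_sub']
      simp
      ring
    have h2 : ‖s 0 - s m + 2 * (Complex.I * h) * (m * D)‖ ≤ K * (h * (m * S)) + K * E γ := by
      rw [hsum]
      refine (norm_sum_le_of_le _ hT).trans ?_
      rw [Finset.sum_add_distrib, Finset.sum_const, Finset.card_range, nsmul_eq_mul,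
        ← Finset.mul_sum]
      exact add_le_add (le_of_eq (by ring)) le_rfl
    have hs0 : ‖s 0‖ ≤ B := by
      rw [hs]
      by_cases hm : 0 = m
      · simp only [hm, if_true]
        have := (hB γ hγ).2
        rw [← hm] at this ⊢
        exact this
      · simp only [hm, if_false]
        exact (hB γ hγ).1
    have hsm : ‖s m‖ ≤ B := by
      rw [hs]
      simp only [if_true]
      exact (hB γ hγ).2
    have h3 : ‖2 * (Complex.I * h) * (m * D)‖ = 2 * h * m * ‖D‖ := by
      have e6 : ‖Complex.I * (h : ℂ)‖ = h := by
        rw [← norm_neg, norm_neg_I_mul hh]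
      rw [norm_mul, norm_mul (2 : ℂ), e6, norm_mul, Complex.norm_ofNat, Complex.norm_natCast]
      ring
    rw [← h3]
    have e5 : 2 * (Complex.I * h) * (m * D)
        = (s 0 - s m + 2 * (Complex.I * h) * (m * D)) - (s 0 - s m) := by ring
    rw [e5]
    refine (norm_sub_le _ _).trans ?_
    have := norm_sub_le (s 0) (s m)
    linarith
  -- B and S do not depend on γ, so γ → 0 removes the defect terms alone.
  have hElim : Tendsto (fun k : ℕ => 2 * B + K * (h * (m * S)) + K * E (1 / ((k : ℝ) + 1))) atTop
      (𝓝 (2 * B + K * (h * (m * S)) + K * 0)) := by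
    refine Tendsto.const_add _ (Tendsto.const_mul _ ?_)
    have h1 : ∀ i ∈ Finset.range m, Tendsto (fun k : ℕ =>
        (∑ α, ‖jet h α ((R' ^ (i + 1)) f')‖) *
          (∑ α, ‖mulOp (defect (1 / ((k : ℝ) + 1))) (jet h α ((R ^ (m - i)) f))‖)
          + (∑ α, ‖jet h α ((R ^ (m - i)) f)‖) *
          (∑ α, ‖mulOp (defect (1 / ((k : ℝ) + 1))) (jet h α ((R' ^ (i + 1)) f'))‖)) atTop
        (𝓝 0) := by
      intro i _
      have := ((tendsto_sum_norm_defect fun α => jet h α ((R ^ (m - i)) f)).const_mul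
        (∑ α, ‖jet h α ((R' ^ (i + 1)) f')‖)).add
        ((tendsto_sum_norm_defect fun α => jet h α ((R' ^ (i + 1)) f')).const_mul
        (∑ α, ‖jet h α ((R ^ (m - i)) f)‖))
      simpa only [mul_zero, add_zero] using this
    simpa only [Finset.sum_const_zero] using tendsto_finsetSum _ h1
  rw [mul_zero, add_zero] at hElim
  refine ge_of_tendsto' hElim fun k => key _ ⟨by positivity, ?_⟩
  rw [div_le_one (by positivity)]
  linarith [Nat.cast_nonneg (α := ℝ) k]

end ResolventPowers

end SemiclassicalDecay

end

noncomputable section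

namespace SemiclassicalDecay

/-! ### The weights ⟨x⟩^a ⟨γx⟩^b -/

section PowerWeights

variable {n : ℕ}

theorem bracket_rpow_eq {E : Type*} [NormedAddCommGroup E] (a : ℝ) (x : E) :
    bracket x ^ a = (1 + ‖x‖ ^ 2) ^ (a / 2) := by
  unfold bracket
  rw [Real.sqrt_eq_rpow, ← Real.rpow_mul (by positivity)]
  congr 1
  ring

theorem contDiff_bracket_rpow (a : ℝ) : ContDiff ℝ 1 fun x : Space n => bracket x ^ a := by
  simp only [bracket_rpow_eq]
  exact (contDiff_const.add (contDiff_norm_sq ℝ)).rpow_const_of_ne fun x => by positivity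

theorem fderiv_bracket_rpow (a : ℝ) (j : Fin n) (x : Space n) :
    fderiv ℝ (fun x : Space n => bracket x ^ a) x (stdVec j) = bracket x ^ a * (a * logGrad j x) := by
  have h0 : (0 : ℝ) < 1 + ‖x‖ ^ 2 := by positivity
  simp only [bracket_rpow_eq]
  rw [((hasFDerivAt_one_add_norm_sq x).rpow_const (p := a / 2) (Or.inl h0.ne')).fderiv]
  simp only [logGrad, invSq, smul_apply, innerSL_apply_apply, inner_stdVec, smul_eq_mul,
    nsmul_eq_mul, Real.rpow_sub_one h0.ne']
  push_cast
  field_simp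

/-- The weights `⟨x⟩^a ⟨γx⟩^b`. -/
def powWeight (a b γ : ℝ) (x : Space n) : ℝ := bracket x ^ a * bracket (γ • x) ^ b

/-- The logarithmic gradient of `powWeight a b γ`. -/
def powLog (a b γ : ℝ) : Option (Fin n) → Space n → ℝ
  | none, _ => 0
  | some j, x => a * logGrad j x + b * γ * logGrad j (γ • x)

theorem powWeight_pos (a b γ : ℝ) (x : Space n) : 0 < powWeight a b γ x :=
  mul_pos (Real.rpow_pos_of_pos (bracket_pos _) _) (Real.rpow_pos_of_pos (bracket_pos _) _)

theorem contDiff_powWeight (a b γ : ℝ) : ContDiff ℝ 1 (powWeight (n := n) a b γ) :=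
  (contDiff_bracket_rpow a).mul ((contDiff_bracket_rpow b).comp (contDiff_const_smul γ))

theorem fderiv_powWeight (a b γ : ℝ) (j : Fin n) (x : Space n) :
    fderiv ℝ (powWeight a b γ) x (stdVec j) = powWeight a b γ x * powLog a b γ (some j) x := by
  have h1 : DifferentiableAt ℝ (fun x : Space n => bracket x ^ a) x :=
    (contDiff_bracket_rpow a).differentiable one_ne_zero x
  have h2 : DifferentiableAt ℝ (fun x : Space n => bracket (γ • x) ^ b) x :=
    ((contDiff_bracket_rpow b).comp (contDiff_const_smul γ)).differentiable one_ne_zero x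
  have h3 : fderiv ℝ (powWeight a b γ) x = _ := fderiv_fun_mul h1 h2
  rw [h3]
  simp only [add_apply, smul_apply, smul_eq_mul, fderiv_bracket_rpow]
  rw [fderiv_comp_smul_apply (fun x : Space n => bracket x ^ b), fderiv_bracket_rpow]
  unfold powWeight powLog
  ring

theorem abs_powLog_le {a b γ : ℝ} (hγ : 0 ≤ γ) (hγ1 : γ ≤ 1) (α : Option (Fin n)) (x : Space n) :
    |powLog a b γ α x| ≤ 3 * (|a| + |b|) := by
  have ha := abs_nonneg a
  have hb := abs_nonneg b
  cases α with
  | none =>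
    simp only [powLog, abs_zero]
    positivity
  | some j =>
    simp only [powLog]
    refine (abs_add_le _ _).trans ?_
    rw [abs_mul, abs_mul, abs_mul, abs_of_nonneg hγ]
    have h1 := abs_logGrad_le j x
    have h2 := abs_logGrad_le j (γ • x)
    have h3 : |b| * γ * |logGrad j (γ • x)| ≤ |b| * 1 * 1 := by gcongr
    have h4 : |a| * |logGrad j x| ≤ |a| * 1 := by gcongr
    linarith

theorem fderiv_powLog (a b γ : ℝ) (j k : Fin n) (x : Space n) :
    fderiv ℝ (powLog a b γ (some j)) x (stdVec k)
      = a * fderiv ℝ (logGrad j) x (stdVec k)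
        + b * γ * (γ * fderiv ℝ (logGrad j) (γ • x) (stdVec k)) := by
  have h1 : DifferentiableAt ℝ (logGrad j) x := (c1Bounded_logGrad j).differentiable x
  have h2 : DifferentiableAt ℝ (fun x : Space n => logGrad j (γ • x)) x :=
    ((c1Bounded_logGrad j).comp_smul γ).differentiable x
  have h3 : fderiv ℝ (powLog a b γ (some j)) x = _ :=
    fderiv_fun_add (h1.const_mul a) (h2.const_mul (b * γ))
  rw [h3, fderiv_const_mul h1, fderiv_const_mul h2, ← fderiv_comp_smul_apply]
  rfl

/-- Boundedness of the weight enters only qualitatively. The constant depends on a and b alone, so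
estimates for growing weights are uniform as γ → 0. -/
theorem logWeight_powWeight {a b γ : ℝ} (hγ : 0 ≤ γ) (hγ1 : γ ≤ 1)
    (hbd : ∃ D : ℝ, ∀ x : Space n, powWeight a b γ x ≤ D) :
    LogWeight (3 * (|a| + |b|)) (powWeight (n := n) a b γ) (powLog a b γ) := by
  have ha := abs_nonneg a
  have hb := abs_nonneg b
  obtain ⟨D, hD⟩ := hbd
  refine ⟨powWeight_pos a b γ, ⟨contDiff_powWeight a b γ, ⟨D, fun x => ?_⟩,
    ⟨D * (3 * (|a| + |b|)), fun j x => ?_⟩⟩, fun x => rfl, fderiv_powWeight a b γ, fun α => ?_,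
    abs_powLog_le hγ hγ1, fun α k x => ?_⟩
  · rw [abs_of_pos (powWeight_pos _ _ _ _)]
    exact hD x
  · rw [fderiv_powWeight, abs_mul, abs_of_pos (powWeight_pos _ _ _ _)]
    exact mul_le_mul (hD x) (abs_powLog_le hγ hγ1 _ x) (abs_nonneg _)
      ((powWeight_pos a b γ x).le.trans (hD x))
  · cases α with
    | none => exact C1Bounded.const 0
    | some j =>
      exact ((C1Bounded.const a).mul (c1Bounded_logGrad j)).add
        ((C1Bounded.const (b * γ)).mul ((c1Bounded_logGrad j).comp_smul γ))
  · cases α with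
    | none =>
      have : powLog a b γ none = fun _ : Space n => (0 : ℝ) := rfl
      rw [this, fderiv_fun_const]
      simp only [Pi.zero_apply, zero_apply, abs_zero]
      positivity
    | some j =>
      rw [fderiv_powLog]
      refine (abs_add_le _ _).trans ?_
      rw [abs_mul, abs_mul, abs_mul, abs_mul, abs_of_nonneg hγ]
      have h1 := abs_fderiv_logGrad_le j k x
      have h2 := abs_fderiv_logGrad_le j k (γ • x)
      have h3 : |b| * γ * (γ * |fderiv ℝ (logGrad j) (γ • x) (stdVec k)|) ≤ |b| * 1 * (1 * 3) := by
        gcongr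
      have h4 : |a| * |fderiv ℝ (logGrad j) x (stdVec k)| ≤ |a| * 3 := by gcongr
      linarith

theorem powWeight_zero_right (a γ : ℝ) :
    powWeight (n := n) a 0 γ = fun x => bracket x ^ a := by
  funext x
  simp [powWeight]

theorem powWeight_neg (a γ : ℝ) :
    powWeight (n := n) a (-a) γ = fun x => (bracket x / bracket (γ • x)) ^ a := by
  funext x
  rw [powWeight, Real.div_rpow (bracket_pos _).le (bracket_pos _).le,
    Real.rpow_neg (bracket_pos _).le, div_eq_mul_inv]

theorem bracket_div_le_inv {γ : ℝ} (hγ : 0 < γ) (hγ1 : γ ≤ 1) (x : Space n) :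
    bracket x / bracket (γ • x) ≤ γ⁻¹ := by
  rw [div_le_iff₀ (bracket_pos _), inv_mul_eq_div, le_div_iff₀ hγ]
  refine abs_le_of_sq_le_sq' ?_ (bracket_pos _).le |>.2
  rw [mul_pow, bracket_sq, bracket_sq, norm_smul, mul_pow, Real.norm_of_nonneg hγ.le]
  nlinarith [sq_nonneg ‖x‖]

theorem logWeight_bracket_neg {c : ℝ} (hc : 0 ≤ c) :
    LogWeight (3 * c) (fun x : Space n => bracket x ^ (-c)) (powLog (-c) 0 0) := by
  have := logWeight_powWeight (n := n) (a := -c) (b := 0) (γ := 0) le_rfl zero_le_one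
    ⟨1, fun x => by
      rw [powWeight_zero_right]
      exact bracket_rpow_neg_le_one hc x⟩
  rwa [powWeight_zero_right, abs_neg, abs_of_nonneg hc, abs_zero, add_zero] at this

theorem logWeight_bracket_div {a γ : ℝ} (ha : 0 ≤ a) (hγ : 0 < γ) (hγ1 : γ ≤ 1) :
    LogWeight (6 * a) (fun x : Space n => (bracket x / bracket (γ • x)) ^ a)
      (powLog a (-a) γ) := by
  have := logWeight_powWeight (n := n) (a := a) (b := -a) (γ := γ) hγ.le hγ1
    ⟨(γ⁻¹) ^ a, fun x => by
      rw [powWeight_neg]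
      exact Real.rpow_le_rpow (div_pos (bracket_pos _) (bracket_pos _)).le
        (bracket_div_le_inv hγ hγ1 x) ha⟩
  rw [powWeight_neg, abs_neg, abs_of_nonneg ha] at this
  convert this using 1
  ring

/-- For the square root of `⟨x⟩ / ⟨γx⟩` the derivative of the square is bounded. -/
theorem abs_sq_mul_powLog_le {γ : ℝ} (hγ : 0 < γ) (hγ1 : γ ≤ 1) (α : Option (Fin n))
    (x : Space n) :
    |(bracket x / bracket (γ • x)) ^ (1 / 2 : ℝ) * (bracket x / bracket (γ • x)) ^ (1 / 2 : ℝ)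
      * powLog (1 / 2) (-(1 / 2)) γ α x| ≤ 1 := by
  set W := bracket x / bracket (γ • x) with hW
  have hW0 : 0 < W := div_pos (bracket_pos _) (bracket_pos _)
  rw [← Real.rpow_add hW0, show (1 / 2 : ℝ) + 1 / 2 = 1 by norm_num, Real.rpow_one]
  cases α with
  | none => simp [powLog]
  | some j =>
    have e1 : W * |logGrad j x| ≤ 1 := by
      rw [logGrad, abs_mul, abs_of_pos (invSq_pos x), invSq_eq]
      have h1 : |x j| ≤ bracket x := (abs_coord_le x j).trans (norm_le_bracket x)
      have h2 := bracket_pos x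
      calc W * (|x j| * (bracket x ^ 2)⁻¹) ≤ bracket x * (bracket x * (bracket x ^ 2)⁻¹) := by
            gcongr
            exact bracket_div_le x
        _ = 1 := by field_simp
    have e2 : W * (γ * |logGrad j (γ • x)|) ≤ 1 := by
      rw [logGrad, abs_mul, abs_of_pos (invSq_pos _), invSq_eq]
      have h1 : |(γ • x) j| ≤ bracket (γ • x) := (abs_coord_le _ j).trans (norm_le_bracket _)
      have h2 := bracket_pos (γ • x)
      calc W * (γ * (|(γ • x) j| * (bracket (γ • x) ^ 2)⁻¹))
          ≤ γ⁻¹ * (γ * (bracket (γ • x) * (bracket (γ • x) ^ 2)⁻¹)) := by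
            gcongr
            exact bracket_div_le_inv hγ hγ1 x
        _ = (bracket (γ • x))⁻¹ := by field_simp
        _ ≤ 1 := inv_le_one_of_one_le₀ (one_le_bracket _)
    simp only [powLog]
    rw [abs_mul, abs_of_pos hW0]
    have h3 : |1 / 2 * logGrad j x + -(1 / 2) * γ * logGrad j (γ • x)|
        ≤ 1 / 2 * |logGrad j x| + 1 / 2 * (γ * |logGrad j (γ • x)|) := by
      refine (abs_add_le _ _).trans (le_of_eq ?_)
      simp only [abs_mul, abs_neg, abs_of_pos hγ]
      norm_num
      ring
    calc W * |1 / 2 * logGrad j x + -(1 / 2) * γ * logGrad j (γ • x)|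
        ≤ W * (1 / 2 * |logGrad j x| + 1 / 2 * (γ * |logGrad j (γ • x)|)) := by gcongr
      _ ≤ 1 := by linarith

end PowerWeights

end SemiclassicalDecay

end

noncomputable section

namespace SemiclassicalDecay

/-! ### Calculus of the rates μ^p T^{k-p} -/

section Rate

/-- The rate `μ^p T^{k-p}`. -/
def rate (μ T k p : ℝ) : ℝ := μ ^ p * T ^ (k - p)

variable {μ T k p : ℝ}

theorem rate_pos (hμ : 1 ≤ μ) (hT : μ ≤ T) : 0 < rate μ T k p :=
  mul_pos (Real.rpow_pos_of_pos (by linarith) _) (Real.rpow_pos_of_pos (by linarith) _)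

/-- Because μ ≤ T, exchanging a power of T for a power of μ improves the bound: a larger p is a
stronger statement. -/
theorem rate_anti (hμ : 1 ≤ μ) (hT : μ ≤ T) {p' : ℝ} (hp : p ≤ p') :
    rate μ T k p' ≤ rate μ T k p := by
  have hμ0 : 0 < μ := by linarith
  have hT0 : 0 < T := by linarith
  have h1 : μ ^ p' = μ ^ p * μ ^ (p' - p) := by
    rw [← Real.rpow_add hμ0]
    congr 1
    ring
  have h2 : T ^ (k - p) = T ^ (k - p') * T ^ (p' - p) := by
    rw [← Real.rpow_add hT0]
    congr 1
    ring
  unfold rate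
  rw [h1, h2]
  have h3 : μ ^ (p' - p) ≤ T ^ (p' - p) := Real.rpow_le_rpow hμ0.le hT (by linarith)
  have h4 : 0 ≤ μ ^ p := by positivity
  have h5 : 0 ≤ T ^ (k - p') := by positivity
  calc μ ^ p * μ ^ (p' - p) * T ^ (k - p') = (μ ^ p * T ^ (k - p')) * μ ^ (p' - p) := by ring
    _ ≤ (μ ^ p * T ^ (k - p')) * T ^ (p' - p) := by gcongr
    _ = _ := by ring

theorem rate_mono (hμ : 1 ≤ μ) (hT : μ ≤ T) {k' : ℝ} (hk : k ≤ k') :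
    rate μ T k p ≤ rate μ T k' p := by
  have hμ0 : 0 < μ := by linarith
  unfold rate
  gcongr
  exact hμ.trans hT

theorem mul_rate_mul_rate (hμ : 1 ≤ μ) (hT : μ ≤ T) (k' p' : ℝ) :
    rate μ T k p * rate μ T k' p' = rate μ T (k + k') (p + p') := by
  have hμ0 : 0 < μ := by linarith
  have hT0 : 0 < T := by linarith
  unfold rate
  rw [show k + k' - (p + p') = (k - p) + (k' - p') by ring, Real.rpow_add hμ0, Real.rpow_add hT0]
  ring

theorem rate_rpow_mul_rate_rpow (hμ : 1 ≤ μ) (hT : μ ≤ T) (p' θ : ℝ) :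
    rate μ T k p ^ (1 - θ) * rate μ T k p' ^ θ = rate μ T k ((1 - θ) * p + θ * p') := by
  have hμ0 : 0 < μ := by linarith
  have hT0 : 0 < T := by linarith
  unfold rate
  rw [Real.mul_rpow (by positivity) (by positivity), Real.mul_rpow (by positivity) (by positivity),
    ← Real.rpow_mul hμ0.le, ← Real.rpow_mul hT0.le, ← Real.rpow_mul hμ0.le, ← Real.rpow_mul hT0.le,
    show k - ((1 - θ) * p + θ * p') = (k - p) * (1 - θ) + (k - p') * θ by ring,
    show (1 - θ) * p + θ * p' = p * (1 - θ) + p' * θ by ring, Real.rpow_add hμ0, Real.rpow_add hT0]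
  ring

theorem rate_zero_right (T k : ℝ) : rate μ T k 0 = T ^ k := by simp [rate]

theorem mul_rate_sub_one (hμ : 1 ≤ μ) : μ * rate μ T (k - 1) (p - 1) = rate μ T k p := by
  have hμ0 : 0 < μ := by linarith
  unfold rate
  rw [show k - 1 - (p - 1) = k - p by ring, Real.rpow_sub_one hμ0.ne']
  field_simp

end Rate

/-! ### Admissible spectral parameters and decaying weights -/

section Sample

open scoped InnerProductSpace ComplexConjugate

variable {n : ℕ}

/-- The spectral parameters `z` and the operators for which the limiting absorption principle
gives resolvent bounds, with constants that do not depend on the parameters. -/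
structure ResolventSample (δ C r : ℝ) (L : ℝ → ℝ) (L' : ℝ → ℝ → ℝ) (h : ℝ)
    (P : L2 n →ₗ.[ℂ] L2 n) (M : Option (Fin n) → Option (Fin n) → Space n → ℝ) (V : Space n → ℝ)
    (μ : ℝ) (z : ℂ) : Prop where
  hasForm : HasForm δ C h P M V
  inv_le : h⁻¹ ≤ μ
  im_ne : z.im ≠ 0
  le_inv : μ ≤ |z.im|⁻¹
  le_norm : r ≤ ‖z‖
  norm_le : ‖z‖ ≤ C
  energy : ∀ b, 1 / 2 < b → ∀ f, ‖resolventOp P z (weightOp n b f)‖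
    ≤ L b * rate μ |z.im|⁻¹ 1 (1 / 2) * ‖f‖
  sandwich : ∀ b p, 1 / 2 < b → p < 1 →
    ‖weightOp n b ∘L resolventOp P z ∘L weightOp n b‖ ≤ L' b p * rate μ |z.im|⁻¹ 1 p

theorem star_weightOp {r : ℝ} (hr : 0 ≤ r) : star (weightOp n r) = weightOp n r := by
  have hm : IsMultiplier fun x : Space n => bracket x ^ (-r) :=
    (logWeight_bracket_neg hr).c1Bounded.isMultiplier
  rw [ContinuousLinearMap.star_eq_adjoint, eq_comm, ContinuousLinearMap.eq_adjoint_iff]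
  intro f g
  exact inner_mulOp_left hm f g

theorem norm_pow_resolventOp_le {H : Type*} [NormedAddCommGroup H] [InnerProductSpace ℂ H]
    [CompleteSpace H] {P : H →ₗ.[ℂ] H} (hP : IsSelfAdjoint P) {z : ℂ} (hz : z.im ≠ 0) (k : ℕ)
    (f : H) :
    ‖(resolventOp P z ^ k) f‖ ≤ |z.im|⁻¹ ^ k * ‖f‖ := by
  induction k with
  | zero => simp
  | succ k ih =>
    rw [pow_succ', pow_succ', mul_assoc, mul_apply_eq_comp]
    exact (ContinuousLinearMap.le_opNorm _ _).trans (mul_le_mul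
      (norm_resolventOp_le hP hz) ih (norm_nonneg _) (by positivity))

/-- R(conj z) is the adjoint of the normal operator R(z). All bounds thus hold in both half planes
once they hold in one. -/
theorem norm_resolventOp_conj {H : Type*} [NormedAddCommGroup H] [InnerProductSpace ℂ H]
    [CompleteSpace H] {P : H →ₗ.[ℂ] H} (hP : IsSelfAdjoint P) {z : ℂ} (hz : z.im ≠ 0) (g : H) :
    ‖resolventOp P (conj z) g‖ = ‖resolventOp P z g‖ := by
  have hz' : (conj z).im ≠ 0 := by simpa using hz
  have h1 : ∀ w : ℂ, w.im ≠ 0 → ⟪resolventOp P w g, resolventOp P w g⟫_ℂ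
      = ⟪g, (resolventOp P (conj w) * resolventOp P w) g⟫_ℂ := by
    intro w hw
    have := inner_pow_resolventOp_conj hP (z := conj w) (by simpa using hw) 1 g
      (resolventOp P w g)
    simpa using this
  have h2 : ⟪resolventOp P (conj z) g, resolventOp P (conj z) g⟫_ℂ
      = ⟪resolventOp P z g, resolventOp P z g⟫_ℂ := by
    rw [h1 _ hz', h1 _ hz, Complex.conj_conj, resolventOp_mul_comm hP hz hz']
  rw [inner_self_eq_norm_sq_to_K, inner_self_eq_norm_sq_to_K] at h2
  have h3 : ‖resolventOp P (conj z) g‖ ^ 2 = ‖resolventOp P z g‖ ^ 2 := by exact_mod_cast h2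
  exact (sq_eq_sq₀ (norm_nonneg _) (norm_nonneg _)).1 h3

variable {δ C r : ℝ} {L : ℝ → ℝ} {L' : ℝ → ℝ → ℝ} {h : ℝ} {P : L2 n →ₗ.[ℂ] L2 n}
  {M : Option (Fin n) → Option (Fin n) → Space n → ℝ} {V : Space n → ℝ} {μ : ℝ} {z : ℂ}

theorem norm_sandwich_conj (hP : IsSelfAdjoint P) (hz : z.im ≠ 0) {b : ℝ} (hb : 0 ≤ b) :
    ‖weightOp n b ∘L resolventOp P (conj z) ∘L weightOp n b‖
      = ‖weightOp n b ∘L resolventOp P z ∘L weightOp n b‖ := by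
  have h1 : weightOp n b ∘L resolventOp P (conj z) ∘L weightOp n b
      = star (weightOp n b ∘L resolventOp P z ∘L weightOp n b) := by
    change weightOp n b * (resolventOp P (conj z) * weightOp n b)
      = star (weightOp n b * (resolventOp P z * weightOp n b))
    rw [star_mul, star_mul, star_weightOp hb, star_resolventOp hP hz, mul_assoc]
  rw [h1, ContinuousLinearMap.star_eq_adjoint, LinearIsometryEquiv.norm_map]

namespace ResolventSample

theorem conjugate (hS : ResolventSample δ C r L L' h P M V μ z) :
    ResolventSample δ C r L L' h P M V μ (conj z) where
  hasForm := hS.hasForm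
  inv_le := hS.inv_le
  im_ne := by simpa using hS.im_ne
  le_inv := by simpa using hS.le_inv
  le_norm := by simpa using hS.le_norm
  norm_le := by simpa using hS.norm_le
  energy b hb f := by
    rw [norm_resolventOp_conj hS.hasForm.isSelfAdjoint hS.im_ne]
    simpa using hS.energy b hb f
  sandwich b p hb hp := by
    rw [norm_sandwich_conj hS.hasForm.isSelfAdjoint hS.im_ne (by linarith)]
    simpa using hS.sandwich b p hb hp

theorem one_le (hS : ResolventSample δ C r L L' h P M V μ z) : 1 ≤ μ :=
  ((one_le_inv₀ hS.hasForm.h_pos).2 hS.hasForm.h_le_one).trans hS.inv_le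

end ResolventSample

theorem norm_weightOp_le {c : ℝ} (hc : 0 ≤ c) (f : L2 n) : ‖weightOp n c f‖ ≤ ‖f‖ := by
  have := norm_mulOp_le (logWeight_bracket_neg (n := n) hc).c1Bounded.isMultiplier (C := 1)
    (ae_of_all _ fun x => by
      rw [abs_of_pos (Real.rpow_pos_of_pos (bracket_pos x) _)]
      exact bracket_rpow_neg_le_one hc x) f
  rwa [one_mul] at this

theorem norm_weightOp_anti {c c' : ℝ} (hc : 0 ≤ c) (hcc : c ≤ c') (f : L2 n) :
    ‖weightOp n c' f‖ ≤ ‖weightOp n c f‖ := by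
  have := norm_mulOp_le_of_abs_le (logWeight_bracket_neg (n := n) (hc.trans hcc)).c1Bounded.isMultiplier
    (logWeight_bracket_neg (n := n) hc).c1Bounded.isMultiplier (C := 1)
    (ae_of_all _ fun x => by
      rw [abs_of_pos (Real.rpow_pos_of_pos (bracket_pos x) _),
        abs_of_pos (Real.rpow_pos_of_pos (bracket_pos x) _), one_mul]
      exact Real.rpow_le_rpow_of_exponent_le (one_le_bracket x) (by linarith)) f
  rwa [one_mul] at this

theorem weightOp_weightOp {c c' : ℝ} (hc : 0 ≤ c) (hc' : 0 ≤ c') (f : L2 n) :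
    weightOp n c (weightOp n c' f) = weightOp n (c + c') f := by
  rw [weightOp_eq_mulOp, weightOp_eq_mulOp, weightOp_eq_mulOp, mulOp_mulOp
    (logWeight_bracket_neg hc).c1Bounded.isMultiplier
    (logWeight_bracket_neg hc').c1Bounded.isMultiplier]
  congr 2
  funext x
  rw [← Real.rpow_add (bracket_pos x)]
  congr 1
  ring

theorem norm_weightOp_interpolate {c θ : ℝ} (hc : 0 ≤ c) (hθ : 0 ≤ θ) (hθ1 : θ ≤ 1) (f : L2 n) :
    ‖weightOp n (θ * c) f‖ ≤ ‖f‖ ^ (1 - θ) * ‖weightOp n c f‖ ^ θ := by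
  have := norm_mulOp_le_rpow_mul_rpow
    (logWeight_bracket_neg (n := n) (mul_nonneg hθ hc)).c1Bounded.isMultiplier
    (IsMultiplier.const 1) (logWeight_bracket_neg (n := n) hc).c1Bounded.isMultiplier hθ hθ1
    (ae_of_all _ fun x => by
      rw [abs_of_pos (Real.rpow_pos_of_pos (bracket_pos x) _),
        abs_of_pos (Real.rpow_pos_of_pos (bracket_pos x) _), abs_one, Real.one_rpow, one_mul,
        ← Real.rpow_mul (bracket_pos x).le]
      exact le_of_eq (by congr 1; ring)) f
  rwa [mulOp_const, show ((1 : ℝ) : ℂ) • f = f by simp] at this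

end Sample

end SemiclassicalDecay

end

noncomputable section

namespace SemiclassicalDecay

/-! ### Weighted bounds, their interpolation, and growth in x -/

section DecayBounds

open scoped InnerProductSpace ComplexConjugate

variable {n : ℕ}

/-- The weighted bound `‖⟨x⟩^{-c} D^α R(z)^k ⟨x⟩^{-b}‖ ≤ K μ^p T^{k-p}`, `T = 1/|Im z|`, for the
components `α ∈ A` of the jet, with a constant that does not depend on the sample. -/
def DecayBound (A : Set (Option (Fin n))) (δ C r : ℝ) (L : ℝ → ℝ) (L' : ℝ → ℝ → ℝ) (k : ℕ)
    (c b p : ℝ) : Prop :=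
  ∃ K : ℝ, 0 ≤ K ∧ ∀ (h : ℝ) (P : L2 n →ₗ.[ℂ] L2 n)
    (M : Option (Fin n) → Option (Fin n) → Space n → ℝ) (V : Space n → ℝ) (μ : ℝ) (z : ℂ),
    ResolventSample δ C r L L' h P M V μ z → ∀ f, ∀ α ∈ A,
      ‖weightOp n c (jet h α ((resolventOp P z ^ k) (weightOp n b f)))‖
        ≤ K * rate μ |z.im|⁻¹ k p * ‖f‖

variable {A : Set (Option (Fin n))} {δ C r : ℝ} {L : ℝ → ℝ} {L' : ℝ → ℝ → ℝ} {k : ℕ}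
  {c c' b b' p p' : ℝ}

namespace DecayBound

theorem anti (H : DecayBound A δ C r L L' k c b p') (hp : p ≤ p') :
    DecayBound A δ C r L L' k c b p := by
  obtain ⟨K, hK, H⟩ := H
  refine ⟨K, hK, fun h P M V μ z hS f α hα => (H h P M V μ z hS f α hα).trans ?_⟩
  gcongr
  exact rate_anti hS.one_le hS.le_inv hp

theorem mono_left (H : DecayBound A δ C r L L' k c b p) (hc : 0 ≤ c) (hcc : c ≤ c') :
    DecayBound A δ C r L L' k c' b p := by
  obtain ⟨K, hK, H⟩ := H
  exact ⟨K, hK, fun h P M V μ z hS f α hα =>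
    (norm_weightOp_anti hc hcc _).trans (H h P M V μ z hS f α hα)⟩

theorem mono_right (H : DecayBound A δ C r L L' k c b p) (hb : 0 ≤ b) (hbb : b ≤ b') :
    DecayBound A δ C r L L' k c b' p := by
  obtain ⟨K, hK, H⟩ := H
  refine ⟨K, hK, fun h P M V μ z hS f α hα => ?_⟩
  have h1 := H h P M V μ z hS (weightOp n (b' - b) f) α hα
  rw [weightOp_weightOp hb (sub_nonneg.2 hbb), add_sub_cancel] at h1
  refine h1.trans ?_
  have := (rate_pos (k := k) (p := p) hS.one_le hS.le_inv).le
  gcongr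
  exact norm_weightOp_le (sub_nonneg.2 hbb) f

/-- Hölder's inequality between the weight exponents 0 and c; the exponent p of the rate moves
affinely with the weight. -/
theorem interpolate (H₀ : DecayBound A δ C r L L' k 0 b p) (H : DecayBound A δ C r L L' k c b p')
    (hc : 0 ≤ c) {θ : ℝ} (hθ : 0 ≤ θ) (hθ1 : θ ≤ 1) :
    DecayBound A δ C r L L' k (θ * c) b ((1 - θ) * p + θ * p') := by
  obtain ⟨K₀, hK₀, H₀⟩ := H₀
  obtain ⟨K, hK, H⟩ := H
  refine ⟨K₀ ^ (1 - θ) * K ^ θ, by positivity, fun h P M V μ z hS f α hα => ?_⟩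
  have h0 := H₀ h P M V μ z hS f α hα
  have h1 := H h P M V μ z hS f α hα
  set u := jet h α ((resolventOp P z ^ k) (weightOp n b f)) with hu
  have h2 : ‖u‖ ≤ K₀ * rate μ |z.im|⁻¹ k p * ‖f‖ := by
    have e : weightOp n 0 u = u := by
      rw [weightOp_eq_mulOp]
      simp only [neg_zero, Real.rpow_zero]
      rw [mulOp_const]
      simp
    rwa [e] at h0
  have hr0 := (rate_pos (k := k) (p := p) hS.one_le hS.le_inv).le
  have hr1 := (rate_pos (k := k) (p := p') hS.one_le hS.le_inv).le
  have hθ' : 0 ≤ 1 - θ := by linarith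
  calc ‖weightOp n (θ * c) u‖ ≤ ‖u‖ ^ (1 - θ) * ‖weightOp n c u‖ ^ θ :=
        norm_weightOp_interpolate hc hθ hθ1 u
    _ ≤ (K₀ * rate μ |z.im|⁻¹ k p * ‖f‖) ^ (1 - θ) * (K * rate μ |z.im|⁻¹ k p' * ‖f‖) ^ θ := by
        gcongr
    _ = K₀ ^ (1 - θ) * K ^ θ * (rate μ |z.im|⁻¹ k p ^ (1 - θ) * rate μ |z.im|⁻¹ k p' ^ θ)
          * (‖f‖ ^ (1 - θ) * ‖f‖ ^ θ) := by
        rw [Real.mul_rpow (by positivity) (norm_nonneg _), Real.mul_rpow hK₀ hr0,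
          Real.mul_rpow (by positivity) (norm_nonneg _), Real.mul_rpow hK hr1]
        ring
    _ = _ := by
        rw [rate_rpow_mul_rate_rpow hS.one_le hS.le_inv, ← Real.rpow_add' (norm_nonneg _)
          (by norm_num), show 1 - θ + θ = 1 by ring, Real.rpow_one]

/-- The bound without decay. -/
theorem trivial (hc : 0 ≤ c) (hb : 0 ≤ b) : DecayBound {none} δ C r L L' (n := n) k c b 0 := by
  refine ⟨1, zero_le_one, fun h P M V μ z hS f α hα => ?_⟩
  rw [Set.mem_singleton_iff.1 hα, jet_none, rate_zero_right, one_mul, Real.rpow_natCast]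
  refine (norm_weightOp_le hc _).trans ((norm_pow_resolventOp_le hS.hasForm.isSelfAdjoint hS.im_ne k _).trans ?_)
  gcongr
  exact norm_weightOp_le hb f

/-- The factor next to the weight gains (μ T)^{1/2}; each other factor costs its norm T. -/
theorem energy (hb : 1 / 2 < b) :
    DecayBound {none} δ C r L L' (n := n) (k + 1) 0 b (1 / 2) := by
  refine ⟨|L b|, abs_nonneg _, fun h P M V μ z hS f α hα => ?_⟩
  rw [Set.mem_singleton_iff.1 hα, jet_none, pow_succ, mul_apply_eq_comp]
  have hT : 0 < |z.im|⁻¹ := inv_pos.2 (abs_pos.2 hS.im_ne)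
  have hr := (rate_pos (k := 1) (p := 1 / 2) hS.one_le hS.le_inv).le
  refine (norm_weightOp_le le_rfl _).trans ((norm_pow_resolventOp_le hS.hasForm.isSelfAdjoint hS.im_ne k _).trans ?_)
  have e : rate μ |z.im|⁻¹ ((k + 1 : ℕ) : ℝ) (1 / 2)
      = |z.im|⁻¹ ^ k * rate μ |z.im|⁻¹ 1 (1 / 2) := by
    unfold rate
    rw [← Real.rpow_natCast, mul_left_comm, ← Real.rpow_add hT]
    push_cast
    congr 2
    ring
  rw [e]
  calc |z.im|⁻¹ ^ k * ‖resolventOp P z (weightOp n b f)‖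
      ≤ |z.im|⁻¹ ^ k * (|L b| * rate μ |z.im|⁻¹ 1 (1 / 2) * ‖f‖) := by
        gcongr
        refine (hS.energy b hb f).trans ?_
        gcongr
        exact le_abs_self _
    _ = _ := by ring

theorem sandwich (hb : 1 / 2 < b) (hp : p < 1) :
    DecayBound {none} δ C r L L' (n := n) 1 b b p := by
  refine ⟨|L' b p|, abs_nonneg _, fun h P M V μ z hS f α hα => ?_⟩
  rw [Set.mem_singleton_iff.1 hα, jet_none, pow_one]
  have hr := (rate_pos (k := 1) (p := p) hS.one_le hS.le_inv).le
  refine (ContinuousLinearMap.le_opNorm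
    (weightOp n b ∘L resolventOp P z ∘L weightOp n b) f).trans ?_
  rw [Nat.cast_one]
  gcongr
  refine (hS.sandwich b p hb hp).trans ?_
  gcongr
  exact le_abs_self _

/-- Bounds on the solution imply bounds on its jet. -/
theorem univ_of_none (hδ : 0 ≤ δ) (hC : 0 ≤ C) (hc : 0 ≤ c)
    (H : DecayBound {none} δ C r L L' (n := n) (k + 1) c b p)
    (H' : DecayBound {none} δ C r L L' (n := n) k c b (p - 1)) :
    DecayBound Set.univ δ C r L L' (n := n) (k + 1) c b p := by
  obtain ⟨K, hK, H⟩ := H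
  obtain ⟨K', hK', H'⟩ := H'
  obtain ⟨K₁, hK₁, H₁⟩ := exists_norm_mulOp_jet_le n hC (C₀ := 3 * c) (by positivity)
  refine ⟨K₁ * (C * K + K' + K), by positivity, fun h P M V μ z hS f α _ => ?_⟩
  obtain ⟨u, hu, hPu⟩ := exists_pow_resolventOp hS.hasForm.isSelfAdjoint hS.im_ne k
    (weightOp n b f)
  have h0 := H h P M V μ z hS f none rfl
  have h1 := H' h P M V μ z hS f none rfl
  have h2 := H₁ δ h P M V _ _ hδ hS.hasForm (logWeight_bracket_neg hc) u α
  rw [← weightOp_eq_mulOp] at h2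
  rw [jet_none] at h0 h1
  rw [← hu] at h0 hPu ⊢
  -- Lowering k and p by one leaves the power of T unchanged and divides by μ ≥ 1.
  have hr : rate μ |z.im|⁻¹ k (p - 1) ≤ rate μ |z.im|⁻¹ ((k + 1 : ℕ) : ℝ) p := by
    rw [← mul_rate_sub_one (k := ((k + 1 : ℕ) : ℝ)) hS.one_le]
    push_cast
    rw [add_sub_cancel_right]
    exact le_mul_of_one_le_left (rate_pos hS.one_le hS.le_inv).le hS.one_le
  have hr0 := (rate_pos (k := ((k + 1 : ℕ) : ℝ)) (p := p) hS.one_le hS.le_inv).le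
  set ρ := rate μ |z.im|⁻¹ ((k + 1 : ℕ) : ℝ) p with hρ
  have h3 : ‖weightOp n c (P u)‖ ≤ C * (K * ρ * ‖f‖) + K' * ρ * ‖f‖ := by
    rw [hPu, map_add, map_smul]
    refine (norm_add_le _ _).trans (add_le_add ?_ (h1.trans (by gcongr)))
    rw [norm_smul]
    exact mul_le_mul hS.norm_le h0 (norm_nonneg _) hC
  calc ‖weightOp n c (jet h α (u : L2 n))‖
      ≤ K₁ * ((C * (K * ρ * ‖f‖) + K' * ρ * ‖f‖) + K * ρ * ‖f‖) := by
        refine h2.trans ?_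
        gcongr
    _ = _ := by ring

theorem energy_univ (hδ : 0 ≤ δ) (hC : 0 ≤ C) (hb : 1 / 2 < b) :
    DecayBound Set.univ δ C r L L' (n := n) (k + 1) 0 b (1 / 2) :=
  (energy hb).univ_of_none hδ hC le_rfl
    ((DecayBound.trivial le_rfl (by linarith)).anti (by norm_num))

end DecayBound

theorem norm_mulOp_bracket_div_weightOp_le {γ : ℝ} (hγ : 0 < γ) (hγ1 : γ ≤ 1) (hb : 1 / 2 ≤ b)
    (f : L2 n) : ‖mulOp (fun x => (bracket x / bracket (γ • x)) ^ (1 / 2 : ℝ)) (weightOp n b f)‖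
      ≤ ‖f‖ := by
  have h1 := (logWeight_bracket_div (n := n) (a := 1 / 2) (by norm_num) hγ
    hγ1).c1Bounded.isMultiplier
  have h2 := (logWeight_bracket_neg (n := n) (c := b) (by linarith)).c1Bounded.isMultiplier
  rw [weightOp_eq_mulOp, mulOp_mulOp h1 h2]
  have := norm_mulOp_le (h1.mul h2) (C := 1) (ae_of_all _ fun x => by
    have h3 : 0 < bracket x / bracket (γ • x) := div_pos (bracket_pos _) (bracket_pos _)
    have h4 := bracket_pos x
    rw [abs_of_pos (by positivity)]
    calc (bracket x / bracket (γ • x)) ^ (1 / 2 : ℝ) * bracket x ^ (-b)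
        ≤ bracket x ^ (1 / 2 : ℝ) * bracket x ^ (-(1 / 2) : ℝ) := by
          gcongr
          · exact bracket_div_le x
          · exact one_le_bracket x
      _ = 1 := by
          rw [← Real.rpow_add h4]
          norm_num) f
  rwa [one_mul] at this

/-- The balance behind the growth estimate: the source term of the quadratic inequality, after
division by |Im z|, is the square of the claimed rate. -/
theorem rate_growth_sq {μ T h : ℝ} (hμ : 1 ≤ μ) (hT : μ ≤ T) (hh : 0 ≤ h) (k : ℝ) :
    T * (h * (rate μ T k (1 / 2) * rate μ T k (1 / 2)))
      = (h ^ (1 / 2 : ℝ) * rate μ T (k + 1 / 2) (1 / 2)) ^ 2 := by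
  have hT0 : 0 < T := by linarith
  rw [mul_pow, sq, sq, ← Real.rpow_add' hh (by norm_num), mul_rate_mul_rate hμ hT,
    mul_rate_mul_rate hμ hT, show (1 / 2 : ℝ) + 1 / 2 = 1 by norm_num, Real.rpow_one]
  have : rate μ T (k + 1 / 2 + (k + 1 / 2)) 1 = T * rate μ T (k + k) 1 := by
    unfold rate
    rw [show k + 1 / 2 + (k + 1 / 2) - 1 = (k + k - 1) + 1 by ring, Real.rpow_add_one hT0.ne']
    ring
  rw [this]
  ring

theorem mul_rate_eq {μ T : ℝ} (hT : 0 < T) (k p : ℝ) : T * rate μ T k p = rate μ T (k + 1) p := by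
  unfold rate
  rw [show k + 1 - p = (k - p) + 1 by ring, Real.rpow_add_one hT.ne']
  ring

/-- Moderate growth in `x` of the powers of the resolvent. -/
theorem exists_norm_mulOp_bracket_div_half_le (hδ : 0 ≤ δ) (hC : 0 ≤ C) (hb : 1 / 2 < b) (k : ℕ) :
    ∃ K : ℝ, 0 ≤ K ∧ ∀ (h : ℝ) (P : L2 n →ₗ.[ℂ] L2 n)
      (M : Option (Fin n) → Option (Fin n) → Space n → ℝ) (V : Space n → ℝ) (μ : ℝ) (z : ℂ),
      ResolventSample δ C r L L' h P M V μ z → ∀ γ ∈ Set.Ioc (0 : ℝ) 1, ∀ f,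
        ‖mulOp (fun x => (bracket x / bracket (γ • x)) ^ (1 / 2 : ℝ))
          ((resolventOp P z ^ k) (weightOp n b f))‖
          ≤ K * (h ^ (1 / 2 : ℝ) * rate μ |z.im|⁻¹ (k + 1 / 2) (1 / 2)) * ‖f‖ := by
  induction k with
  | zero =>
    refine ⟨1, zero_le_one, fun h P M V μ z hS γ hγ f => ?_⟩
    have h1 := norm_mulOp_bracket_div_weightOp_le hγ.1 hγ.2 hb.le f
    -- For k = 0 the rate is (h μ)^{1/2}, which is at least 1 because 1/h ≤ μ.
    have h2 : 1 ≤ h ^ (1 / 2 : ℝ) * rate μ |z.im|⁻¹ ((0 : ℕ) + 1 / 2) (1 / 2) := by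
      unfold rate
      rw [Nat.cast_zero, zero_add, sub_self, Real.rpow_zero, mul_one,
        ← Real.mul_rpow hS.hasForm.h_pos.le (by linarith [hS.one_le])]
      refine Real.one_le_rpow ?_ (by norm_num)
      have := hS.inv_le
      rwa [inv_le_iff_one_le_mul₀' hS.hasForm.h_pos] at this
    rw [pow_zero, one_mul]
    exact h1.trans (le_mul_of_one_le_left (norm_nonneg _) h2)
  | succ k ih =>
    obtain ⟨K, hK, H⟩ := ih
    obtain ⟨K', hK', H'⟩ := DecayBound.energy_univ (n := n) (r := r) (L := L) (L' := L') (k := k)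
      hδ hC hb
    set c₀ : ℝ := (Fintype.card (Option (Fin n)) : ℝ) ^ 2 * (2 * 1 * C) * (K' * K') with hc₀
    have hc₀0 : 0 ≤ c₀ := by positivity
    refine ⟨K + c₀ + 1, by positivity, fun h P M V μ z hS γ hγ f => ?_⟩
    have hη := abs_pos.2 hS.im_ne
    have hT : 0 < |z.im|⁻¹ := inv_pos.2 hη
    obtain ⟨u, hu, hPu⟩ := exists_pow_resolventOp hS.hasForm.isSelfAdjoint hS.im_ne k
      (weightOp n b f)
    have hY : ∀ α, ‖jet h α (u : L2 n)‖ ≤ K' * rate μ |z.im|⁻¹ (k + 1) (1 / 2) * ‖f‖ := by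
      intro α
      have h0 := H' h P M V μ z hS f α (Set.mem_univ _)
      have e : ∀ v : L2 n, weightOp n 0 v = v := fun v => by
        rw [weightOp_eq_mulOp]
        simp only [neg_zero, Real.rpow_zero]
        rw [mulOp_const]
        simp
      rw [e, ← hu] at h0
      exact_mod_cast h0
    -- The weight (⟨x⟩/⟨γx⟩)^{1/2} has m² ℓ bounded by 1 uniformly in γ. The new source is therefore
    -- controlled by the unweighted jets, and the previous power enters through the induction
    -- hypothesis.
    have h1 := hS.hasForm.abs_im_mul_norm_mulOp_sq_le hδ
      (logWeight_bracket_div (n := n) (a := 1 / 2) (by norm_num) hγ.1 hγ.2)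
      (abs_sq_mul_powLog_le hγ.1 hγ.2) zero_le_one (hu ▸ hPu) hY
    have h2 := H h P M V μ z hS γ hγ f
    have hY0 := hY none
    rw [jet_none] at hY0
    rw [← hu]
    set X := ‖mulOp (fun x => (bracket x / bracket (γ • x)) ^ (1 / 2 : ℝ)) (u : L2 n)‖ with hX
    set X' := ‖mulOp (fun x => (bracket x / bracket (γ • x)) ^ (1 / 2 : ℝ))
      ((resolventOp P z ^ k) (weightOp n b f))‖ with hX'
    set ρ := h ^ (1 / 2 : ℝ) * rate μ |z.im|⁻¹ ((k + 1 : ℕ) + 1 / 2) (1 / 2) * ‖f‖ with hρ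
    have hX0 : 0 ≤ X := norm_nonneg _
    have hρ0 : 0 ≤ ρ := by
      have := (rate_pos (k := ((k + 1 : ℕ) : ℝ) + 1 / 2) (p := 1 / 2) hS.one_le hS.le_inv).le
      have := hS.hasForm.h_pos
      positivity
    have e1 : |z.im|⁻¹ * X' ≤ K * ρ := by
      refine (mul_le_mul_of_nonneg_left h2 hT.le).trans (le_of_eq ?_)
      rw [hρ, show (((k + 1 : ℕ) : ℝ) + 1 / 2) = (k + 1 / 2) + 1 by push_cast; ring,
        ← mul_rate_eq hT]
      ring
    have e2 : |z.im|⁻¹ * ((Fintype.card (Option (Fin n)) : ℝ) ^ 2 * (2 * 1 * C) * h *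
        (‖(u : L2 n)‖ * (K' * rate μ |z.im|⁻¹ (k + 1) (1 / 2) * ‖f‖))) ≤ c₀ * ρ ^ 2 := by
      have hr := (rate_pos (k := (k : ℝ) + 1) (p := 1 / 2) hS.one_le hS.le_inv).le
      have hh := hS.hasForm.h_pos
      calc _ ≤ |z.im|⁻¹ * ((Fintype.card (Option (Fin n)) : ℝ) ^ 2 * (2 * 1 * C) * h *
          ((K' * rate μ |z.im|⁻¹ (k + 1) (1 / 2) * ‖f‖)
            * (K' * rate μ |z.im|⁻¹ (k + 1) (1 / 2) * ‖f‖))) := by gcongr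
        _ = c₀ * (|z.im|⁻¹ * (h * (rate μ |z.im|⁻¹ (k + 1) (1 / 2)
            * rate μ |z.im|⁻¹ (k + 1) (1 / 2)))) * ‖f‖ ^ 2 := by ring
        _ = c₀ * ρ ^ 2 := by
          rw [rate_growth_sq hS.one_le hS.le_inv hh.le, hρ]
          push_cast
          ring
    have e3 : X ^ 2 ≤ X * (K * ρ) + c₀ * ρ ^ 2 := by
      have h3 := mul_le_mul_of_nonneg_left h1 hT.le
      rw [mul_add, ← mul_assoc, inv_mul_cancel₀ hη.ne', one_mul] at h3
      have h4 := mul_le_mul_of_nonneg_left e1 hX0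
      linarith
    -- The inequality X² ≤ X K ρ + c₀ ρ² forces X to be at most a constant multiple of ρ.
    have e4 : X ≤ (K + c₀ + 1) * ρ := by
      by_contra hlt
      push Not at hlt
      have h5 : ρ ≤ X := by nlinarith [mul_nonneg (add_nonneg hK hc₀0) hρ0]
      rcases hρ0.eq_or_lt with h6 | h6
      · rw [← h6] at e3 hlt
        nlinarith
      · nlinarith [mul_nonneg hc₀0 (mul_nonneg hρ0 (sub_nonneg.2 h5)),
          mul_lt_mul_of_pos_left hlt (h6.trans_le h5), mul_pos h6 (h6.trans_le h5)]
    rw [mul_assoc, ← hρ]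
    exact e4

end DecayBounds

end SemiclassicalDecay

end

noncomputable section

namespace SemiclassicalDecay

/-! ### Growth of the jets and the boundary terms -/

section Growth

open scoped InnerProductSpace ComplexConjugate

variable {n : ℕ} {δ C r : ℝ} {L : ℝ → ℝ} {L' : ℝ → ℝ → ℝ} {b : ℝ}

theorem weightOp_zero (f : L2 n) : weightOp n 0 f = f := by
  rw [weightOp_eq_mulOp]
  simp only [neg_zero, Real.rpow_zero]
  rw [mulOp_const]
  simp

/-- In this form growth of order ⟨x⟩^{1/2} costs exactly (h T)^{1/2} compared with the energy bound.
-/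
theorem rate_add_half {μ T h : ℝ} (hμ : 1 ≤ μ) (hT : μ ≤ T) (hh : 0 ≤ h) (k : ℝ) :
    h ^ (1 / 2 : ℝ) * rate μ T (k + 1 / 2) (1 / 2)
      = (h * T) ^ (1 / 2 : ℝ) * rate μ T k (1 / 2) := by
  have hT0 : 0 < T := by linarith
  rw [Real.mul_rpow hh hT0.le]
  unfold rate
  rw [show k + 1 / 2 - 1 / 2 = 1 / 2 + (k - 1 / 2) by ring, Real.rpow_add hT0]
  ring

/-- Interpolation with parameter 2a between the energy bound, of weight exponent 0, and the growth
estimate, of weight exponent 1/2. Each power of ⟨x⟩ costs one power of h T. -/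
theorem exists_norm_mulOp_bracket_div_jet_le (hδ : 0 ≤ δ) (hC : 0 ≤ C) (hb : 1 / 2 < b) (k : ℕ)
    {a : ℝ} (ha : 0 ≤ a) (ha' : a ≤ 1 / 2) :
    ∃ K : ℝ, 0 ≤ K ∧ ∀ (h : ℝ) (P : L2 n →ₗ.[ℂ] L2 n)
      (M : Option (Fin n) → Option (Fin n) → Space n → ℝ) (V : Space n → ℝ) (μ : ℝ) (z : ℂ),
      ResolventSample δ C r L L' h P M V μ z → ∀ γ ∈ Set.Ioc (0 : ℝ) 1, ∀ f α,
        ‖mulOp (fun x => (bracket x / bracket (γ • x)) ^ a)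
          (jet h α ((resolventOp P z ^ (k + 1)) (weightOp n b f)))‖
          ≤ K * ((h * |z.im|⁻¹) ^ a * rate μ |z.im|⁻¹ (k + 1) (1 / 2)) * ‖f‖ := by
  obtain ⟨K₀, hK₀, H₀⟩ := DecayBound.energy_univ (n := n) (r := r) (L := L) (L' := L') (k := k)
    hδ hC hb
  obtain ⟨K, hK, H⟩ := exists_norm_mulOp_bracket_div_half_le (n := n) (r := r) (L := L)
    (L' := L') hδ hC hb k
  obtain ⟨K', hK', H'⟩ := exists_norm_mulOp_bracket_div_half_le (n := n) (r := r) (L := L)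
    (L' := L') hδ hC hb (k + 1)
  obtain ⟨K₁, hK₁, H₁⟩ := exists_norm_mulOp_jet_le n hC (C₀ := 6 * (1 / 2)) (by positivity)
  set K₂ : ℝ := K₁ * (C * K' + K + K') with hK₂
  have hK₂0 : 0 ≤ K₂ := by positivity
  refine ⟨K₀ ^ (1 - 2 * a) * K₂ ^ (2 * a), by positivity, fun h P M V μ z hS γ hγ f α => ?_⟩
  have hh := hS.hasForm.h_pos
  have hT : 0 < |z.im|⁻¹ := inv_pos.2 (abs_pos.2 hS.im_ne)
  have h0 := H₀ h P M V μ z hS f α (Set.mem_univ _)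
  have h1 := H h P M V μ z hS γ hγ f
  have h2 := H' h P M V μ z hS γ hγ f
  rw [weightOp_zero] at h0
  obtain ⟨u, hu, hPu⟩ := exists_pow_resolventOp hS.hasForm.isSelfAdjoint hS.im_ne k
    (weightOp n b f)
  have hW := logWeight_bracket_div (n := n) (a := 1 / 2) (by norm_num) hγ.1 hγ.2
  have h3 := H₁ δ h P M V _ _ hδ hS.hasForm hW u α
  rw [← hu] at h0 h2 hPu ⊢
  set m : Space n → ℝ := fun x => (bracket x / bracket (γ • x)) ^ (1 / 2 : ℝ) with hm
  push_cast at h0 h2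
  have hr := (rate_pos (k := (k : ℝ) + 1) (p := 1 / 2) hS.one_le hS.le_inv).le
  have h4 : ‖mulOp m (jet h α (u : L2 n))‖
      ≤ K₂ * ((h * |z.im|⁻¹) ^ (1 / 2 : ℝ) * rate μ |z.im|⁻¹ (k + 1) (1 / 2)) * ‖f‖ := by
    rw [← rate_add_half hS.one_le hS.le_inv hh.le]
    have hr' : rate μ |z.im|⁻¹ (k + 1 / 2) (1 / 2) ≤ rate μ |z.im|⁻¹ (k + 1 + 1 / 2) (1 / 2) :=
      rate_mono hS.one_le hS.le_inv (by linarith)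
    have hr'' := (rate_pos (k := (k : ℝ) + 1 + 1 / 2) (p := 1 / 2) hS.one_le hS.le_inv).le
    set ρ := rate μ |z.im|⁻¹ (k + 1 + 1 / 2) (1 / 2) with hρ
    have h5 : ‖mulOp m ((resolventOp P z ^ k) (weightOp n b f))‖
        ≤ K * (h ^ (1 / 2 : ℝ) * ρ) * ‖f‖ := h1.trans (by gcongr)
    have h6 : ‖mulOp m (P u)‖ ≤ C * (K' * (h ^ (1 / 2 : ℝ) * ρ) * ‖f‖)
        + K * (h ^ (1 / 2 : ℝ) * ρ) * ‖f‖ := by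
      rw [hPu, map_add, map_smul]
      refine (norm_add_le _ _).trans (add_le_add ?_ h5)
      rw [norm_smul]
      exact mul_le_mul hS.norm_le h2 (norm_nonneg _) hC
    calc ‖mulOp m (jet h α (u : L2 n))‖
        ≤ K₁ * ((C * (K' * (h ^ (1 / 2 : ℝ) * ρ) * ‖f‖) + K * (h ^ (1 / 2 : ℝ) * ρ) * ‖f‖)
          + K' * (h ^ (1 / 2 : ℝ) * ρ) * ‖f‖) := by
          refine h3.trans ?_
          gcongr
      _ = _ := by
          rw [hK₂]
          ring
  have ha1 : 0 ≤ 1 - 2 * a := by linarith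
  have h5 := norm_mulOp_le_rpow_mul_rpow
    (logWeight_bracket_div (n := n) ha hγ.1 hγ.2).c1Bounded.isMultiplier
    (IsMultiplier.const 1) hW.c1Bounded.isMultiplier (θ := 2 * a) (by linarith) (by linarith)
    (ae_of_all _ fun x => by
      have h3 : 0 < bracket x / bracket (γ • x) := div_pos (bracket_pos _) (bracket_pos _)
      rw [abs_of_pos (Real.rpow_pos_of_pos h3 _), abs_of_pos (Real.rpow_pos_of_pos h3 _), abs_one,
        Real.one_rpow, one_mul, ← Real.rpow_mul h3.le]
      exact le_of_eq (by congr 1; ring)) (jet h α (u : L2 n))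
  rw [mulOp_const, show ((1 : ℝ) : ℂ) • jet h α (u : L2 n) = jet h α (u : L2 n) by simp] at h5
  set ρ := rate μ |z.im|⁻¹ (k + 1) (1 / 2) with hρ
  calc _ ≤ ‖jet h α (u : L2 n)‖ ^ (1 - 2 * a) * ‖mulOp m (jet h α (u : L2 n))‖ ^ (2 * a) := h5
    _ ≤ (K₀ * ρ * ‖f‖) ^ (1 - 2 * a)
        * (K₂ * ((h * |z.im|⁻¹) ^ (1 / 2 : ℝ) * ρ) * ‖f‖) ^ (2 * a) := by gcongr
    _ = K₀ ^ (1 - 2 * a) * K₂ ^ (2 * a) * (((h * |z.im|⁻¹) ^ (1 / 2 : ℝ)) ^ (2 * a)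
          * (ρ ^ (1 - 2 * a) * ρ ^ (2 * a))) * (‖f‖ ^ (1 - 2 * a) * ‖f‖ ^ (2 * a)) := by
        rw [Real.mul_rpow (by positivity) (norm_nonneg _), Real.mul_rpow hK₀ hr,
          Real.mul_rpow (by positivity) (norm_nonneg _), Real.mul_rpow hK₂0 (by positivity),
          Real.mul_rpow (by positivity) hr]
        ring
    _ = _ := by
        rw [← Real.rpow_add' (norm_nonneg _) (by norm_num), ← Real.rpow_add' hr (by norm_num),
          show 1 - 2 * a + 2 * a = 1 by ring, Real.rpow_one, Real.rpow_one,
          ← Real.rpow_mul (by positivity), show (1 / 2 : ℝ) * (2 * a) = a by ring]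

/-- The boundary terms of the virial identity. -/
theorem norm_inner_conjOp_radial_le {h γ c : ℝ} (hh : 0 < h) (hh1 : h ≤ 1) (hγ : 0 < γ)
    (hγ1 : γ ≤ 1) (hc : 0 ≤ c) {m : Space n → ℝ} (hm : IsMultiplier m)
    (hle : ∀ x, bracket x ^ (-c) * (bracket x / bracket (γ • x)) ≤ m x) {u : L2 n} {Y : ℝ}
    (hY : ∀ α, ‖mulOp m (jet h α u)‖ ≤ Y) (F : L2 n) :
    ‖⟪weightOp n c F, conjOp h (radial γ) u⟫_ℂ‖ ≤ 3 * n * Y * ‖F‖ := by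
  have hg := smoothField_radial (n := n) hγ
  have hw := (logWeight_bracket_neg (n := n) hc).c1Bounded.isMultiplier
  have hw0 : ∀ x : Space n, 0 < bracket x ^ (-c) := fun x => Real.rpow_pos_of_pos (bracket_pos x) _
  have hY0 : 0 ≤ Y := (norm_nonneg _).trans (hY none)
  have hm1 : ∀ x, bracket x ^ (-c) ≤ m x := fun x =>
    (le_mul_of_one_le_right (hw0 x).le (one_le_bracket_div hγ.le hγ1 x)).trans (hle x)
  have hm0 : ∀ x, |m x| = m x := fun x => abs_of_pos ((hw0 x).trans_le (hm1 x))
  rw [weightOp_eq_mulOp, inner_mulOp_left hw]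
  refine (norm_inner_le_norm _ _).trans ?_
  rw [mul_comm]
  refine mul_le_mul_of_nonneg_right ?_ (norm_nonneg _)
  unfold conjOp
  rw [map_add, map_sum, map_smul]
  have h1 : ∀ j : Fin n, ‖mulOp (fun x => bracket x ^ (-c)) (mulOp (radial γ j)
      (jet h (some j) u))‖ ≤ Y := by
    intro j
    have hgj := (hg.c1Bounded j).isMultiplier
    rw [mulOp_mulOp hw hgj]
    refine (norm_mulOp_le_of_abs_le (hw.mul hgj) hm (C := 1) (ae_of_all _ fun x => ?_) _).trans ?_
    · rw [abs_mul, abs_of_pos (hw0 x), hm0, one_mul]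
      exact (mul_le_mul_of_nonneg_left (abs_radial_le hγ j x) (hw0 x).le).trans (hle x)
    · rw [one_mul]
      exact hY _
  have h2 : ‖mulOp (fun x => bracket x ^ (-c)) (mulOp (divergence (radial γ)) u)‖ ≤ n * 3 * Y := by
    have hd := hg.c1Bounded_divergence.isMultiplier
    rw [mulOp_mulOp hw hd]
    refine (norm_mulOp_le_of_abs_le (hw.mul hd) hm (C := n * 3) (ae_of_all _ fun x => ?_) _).trans ?_
    · rw [abs_mul, abs_of_pos (hw0 x), hm0, mul_comm]
      exact mul_le_mul (abs_divergence_radial_le hγ x) (hm1 x) (hw0 x).le (by positivity)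
    · have := hY none
      rw [jet_none] at this
      gcongr
  have h3 : ‖-(Complex.I * (h : ℂ)) / 2‖ ≤ 1 / 2 := by
    rw [norm_div, norm_neg_I_mul hh.le, Complex.norm_ofNat]
    linarith
  refine (norm_add_le _ _).trans ?_
  rw [norm_smul]
  have h4 : ‖∑ j : Fin n, mulOp (fun x => bracket x ^ (-c)) (mulOp (radial γ j)
      (jet h (some j) u))‖ ≤ n * Y := by
    refine (norm_sum_le_of_le _ fun j _ => h1 j).trans (le_of_eq ?_)
    simp
  have h5 := mul_le_mul h3 h2 (norm_nonneg _) (by norm_num)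
  have h6 : 0 ≤ n * Y := by positivity
  linarith

end Growth

end SemiclassicalDecay

end

noncomputable section

namespace SemiclassicalDecay

/-! ### Induction on the power of the resolvent -/

section Induction

open scoped InnerProductSpace ComplexConjugate

variable {δ C r : ℝ} {L : ℝ → ℝ} {L' : ℝ → ℝ → ℝ}

/-- The weighted bounds for the `k`-th power of the resolvent. -/
def PowerBounds (n : ℕ) (δ C r : ℝ) (L : ℝ → ℝ) (L' : ℝ → ℝ → ℝ) (k : ℕ) : Prop :=
  ∀ c b p : ℝ, 0 ≤ c → c < δ - 1 / 2 → 1 / 2 < b → c ≤ b → p < c + 1 / 2 → (p < k ∨ p ≤ 0) →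
    DecayBound {none} δ C r L L' (n := n) k c b p

variable {n : ℕ}

/-- The alternative p ≤ 0 in `PowerBounds` matters here, since p < 0 alone would exclude the trivial
bound at p = 0. -/
theorem powerBounds_zero : PowerBounds n δ C r L L' 0 := fun c b p hc _ hb _ _ h =>
  (DecayBound.trivial hc (by linarith)).anti (h.elim (fun h => by simpa using h.le) id)

/-- Equal weights c = b > 1/2 suffice. For p ≤ 1/2 the energy bound is enough. For c > 1/2 one only
strengthens the right weight. The case c ≤ 1/2 < p follows by interpolation between the energy bound
and a diagonal bound with c' slightly above 1/2. -/
theorem powerBounds_succ_of_diag (hδ : 1 < δ) {k : ℕ}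
    (H : ∀ c p : ℝ, 1 / 2 < c → c < δ - 1 / 2 → p < c + 1 / 2 → p < k + 1 →
      DecayBound {none} δ C r L L' (n := n) (k + 1) c c p) :
    PowerBounds n δ C r L L' (k + 1) := by
  intro c b p hc hcδ hb hcb hpc hpk
  rcases le_or_gt p (1 / 2) with hp | hp
  · exact ((DecayBound.energy hb).anti hp).mono_left le_rfl hc
  have hpk' : p < k + 1 := by
    rcases hpk with h | h
    · exact_mod_cast h
    · linarith
  rcases lt_or_ge (1 / 2) c with hc2 | hc2
  · exact (H c p hc2 hcδ hpc hpk').mono_right hc hcb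
  have hc0 : 0 < c := by linarith
  -- ρ is the slope of the line through (0, 1/2) and (c, p). It is less than 1, so the line stays
  -- below c' + 1/2, and c' close to 1/2 keeps the endpoint 1/2 + ρ c' below 1.
  set ρ := (p - 1 / 2) / c with hρ
  have hρ0 : 0 < ρ := div_pos (by linarith) hc0
  have hρ1 : ρ < 1 := (div_lt_one hc0).2 (by linarith)
  have h1 : 1 / 2 < 1 / (2 * ρ) := by
    rw [div_lt_div_iff₀ (by norm_num) (by positivity)]
    linarith
  obtain ⟨c', hc', hc''⟩ := exists_between (lt_min (lt_min (show 1 / 2 < δ - 1 / 2 by linarith) hb) h1)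
  rw [lt_min_iff, lt_min_iff] at hc''
  obtain ⟨⟨h2, h3⟩, h4⟩ := hc''
  have hc'0 : 0 < c' := by linarith
  have h5 : ρ * c' < 1 / 2 := by
    rw [lt_div_iff₀ (by positivity)] at h4
    linarith
  have h6 : ρ * c' < c' := mul_lt_of_lt_one_left hc'0 hρ1
  have h7 := (H c' (1 / 2 + ρ * c') hc' h2 (by linarith)
    (by linarith [Nat.cast_nonneg (α := ℝ) k])).mono_right hc'0.le h3.le
  have h8 := (DecayBound.energy (k := k) (δ := δ) (C := C) (r := r) (L := L) (L' := L') (n := n)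
    hb).interpolate h7 hc'0.le (θ := c / c') (by positivity) ((div_le_one hc'0).2 (by linarith))
  have e1 : c / c' * c' = c := div_mul_cancel₀ _ hc'0.ne'
  have e2 : (1 - c / c') * (1 / 2) + c / c' * (1 / 2 + ρ * c') = p := by
    have : c / c' * (ρ * c') = p - 1 / 2 := by
      rw [hρ]
      field_simp
    linarith
  rwa [e1, e2] at h8

theorem PowerBounds.jet (hδ : 0 ≤ δ) (hC : 0 ≤ C) {k : ℕ} (H' : PowerBounds n δ C r L L' k)
    (H : PowerBounds n δ C r L L' (k + 1)) {c b p : ℝ} (hc : 0 ≤ c) (hcδ : c < δ - 1 / 2)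
    (hb : 1 / 2 < b) (hcb : c ≤ b) (hpc : p < c + 1 / 2) (hpk : p < k + 1) :
    DecayBound Set.univ δ C r L L' (n := n) (k + 1) c b p :=
  (H c b p hc hcδ hb hcb hpc (Or.inl (by exact_mod_cast hpk))).univ_of_none hδ hC hc
    (H' c b (p - 1) hc hcδ hb hcb (by linarith) (Or.inl (by linarith)))

/-- Here 1/h ≤ μ turns the gain of one power of μ into the factor h that the virial identity divides
out. -/
theorem rate_le_mul_rate_succ {μ T h : ℝ} (hμ : 1 ≤ μ) (hT : μ ≤ T) (hh : 0 < h) (hhμ : h⁻¹ ≤ μ)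
    (k p : ℝ) : rate μ T k (p - 1) ≤ h * rate μ T (k + 1) p := by
  rw [← mul_rate_sub_one (k := k + 1) hμ, add_sub_cancel_right, ← mul_assoc]
  refine le_mul_of_one_le_left (rate_pos hμ hT).le ?_
  rwa [inv_le_iff_one_le_mul₀' hh] at hhμ

/-- The counterpart for c < 1: the factor h^{-c} lost in the growth estimate is bounded by μ^c. -/
theorem rpow_mul_rate_le {μ T h c p : ℝ} (hμ : 1 ≤ μ) (hT : μ ≤ T) (hh : 0 < h) (hhμ : h⁻¹ ≤ μ)
    (hc : 0 ≤ c) (hp : p ≤ c + 1 / 2) (k : ℝ) :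
    (h * T) ^ (1 - c) * rate μ T k (1 / 2) ≤ h * rate μ T (k + 1) p := by
  have hμ0 : 0 < μ := by linarith
  have hT0 : 0 < T := by linarith
  refine le_trans ?_ (mul_le_mul_of_nonneg_left (rate_anti hμ hT hp) hh.le)
  unfold rate
  rw [Real.mul_rpow hh.le hT0.le, show k + 1 - (c + 1 / 2) = (1 - c) + (k - 1 / 2) by ring,
    Real.rpow_add hT0, Real.rpow_add hμ0, sub_eq_add_neg 1 c, Real.rpow_add hh, Real.rpow_one,
    Real.rpow_neg hh.le, ← Real.inv_rpow hh.le]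
  have h1 : h⁻¹ ^ c ≤ μ ^ c := Real.rpow_le_rpow (by positivity) hhμ hc
  calc h * h⁻¹ ^ c * T ^ (1 + -c) * (μ ^ (1 / 2 : ℝ) * T ^ (k - 1 / 2))
      ≤ h * μ ^ c * T ^ (1 + -c) * (μ ^ (1 / 2 : ℝ) * T ^ (k - 1 / 2)) := by gcongr
    _ = _ := by ring

/-- The boundary terms of the virial identity for powers of the resolvent. -/
theorem exists_norm_inner_conjOp_pow_le (hδ : 1 < δ) (hC : 0 ≤ C) {k : ℕ}
    (H' : PowerBounds n δ C r L L' k) (H : PowerBounds n δ C r L L' (k + 1)) {c p : ℝ}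
    (hc : 1 / 2 < c) (hcδ : c < δ - 1 / 2) (hpc : p < c + 1 / 2) (hpk : p < k + 2) :
    ∃ K : ℝ, 0 ≤ K ∧ ∀ (h : ℝ) (P : L2 n →ₗ.[ℂ] L2 n)
      (M : Option (Fin n) → Option (Fin n) → Space n → ℝ) (V : Space n → ℝ) (μ : ℝ) (z : ℂ),
      ResolventSample δ C r L L' h P M V μ z → ∀ γ ∈ Set.Ioc (0 : ℝ) 1, ∀ f F,
        ‖⟪weightOp n c F, conjOp h (radial γ)
          ((resolventOp P z ^ (k + 1)) (weightOp n c f))⟫_ℂ‖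
          ≤ K * (h * rate μ |z.im|⁻¹ (k + 2) p) * ‖f‖ * ‖F‖ := by
  have hδ0 : 0 ≤ δ := by linarith
  have hk2 : (k : ℝ) + 2 = k + 1 + 1 := by ring
  -- Against the weight ⟨x⟩^{-c} the radial operator leaves ⟨x⟩^{1-c}. For c ≥ 1 this decays and the
  -- induction hypothesis applies at (c - 1, p - 1). For c < 1 it grows with exponent 1 - c < 1/2
  -- and the growth estimate applies.
  rcases le_or_gt 1 c with hc1 | hc1
  · obtain ⟨K, hK, HK⟩ := PowerBounds.jet hδ0 hC H' H (c := c - 1) (b := c) (p := p - 1)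
      (by linarith) (by linarith) hc (by linarith) (by linarith) (by linarith)
    refine ⟨3 * n * K, by positivity, fun h P M V μ z hS γ hγ f F => ?_⟩
    have hh := hS.hasForm.h_pos
    refine (norm_inner_conjOp_radial_le hh hS.hasForm.h_le_one hγ.1 hγ.2 (by linarith)
      (logWeight_bracket_neg (n := n) (c := c - 1) (by linarith)).c1Bounded.isMultiplier
      (fun x => ?_) (fun α => HK h P M V μ z hS f α (Set.mem_univ _)) F).trans ?_
    · calc bracket x ^ (-c) * (bracket x / bracket (γ • x)) ≤ bracket x ^ (-c) * bracket x := by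
            have := bracket_pos x
            gcongr
            exact bracket_div_le x
        _ = bracket x ^ (-(c - 1)) := by
            rw [neg_sub, sub_eq_add_neg, add_comm, Real.rpow_add_one (bracket_pos x).ne']
    · have := rate_le_mul_rate_succ hS.one_le hS.le_inv hh hS.inv_le (k + 1) p
      rw [hk2]
      push_cast
      calc 3 * n * (K * rate μ |z.im|⁻¹ (k + 1) (p - 1) * ‖f‖) * ‖F‖
          ≤ 3 * n * (K * (h * rate μ |z.im|⁻¹ (k + 1 + 1) p) * ‖f‖) * ‖F‖ := by gcongr
        _ = _ := by ring
  · obtain ⟨K, hK, HK⟩ := exists_norm_mulOp_bracket_div_jet_le (n := n) (r := r) (L := L)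
      (L' := L') hδ0 hC hc k (a := 1 - c) (by linarith) (by linarith)
    refine ⟨3 * n * K, by positivity, fun h P M V μ z hS γ hγ f F => ?_⟩
    have hh := hS.hasForm.h_pos
    refine (norm_inner_conjOp_radial_le hh hS.hasForm.h_le_one hγ.1 hγ.2 (by linarith)
      (logWeight_bracket_div (n := n) (a := 1 - c) (by linarith) hγ.1
        hγ.2).c1Bounded.isMultiplier
      (fun x => ?_) (HK h P M V μ z hS γ hγ f) F).trans ?_
    · have hW : 0 < bracket x / bracket (γ • x) := div_pos (bracket_pos _) (bracket_pos _)
      rw [sub_eq_add_neg, add_comm, Real.rpow_add_one hW.ne']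
      exact mul_le_mul_of_nonneg_right
        (Real.rpow_le_rpow_of_nonpos hW (bracket_div_le x) (by linarith)) hW.le
    · have := rpow_mul_rate_le hS.one_le hS.le_inv hh hS.inv_le (by linarith) hpc.le (k + 1)
      rw [hk2]
      calc 3 * n * (K * ((h * |z.im|⁻¹) ^ (1 - c) * rate μ |z.im|⁻¹ (k + 1) (1 / 2)) * ‖f‖) * ‖F‖
          ≤ 3 * n * (K * (h * rate μ |z.im|⁻¹ (k + 1 + 1) p) * ‖f‖) * ‖F‖ := by gcongr
        _ = _ := by ring

/-- The weights and the constants in the error terms of the virial identity. -/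
theorem exists_error_weights (hδ : 1 < δ) (hC : 0 ≤ C) {m : ℕ}
    (H : ∀ j ≤ m, PowerBounds n δ C r L L' j) {c p : ℝ}
    (hc : 1 / 2 < c) (hcδ : c < δ - 1 / 2) (hp0 : 0 ≤ p) (hpc : p < c + 1 / 2) (hpk : p < m + 1)
    {i : ℕ} (hi : i < m) :
    ∃ c₁ c₂ p₁ p₂ : ℝ, 0 ≤ c₁ ∧ 0 ≤ c₂ ∧ c₁ + c₂ ≤ δ - 1 ∧ p₁ + p₂ = p ∧
      DecayBound Set.univ δ C r L L' (n := n) (i + 1) c₁ c p₁ ∧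
      DecayBound Set.univ δ C r L L' (n := n) (m - i) c₂ c p₂ := by
  have hδ0 : 0 ≤ δ := by linarith
  have hi' : (i : ℝ) + 1 ≤ m := by exact_mod_cast hi
  have hi0 : (0 : ℝ) ≤ i := i.cast_nonneg
  have hm : (0 : ℝ) < m := by linarith
  -- d is the total weight to be distributed: at most c - 1/2 < δ - 1 so that it fits the short
  -- range decay, and at most m so that each share respects its number of resolvents. The shares are
  -- proportional to i + 1/2 and m - i - 1/2, whose sum is m.
  set d : ℝ := min (c - 1 / 2) m with hd
  have hd0 : 0 < d := lt_min (by linarith) hm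
  have hd1 : d ≤ c - 1 / 2 := min_le_left _ _
  have hd2 : d ≤ m := min_le_right _ _
  have hpd : p < d + 1 := by
    rw [hd, min_add]
    exact lt_min (by linarith) hpk
  -- The exponents (c_j + 1/2) q add up to q (d + 1) = p, and q < 1 makes both admissible.
  set q := p / (d + 1) with hq
  have hq0 : 0 ≤ q := by positivity
  have hq1 : q < 1 := (div_lt_one (by linarith)).2 hpd
  have hdm : d / m ≤ 1 := (div_le_one hm).2 hd2
  have hdm0 : 0 < d / m := by positivity
  have hsum : d / m * (i + 1 / 2) + d / m * (m - i - 1 / 2) = d := by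
    field_simp
    ring
  set c₁ := d / m * (i + 1 / 2) with hc₁
  set c₂ := d / m * (m - i - 1 / 2) with hc₂
  have hc₁0 : 0 < c₁ := by positivity
  have hc₂0 : 0 < c₂ := mul_pos hdm0 (by linarith)
  have hc₁i : c₁ ≤ i + 1 / 2 := by
    have := mul_le_mul_of_nonneg_right hdm (show (0 : ℝ) ≤ i + 1 / 2 by linarith)
    linarith
  have hc₂i : c₂ ≤ m - i - 1 / 2 := by
    have := mul_le_mul_of_nonneg_right hdm (show (0 : ℝ) ≤ m - i - 1 / 2 by linarith)
    linarith
  have hp₁ : (c₁ + 1 / 2) * q < c₁ + 1 / 2 := mul_lt_of_lt_one_right (by linarith) hq1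
  have hp₂ : (c₂ + 1 / 2) * q < c₂ + 1 / 2 := mul_lt_of_lt_one_right (by linarith) hq1
  refine ⟨c₁, c₂, (c₁ + 1 / 2) * q, (c₂ + 1 / 2) * q, hc₁0.le, hc₂0.le, by linarith, ?_, ?_, ?_⟩
  · rw [← add_mul, show c₁ + 1 / 2 + (c₂ + 1 / 2) = d + 1 by linarith, hq]
    field_simp
  · exact PowerBounds.jet hδ0 hC (H i hi.le) (H (i + 1) hi) hc₁0.le (by linarith) hc
      (by linarith) hp₁ (by linarith)
  · obtain ⟨j, hj⟩ : ∃ j, m - i = j + 1 := ⟨m - i - 1, by omega⟩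
    have hj' : (m : ℝ) - i = j + 1 := by
      rw [← Nat.cast_sub hi.le, hj]
      push_cast
      ring
    rw [hj]
    exact PowerBounds.jet hδ0 hC (H j (by omega)) (H (j + 1) (by omega)) hc₂0.le (by linarith) hc
      (by linarith) hp₂ (by linarith)

theorem norm_le_of_forall_inner_le {H : Type*} [NormedAddCommGroup H] [InnerProductSpace ℂ H]
    {v : H} {B : ℝ} (hB : 0 ≤ B) (h : ∀ F : H, ‖⟪F, v⟫_ℂ‖ ≤ B * ‖F‖) : ‖v‖ ≤ B := by
  have h1 := h v
  rw [inner_self_eq_norm_sq_to_K] at h1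
  have h2 : ‖v‖ * ‖v‖ ≤ B * ‖v‖ := by
    simpa [sq] using h1
  rcases (norm_nonneg v).eq_or_lt with h3 | h3
  · rwa [← h3]
  · exact le_of_mul_le_mul_right h2 h3

/-- The induction step. The virial identity with m = k + 1 bounds z R^{k+2} + R^{k+1} between the
weights, and a factor h in every term cancels. The power R^{k+1} is known at p - 1, and dividing by
|z| ≥ r isolates R^{k+2}. -/
theorem decayBound_diag (hδ : 1 < δ) (hC : 0 ≤ C) (hr : 0 < r) {k : ℕ}
    (H : ∀ j ≤ k + 1, PowerBounds n δ C r L L' j) {c p : ℝ}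
    (hc : 1 / 2 < c) (hcδ : c < δ - 1 / 2) (hp1 : 1 ≤ p) (hpc : p < c + 1 / 2) (hpk : p < k + 2) :
    DecayBound {none} δ C r L L' (n := n) (k + 2) c c p := by
  have hδ0 : 0 ≤ δ := by linarith
  have hc0 : 0 ≤ c := by linarith
  have hw := (logWeight_bracket_neg (n := n) hc0).c1Bounded.isMultiplier
  obtain ⟨KR, hKR, HR⟩ := H (k + 1) le_rfl c c (p - 1) hc0 hcδ hc le_rfl (by linarith)
    (Or.inl (by push_cast; linarith))
  obtain ⟨KB, hKB, HB⟩ := exists_norm_inner_conjOp_pow_le hδ hC (H k (by omega)) (H (k + 1) le_rfl)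
    hc hcδ hpc hpk
  obtain ⟨K, hK, HV⟩ := exists_norm_inner_pow_le n hC
  have hE : ∀ i : ℕ, ∃ c₁ c₂ p₁ p₂ K₁ K₂ : ℝ, i < k + 1 → 0 ≤ c₁ ∧ 0 ≤ c₂ ∧ c₁ + c₂ ≤ δ - 1 ∧
      p₁ + p₂ = p ∧ 0 ≤ K₁ ∧ 0 ≤ K₂ ∧
      (∀ h P M V μ z, ResolventSample δ C r L L' (n := n) h P M V μ z → ∀ f α,
        ‖weightOp n c₁ (jet h α ((resolventOp P z ^ (i + 1)) (weightOp n c f)))‖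
          ≤ K₁ * rate μ |z.im|⁻¹ (i + 1 : ℕ) p₁ * ‖f‖) ∧
      (∀ h P M V μ z, ResolventSample δ C r L L' (n := n) h P M V μ z → ∀ f α,
        ‖weightOp n c₂ (jet h α ((resolventOp P z ^ (k + 1 - i)) (weightOp n c f)))‖
          ≤ K₂ * rate μ |z.im|⁻¹ (k + 1 - i : ℕ) p₂ * ‖f‖) := by
    intro i
    by_cases hi : i < k + 1
    · obtain ⟨c₁, c₂, p₁, p₂, h1, h2, h3, h4, ⟨K₁, hK₁, H₁⟩, ⟨K₂, hK₂, H₂⟩⟩ :=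
        exists_error_weights hδ hC H hc hcδ (by linarith) hpc (by push_cast; linarith) hi
      exact ⟨c₁, c₂, p₁, p₂, K₁, K₂, fun _ => ⟨h1, h2, h3, h4, hK₁, hK₂,
        fun h P M V μ z hS f α => H₁ h P M V μ z hS f α (Set.mem_univ _),
        fun h P M V μ z hS f α => H₂ h P M V μ z hS f α (Set.mem_univ _)⟩⟩
    · exact ⟨0, 0, 0, 0, 0, 0, fun h => absurd h hi⟩
  choose c₁ c₂ p₁ p₂ K₁ K₂ hE using hE
  set KS : ℝ := ∑ i ∈ Finset.range (k + 1), |K₁ i * K₂ i| with hKS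
  have hKS0 : 0 ≤ KS := Finset.sum_nonneg fun _ _ => abs_nonneg _
  refine ⟨r⁻¹ * (KB + K * KS + KR), by positivity, fun h P M V μ z hS f α hα => ?_⟩
  rw [Set.mem_singleton_iff.1 hα, jet_none]
  have hh := hS.hasForm.h_pos
  have hTc : |(conj z).im|⁻¹ = |z.im|⁻¹ := by simp
  have hk2 : (((k + 2 : ℕ) : ℝ)) = k + 2 := by push_cast; ring
  rw [hk2]
  have hρ0 := (rate_pos (k := (k : ℝ) + 2) (p := p) hS.one_le hS.le_inv).le
  refine norm_le_of_forall_inner_le (by positivity) fun F => ?_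
  set ρ := rate μ |z.im|⁻¹ (k + 2) p with hρ
  set u := (resolventOp P z ^ (k + 2)) (weightOp n c f) with hu
  -- The left factor lives at the conjugate spectral parameter, which is again a sample. The second
  -- boundary term is therefore the first one with f and F exchanged.
  have hV := HV δ h P M V hδ0 hS.hasForm z hS.im_ne (k + 1) (weightOp n c f) (weightOp n c F)
    (KB * (h * ρ) * ‖f‖ * ‖F‖) (KS * ρ * (‖f‖ * ‖F‖))
    (fun γ hγ => ⟨HB h P M V μ z hS γ hγ f F, by
      rw [norm_inner_symm]
      have := HB h P M V μ (conj z) hS.conjugate γ hγ F f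
      rw [hTc] at this
      exact this.trans (le_of_eq (by ring))⟩)
    (fun i hi => by
      obtain ⟨h1, h2, h3, h4, hK₁, hK₂, H₁, H₂⟩ := hE i hi
      have a1 := H₁ h P M V μ (conj z) hS.conjugate F
      have a2 := H₂ h P M V μ z hS f
      rw [hTc] at a1
      refine ⟨_, _, _, _, (logWeight_bracket_neg (n := n) h1).c1Bounded.isMultiplier,
        (logWeight_bracket_neg (n := n) h2).c1Bounded.isMultiplier,
        fun x => Real.rpow_pos_of_pos (bracket_pos x) _,
        fun x => Real.rpow_pos_of_pos (bracket_pos x) _, fun x => ?_, a1, a2, ?_⟩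
      · rw [← Real.rpow_add (bracket_pos x)]
        exact Real.rpow_le_rpow_of_exponent_le (one_le_bracket x) (by linarith)
      · have e1 : rate μ |z.im|⁻¹ ((i + 1 : ℕ) : ℝ) (p₁ i)
            * rate μ |z.im|⁻¹ ((k + 1 - i : ℕ) : ℝ) (p₂ i) = ρ := by
          rw [mul_rate_mul_rate hS.one_le hS.le_inv, h4, Nat.cast_sub hi.le]
          push_cast
          rw [hρ]
          congr 1
          ring
        have e2 : K₁ i * K₂ i ≤ KS := (le_abs_self _).trans
          (Finset.single_le_sum (f := fun i => |K₁ i * K₂ i|) (fun _ _ => abs_nonneg _)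
            (Finset.mem_range.2 hi))
        calc _ = (K₁ i * K₂ i) * (rate μ |z.im|⁻¹ ((i + 1 : ℕ) : ℝ) (p₁ i)
            * rate μ |z.im|⁻¹ ((k + 1 - i : ℕ) : ℝ) (p₂ i)) * (‖f‖ * ‖F‖) := by ring
          _ ≤ _ := by
            rw [e1]
            gcongr)
  set v := (resolventOp P z ^ (k + 1)) (weightOp n c f) with hv
  change 2 * h * ((k + 1 : ℕ) : ℝ) * ‖⟪weightOp n c F, z • u + v⟫_ℂ‖ ≤ _ at hV
  have h1 : ‖⟪weightOp n c F, z • u + v⟫_ℂ‖ ≤ (KB + K * KS) * ρ * ‖f‖ * ‖F‖ := by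
    have hkm : (1 : ℝ) ≤ ((k + 1 : ℕ) : ℝ) := by
      push_cast
      linarith [Nat.cast_nonneg (α := ℝ) k]
    have h2 : 2 * (KB * (h * ρ) * ‖f‖ * ‖F‖) ≤ 2 * (KB * (h * ρ) * ‖f‖ * ‖F‖) * ((k + 1 : ℕ) : ℝ) :=
      le_mul_of_one_le_right (by positivity) hkm
    have h3 : 0 ≤ K * (h * (((k + 1 : ℕ) : ℝ) * (KS * ρ * (‖f‖ * ‖F‖)))) := by positivity
    have h4 : 0 < 2 * h * ((k + 1 : ℕ) : ℝ) := by positivity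
    refine le_of_mul_le_mul_left ?_ h4
    refine hV.trans ?_
    calc _ ≤ 2 * (KB * (h * ρ) * ‖f‖ * ‖F‖) * ((k + 1 : ℕ) : ℝ)
          + 2 * (K * (h * (((k + 1 : ℕ) : ℝ) * (KS * ρ * (‖f‖ * ‖F‖))))) := by linarith
      _ = _ := by ring
  have h2 : ‖⟪weightOp n c F, v⟫_ℂ‖ ≤ KR * ρ * ‖f‖ * ‖F‖ := by
    rw [weightOp_eq_mulOp, inner_mulOp_left hw]
    refine (norm_inner_le_norm _ _).trans ?_
    rw [mul_comm]
    refine mul_le_mul_of_nonneg_right ?_ (norm_nonneg _)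
    refine (HR h P M V μ z hS f none rfl).trans ?_
    have h3 := rate_le_mul_rate_succ hS.one_le hS.le_inv hh hS.inv_le (k + 1) p
    rw [show (k : ℝ) + 1 + 1 = k + 2 by ring] at h3
    have h4 : h * ρ ≤ ρ := mul_le_of_le_one_left hρ0 hS.hasForm.h_le_one
    have h5 := h3.trans h4
    push_cast
    gcongr
  have h3 : r * ‖⟪F, weightOp n c u⟫_ℂ‖ ≤ (KB + K * KS + KR) * ρ * ‖f‖ * ‖F‖ := by
    have e1 : ⟪weightOp n c F, z • u + v⟫_ℂ - ⟪weightOp n c F, v⟫_ℂ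
        = z * ⟪F, weightOp n c u⟫_ℂ := by
      rw [inner_add_right, add_sub_cancel_right, inner_smul_right]
      congr 1
      exact inner_mulOp_left hw F u
    calc r * ‖⟪F, weightOp n c u⟫_ℂ‖ ≤ ‖z‖ * ‖⟪F, weightOp n c u⟫_ℂ‖ := by
          gcongr
          exact hS.le_norm
      _ = ‖⟪weightOp n c F, z • u + v⟫_ℂ - ⟪weightOp n c F, v⟫_ℂ‖ := by rw [e1, norm_mul]
      _ ≤ _ := (norm_sub_le _ _).trans (add_le_add h1 h2)
      _ = _ := by ring
  calc ‖⟪F, weightOp n c u⟫_ℂ‖ = r⁻¹ * (r * ‖⟪F, weightOp n c u⟫_ℂ‖) := by field_simp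
    _ ≤ r⁻¹ * ((KB + K * KS + KR) * ρ * ‖f‖ * ‖F‖) := by gcongr
    _ = _ := by ring

/-- Weighted bounds for all powers of the resolvent. -/
theorem powerBounds (hδ : 1 < δ) (hC : 0 ≤ C) (hr : 0 < r) (k : ℕ) :
    PowerBounds n δ C r L L' k := by
  induction k using Nat.strong_induction_on with
  | _ k ih =>
    rcases k with _ | _ | k
    · exact powerBounds_zero
    · refine powerBounds_succ_of_diag hδ fun c p hc hcδ hpc hpk => DecayBound.sandwich hc ?_
      simpa using hpk
    · refine powerBounds_succ_of_diag hδ fun c p hc hcδ hpc hpk => ?_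
      have h1 : ((k + 1 : ℕ) : ℝ) + 1 = k + 2 := by push_cast; ring
      rw [h1] at hpk
      have h2 : (0 : ℝ) ≤ k := k.cast_nonneg
      -- The step is made for p ≥ 1; smaller p follow because the rate is decreasing in p, and 1 is
      -- admissible since c > 1/2.
      exact (decayBound_diag hδ hC hr (fun j hj => ih j (by omega)) hc hcδ (le_max_right p 1)
        (max_lt hpc (by linarith)) (max_lt hpk (by linarith))).anti (le_max_left p 1)

end Induction

end SemiclassicalDecay

end

noncomputable section

namespace SemiclassicalDecay

/-! ### From limiting absorption to resolvent bounds off the axis -/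

section Samples

open scoped InnerProductSpace ComplexConjugate

variable {n : ℕ}

theorem HasForm.mono {δ C C' h : ℝ} {P : L2 n →ₗ.[ℂ] L2 n}
    {M : Option (Fin n) → Option (Fin n) → Space n → ℝ} {V : Space n → ℝ}
    (hF : HasForm δ C h P M V) (hC : C ≤ C') : HasForm δ C' h P M V where
  isSelfAdjoint := hF.isSelfAdjoint
  nonneg := hF.nonneg.trans hC
  h_pos := hF.h_pos
  h_le_one := hF.h_le_one
  symm := hF.symm
  c1Bounded := hF.c1Bounded
  aestronglyMeasurable := hF.aestronglyMeasurable
  abs_le α β x := (hF.abs_le α β x).trans hC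
  abs_fderiv_le α β k x := (hF.abs_fderiv_le α β k x).trans
    (mul_le_mul_of_nonneg_right hC (Real.rpow_pos_of_pos (bracket_pos x) _).le)
  abs_le_short α x := (hF.abs_le_short α x).trans
    (mul_le_mul_of_nonneg_right hC (Real.rpow_pos_of_pos (bracket_pos x) _).le)
  abs_V_le := hF.abs_V_le.mono fun x hx => hx.trans
    (mul_le_mul_of_nonneg_right hC (Real.rpow_pos_of_pos (bracket_pos x) _).le)
  inH2 := hF.inH2
  inner_apply := hF.inner_apply
  norm_jet_le u α := (hF.norm_jet_le u α).trans (mul_le_mul_of_nonneg_right hC (by positivity))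
  norm_jet_jet_le u i j := (hF.norm_jet_jet_le u i j).trans
    (mul_le_mul_of_nonneg_right hC (by positivity))

/-- The one-sided weighted resolvent bound that follows from the limiting absorption principle. -/
theorem norm_resolventOp_weightOp_le {P : L2 n →ₗ.[ℂ] L2 n} (hP : IsSelfAdjoint P) {b B μ d l η : ℝ}
    (hb : 0 ≤ b) (hB : 0 ≤ B) (hμ : 1 ≤ μ) (hd : 0 < d) {s : Set ℝ}
    (hs : Metric.closedBall l (2 * d) ⊆ s) {R : ℝ → (L2 n →L[ℂ] L2 n)}
    (hR : ∀ x ∈ s, Tendsto (fun η : ℝ => weightedResolvent P b (x + η * Complex.I)) (𝓝[>] 0)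
      (𝓝 (R x)) ∧ ‖R x‖ ≤ B * μ) (hη : 0 < η) (hημ : μ ≤ η⁻¹) (f : L2 n) :
    ‖resolventOp P (l + η * Complex.I) (weightOp n b f)‖
      ≤ Real.sqrt (Real.pi * B + (d ^ 2)⁻¹) * rate μ η⁻¹ 1 (1 / 2) * ‖f‖ := by
  have hw := (logWeight_bracket_neg (n := n) hb).c1Bounded.isMultiplier
  have hμ0 : 0 < μ := by linarith
  -- Applied to the vector ⟨x⟩^{-b} f. Its boundary values are those of the weighted resolvent at f,
  -- which gives M = B μ ‖f‖².
  have h1 := mul_norm_resolventOp_sq_le hP (weightOp n b f) (M := B * μ * ‖f‖ ^ 2) (by positivity)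
    (fun x hx => ⟨(⟪f, R x f⟫_ℂ).im, ?_, ?_⟩) hd hs hη
  · have hη1 : η ≤ 1 := by
      rw [le_inv_comm₀ hμ0 hη] at hημ
      exact hημ.trans (inv_le_one_of_one_le₀ hμ)
    have h2 : ‖weightOp n b f‖ ^ 2 ≤ ‖f‖ ^ 2 := by
      have := norm_weightOp_le hb f
      gcongr
    have h3 : η / d ^ 2 * ‖weightOp n b f‖ ^ 2 ≤ (d ^ 2)⁻¹ * μ * ‖f‖ ^ 2 := by
      rw [div_eq_inv_mul]
      gcongr
      linarith
    set N := ‖resolventOp P (l + η * Complex.I) (weightOp n b f)‖ with hN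
    refine abs_le_of_sq_le_sq' (?_ : N ^ 2 ≤ _) (by
      have := (rate_pos (k := 1) (p := 1 / 2) hμ hημ).le
      positivity) |>.2
    have h4 : rate μ η⁻¹ 1 (1 / 2) ^ 2 = μ * η⁻¹ := by
      rw [sq, mul_rate_mul_rate hμ hημ]
      unfold rate
      norm_num
    have h5 : 0 ≤ Real.pi * B + (d ^ 2)⁻¹ := by positivity
    rw [mul_pow, mul_pow, Real.sq_sqrt h5, h4]
    have h6 : η * N ^ 2 ≤ (Real.pi * B + (d ^ 2)⁻¹) * μ * ‖f‖ ^ 2 := by linarith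
    calc N ^ 2 = η⁻¹ * (η * N ^ 2) := by field_simp
      _ ≤ η⁻¹ * ((Real.pi * B + (d ^ 2)⁻¹) * μ * ‖f‖ ^ 2) := by gcongr
      _ = _ := by ring
  · refine (Complex.abs_im_le_norm _ |> (le_abs_self _).trans).trans ?_
    refine (norm_inner_le_norm _ _).trans ?_
    have h2 := (R x).le_opNorm f
    have h3 := (hR x hx).2
    calc ‖f‖ * ‖R x f‖ ≤ ‖f‖ * (B * μ * ‖f‖) := by
          gcongr
          exact h2.trans (by gcongr)
      _ = _ := by ring
  · have h2 : Tendsto (fun η : ℝ => weightedResolvent P b (x + η * Complex.I) f) (𝓝[>] 0)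
        (𝓝 (R x f)) :=
      ((ContinuousLinearMap.apply ℂ (L2 n) f).continuous.tendsto _).comp (hR x hx).1
    have h3 := (Complex.continuous_im.tendsto _).comp
      (Tendsto.inner (tendsto_const_nhds (x := f)) h2)
    refine h3.congr fun η => ?_
    simp only [Function.comp_apply]
    congr 1
    exact (inner_mulOp_left hw f _).symm

/-- R(z)² is the adjoint of R(conj z) composed with R(z). A weighted square is therefore a product
of two one-sided bounds. -/
theorem norm_sandwich_pow_two_le {P : L2 n →ₗ.[ℂ] L2 n} (hP : IsSelfAdjoint P) {z : ℂ}
    (hz : z.im ≠ 0) {b A : ℝ} (hb : 0 ≤ b) (hA : 0 ≤ A)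
    (H : ∀ f, ‖resolventOp P z (weightOp n b f)‖ ≤ A * ‖f‖) :
    ‖weightOp n b ∘L (resolventOp P z ^ 2) ∘L weightOp n b‖ ≤ A ^ 2 := by
  have hw := (logWeight_bracket_neg (n := n) hb).c1Bounded.isMultiplier
  have hz' : (conj z).im ≠ 0 := by simpa using hz
  refine ContinuousLinearMap.opNorm_le_bound _ (by positivity) fun f => ?_
  refine norm_le_of_forall_inner_le (by positivity) fun F => ?_
  have e1 : ⟪F, (weightOp n b ∘L (resolventOp P z ^ 2) ∘L weightOp n b) f⟫_ℂ
      = ⟪resolventOp P (conj z) (weightOp n b F), resolventOp P z (weightOp n b f)⟫_ℂ := by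
    have h1 := inner_pow_resolventOp_conj hP hz 1 (weightOp n b F)
      (resolventOp P z (weightOp n b f))
    rw [pow_one, pow_one] at h1
    rw [h1]
    refine (inner_mulOp_left hw F _).symm.trans ?_
    rw [sq]
    rfl
  rw [e1]
  refine (norm_inner_le_norm _ _).trans ?_
  rw [norm_resolventOp_conj hP hz]
  calc _ ≤ (A * ‖F‖) * (A * ‖f‖) := mul_le_mul (H F) (H f) (norm_nonneg _) (by positivity)
    _ = _ := by ring

theorem hasDerivAt_sandwich {H : Type*} [NormedAddCommGroup H] [NormedSpace ℂ H] (w : H →L[ℂ] H)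
    {G : ℝ → (H →L[ℂ] H)} {G' : H →L[ℂ] H} {t : ℝ} (hG : HasDerivAt G G' t) :
    HasDerivAt (fun y => w ∘L G y ∘L w) (w ∘L G' ∘L w) t := by
  set Φ : (H →L[ℂ] H) →L[ℂ] (H →L[ℂ] H) :=
    (ContinuousLinearMap.compL ℂ H H H w) ∘L ((ContinuousLinearMap.compL ℂ H H H).flip w) with hΦ
  exact (Φ.restrictScalars ℝ).hasFDerivAt.comp_hasDerivAt t hG

theorem norm_sandwich_le {P : L2 n →ₗ.[ℂ] L2 n} (hP : IsSelfAdjoint P) {z : ℂ} (hz : z.im ≠ 0)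
    {b : ℝ} (hb : 0 ≤ b) (k : ℕ) :
    ‖weightOp n b ∘L (resolventOp P z ^ k) ∘L weightOp n b‖ ≤ |z.im|⁻¹ ^ k := by
  refine ContinuousLinearMap.opNorm_le_bound _ (by positivity) fun f => ?_
  refine (norm_weightOp_le hb _).trans ?_
  have h1 : ∀ g : L2 n, ‖(resolventOp P z ^ k) g‖ ≤ |z.im|⁻¹ ^ k * ‖g‖ := fun g =>
    norm_pow_resolventOp_le hP hz k g
  exact (h1 _).trans (mul_le_mul_of_nonneg_left (norm_weightOp_le hb f) (by positivity))

/-- The two-sided weighted resolvent bound, obtained by integration in the imaginary direction. -/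
theorem norm_sandwich_resolventOp_le {P : L2 n →ₗ.[ℂ] L2 n} (hP : IsSelfAdjoint P)
    {b A μ l η p : ℝ} (hb : 0 ≤ b) (hA : 0 ≤ A) (hμ : 1 ≤ μ) (hp : p < 1)
    (H : ∀ η : ℝ, 0 < η → μ ≤ η⁻¹ → ∀ f, ‖resolventOp P (l + η * Complex.I) (weightOp n b f)‖
      ≤ A * rate μ η⁻¹ 1 (1 / 2) * ‖f‖) (hη : 0 < η) (hημ : μ ≤ η⁻¹) :
    ‖weightOp n b ∘L resolventOp P (l + η * Complex.I) ∘L weightOp n b‖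
      ≤ (1 + A ^ 2 / (1 - p)) * rate μ η⁻¹ 1 p := by
  have hμ0 : 0 < μ := by linarith
  have hp1 : 0 < 1 - p := by linarith
  set K := 1 + A ^ 2 / (1 - p) with hK
  have hK1 : 1 ≤ K := by
    rw [hK]
    have : 0 ≤ A ^ 2 / (1 - p) := by positivity
    linarith
  have hKA : A ^ 2 ≤ K * (1 - p) := by
    rw [hK, add_mul, div_mul_cancel₀ _ hp1.ne']
    linarith
  have hημ' : η ≤ μ⁻¹ := by rwa [le_inv_comm₀ hμ0 hη] at hημ
  -- The path descends from height 1/μ, where the trivial bound is μ, to height η; t = 1/μ - Im z is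
  -- the distance covered.
  set T : ℝ → (L2 n →L[ℂ] L2 n) := fun t =>
    weightOp n b ∘L resolventOp P (l + ((μ⁻¹ - t : ℝ) : ℂ) * Complex.I) ∘L weightOp n b with hT
  set T' : ℝ → (L2 n →L[ℂ] L2 n) := fun t =>
    weightOp n b ∘L ((-Complex.I) • resolventOp P (l + ((μ⁻¹ - t : ℝ) : ℂ) * Complex.I) ^ 2)
      ∘L weightOp n b with hT'
  -- At height y the derivative is at most A² μ / y, whose integral is only logarithmic. Since μ ≤
  -- 1/y it is at most A² μ^p y^{p-2}, which for p < 1 has the primitive μ^p y^{p-1} / (1 - p). This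
  -- accounts for the constant K and for the exclusion of p = 1.
  set B : ℝ → ℝ := fun t => K * (μ ^ p * (μ⁻¹ - t) ^ (p - 1)) with hB
  set B' : ℝ → ℝ := fun t => K * (μ ^ p * ((1 - p) * (μ⁻¹ - t) ^ (p - 2))) with hB'
  have hpos : ∀ t ∈ Set.Icc 0 (μ⁻¹ - η), 0 < μ⁻¹ - t := fun t ht => by linarith [ht.2]
  have hderiv : ∀ t ∈ Set.Icc 0 (μ⁻¹ - η), HasDerivAt T (T' t) t := by
    intro t ht
    have h1 : HasDerivAt (fun t : ℝ => (l : ℂ) + ((μ⁻¹ - t : ℝ) : ℂ) * Complex.I) (-Complex.I) t := by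
      have h2 : HasDerivAt (fun t : ℝ => μ⁻¹ - t) (-1) t := by
        simpa using (hasDerivAt_id t).const_sub μ⁻¹
      simpa using (h2.ofReal_comp.mul_const Complex.I).const_add (l : ℂ)
    have h3 := hasDerivAt_resolventOp_comp hP h1 (by simpa using (hpos t ht).ne') 1
    simp only [pow_one, Nat.cast_one, mul_one, one_add_one_eq_two] at h3
    exact hasDerivAt_sandwich (weightOp n b) h3
  have hBderiv : ∀ t ∈ Set.Icc 0 (μ⁻¹ - η), HasDerivAt B (B' t) t := by
    intro t ht
    have h2 : HasDerivAt (fun t : ℝ => μ⁻¹ - t) (-1) t := by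
      simpa using (hasDerivAt_id t).const_sub μ⁻¹
    have h3 := ((h2.rpow_const (p := p - 1) (Or.inl (hpos t ht).ne')).const_mul (μ ^ p)).const_mul K
    have e : K * (μ ^ p * (-1 * (p - 1) * (μ⁻¹ - t) ^ (p - 1 - 1))) = B' t := by
      rw [show p - 1 - 1 = p - 2 by ring]
      simp only [hB']
      ring
    rw [← e]
    exact h3
  have hbound : ∀ t ∈ Set.Ico 0 (μ⁻¹ - η), ‖T' t‖ ≤ B' t := by
    intro t ht
    have h0 := hpos t (Set.Ico_subset_Icc_self ht)
    set y := μ⁻¹ - t with hy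
    have hyμ : μ ≤ y⁻¹ := by
      rw [le_inv_comm₀ hμ0 h0]
      linarith [ht.1]
    have hr := (rate_pos (k := 1) (p := 1 / 2) hμ hyμ).le
    have e1 : T' t = (-Complex.I) • (weightOp n b ∘L
        (resolventOp P (l + (y : ℂ) * Complex.I) ^ 2) ∘L weightOp n b) := by
      rw [hT']
      simp only [ContinuousLinearMap.smul_comp, ContinuousLinearMap.comp_smul, hy]
    rw [e1, norm_smul, norm_neg, Complex.norm_I, one_mul]
    refine (norm_sandwich_pow_two_le hP (by simpa using h0.ne') hb (by positivity)
      (H y h0 hyμ)).trans ?_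
    rw [mul_pow, sq (rate _ _ _ _), mul_rate_mul_rate hμ hyμ]
    have h3 : rate μ y⁻¹ (1 + 1) (1 / 2 + 1 / 2) ≤ rate μ y⁻¹ 2 p := by
      rw [one_add_one_eq_two, show (1 / 2 : ℝ) + 1 / 2 = 1 by norm_num]
      exact rate_anti hμ hyμ hp.le
    have h4 : rate μ y⁻¹ 2 p = μ ^ p * y ^ (p - 2) := by
      unfold rate
      rw [Real.inv_rpow h0.le, ← Real.rpow_neg h0.le, neg_sub]
    calc A ^ 2 * rate μ y⁻¹ (1 + 1) (1 / 2 + 1 / 2) ≤ K * (1 - p) * (μ ^ p * y ^ (p - 2)) := by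
          rw [← h4]
          have := (rate_pos (k := 1 + 1) (p := 1 / 2 + 1 / 2) hμ hyμ).le
          gcongr
      _ = B' t := by
          simp only [hB']
          ring
  have hstart : ‖T 0‖ ≤ B 0 := by
    have h1 : ‖T 0‖ ≤ μ := by
      have h2 := norm_sandwich_le hP (z := l + ((μ⁻¹ - 0 : ℝ) : ℂ) * Complex.I)
        (by simpa using hμ0.ne') hb 1
      rw [pow_one, pow_one] at h2
      refine h2.trans (le_of_eq ?_)
      simp [abs_of_pos hμ0]
    have h2 : B 0 = K * μ := by
      rw [hB]
      simp only [sub_zero]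
      rw [Real.inv_rpow hμ0.le, ← Real.rpow_neg hμ0.le, ← Real.rpow_add hμ0]
      congr 1
      rw [show p + -(p - 1) = 1 by ring, Real.rpow_one]
    rw [h2]
    nlinarith
  have h := image_norm_le_of_norm_deriv_right_le_deriv_boundary' (f := T) (f' := T') (B := B)
    (B' := B') (a := 0) (b := μ⁻¹ - η) (fun t ht => (hderiv t ht).continuousAt.continuousWithinAt)
    (fun t ht => (hderiv t (Set.Ico_subset_Icc_self ht)).hasDerivWithinAt) hstart
    (fun t ht => (hBderiv t ht).continuousAt.continuousWithinAt)
    (fun t ht => (hBderiv t (Set.Ico_subset_Icc_self ht)).hasDerivWithinAt) hbound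
    (Set.right_mem_Icc.2 (by linarith))
  have e1 : rate μ η⁻¹ 1 p = μ ^ p * η ^ (p - 1) := by
    unfold rate
    rw [Real.inv_rpow hη.le, ← Real.rpow_neg hη.le, neg_sub]
  rw [e1]
  simpa only [hT, hB, sub_sub_cancel] using h

end Samples

end SemiclassicalDecay

end

noncomputable section

namespace SemiclassicalDecay

/-! ### Uniform bounds in the energy window -/

section Conclusion

open scoped InnerProductSpace ComplexConjugate

variable {n : ℕ}

/-- The hypotheses provide samples at all spectral parameters close to the real axis. -/
theorem exists_resolventSample {c : Coefficients n} {P : ℝ → (L2 n →ₗ.[ℂ] L2 n)} {δ E ε₀ : ℝ}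
    (hδ : 0 ≤ δ) (hE : ε₀ < E) {μ : ℝ → ℝ} (hμ : ∀ h ∈ Set.Ioc (0 : ℝ) 1, h⁻¹ ≤ μ h)
    (hreg : c.Regular) (hP : ∀ h ∈ Set.Ioc (0 : ℝ) 1, IsSelfAdjointRealization c h (P h))
    (hell : Elliptic P) (hshort : c.ShortRange δ) (hlim : LimitingAbsorption P μ E ε₀)
    {S : Set ℝ} (hSc : IsCompact S) (hS : S ⊆ Set.Ioo (E - ε₀) (E + ε₀)) :
    ∃ (C r : ℝ) (L : ℝ → ℝ) (L' : ℝ → ℝ → ℝ), 0 ≤ C ∧ 0 < r ∧ ∀ h ∈ Set.Ioc (0 : ℝ) 1,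
      ∃ M V, ∀ l ∈ S, ∀ η : ℝ, 0 < η → μ h ≤ η⁻¹ → ∀ σ : ℝ, (σ = 1 ∨ σ = -1) →
        ResolventSample δ C r L L' h (P h) M V (μ h) (l + (σ * η : ℝ) * Complex.I) := by
  obtain ⟨C₀, hC₀⟩ := exists_hasForm hδ hreg hP hell hshort
  -- Compactness of S leaves room: a ball of radius d around each point stays inside the window, as
  -- the localized Poisson argument requires.
  obtain ⟨d, hd, hdS⟩ := hSc.exists_cthickening_subset_open isOpen_Ioo hS
  have hlim' : ∀ b : ℝ, ∃ B : ℝ, 1 / 2 < b → 0 ≤ B ∧ ∀ h ∈ Set.Ioc (0 : ℝ) 1,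
      ∃ R : ℝ → (L2 n →L[ℂ] L2 n), ∀ x ∈ Set.Icc (E - ε₀) (E + ε₀),
        Tendsto (fun η : ℝ => weightedResolvent (P h) b (x + η * Complex.I)) (𝓝[>] 0)
          (𝓝 (R x)) ∧ ‖R x‖ ≤ B * μ h := by
    intro b
    by_cases hb : 1 / 2 < b
    · obtain ⟨B, hB⟩ := hlim b hb
      refine ⟨|B|, fun _ => ⟨abs_nonneg _, fun h hh => ?_⟩⟩
      obtain ⟨R, -, hR⟩ := hB h hh 1 (Or.inl rfl)
      refine ⟨R, fun x hx => ⟨by simpa using (hR x hx).1, (hR x hx).2.trans ?_⟩⟩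
      have : 0 < μ h := (inv_pos.2 hh.1).trans_le (hμ h hh)
      gcongr
      exact le_abs_self B
    · exact ⟨0, fun h => absurd h hb⟩
  choose B hB using hlim'
  set L : ℝ → ℝ := fun b => Real.sqrt (Real.pi * B b + ((d / 2) ^ 2)⁻¹) with hL
  refine ⟨max (max C₀ 0) (E + ε₀ + 1), E - ε₀, L, fun b p => 1 + L b ^ 2 / (1 - p),
    (le_max_right _ _).trans (le_max_left _ _), by linarith, fun h hh => ?_⟩
  obtain ⟨M, V, hF⟩ := hC₀ h hh
  have hFm := hF.mono ((le_max_left C₀ 0).trans (le_max_left _ (E + ε₀ + 1)))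
  have hPs := (hP h hh).isSelfAdjoint
  have hμ1 : 1 ≤ μ h := ((one_le_inv₀ hh.1).2 hh.2).trans (hμ h hh)
  refine ⟨M, V, fun l hl => ?_⟩
  have hball : Metric.closedBall l (2 * (d / 2)) ⊆ Set.Icc (E - ε₀) (E + ε₀) := by
    rw [mul_div_cancel₀ _ two_ne_zero]
    exact (Metric.closedBall_subset_cthickening hl d).trans (hdS.trans Set.Ioo_subset_Icc_self)
  have hen : ∀ b, 1 / 2 < b → ∀ η : ℝ, 0 < η → μ h ≤ η⁻¹ → ∀ f,
      ‖resolventOp (P h) (l + η * Complex.I) (weightOp n b f)‖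
        ≤ L b * rate (μ h) η⁻¹ 1 (1 / 2) * ‖f‖ := by
    intro b hb η hη hημ f
    obtain ⟨hB0, hBR⟩ := hB b hb
    obtain ⟨R, hR⟩ := hBR h hh
    exact norm_resolventOp_weightOp_le hPs (by linarith) hB0 hμ1 (by linarith) hball hR hη hημ f
  have key : ∀ η : ℝ, 0 < η → μ h ≤ η⁻¹ →
      ResolventSample δ (max (max C₀ 0) (E + ε₀ + 1)) (E - ε₀) L
        (fun b p => 1 + L b ^ 2 / (1 - p)) h (P h) M V (μ h) (l + η * Complex.I) := by
    intro η hη hημ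
    have him : ((l : ℂ) + η * Complex.I).im = η := by simp
    have hre : ((l : ℂ) + η * Complex.I).re = l := by simp
    have habs : |((l : ℂ) + η * Complex.I).im| = η := by rw [him, abs_of_pos hη]
    have hl' := hS hl
    have hη1 : η ≤ 1 := by
      rw [le_inv_comm₀ (by linarith) hη] at hημ
      exact hημ.trans (inv_le_one_of_one_le₀ hμ1)
    refine ⟨hFm, hμ h hh, by rw [him]; exact hη.ne', by rw [habs]; exact hημ, ?_, ?_, ?_, ?_⟩
    · have := (le_abs_self _).trans (Complex.abs_re_le_norm ((l : ℂ) + η * Complex.I))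
      rw [hre] at this
      linarith [hl'.1]
    · refine le_max_of_le_right ?_
      have := Complex.norm_le_abs_re_add_abs_im ((l : ℂ) + η * Complex.I)
      rw [hre, habs, abs_of_pos (by linarith [hl'.1])] at this
      linarith [hl'.2]
    · intro b hb f
      rw [habs]
      exact hen b hb η hη hημ f
    · intro b p hb hp
      rw [habs]
      exact norm_sandwich_resolventOp_le hPs (by linarith) (Real.sqrt_nonneg _) hμ1 hp (hen b hb)
        hη hημ
  intro η hη hημ σ hσ
  rcases hσ with rfl | rfl
  · simpa using key η hη hημ
  -- The lower half plane follows by passing to adjoints.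
  · have := (key η hη hημ).conjugate
    simpa using this

/-- A non-integer between two real numbers. -/
theorem exists_nat_add_btwn {s u : ℝ} (hs : 0 ≤ s) (hsu : s < u) :
    ∃ (m : ℕ) (q : ℝ), 0 < q ∧ q < 1 ∧ s < m + q ∧ m + q < u := by
  -- Irrationality keeps the fractional part q away from 0, as the Hölder argument demands.
  obtain ⟨x, hx, hsx, hxu⟩ := exists_irrational_btwn hsu
  have hx0 : 0 ≤ x := hs.trans hsx.le
  have h1 := Nat.floor_le hx0
  have h2 := Nat.lt_floor_add_one x
  have h3 : x ≠ (⌊x⌋₊ : ℝ) := hx.ne_nat _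
  refine ⟨⌊x⌋₊, x - ⌊x⌋₊, ?_, by linarith, by linarith, by linarith⟩
  exact sub_pos.2 (lt_of_le_of_ne h1 h3.symm)

/-- Resolvent powers between the weights of the theorem. -/
theorem exists_norm_sandwich_pow_le {c : Coefficients n} {P : ℝ → (L2 n →ₗ.[ℂ] L2 n)}
    {δ E ε₀ : ℝ} (hδ : 1 < δ) (hE : ε₀ < E) {μ : ℝ → ℝ} (hμ : ∀ h ∈ Set.Ioc (0 : ℝ) 1, h⁻¹ ≤ μ h)
    (hreg : c.Regular) (hP : ∀ h ∈ Set.Ioc (0 : ℝ) 1, IsSelfAdjointRealization c h (P h))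
    (hell : Elliptic P) (hshort : c.ShortRange δ) (hlim : LimitingAbsorption P μ E ε₀)
    {S : Set ℝ} (hSc : IsCompact S) (hS : S ⊆ Set.Ioo (E - ε₀) (E + ε₀))
    {b : ℝ} {N : ℕ} {q : ℝ} (hq : 0 < q) (hq1 : q < 1) (hNb : N + q + 1 / 2 < b)
    (hNδ : N + q < δ - 1) :
    ∃ K : ℝ, 0 ≤ K ∧ ∀ h ∈ Set.Ioc (0 : ℝ) 1, ∀ k, 1 ≤ k → k ≤ N + 2 → ∀ l ∈ S,
      ∀ η ∈ Set.Ioc (0 : ℝ) 1, ∀ σ : ℝ, (σ = 1 ∨ σ = -1) →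
        ‖weightOp n b ∘L (resolventOp (P h) (l + (σ * η : ℝ) * Complex.I) ^ k) ∘L weightOp n b‖
          ≤ K * μ h ^ (1 + (N + q)) * η ^ (q - 1) := by
  obtain ⟨C, r, L, L', hC, hr, H⟩ := exists_resolventSample (by linarith) hE hμ hreg hP hell hshort
    hlim hSc hS
  have hN0 : (0 : ℝ) ≤ N := N.cast_nonneg
  -- The bound for R^{k+1} is used with p = k + q, where k ≤ N + 1. The left weight c' must exceed N
  -- + q + 1/2 to allow these p, and stay below b and δ - 1/2.
  obtain ⟨c', hc1, hc2⟩ := exists_between (lt_min hNb (show (N : ℝ) + q + 1 / 2 < δ - 1 / 2 by linarith))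
  rw [lt_min_iff] at hc2
  have hD : ∀ k : ℕ, ∃ K : ℝ, 0 ≤ K ∧ (k ≤ N + 1 → ∀ h P M V μ z,
      ResolventSample δ C r L L' (n := n) h P M V μ z → ∀ f,
        ‖weightOp n b ((resolventOp P z ^ (k + 1)) (weightOp n b f))‖
          ≤ K * rate μ |z.im|⁻¹ (k + 1 : ℕ) (k + q) * ‖f‖) := by
    intro k
    by_cases hk : k ≤ N + 1
    · have hk' : (k : ℝ) ≤ N + 1 := by exact_mod_cast hk
      obtain ⟨K, hK, HK⟩ := (powerBounds (L := L) (L' := L') hδ hC hr (k + 1) c' b (k + q)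
        (by linarith) hc2.2 (by linarith) hc2.1.le (by linarith)
        (Or.inl (by push_cast; linarith))).mono_left (by linarith) hc2.1.le
      exact ⟨K, hK, fun _ h P M V μ z hS f => HK h P M V μ z hS f none rfl⟩
    · exact ⟨0, le_rfl, fun h => absurd h hk⟩
  choose K hK HK using hD
  set K' : ℝ := 1 + ∑ k ∈ Finset.range (N + 2), K k with hK'
  have hsum0 : 0 ≤ ∑ k ∈ Finset.range (N + 2), K k := Finset.sum_nonneg fun k _ => hK k
  refine ⟨K', by linarith, fun h hh k hk1 hkN l hl η hη σ hσ => ?_⟩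
  obtain ⟨k, rfl⟩ : ∃ j, k = j + 1 := ⟨k - 1, by omega⟩
  obtain ⟨M, V, HS⟩ := H h hh
  have hPs := (hP h hh).isSelfAdjoint
  have hμ1 : 1 ≤ μ h := ((one_le_inv₀ hh.1).2 hh.2).trans (hμ h hh)
  have hμ0 : 0 < μ h := by linarith
  have hkN' : (k : ℝ) ≤ N + 1 := by exact_mod_cast (by omega : k ≤ N + 1)
  have hT1 : 1 ≤ η⁻¹ := (one_le_inv₀ hη.1).2 hη.2
  have habs : |((l : ℂ) + (σ * η : ℝ) * Complex.I).im| = η := by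
    rcases hσ with rfl | rfl <;> simp [abs_of_pos hη.1]
  have him : ((l : ℂ) + (σ * η : ℝ) * Complex.I).im ≠ 0 := by
    intro h0
    rw [h0, abs_zero] at habs
    exact hη.1.ne habs
  have e1 : η ^ (q - 1) = η⁻¹ ^ (1 - q) := by
    rw [Real.inv_rpow hη.1.le, ← Real.rpow_neg hη.1.le, neg_sub]
  have e2 : μ h ^ ((k : ℝ) + q) * η⁻¹ ^ (1 - q) ≤ μ h ^ (1 + (N + q)) * η ^ (q - 1) := by
    rw [e1]
    refine mul_le_mul_of_nonneg_right
      (Real.rpow_le_rpow_of_exponent_le hμ1 (by linarith)) (Real.rpow_nonneg ?_ _)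
    linarith
  have hr0 : 0 ≤ μ h ^ (1 + (N + q)) * η ^ (q - 1) := by
    have := hη.1
    positivity
  rw [mul_assoc]
  -- If μ ≤ 1/η the spectral parameter is a sample and the rate is μ^{k+q} η^{q-1}. Otherwise the
  -- trivial bound η^{-(k+1)} = η^{-(k+q)} η^{q-1} is already smaller than that.
  rcases le_or_gt (μ h) η⁻¹ with hημ | hημ
  · have hSam := HS l hl η hη.1 hημ σ hσ
    refine ContinuousLinearMap.opNorm_le_bound _ (mul_nonneg (by linarith) hr0) fun f => ?_
    refine (HK k (by omega) h (P h) M V (μ h) _ hSam f).trans ?_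
    have e3 : rate (μ h) η⁻¹ ((k + 1 : ℕ) : ℝ) (k + q) = μ h ^ ((k : ℝ) + q) * η⁻¹ ^ (1 - q) := by
      unfold rate
      push_cast
      congr 2
      ring
    rw [habs, e3]
    have e4 : K k ≤ K' := by
      have := Finset.single_le_sum (f := K) (fun i _ => hK i) (Finset.mem_range.2 (by omega : k < N + 2))
      linarith
    have := hK k
    gcongr
  · refine (norm_sandwich_le hPs him (by linarith) (k + 1)).trans ?_
    rw [habs]
    have e3 : η⁻¹ ^ (k + 1) = η⁻¹ ^ ((k : ℝ) + q) * η⁻¹ ^ (1 - q) := by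
      rw [← Real.rpow_natCast, ← Real.rpow_add (by linarith)]
      congr 1
      push_cast
      ring
    rw [e3]
    have e4 : η⁻¹ ^ ((k : ℝ) + q) ≤ μ h ^ ((k : ℝ) + q) := by
      have : (0 : ℝ) ≤ k := k.cast_nonneg
      exact Real.rpow_le_rpow (by linarith) hημ.le (by linarith)
    calc _ ≤ μ h ^ ((k : ℝ) + q) * η⁻¹ ^ (1 - q) := by gcongr
      _ ≤ μ h ^ (1 + (N + q)) * η ^ (q - 1) := e2
      _ ≤ K' * (μ h ^ (1 + (N + q)) * η ^ (q - 1)) := le_mul_of_one_le_left hr0 (by linarith)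

end Conclusion

end SemiclassicalDecay

end

/-! ### Choice of exponents and conclusion -/

theorem theorem3p1 (n : ℕ) (hn : 2 ≤ n) (c : SemiclassicalDecay.Coefficients n)
    (P : ℝ → (SemiclassicalDecay.L2 n →ₗ.[ℂ] SemiclassicalDecay.L2 n))
    (δ : ℝ) (hδ : 1 < δ) (E ε₀ : ℝ) (hε₀ : 0 < ε₀) (hE : ε₀ < E)
    (μ : ℝ → ℝ) (hμ : ∀ h ∈ Set.Ioc (0 : ℝ) 1, h⁻¹ ≤ μ h)
    (hreg : c.Regular)
    (hP : ∀ h ∈ Set.Ioc (0 : ℝ) 1, SemiclassicalDecay.IsSelfAdjointRealization c h (P h))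
    (hell : SemiclassicalDecay.Elliptic P)
    (hshort : c.ShortRange δ)
    (hlim : SemiclassicalDecay.LimitingAbsorption P μ E ε₀)
    (φ : ℝ → ℂ) (hφ : ContDiff ℝ ∞ φ) (hφc : HasCompactSupport φ)
    (hφs : tsupport φ ⊆ Set.Ioo (E - ε₀) (E + ε₀))
    (s : ℝ) (hs : 0 ≤ s) (hsδ : s < δ - 1) (ϵ : ℝ) (hϵ : 0 < ϵ) (ε : ℝ) (hε : 0 < ε) :
    ∃ C : ℝ, 0 < C ∧ ∀ h ∈ Set.Ioc (0 : ℝ) 1,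
      (∀ f : SemiclassicalDecay.L2 n,
        ∫⁻ t : ℝ, ENNReal.ofReal (SemiclassicalDecay.bracket t ^ (2 * s) *
          ‖SemiclassicalDecay.sandwich s ϵ (SemiclassicalDecay.waveGroup (P h) φ t) f‖ ^ 2)
        ≤ ENNReal.ofReal (C * μ h ^ (2 + 2 * s + 2 * ε) * ‖f‖ ^ 2)) ∧
      (∀ t : ℝ,
        ‖SemiclassicalDecay.sandwich s ϵ (SemiclassicalDecay.waveGroup (P h) φ t)‖
          ≤ C * μ h ^ (1 + s + ε) * SemiclassicalDecay.bracket t ^ (-s)) ∧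
      (∀ f : SemiclassicalDecay.L2 n,
        ∫⁻ t : ℝ, ENNReal.ofReal (SemiclassicalDecay.bracket t ^ (2 * s) *
          ‖SemiclassicalDecay.sandwich s ϵ (SemiclassicalDecay.schrodingerGroup (P h) φ t) f‖ ^ 2)
        ≤ ENNReal.ofReal (C * μ h ^ (2 + 2 * s + 2 * ε) * ‖f‖ ^ 2)) ∧
      (∀ t : ℝ,
        ‖SemiclassicalDecay.sandwich s ϵ (SemiclassicalDecay.schrodingerGroup (P h) φ t)‖
          ≤ C * μ h ^ (1 + s + ε) * SemiclassicalDecay.bracket t ^ (-s)) := by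
  -- N + q > s gives the decay. N + q < s + ϵ makes the weight 1/2 + s + ϵ strong enough, N + q < s
  -- + ε keeps the power of μ below 1 + s + ε, and N + q < δ - 1 is what the short range condition
  -- permits.
  obtain ⟨N, q, hq, hq1, hsN, hNu⟩ := SemiclassicalDecay.exists_nat_add_btwn hs
    (lt_min (lt_min (show s < s + ϵ by linarith) (show s < s + ε by linarith)) hsδ)
  rw [lt_min_iff, lt_min_iff] at hNu
  obtain ⟨⟨hNϵ, hNε⟩, hNδ⟩ := hNu
  obtain ⟨K, hK, HK⟩ := SemiclassicalDecay.exists_norm_sandwich_pow_le hδ hE hμ hreg hP hell hshort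
    hlim hφc hφs (b := 1 / 2 + s + ϵ) hq hq1 (by linarith) hNδ
  obtain ⟨C₁, hC₁, H₁⟩ := SemiclassicalDecay.exists_waveGroup_decay
    (H := SemiclassicalDecay.L2 n) hφ hφc (a := E - ε₀) (by linarith)
    (fun l hl => (hφs hl).1) N hq hq1 hs hsN
  obtain ⟨C₂, hC₂, H₂⟩ := SemiclassicalDecay.exists_schrodingerGroup_decay
    (H := SemiclassicalDecay.L2 n) hφ hφc N hq hq1 hs hsN
  -- The pointwise bounds are linear in K and the integrated ones quadratic; the summand 1 ensures
  -- positivity.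
  set C : ℝ := (C₁ + C₂) * (K + K ^ 2) + 1 with hC
  have hCpos : 0 < C := by positivity
  have hle1 : ∀ A, 0 ≤ A → A ≤ C₁ + C₂ → A * K ≤ C := fun A hA hAC => by
    rw [hC]
    nlinarith [mul_le_mul_of_nonneg_right hAC hK, mul_nonneg (add_nonneg hC₁ hC₂) (sq_nonneg K)]
  have hle2 : ∀ A, 0 ≤ A → A ≤ C₁ + C₂ → A * K ^ 2 ≤ C := fun A hA hAC => by
    rw [hC]
    nlinarith [mul_le_mul_of_nonneg_right hAC (sq_nonneg K), mul_nonneg (add_nonneg hC₁ hC₂) hK]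
  refine ⟨C, hCpos, fun h hh => ?_⟩
  have hμ1 : 1 ≤ μ h := ((one_le_inv₀ hh.1).2 hh.2).trans (hμ h hh)
  have hμ0 : 0 < μ h := by linarith
  have hKμ : 0 ≤ K * μ h ^ (1 + (N + q)) := by positivity
  have hexp : μ h ^ (1 + (N + q)) ≤ μ h ^ (1 + s + ε) :=
    Real.rpow_le_rpow_of_exponent_le hμ1 (by linarith)
  have hexp2 : (μ h ^ (1 + (N + q))) ^ 2 ≤ μ h ^ (2 + 2 * s + 2 * ε) := by
    refine (pow_le_pow_left₀ (by positivity) hexp 2).trans (le_of_eq ?_)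
    rw [← Real.rpow_natCast, ← Real.rpow_mul hμ0.le]
    congr 1
    push_cast
    ring
  have hint : ∀ A, 0 ≤ A → A ≤ C₁ + C₂ → ∀ f : SemiclassicalDecay.L2 n,
      ENNReal.ofReal (A * (K * μ h ^ (1 + (N + q))) ^ 2 * ‖f‖ ^ 2)
        ≤ ENNReal.ofReal (C * μ h ^ (2 + 2 * s + 2 * ε) * ‖f‖ ^ 2) := by
    intro A hA hAC f
    refine ENNReal.ofReal_le_ofReal (mul_le_mul_of_nonneg_right ?_ (sq_nonneg _))
    rw [mul_pow, ← mul_assoc]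
    exact mul_le_mul (hle2 A hA hAC) hexp2 (by positivity) hCpos.le
  have hpt : ∀ A, 0 ≤ A → A ≤ C₁ + C₂ → ∀ t : ℝ,
      A * (K * μ h ^ (1 + (N + q))) * SemiclassicalDecay.bracket t ^ (-s)
        ≤ C * μ h ^ (1 + s + ε) * SemiclassicalDecay.bracket t ^ (-s) := by
    intro A hA hAC t
    refine mul_le_mul_of_nonneg_right ?_
      (Real.rpow_pos_of_pos (SemiclassicalDecay.bracket_pos t) _).le
    rw [← mul_assoc]
    exact mul_le_mul (hle1 A hA hAC) hexp (by positivity) hCpos.le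
  have W := H₁ (P h) (hP h hh).isSelfAdjoint
    (SemiclassicalDecay.weightOp n (1 / 2 + s + ϵ)) _ hKμ (HK h hh)
  have S := H₂ (P h) (hP h hh).isSelfAdjoint
    (SemiclassicalDecay.weightOp n (1 / 2 + s + ϵ)) _ hKμ (HK h hh)
  exact ⟨fun f => (W.1 f).trans (hint C₁ hC₁ (by linarith) f),
    fun t => (W.2 t).trans (hpt C₁ hC₁ (by linarith) t),
    fun f => (S.1 f).trans (hint C₂ hC₂ (by linarith) f),
    fun t => (S.2 t).trans (hpt C₂ hC₂ (by linarith) t)⟩
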